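/- Let $(M,\xi)$ be a closed connected manifold of dimension $2n-1$ ($n\ge 1$) with a cooriented contact structure. Its symplectization $SM\subset T^*M$ is the set of covectors whose kernel equals $\xi$ as a cooriented hyperplane, with projection $\pi:SM\to M$, Liouville form $\lambda$ (the restriction of the canonical form of $T^*M$) and symplectic form $\omega=d\lambda$; for $t\in\mathbb R$ let $\varphi_t(p)=e^tp$. A section of $\pi$ is a contact form for $\xi$; for sections $\alpha,\beta$, write $\alpha<\beta$ if this holds at each point of $M$, and $SM^{\ge\alpha}$, $SM^{\le\alpha}$ for the sets of covectors above and below $\alpha$. For $\Lambda\subset M$ put $S\Lambda=\pi^{-1}(\Lambda)$. A Hamiltonian isotopy of $SM$ is a smooth family of diffeomorphisms $\phi_t$, $t\in[0,1]$, with $\phi_0=\mathrm{id}$, generated by a smooth time-dependent Hamiltonian (no condition on supports). Subsets $A,B\subset SM$ are Hamiltonian isotopic if $\phi_1(A)=B$ for some Hamiltonian isotopy. For closed Legendrian submanifolds $\Lambda_-,\Lambda_+$ of $M$, an exact Lagrangian cobordism $(L;\Lambda_-,\Lambda_+)$ is a Lagrangian submanifold $L\subset SM$ for which there are sections $\alpha_-<\alpha_+$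 such that $L\cap SM^{\ge\alpha_+}=S\Lambda_+\cap SM^{\ge\alpha_+}$ and $L\cap SM^{\le\alpha_-}=S\Lambda_-\cap SM^{\le\alpha_-}$, the part of $L$ between $\alpha_-$ and $\alpha_+$ is a compact cobordism from $\Lambda_-$ to $\Lambda_+$, and $\lambda|_L=dg$ for a smooth function $g:L\to\mathbb R$ that is constant on $L\cap SM^{\ge\alpha_+}$ and constant on $L\cap SM^{\le\alpha_-}$. Two cobordisms with the same ends are equivalent, $L_0\sim L_1$, if there are a Hamiltonian isotopy $\phi_t$ and sections $\alpha_-<\alpha_+$ such that $\phi_1(L_0)=L_1$ and every $\phi_t$ is the identity on $SM^{\ge\alpha_+}\cup SM^{\le\alpha_-}$. The composition $L\odot L'$ of $(L;\Lambda,\Lambda')$ and $(L';\Lambda',\Lambda'')$ is obtained by choosing $t\ge0$ and sections $\alpha<\alpha'$ with $L\cap SM^{\ge\alpha}=S\Lambda'\cap SM^{\ge\alpha}$ and $\varphi_t(L')\cap SM^{\le\alpha'}=S\Lambda'\cap SM^{\le\alpha'}$, and taking $(L\cap SM^{\le\alpha'})\cup(\varphi_t(L')\cap SM^{\ge\alpha})$;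 up to equivalence it does not depend on the choices. An exact Lagrangian cobordism $(L;\Lambda,\Lambda')$ is invertible if there is an exact Lagrangian cobordism $(L';\Lambda',\Lambda)$ with $L\odot L'\sim S\Lambda$ and $L'\odot L\sim S\Lambda'$. **Proposition.** Let $\Lambda$ and $\Lambda'$ be closed Legendrian submanifolds of $M$. Then the following are equivalent: 1. $S\Lambda$ and $S\Lambda'$ are Hamiltonian isotopic in $SM$; 2. there exists an invertible exact Lagrangian cobordism $(L;\Lambda,\Lambda')$. -/

import Mathlib

open Set
open scoped Manifold ContDiff

noncomputable section

/-! ### One-forms, submanifolds and tangent vectors on a manifold without boundary -/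

section Manifolds

variable {E : Type*} [NormedAddCommGroup E] [NormedSpace ℝ E] {H : Type*} [TopologicalSpace H]
  (I : ModelWithCorners ℝ E H) {N : Type*} [TopologicalSpace N] [ChartedSpace H N]

/-- The expression of the one-form `β` in the preferred chart at `x`: the pullback of `β` under the
inverse of the chart. -/
def localForm [IsManifold I ∞ N] (β : ∀ x : N, TangentSpace I x →L[ℝ] ℝ) (x : N) :
    E → E →L[ℝ] ℝ :=
  fun y => (β ((extChartAt I x).symm y)).comp (mfderiv 𝓘(ℝ, E) I (extChartAt I x).symm y)

/-- The exterior derivative `(dβ)_x (u, v)` of a one-form on a manifold without boundary, computed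
in the preferred chart at `x`; that chart is the one by which the tangent space at `x` is identified
with the model space `E`. -/
def extD [IsManifold I ∞ N] (β : ∀ x : N, TangentSpace I x →L[ℝ] ℝ) (x : N)
    (u v : TangentSpace I x) : ℝ :=
  fderiv ℝ (localForm I β x) (extChartAt I x x) u v
    - fderiv ℝ (localForm I β x) (extChartAt I x x) v u

/-- `β` is a smooth section of the cotangent bundle. -/
def IsSmoothForm [IsManifold I ∞ N] (β : ∀ x : N, TangentSpace I x →L[ℝ] ℝ) : Prop :=
  ContMDiff I (I.prod 𝓘(ℝ, E →L[ℝ] ℝ)) ∞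
    (fun x => Bundle.TotalSpace.mk' (E →L[ℝ] ℝ)
      (E := fun x : N => TangentSpace I x →L[ℝ] ℝ) x (β x))

/-- `A` is an embedded smooth submanifold (without boundary) of dimension `k`: near each of its
points it is a `k`-dimensional linear slice in some smooth chart of the ambient manifold. -/
def IsSubmanifold (k : ℕ) (A : Set N) : Prop :=
  ∀ p ∈ A, ∃ e ∈ IsManifold.maximalAtlas I ∞ N, p ∈ e.source ∧
    ∃ V : Submodule ℝ E, Module.finrank ℝ V = k ∧ ∀ q ∈ e.source, (q ∈ A ↔ e.extend I q ∈ V)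

/-- The tangent vectors of `A`, as a subset of the tangent bundle of the ambient manifold: the
velocities of the smooth curves that run inside `A`. -/
def tangentVectors (A : Set N) : Set (TangentBundle I N) :=
  {w | ∃ γ : ℝ → N, ContMDiff 𝓘(ℝ, ℝ) I ∞ γ ∧ (∀ t, γ t ∈ A) ∧
    w = ⟨γ 0, mfderiv 𝓘(ℝ, ℝ) I γ 0 (1 : ℝ)⟩}

end Manifolds

/-! ### Cooriented contact structures and Legendrian submanifolds -/

section Contact

variable (m : ℕ) (M : Type*) [TopologicalSpace M]
  [ChartedSpace (EuclideanSpace ℝ (Fin (2 * m + 1))) M] [IsManifold (𝓡 (2 * m + 1)) ∞ M]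

variable {m M} in
/-- `α` is a contact form: it is smooth and nowhere zero, and `dα` is nondegenerate on `ker α`. -/
structure IsContactForm (α : ∀ x : M, TangentSpace (𝓡 (2 * m + 1)) x →L[ℝ] ℝ) : Prop where
  smooth : IsSmoothForm (𝓡 (2 * m + 1)) α
  ne_zero : ∀ x, α x ≠ 0
  nondegenerate : ∀ x, ∀ u : TangentSpace (𝓡 (2 * m + 1)) x, α x u = 0 → u ≠ 0 →
    ∃ v : TangentSpace (𝓡 (2 * m + 1)) x, α x v = 0 ∧ extD (𝓡 (2 * m + 1)) α x u v ≠ 0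

/-- A cooriented contact structure on a manifold of dimension `2 * m + 1`: a field of hyperplanes
with a choice of a positive side of each of them, which is the field of kernels and positive sides
of some contact form. -/
structure ContactStructure where
  plane : ∀ x : M, Submodule ℝ (TangentSpace (𝓡 (2 * m + 1)) x)
  posSide : ∀ x : M, Set (TangentSpace (𝓡 (2 * m + 1)) x)
  exists_form : ∃ α : ∀ x : M, TangentSpace (𝓡 (2 * m + 1)) x →L[ℝ] ℝ, IsContactForm α ∧
    ∀ x, plane x = LinearMap.ker (α x).toLinearMap ∧ posSide x = {v | 0 < α x v}

variable {m M}

namespace ContactStructure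

variable (ξ : ContactStructure m M)

/-- The kernel of the covector `p` is the contact hyperplane at `x`, as cooriented hyperplanes. -/
def IsPositiveCovector (x : M) (p : TangentSpace (𝓡 (2 * m + 1)) x →L[ℝ] ℝ) : Prop :=
  LinearMap.ker p.toLinearMap = ξ.plane x ∧ {v | 0 < p v} = ξ.posSide x

/-- Compact Legendrian submanifolds (without boundary). -/
structure IsClosedLegendrian (Λ : Set M) : Prop where
  compact : IsCompact Λ
  submanifold : IsSubmanifold (𝓡 (2 * m + 1)) m Λ
  tangent : ∀ w ∈ tangentVectors (𝓡 (2 * m + 1)) Λ, w.2 ∈ ξ.plane w.1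

/-- A smooth section of the symplectization, that is, a contact form for `ξ`. -/
structure Form where
  form : ∀ x : M, TangentSpace (𝓡 (2 * m + 1)) x →L[ℝ] ℝ
  smooth : IsSmoothForm (𝓡 (2 * m + 1)) form
  positive : ∀ x, ξ.IsPositiveCovector x (form x)

/-- `α < β` at each point of `M`. -/
def Form.Below {ξ : ContactStructure m M} (α β : ξ.Form) : Prop :=
  ∀ x, ∀ v ∈ ξ.posSide x, α.form x v < β.form x v

/-- The symplectization: the covectors whose kernel is the contact hyperplane, as cooriented
hyperplanes. -/
@[ext]
structure Symp where
  base : M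
  covector : TangentSpace (𝓡 (2 * m + 1)) base →L[ℝ] ℝ
  positive : ξ.IsPositiveCovector base covector

/-- Some contact form for `ξ`. -/
def someForm : ∀ x : M, TangentSpace (𝓡 (2 * m + 1)) x →L[ℝ] ℝ := ξ.exists_form.choose

lemma someForm_positive (x : M) : ξ.IsPositiveCovector x (ξ.someForm x) :=
  ⟨(ξ.exists_form.choose_spec.2 x).1.symm, (ξ.exists_form.choose_spec.2 x).2.symm⟩

lemma exists_someForm_eq_one (x : M) :
    ∃ v : TangentSpace (𝓡 (2 * m + 1)) x, ξ.someForm x v = 1 := by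
  have h : ξ.someForm x ≠ 0 := ξ.exists_form.choose_spec.1.ne_zero x
  obtain ⟨v, hv⟩ : ∃ v, ξ.someForm x v ≠ 0 := by
    by_contra! hc
    exact h (ContinuousLinearMap.ext hc)
  exact ⟨(ξ.someForm x v)⁻¹ • v, by simp [hv]⟩

/-- A vector on which `someForm` takes the value one. -/
def someVec (x : M) : TangentSpace (𝓡 (2 * m + 1)) x := (ξ.exists_someForm_eq_one x).choose

lemma someForm_someVec (x : M) : ξ.someForm x (ξ.someVec x) = 1 :=
  (ξ.exists_someForm_eq_one x).choose_spec

variable {ξ} in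
lemma IsPositiveCovector.smul {x : M} {p : TangentSpace (𝓡 (2 * m + 1)) x →L[ℝ] ℝ}
    (hp : ξ.IsPositiveCovector x p) {c : ℝ} (hc : 0 < c) : ξ.IsPositiveCovector x (c • p) := by
  refine ⟨?_, ?_⟩
  · rw [← hp.1]
    ext v
    simp [hc.ne']
  · rw [← hp.2]
    ext v
    simp [hc]

variable {ξ} in
lemma IsPositiveCovector.apply_someVec_pos {x : M} {p : TangentSpace (𝓡 (2 * m + 1)) x →L[ℝ] ℝ}
    (hp : ξ.IsPositiveCovector x p) : 0 < p (ξ.someVec x) := by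
  have h : ξ.someVec x ∈ {v | 0 < p v} := by
    rw [hp.2, ← (ξ.someForm_positive x).2]
    simp [ξ.someForm_someVec x]
  exact h

variable {ξ} in
lemma IsPositiveCovector.eq_smul {x : M} {p : TangentSpace (𝓡 (2 * m + 1)) x →L[ℝ] ℝ}
    (hp : ξ.IsPositiveCovector x p) : p = p (ξ.someVec x) • ξ.someForm x := by
  ext v
  have h : v - ξ.someForm x v • ξ.someVec x ∈ LinearMap.ker p.toLinearMap := by
    rw [hp.1, ← (ξ.someForm_positive x).1]
    simp [ξ.someForm_someVec x]
  have h2 : p v - ξ.someForm x v * p (ξ.someVec x) = 0 := by simpa using h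
  rw [smul_apply, smul_eq_mul]
  linarith

/-- The trivialization of the symplectization by a contact form `α`: the pair `(x, s)` corresponds
to the covector `e ^ s • α_x`. -/
def trivialization : ξ.Symp ≃ M × ℝ where
  toFun p := (p.base, Real.log (p.covector (ξ.someVec p.base)))
  invFun q := ⟨q.1, Real.exp q.2 • ξ.someForm q.1, (ξ.someForm_positive q.1).smul (Real.exp_pos _)⟩
  left_inv p := by
    obtain ⟨x, p, hp⟩ := p
    have : Real.exp (Real.log (p (ξ.someVec x))) • ξ.someForm x = p := by
      rw [Real.exp_log hp.apply_someVec_pos, ← hp.eq_smul]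
    simp [this]
  right_inv q := by
    simp [ξ.someForm_someVec q.1]

/-- The manifold structure of the symplectization is the one for which the trivialization by a
contact form is a diffeomorphism; two contact forms differ by a smooth positive function, so the
choice of the form does not matter. -/
instance : TopologicalSpace ξ.Symp := TopologicalSpace.induced ξ.trivialization inferInstance

/-- The trivialization as a homeomorphism. -/
def trivializationHomeo : ξ.Symp ≃ₜ M × ℝ :=
  ξ.trivialization.toHomeomorphOfIsInducing ⟨rfl⟩

instance : ChartedSpace (ModelProd (EuclideanSpace ℝ (Fin (2 * m + 1))) ℝ) ξ.Symp where
  atlas := {e | ∃ c ∈ atlas (ModelProd (EuclideanSpace ℝ (Fin (2 * m + 1))) ℝ) (M × ℝ),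
    e = ξ.trivializationHomeo.toOpenPartialHomeomorph.trans c}
  chartAt p := ξ.trivializationHomeo.toOpenPartialHomeomorph.trans
    (chartAt (ModelProd (EuclideanSpace ℝ (Fin (2 * m + 1))) ℝ) (ξ.trivializationHomeo p))
  mem_chart_source p := by simp
  chart_mem_atlas p := ⟨_, chart_mem_atlas _ _, rfl⟩

variable (m) in
/-- The model of the symplectization. -/
abbrev sympModel : ModelWithCorners ℝ (EuclideanSpace ℝ (Fin (2 * m + 1)) × ℝ)
    (ModelProd (EuclideanSpace ℝ (Fin (2 * m + 1))) ℝ) :=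
  (𝓡 (2 * m + 1)).prod 𝓘(ℝ, ℝ)

instance : IsManifold (sympModel m) ∞ ξ.Symp := by
  have h : HasGroupoid ξ.Symp (contDiffGroupoid ∞ (sympModel m)) := by
    refine ⟨?_⟩
    rintro e e' ⟨c, hc, rfl⟩ ⟨c', hc', rfl⟩
    have h1 : c.symm.trans c' ∈ contDiffGroupoid ∞ (sympModel m) :=
      HasGroupoid.compatible hc hc'
    refine (contDiffGroupoid ∞ (sympModel m)).mem_of_eqOnSource h1 ?_
    constructor
    · ext y
      simp
    · intro y hy
      simp
  exact { h with }

/-- The canonical one-form: `λ_p (v) = p (dπ v)`. -/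
def canForm (p : ξ.Symp) : TangentSpace (sympModel m) p →L[ℝ] ℝ :=
  p.covector.comp (mfderiv (sympModel m) (𝓡 (2 * m + 1)) (Symp.base : ξ.Symp → M) p)

/-- The symplectic form `ω = dλ`. -/
def omega (p : ξ.Symp) (u v : TangentSpace (sympModel m) p) : ℝ :=
  extD (sympModel m) ξ.canForm p u v

/-- The symplectization of a subset of `M`: its preimage under the projection. -/
def cyl (Λ : Set M) : Set ξ.Symp := {p | p.base ∈ Λ}

/-- The part of the symplectization above a section. -/
def above (α : ξ.Form) : Set ξ.Symp :=
  {p | ∀ v ∈ ξ.posSide p.base, α.form p.base v ≤ p.covector v}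

/-- The part of the symplectization below a section. -/
def below (α : ξ.Form) : Set ξ.Symp :=
  {p | ∀ v ∈ ξ.posSide p.base, p.covector v ≤ α.form p.base v}

/-- The flow `p ↦ e ^ t • p` of the canonical Liouville vector field. -/
def push (t : ℝ) (p : ξ.Symp) : ξ.Symp :=
  ⟨p.base, Real.exp t • p.covector, p.positive.smul (Real.exp_pos t)⟩

/-! ### Hamiltonian isotopies -/

/-- `φ_t`, `t ∈ [0,1]`, is a Hamiltonian isotopy of the symplectization: a smooth family of
diffeomorphisms with `φ_0 = id`, generated by a smooth time-dependent Hamiltonian `K_t`, with the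
sign convention `ω (X_K, ·) = - dK`. The values of `φ` outside `[0,1]` play no role. -/
def IsHamiltonianIsotopy (φ : ℝ → ξ.Symp ≃ₘ⟮sympModel m, sympModel m⟯ ξ.Symp) : Prop :=
  ContMDiffOn (𝓘(ℝ, ℝ).prod (sympModel m)) (sympModel m) ∞
    (fun q : ℝ × ξ.Symp => φ q.1 q.2) (Icc 0 1 ×ˢ univ) ∧
  (∀ p, φ 0 p = p) ∧
  ∃ K : ℝ → ξ.Symp → ℝ,
    ContMDiffOn (𝓘(ℝ, ℝ).prod (sympModel m)) 𝓘(ℝ, ℝ) ∞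
      (fun q : ℝ × ξ.Symp => K q.1 q.2) (Icc 0 1 ×ˢ univ) ∧
    ∀ t ∈ Icc (0 : ℝ) 1, ∀ p, ∃ X : TangentSpace (sympModel m) (φ t p),
      HasMFDerivWithinAt 𝓘(ℝ, ℝ) (sympModel m) (fun s : ℝ => φ s p) (Icc 0 1) t
        ((1 : ℝ →L[ℝ] ℝ).smulRight X) ∧
      ∀ v : TangentSpace (sympModel m) (φ t p),
        ξ.omega (φ t p) X v = - mfderiv (sympModel m) 𝓘(ℝ, ℝ) (K t) (φ t p) v

/-- Two subsets of the symplectization are Hamiltonian isotopic (without any condition on the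
supports). -/
def HamiltonianIsotopic (A B : Set ξ.Symp) : Prop :=
  ∃ φ : ℝ → ξ.Symp ≃ₘ⟮sympModel m, sympModel m⟯ ξ.Symp,
    ξ.IsHamiltonianIsotopy φ ∧ φ 1 '' A = B

/-! ### Exact Lagrangian cobordisms -/

/-- Lagrangian submanifolds: submanifolds of half the dimension, on which `ω` vanishes. -/
structure IsLagrangian (L : Set ξ.Symp) : Prop where
  submanifold : IsSubmanifold (sympModel m) (m + 1) L
  isotropic : ∀ (p : ξ.Symp) (u v : TangentSpace (sympModel m) p),
    (⟨p, u⟩ : TangentBundle (sympModel m) ξ.Symp) ∈ tangentVectors (sympModel m) L →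
    (⟨p, v⟩ : TangentBundle (sympModel m) ξ.Symp) ∈ tangentVectors (sympModel m) L →
    ξ.omega p u v = 0

/-- `(L; Λ, Λ')` is an exact Lagrangian cobordism in the symplectization.
Since `L` is a submanifold without boundary which is cylindrical above `α'` and below `α`, it is
transverse to the graphs of `α` and `α'`, so its part between them is a submanifold with boundary
the disjoint union of copies of `Λ` and `Λ'`; that this part is a compact cobordism from `Λ` to `Λ'`
thus amounts to its compactness. As `L` is closed, a smooth function on `L` is the restriction of a
smooth function `g` on the whole symplectization. -/
structure IsExactCobordism (L : Set ξ.Symp) (Λ Λ' : Set M) : Prop where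
  lagrangian : ξ.IsLagrangian L
  legendrian_bot : ξ.IsClosedLegendrian Λ
  legendrian_top : ξ.IsClosedLegendrian Λ'
  exists_sections : ∃ α α' : ξ.Form, α.Below α' ∧
    L ∩ ξ.above α' = ξ.cyl Λ' ∩ ξ.above α' ∧
    L ∩ ξ.below α = ξ.cyl Λ ∩ ξ.below α ∧
    IsCompact (L ∩ (ξ.above α ∩ ξ.below α')) ∧
    ∃ g : ξ.Symp → ℝ, ContMDiff (sympModel m) 𝓘(ℝ, ℝ) ∞ g ∧
      (∀ w ∈ tangentVectors (sympModel m) L,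
        ξ.canForm w.1 w.2 = mfderiv (sympModel m) 𝓘(ℝ, ℝ) g w.1 w.2) ∧
      (∃ c, ∀ p ∈ L ∩ ξ.above α', g p = c) ∧
      (∃ c, ∀ p ∈ L ∩ ξ.below α, g p = c)

/-- Equivalence of exact Lagrangian cobordisms: Hamiltonian isotopy relative to the complement of
a region between two sections. -/
def Equivalent (L₀ L₁ : Set ξ.Symp) : Prop :=
  ∃ φ : ℝ → ξ.Symp ≃ₘ⟮sympModel m, sympModel m⟯ ξ.Symp, ξ.IsHamiltonianIsotopy φ ∧
    φ 1 '' L₀ = L₁ ∧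
    ∃ α α' : ξ.Form, α.Below α' ∧
      ∀ t ∈ Icc (0 : ℝ) 1, ∀ p ∈ ξ.above α' ∪ ξ.below α, φ t p = p

/-- `K` is a composition of `L`, with top end `Λ'`, and of `L'`, with bottom end `Λ'`: after `L'` has
been pushed up by the Liouville flow, so that both sets coincide with the cylinder over `Λ'` between
two sections `α < α'`, `K` is `L` below `α'` and the pushed `L'` above `α`. The equivalence class of
`K` does not depend on the choices. -/
def IsComposition (Λ' : Set M) (L L' K : Set ξ.Symp) : Prop :=
  ∃ t : ℝ, 0 ≤ t ∧ ∃ α α' : ξ.Form, α.Below α' ∧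
    L ∩ ξ.above α = ξ.cyl Λ' ∩ ξ.above α ∧
    (ξ.push t '' L') ∩ ξ.below α' = ξ.cyl Λ' ∩ ξ.below α' ∧
    K = (L ∩ ξ.below α') ∪ ((ξ.push t '' L') ∩ ξ.above α)

/-- `(L; Λ, Λ')` is an invertible exact Lagrangian cobordism. -/
def IsInvertibleCobordism (L : Set ξ.Symp) (Λ Λ' : Set M) : Prop :=
  ξ.IsExactCobordism L Λ Λ' ∧ ∃ L' : Set ξ.Symp, ξ.IsExactCobordism L' Λ' Λ ∧
    (∃ K, ξ.IsComposition Λ' L L' K ∧ ξ.Equivalent K (ξ.cyl Λ)) ∧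
    (∃ K', ξ.IsComposition Λ L' L K' ∧ ξ.Equivalent K' (ξ.cyl Λ'))

end ContactStructure

end Contact

end

/-! Write Z and Z' for the Lagrangian cylinders over Λ and Λ'. Almost all of the argument takes
place in a `LiouvilleCyl`: an exact symplectic manifold with a complete Liouville flow `push`, which
multiplies the one-form by e^t, and a height function that grows at unit speed along the flow, is
proper, and has connected preimages of intervals. In the symplectization the height is the logarithm
of the ratio to a fixed contact form; since M is compact, conditions in terms of sections become
conditions in terms of bounds on the height.

From an invertible cobordism to an isotopy the proof is an infinite swindle. Let L' be an inverse of
L, and stack translates of L and L' alternately in a doubly infinite chain ... L L' L L' ..., which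
is invariant under `push` by the period. Grouped as copies of L ⊙ L', the chain is deformed to Z:
the isotopy from L ⊙ L' to Z has support in one window, and its conjugates by multiples of the
period act simultaneously in all windows. Grouped as copies of L' ⊙ L, the same chain is deformed to
Z'. The Hamiltonian grows like e^(kT) from window to window, which is harmless because no condition
is put on supports; its constant values at the two ends of a window are matched by adding a function
of time. See `exists_isotopy_perSet`, `perSet_comp` and `exists_isotopy_of_invertible`.

Conversely, let an isotopy carry Z to Z'. By `exists_action_eq_zero` it can be replaced by one, ψ,
whose time one map has an action vanishing on Z. Cutting off its Hamiltonian at large heights gives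
an isotopy ηB of bounded support, and B = ηB(Z) equals Z far up and far down, but equals Z' near
height zero: the trajectories that end there never meet the cutoff. Cut B at height zero. The lower
half continued upwards by Z' is L, the upper half continued downwards by Z' is L', and both are
exact because the action of ψ vanishes on Z. Then L ⊙ L' is B, hence isotopic to Z.

That L' is also a left inverse is obtained indirectly. A second cutoff ηA, with a much lower bottom
level, yields Q = ηB ηA⁻¹(Z'), which is isotopic to Z' by an isotopy of bounded support. The slab of
points which ψ brings to heights between -1 and 1 moves as a barrier that no trajectory of ηA or ηB
can cross, so Q equals Z' above height -1 and B for some distance below height zero. Hence Q = P ⊙ L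
for a suitable P, a left inverse of L, and as usual the right inverse L' is then a left inverse as
well: L' ~ P ⊙ L ⊙ L' ~ P. This is `exists_invertible_of_isotopy` with
`exists_relIsotopic_comp_swap`.

In both directions a composition may be formed with any sufficiently large shift. The isotopy class
does not change because, by `exists_slide`, an exact Lagrangian is moved by the Liouville flow in
the same way as by a Hamiltonian isotopy: along it the two vector fields differ by a tangent vector.

The analysis underneath is developed on manifolds without boundary: smooth dependence of flows on
initial points, smoothness of Hamiltonian fields, integration of compactly supported Hamiltonians,
naturality of the exterior derivative, and the action of an isotopy. -/

set_option linter.unusedSectionVars false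

noncomputable section

/-! ### Superposition operators on spaces of continuous maps -/

section Nemytskii

universe u
variable {K : Type*} [TopologicalSpace K] [CompactSpace K]
variable {E F : Type u} [NormedAddCommGroup E] [NormedSpace ℝ E]
  [NormedAddCommGroup F] [NormedSpace ℝ F]

/-- Pointwise application of a continuous family of operators to a continuous map. -/
def pointwiseApply (K : Type*) [TopologicalSpace K] [CompactSpace K] (E F : Type u)
    [NormedAddCommGroup E] [NormedSpace ℝ E] [NormedAddCommGroup F] [NormedSpace ℝ F] :
    C(K, E →L[ℝ] F) →L[ℝ] C(K, E) →L[ℝ] C(K, F) :=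
  LinearMap.mkContinuous₂
    (LinearMap.mk₂ ℝ (fun (A : C(K, E →L[ℝ] F)) (γ : C(K, E)) =>
        (⟨fun k => A k (γ k), by fun_prop⟩ : C(K, F)))
      (fun _ _ _ => by ext; simp) (fun _ _ _ => by ext; simp)
      (fun _ _ _ => by ext; simp) (fun _ _ _ => by ext; simp)) 1
    (fun A γ => by
      rw [one_mul]
      refine (ContinuousMap.norm_le _ (by positivity)).2 fun k => ?_
      exact (ContinuousLinearMap.le_opNorm _ _).trans
        (by gcongr; exacts [A.norm_coe_le_norm k, γ.norm_coe_le_norm k]))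

@[simp] lemma pointwiseApply_apply (A : C(K, E →L[ℝ] F)) (γ : C(K, E)) (k : K) :
    pointwiseApply K E F A γ k = A k (γ k) := rfl

/-- Composition with a continuous map, as an operator between spaces of continuous maps. -/
def postcomp (K : Type*) [TopologicalSpace K] (f : E → F) (hf : Continuous f) (γ : C(K, E)) :
    C(K, F) := ⟨fun k => f (γ k), hf.comp γ.continuous⟩

@[simp] lemma postcomp_apply (f : E → F) (hf : Continuous f) (γ : C(K, E)) (k : K) :
    postcomp K f hf γ k = f (γ k) := rfl

lemma continuous_postcomp' (f : E → F) (hf : Continuous f) : Continuous (postcomp K f hf) :=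
  ContinuousMap.continuous_postcomp (X := K) ⟨f, hf⟩

/-- Superposition by `fderiv ℝ f` is continuous in the sup norm. Hence for small η the derivative of
f varies by at most c on the segments from γ k to γ k + η k, for all k at once, and the mean value
inequality at each k bounds the remainder by c ‖η‖. -/
lemma hasFDerivAt_postcomp (f : E → F) (hf : ContDiff ℝ 1 f) (γ : C(K, E)) :
    HasFDerivAt (postcomp K f hf.continuous)
      (pointwiseApply K E F (postcomp K (fderiv ℝ f) (hf.continuous_fderiv one_ne_zero) γ)) γ := by
  rw [hasFDerivAt_iff_isLittleO_nhds_zero, Asymptotics.isLittleO_iff]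
  intro c hc
  have hcont := (continuous_postcomp' (K := K) (fderiv ℝ f)
    (hf.continuous_fderiv one_ne_zero)).tendsto γ
  obtain ⟨δ, hδ, h⟩ := Metric.tendsto_nhds_nhds.1 hcont c hc
  filter_upwards [Metric.ball_mem_nhds (0 : C(K, E)) hδ] with η hη
  refine (ContinuousMap.norm_le _ (by positivity)).2 fun k => ?_
  have key : ∀ y ∈ Metric.ball (γ k) δ, ‖fderiv ℝ f y - fderiv ℝ f (γ k)‖ ≤ c := by
    intro y hy
    -- Translating γ by a constant gives a map within δ of γ whose value at k is y, so the sup norm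
    -- estimate can be read off at the single point k.
    have h2 := h (x := γ + ContinuousMap.const K (y - γ k)) (by
      rw [dist_eq_norm, add_sub_cancel_left]
      refine lt_of_le_of_lt ((ContinuousMap.norm_le _ (norm_nonneg (y - γ k))).2 fun _ => ?_) ?_
      · simp
      · rwa [← dist_eq_norm])
    have h3 := (ContinuousMap.dist_le (le_of_lt hc)).1 h2.le k
    simpa [dist_eq_norm] using h3
  have hηk : γ k + η k ∈ Metric.ball (γ k) δ := by
    rw [Metric.mem_ball, dist_eq_norm, add_sub_cancel_left]
    exact (η.norm_coe_le_norm k).trans_lt (by simpa using hη)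
  have h4 := (convex_ball (γ k) δ).norm_image_sub_le_of_norm_hasFDerivWithin_le' (f := f)
    (f' := fderiv ℝ f) (φ := fderiv ℝ f (γ k))
    (fun y _ => ((hf.differentiable (by simp)) y).hasFDerivAt.hasFDerivWithinAt) key
    (Metric.mem_ball_self hδ) hηk
  rw [add_sub_cancel_left] at h4
  refine le_trans ?_ (h4.trans (mul_le_mul_of_nonneg_left (η.norm_coe_le_norm k) hc.le))
  simp

/-- Induction on n with the target space left free: the derivative of the superposition is the
superposition by `fderiv ℝ f`, with values in operators, followed by a continuous linear map. This
is why E and F share a universe. -/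
lemma contDiff_postcomp_nat (n : ℕ) : ∀ {F : Type u} [NormedAddCommGroup F] [NormedSpace ℝ F]
    (f : E → F) (hf : ContDiff ℝ n f), ContDiff ℝ n (postcomp K f hf.continuous) := by
  induction n with
  | zero => intro F _ _ f hf; exact contDiff_zero.2 (continuous_postcomp' f hf.continuous)
  | succ n ih =>
    intro F _ _ f hf
    have hf1 : ContDiff ℝ 1 f := hf.of_le (by norm_cast; omega)
    have hd := hasFDerivAt_postcomp (K := K) f hf1
    push_cast
    rw [contDiff_succ_iff_fderiv]
    refine ⟨fun γ => (hd γ).differentiableAt, by simp, ?_⟩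
    have h2 : fderiv ℝ (postcomp K f hf.continuous) = fun γ =>
        pointwiseApply K E F (postcomp K (fderiv ℝ f) (hf1.continuous_fderiv one_ne_zero) γ) :=
      funext fun γ => (hd γ).fderiv
    rw [h2]
    have hf' : ContDiff ℝ n (fderiv ℝ f) := by
      push_cast at hf
      exact (contDiff_succ_iff_fderiv.1 hf).2.2
    exact (pointwiseApply K E F).contDiff.comp (ih (fderiv ℝ f) hf')

lemma contDiff_postcomp (f : E → F) (hf : ContDiff ℝ ∞ f) :
    ContDiff ℝ ∞ (postcomp K f hf.continuous) :=
  contDiff_infty.2 fun n => contDiff_postcomp_nat n f (hf.of_le (by exact_mod_cast le_top))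

end Nemytskii

/-! ### Smooth local flows on Banach spaces -/

section LocalFlow

universe u
variable {E : Type u} [NormedAddCommGroup E] [NormedSpace ℝ E]

/-- The primitive vanishing at zero of a continuous map on `[-1, 1]`. -/
def primitive (E : Type u) [NormedAddCommGroup E] [NormedSpace ℝ E] :
    C(Icc (-1 : ℝ) 1, E) →L[ℝ] C(Icc (-1 : ℝ) 1, E) :=
  LinearMap.mkContinuous
    { toFun := fun η => ⟨fun s => ∫ r in (0 : ℝ)..s, IccExtend (by norm_num : (-1 : ℝ) ≤ 1) η r, by
        have := intervalIntegral.continuous_primitive (μ := MeasureTheory.volume)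
          (fun a b => (η.continuous.Icc_extend'
            (h := (by norm_num : (-1 : ℝ) ≤ 1))).intervalIntegrable a b) 0
        exact this.comp continuous_subtype_val⟩
      map_add' := fun η η' => by
        ext s
        simp only [ContinuousMap.coe_mk, ContinuousMap.add_apply]
        rw [← intervalIntegral.integral_add
          ((η.continuous.Icc_extend' ).intervalIntegrable _ _)
          ((η'.continuous.Icc_extend' ).intervalIntegrable _ _)]
        rfl
      map_smul' := fun c η => by
        ext s
        simp only [ContinuousMap.coe_mk, ContinuousMap.smul_apply, RingHom.id_apply]
        rw [← intervalIntegral.integral_smul]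
        rfl } 1
    (fun η => by
      rw [one_mul]
      refine (ContinuousMap.norm_le _ (by positivity)).2 fun s => ?_
      have h := intervalIntegral.norm_integral_le_of_norm_le_const (a := 0) (b := (s : ℝ))
        (f := IccExtend (by norm_num : (-1 : ℝ) ≤ 1) η) (C := ‖η‖)
        (fun r _ => η.norm_coe_le_norm _)
      refine h.trans ?_
      have : |(s : ℝ) - 0| ≤ 1 := by rw [sub_zero]; exact abs_le.2 s.2
      nlinarith [norm_nonneg η])


variable [CompleteSpace E]

/-- The map whose level sets encode the solutions of `γ' = t f(γ)`, `γ 0 = x` on `[-1, 1]`. -/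
def flowMap (f : E → E) (hf : Continuous f) (q : ℝ × E × C(Icc (-1 : ℝ) 1, E)) :
    ℝ × E × C(Icc (-1 : ℝ) 1, E) :=
  (q.1, q.2.1, q.2.2 - ContinuousMap.const _ q.2.1 - q.1 • primitive E (postcomp _ f hf q.2.2))

/-- Constant maps, as a continuous linear map. -/
def constMap (E : Type u) [NormedAddCommGroup E] [NormedSpace ℝ E] :
    E →L[ℝ] C(Icc (-1 : ℝ) 1, E) :=
  LinearMap.mkContinuous
    { toFun := fun x => ContinuousMap.const _ x
      map_add' := fun _ _ => rfl
      map_smul' := fun _ _ => rfl } 1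
    (fun x => by
      rw [one_mul]
      exact (ContinuousMap.norm_le _ (by positivity)).2 fun s => le_rfl)

/-- Evaluation at a point, as a continuous linear map. -/
def evalMap (E : Type u) [NormedAddCommGroup E] [NormedSpace ℝ E] (s : Icc (-1 : ℝ) 1) :
    C(Icc (-1 : ℝ) 1, E) →L[ℝ] E :=
  LinearMap.mkContinuous
    { toFun := fun γ => γ s
      map_add' := fun _ _ => rfl
      map_smul' := fun _ _ => rfl } 1
    (fun γ => by
      rw [one_mul]
      exact γ.norm_coe_le_norm s)

@[simp] lemma constMap_apply (x : E) (s : Icc (-1 : ℝ) 1) : constMap E x s = x := rfl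

lemma contDiff_flowMap (f : E → E) (hf : ContDiff ℝ ∞ f) :
    ContDiff ℝ ∞ (flowMap f hf.continuous) := by
  have h1 : ContDiff ℝ ∞ fun q : ℝ × E × C(Icc (-1 : ℝ) 1, E) =>
      postcomp _ f hf.continuous q.2.2 :=
    (contDiff_postcomp f hf).comp (contDiff_snd.comp contDiff_snd)
  have h2 : ContDiff ℝ ∞ fun q : ℝ × E × C(Icc (-1 : ℝ) 1, E) => constMap E q.2.1 :=
    (constMap E).contDiff.comp (contDiff_fst.comp contDiff_snd)
  exact contDiff_fst.prodMk ((contDiff_fst.comp contDiff_snd).prodMk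
    (((contDiff_snd.comp contDiff_snd).sub h2).sub
      (contDiff_fst.smul ((primitive E).contDiff.comp h1))))

/-- The derivative of `flowMap` at time zero. -/
def flowMapDeriv (w : C(Icc (-1 : ℝ) 1, E)) :
    (ℝ × E × C(Icc (-1 : ℝ) 1, E)) ≃L[ℝ] (ℝ × E × C(Icc (-1 : ℝ) 1, E)) :=
  ContinuousLinearEquiv.equivOfInverse
    ((ContinuousLinearMap.fst ℝ _ _).prod (((ContinuousLinearMap.fst ℝ _ _).comp
      (ContinuousLinearMap.snd ℝ _ _)).prod
      (((ContinuousLinearMap.snd ℝ _ _).comp (ContinuousLinearMap.snd ℝ _ _)) -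
        (constMap E).comp ((ContinuousLinearMap.fst ℝ _ _).comp (ContinuousLinearMap.snd ℝ _ _)) -
        (ContinuousLinearMap.fst ℝ ℝ (E × C(Icc (-1 : ℝ) 1, E))).smulRight w)))
    ((ContinuousLinearMap.fst ℝ _ _).prod (((ContinuousLinearMap.fst ℝ _ _).comp
      (ContinuousLinearMap.snd ℝ _ _)).prod
      (((ContinuousLinearMap.snd ℝ _ _).comp (ContinuousLinearMap.snd ℝ _ _)) +
        (constMap E).comp ((ContinuousLinearMap.fst ℝ _ _).comp (ContinuousLinearMap.snd ℝ _ _)) +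
        (ContinuousLinearMap.fst ℝ ℝ (E × C(Icc (-1 : ℝ) 1, E))).smulRight w)))
    (fun q => by
      refine Prod.ext rfl (Prod.ext rfl ?_)
      simp
      abel)
    (fun q => by
      refine Prod.ext rfl (Prod.ext rfl ?_)
      simp
      abel)

/-- In the product t • (primitive of f ∘ γ) the term that differentiates f carries the factor t = 0.
What remains is triangular with identity blocks, hence invertible without any smallness assumption.
-/
lemma hasFDerivAt_flowMap (f : E → E) (hf : ContDiff ℝ ∞ f) (x : E) :
    HasFDerivAt (flowMap f hf.continuous)
      (flowMapDeriv (primitive E (postcomp _ f hf.continuous (constMap E x))) :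
        (ℝ × E × C(Icc (-1 : ℝ) 1, E)) →L[ℝ] (ℝ × E × C(Icc (-1 : ℝ) 1, E)))
      (0, x, constMap E x) := by
  have hN : HasFDerivAt (fun q : ℝ × E × C(Icc (-1 : ℝ) 1, E) =>
      primitive E (postcomp _ f hf.continuous q.2.2)) _ (0, x, constMap E x) :=
    (((primitive E).contDiff (n := ∞)).comp ((contDiff_postcomp f hf).comp
      (contDiff_snd.comp contDiff_snd))).differentiable (by simp) (0, x, constMap E x)
      |>.hasFDerivAt
  have h1 : HasFDerivAt (fun q : ℝ × E × C(Icc (-1 : ℝ) 1, E) => q.1)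
      (ContinuousLinearMap.fst ℝ _ _) (0, x, constMap E x) := hasFDerivAt_fst
  have h2 : HasFDerivAt (fun q : ℝ × E × C(Icc (-1 : ℝ) 1, E) => q.2.1)
      ((ContinuousLinearMap.fst ℝ _ _).comp (ContinuousLinearMap.snd ℝ _ _))
      (0, x, constMap E x) := hasFDerivAt_fst.comp _ hasFDerivAt_snd
  have h3 : HasFDerivAt (fun q : ℝ × E × C(Icc (-1 : ℝ) 1, E) => q.2.2)
      ((ContinuousLinearMap.snd ℝ _ _).comp (ContinuousLinearMap.snd ℝ _ _))
      (0, x, constMap E x) := hasFDerivAt_snd.comp _ hasFDerivAt_snd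
  have h4 := (constMap E).hasFDerivAt.comp _ h2
  have h := h1.prodMk (h2.prodMk ((h3.sub h4).sub (h1.smul hN)))
  refine h.congr_fderiv ?_
  ext q <;> simp [flowMapDeriv]

lemma flowMap_eq_iff (f : E → E) (hf : Continuous f) (t : ℝ) (x : E)
    (γ : C(Icc (-1 : ℝ) 1, E)) : flowMap f hf (t, x, γ) = (t, x, 0) ↔
      ∀ s : Icc (-1 : ℝ) 1, γ s = x + t • ∫ r in (0 : ℝ)..s,
        f (IccExtend (by norm_num : (-1 : ℝ) ≤ 1) γ r) := by
  simp only [flowMap, Prod.mk.injEq, true_and]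
  rw [ContinuousMap.ext_iff]
  refine forall_congr' fun s => ?_
  have : primitive E (postcomp _ f hf γ) s = ∫ r in (0 : ℝ)..s,
        f (IccExtend (by norm_num : (-1 : ℝ) ≤ 1) γ r) := rfl
  simp only [ContinuousMap.sub_apply, ContinuousMap.const_apply, ContinuousMap.smul_apply,
    ContinuousMap.zero_apply, this]
  rw [sub_sub, sub_eq_zero]

/-- Reparametrization of a map on `[-1, 1]` by a contraction. -/
def rescale (c : ℝ) (γ : C(Icc (-1 : ℝ) 1, E)) : C(Icc (-1 : ℝ) 1, E) :=
  ⟨fun s => IccExtend (by norm_num : (-1 : ℝ) ≤ 1) γ (c * s),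
    (γ.continuous.Icc_extend' (h := by norm_num)).comp
      (by fun_prop : Continuous fun s : Icc (-1 : ℝ) 1 => c * (s : ℝ))⟩

/-- Slowing time down by c turns a solution of γ' = t f(γ) into one of γ' = c t f(γ). Together with
local uniqueness this exhibits the solutions for all smaller parameters as pieces of a single one.
-/
lemma flowMap_rescale (f : E → E) (hf : Continuous f) (t c : ℝ) (hc : |c| ≤ 1) (x : E)
    (γ : C(Icc (-1 : ℝ) 1, E)) (h : flowMap f hf (t, x, γ) = (t, x, 0)) :
    flowMap f hf (c * t, x, rescale c γ) = (c * t, x, 0) := by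
  rw [flowMap_eq_iff] at h ⊢
  intro s
  have hmem : ∀ r ∈ Icc (-1 : ℝ) 1, c * r ∈ Icc (-1 : ℝ) 1 := fun r hr => by
    rw [mem_Icc, ← abs_le, abs_mul]
    have := abs_le.2 hr
    nlinarith [abs_nonneg c, abs_nonneg r]
  have h1 : rescale c γ s = γ ⟨c * s, hmem s s.2⟩ := IccExtend_of_mem (by norm_num) _ (hmem s s.2)
  rw [h1, h]
  congr 1
  have h2 : ∫ r in (0 : ℝ)..s, f (IccExtend (by norm_num : (-1 : ℝ) ≤ 1) (rescale c γ) r) =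
      ∫ r in (0 : ℝ)..s, f (IccExtend (by norm_num : (-1 : ℝ) ≤ 1) γ (c * r)) := by
    refine intervalIntegral.integral_congr fun r hr => ?_
    have hr' : r ∈ Icc (-1 : ℝ) 1 := by
      have hs := s.2
      have := uIcc_subset_Icc (⟨by norm_num, by norm_num⟩ : (0 : ℝ) ∈ Icc (-1 : ℝ) 1) hs hr
      exact this
    change f (IccExtend _ (rescale c γ) r) = _
    rw [IccExtend_of_mem _ (rescale c γ) hr']
    rfl
  rw [h2, mul_comm c t, mul_smul, intervalIntegral.smul_integral_comp_mul_left
    (fun r => f (IccExtend (by norm_num : (-1 : ℝ) ≤ 1) γ r)), mul_zero]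

/-- A smooth vector field on a Banach space has a smooth local flow. -/
theorem exists_smooth_local_flow (f : E → E) (hf : ContDiff ℝ ∞ f) (x₀ : E) :
    ∃ ε > 0, ∃ U ∈ nhds x₀, ∃ φ : ℝ → E → E,
      ContDiffOn ℝ ∞ (fun q : ℝ × E => φ q.1 q.2) (Ioo (-ε) ε ×ˢ U) ∧
      ∀ x ∈ U, φ 0 x = x ∧ ∀ t ∈ Ioo (-ε) ε, HasDerivAt (fun s => φ s x) (f (φ t x)) t := by
  set a : ℝ × E × C(Icc (-1 : ℝ) 1, E) := (0, x₀, constMap E x₀) with ha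
  set w := primitive E (postcomp _ f hf.continuous (constMap E x₀))
  have hG := contDiff_flowMap f hf
  have hGa : flowMap f hf.continuous a = (0, x₀, 0) := by
    rw [ha, flowMap_eq_iff]; intro s; simp
  -- Inverse function theorem at the constant curve, the solution for t = 0: for (t, x) near (0, x₀)
  -- the last component of `e.symm (t, x, 0)` is the solution of γ' = t f(γ) with γ 0 = x.
  set e := hG.contDiffAt.toOpenPartialHomeomorph (flowMap f hf.continuous)
    (hasFDerivAt_flowMap f hf x₀) (by simp) with he
  have hae : a ∈ e.source := hG.contDiffAt.mem_toOpenPartialHomeomorph_source _ (by simp)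
  have hecoe : ∀ q, e q = flowMap f hf.continuous q := fun q => rfl
  -- points where the derivative is invertible
  have hinv : ∀ᶠ q in nhds a, ∃ A : (ℝ × E × C(Icc (-1 : ℝ) 1, E)) ≃L[ℝ]
      (ℝ × E × C(Icc (-1 : ℝ) 1, E)), HasFDerivAt (flowMap f hf.continuous)
        (A : (ℝ × E × C(Icc (-1 : ℝ) 1, E)) →L[ℝ] _) q := by
    have hc : Continuous (fderiv ℝ (flowMap f hf.continuous)) := hG.continuous_fderiv (by simp)
    have h1 := hc.tendsto a (by
      rw [(hasFDerivAt_flowMap f hf x₀).fderiv]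
      exact ContinuousLinearEquiv.nhds (flowMapDeriv w))
    filter_upwards [h1] with q hq
    obtain ⟨A, hA⟩ := hq
    exact ⟨A, by rw [hA]; exact (hG.differentiable (by simp) q).hasFDerivAt⟩
  obtain ⟨δ, hδ, hball⟩ : ∃ δ > 0, Metric.closedBall a δ ⊆ e.source ∩ {q | ∃ A : (ℝ × E ×
      C(Icc (-1 : ℝ) 1, E)) ≃L[ℝ] (ℝ × E × C(Icc (-1 : ℝ) 1, E)), HasFDerivAt
        (flowMap f hf.continuous) (A : (ℝ × E × C(Icc (-1 : ℝ) 1, E)) →L[ℝ] _) q} :=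
    Metric.nhds_basis_closedBall.mem_iff.1 (Filter.inter_mem (e.open_source.mem_nhds hae) hinv)
  have hsymm : Filter.Tendsto (fun q : ℝ × E => e.symm (q.1, q.2, 0)) (nhds (0, x₀)) (nhds a) := by
    have h1 : ContinuousAt e.symm (0, x₀, 0) := e.continuousAt_symm (by
      rw [← hGa]; exact e.map_source hae)
    have h2 : e.symm (0, x₀, 0) = a := by rw [← hGa]; exact e.left_inv hae
    have h3 := h1.tendsto
    rw [h2] at h3
    exact h3.comp (by
      have : Continuous fun q : ℝ × E => ((q.1, q.2, 0) : ℝ × E × C(Icc (-1 : ℝ) 1, E)) := by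
        fun_prop
      exact this.tendsto _)
  have htarget : ∀ᶠ q : ℝ × E in nhds (0, x₀), (q.1, q.2, 0) ∈ e.target := by
    have : Continuous fun q : ℝ × E => ((q.1, q.2, 0) : ℝ × E × C(Icc (-1 : ℝ) 1, E)) := by
      fun_prop
    refine this.tendsto (0, x₀) (e.open_target.mem_nhds ?_)
    simp only
    rw [← hGa]
    exact e.map_source hae
  have hgood := (hsymm.eventually (Metric.closedBall_mem_nhds a hδ)).and htarget
  obtain ⟨r, hr, hrball⟩ := Metric.nhds_basis_ball.mem_iff.1 hgood
  have hgood' : ∀ t x, |t| < r → x ∈ Metric.ball x₀ r →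
      e.symm (t, x, 0) ∈ Metric.closedBall a δ ∧ (t, x, 0) ∈ e.target := by
    intro t x ht hx
    refine hrball (a := (t, x)) ?_
    rw [← ball_prod_same]
    exact ⟨by simpa using ht, hx⟩
  have hsol : ∀ t x, |t| < r → x ∈ Metric.ball x₀ r →
      ∃ γ, e.symm (t, x, 0) = (t, x, γ) ∧ flowMap f hf.continuous (t, x, γ) = (t, x, 0) := by
    intro t x ht hx
    have h1 := e.right_inv (hgood' t x ht hx).2
    rw [hecoe] at h1
    have h2 : (e.symm (t, x, 0)).1 = t := congrArg Prod.fst h1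
    have h3 : (e.symm (t, x, 0)).2.1 = x := congrArg (fun q => q.2.1) h1
    refine ⟨(e.symm (t, x, 0)).2.2, ?_, ?_⟩
    · exact Prod.ext h2 (Prod.ext h3 rfl)
    · have : (t, x, (e.symm (t, x, 0)).2.2) = e.symm (t, x, 0) :=
        Prod.ext h2.symm (Prod.ext h3.symm rfl)
      rw [this]; exact h1
  -- Time t of the flow of f is time 1 of the flow of t f.
  let φ : ℝ → E → E := fun t x => (e.symm (t, x, 0)).2.2 ⟨1, by norm_num, le_rfl⟩
  have hφ : ∀ T x, |T| < r → 0 < T → x ∈ Metric.ball x₀ r → ∀ t ∈ Icc (-T) T,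
      φ t x = IccExtend (by norm_num : (-1 : ℝ) ≤ 1) (e.symm (T, x, 0)).2.2 (t / T) := by
    intro T x hT hT0 hx t ht
    obtain ⟨γ, h1, h2⟩ := hsol T x hT hx
    have hc : |t / T| ≤ 1 := by
      rw [abs_div, abs_of_pos hT0, div_le_one hT0]; exact abs_le.2 ht
    have h3 := flowMap_rescale f hf.continuous T (t / T) hc x γ h2
    rw [div_mul_cancel₀ _ hT0.ne'] at h3
    have hγ := (hgood' T x hT hx).1
    rw [h1, Metric.mem_closedBall, ha, Prod.dist_eq, Prod.dist_eq, max_le_iff, max_le_iff] at hγ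
    -- The rescaled curve takes only values of γ, so it stays in the ball on which `e` is injective;
    -- there uniqueness identifies it with the solution found for t.
    have hmem : (t, x, rescale (t / T) γ) ∈ Metric.closedBall a δ := by
      rw [Metric.mem_closedBall, ha, Prod.dist_eq, Prod.dist_eq, max_le_iff, max_le_iff]
      refine ⟨?_, hγ.2.1, (ContinuousMap.dist_le hδ.le).2 fun s => ?_⟩
      · refine le_trans ?_ hγ.1
        simp only [dist_zero_right, Real.norm_eq_abs, abs_of_pos hT0]
        exact abs_le.2 ht
      · exact (ContinuousMap.dist_le hδ.le).1 hγ.2.2 (projIcc (-1) 1 (by norm_num) (t / T * s))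
    have h4 : e.symm (t, x, 0) = (t, x, rescale (t / T) γ) := by
      rw [← h3, ← hecoe]
      exact e.left_inv (hball hmem).1
    simp only [φ, h1, h4]
    simp [rescale]
  refine ⟨r, hr, Metric.ball x₀ r, Metric.ball_mem_nhds _ hr, φ, ?_, ?_⟩
  · rintro ⟨t, x⟩ ⟨ht, hx⟩
    obtain ⟨h1, h2⟩ := hgood' t x (abs_lt.2 ht) hx
    obtain ⟨A, hA⟩ := (hball h1).2
    have h3 : ContDiffAt ℝ ∞ e.symm (t, x, 0) :=
      e.contDiffAt_symm h2 (f₀' := A) hA hG.contDiffAt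
    have h4 : ContDiff ℝ ∞ fun q : ℝ × E => ((q.1, q.2, 0) : ℝ × E × C(Icc (-1 : ℝ) 1, E)) := by
      fun_prop
    have h5 := ContDiffAt.comp (t, x) (f := fun q : ℝ × E =>
      ((q.1, q.2, 0) : ℝ × E × C(Icc (-1 : ℝ) 1, E))) h3 h4.contDiffAt
    have h6 : ContDiff ℝ ∞ fun q : ℝ × E × C(Icc (-1 : ℝ) 1, E) =>
        q.2.2 ⟨1, by norm_num, le_rfl⟩ :=
      ContDiff.comp (g := fun γ : C(Icc (-1 : ℝ) 1, E) => γ ⟨1, by norm_num, le_rfl⟩)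
        (evalMap E ⟨1, by norm_num, le_rfl⟩).contDiff
        (contDiff_snd.comp contDiff_snd)
    exact (h6.contDiffAt.comp (t, x) h5).contDiffWithinAt
  · intro x hx
    have hint : ∀ T, |T| < r → 0 < T → ∀ t ∈ Icc (-T) T, φ t x = x + T • ∫ u in (0 : ℝ)..(t / T),
        f (IccExtend (by norm_num : (-1 : ℝ) ≤ 1) (e.symm (T, x, 0)).2.2 u) := by
      intro T hT hT0 t ht
      rw [hφ T x hT hT0 hx t ht]
      obtain ⟨γ, h1, h2⟩ := hsol T x hT hx
      have hc : t / T ∈ Icc (-1 : ℝ) 1 := by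
        rw [mem_Icc, ← abs_le, abs_div, abs_of_pos hT0, div_le_one hT0]; exact abs_le.2 ht
      rw [h1, IccExtend_of_mem _ _ hc, (flowMap_eq_iff _ _ _ _ _).1 h2]
    constructor
    · have h1 := hint (r / 2) (by rw [abs_of_pos (by positivity)]; linarith) (by positivity) 0
        ⟨by linarith, by linarith⟩
      simpa using h1
    · intro t ht
      have ht' : |t| < r := abs_lt.2 ht
      have h0 := abs_nonneg t
      -- Any T strictly between |t| and r serves: on [-T, T] the trajectory is a primitive of one
      -- continuous function, so it can be differentiated at t.
      set T := (|t| + r) / 2 with hT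
      have hT0 : 0 < T := by rw [hT]; linarith
      have hTr : |T| < r := by rw [abs_of_pos hT0, hT]; linarith
      have htT : |t| < T := by rw [hT]; linarith
      have hev : (fun s => φ s x) =ᶠ[nhds t] fun s => x + T • ∫ u in (0 : ℝ)..(s / T),
          f (IccExtend (by norm_num : (-1 : ℝ) ≤ 1) (e.symm (T, x, 0)).2.2 u) := by
        filter_upwards [Icc_mem_nhds (abs_lt.1 htT).1 (abs_lt.1 htT).2] with s hs
        exact hint T hTr hT0 s hs
      have hcont : Continuous fun u =>
          f (IccExtend (by norm_num : (-1 : ℝ) ≤ 1) (e.symm (T, x, 0)).2.2 u) :=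
        hf.continuous.comp (((e.symm (T, x, 0)).2.2).continuous.Icc_extend')
      have h1 := (hcont.integral_hasStrictDerivAt 0 (t / T)).hasDerivAt
      have h2 : HasDerivAt (fun s : ℝ => s / T) (1 / T) t := (hasDerivAt_id t).div_const T
      have h3 := ((h1.scomp t h2).const_smul T).const_add x
      have h4 := h3.congr_of_eventuallyEq hev
      rw [← hφ T x hTr hT0 hx t (abs_le.1 htT.le), smul_smul, mul_one_div_cancel hT0.ne',
        one_smul] at h4
      exact h4

end LocalFlow

end

noncomputable section

/-! ### Vector fields and one-forms in charts -/

section Charts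

variable {E : Type*} [NormedAddCommGroup E] [NormedSpace ℝ E] {H : Type*} [TopologicalSpace H]
  {I : ModelWithCorners ℝ E H} [I.Boundaryless] {N : Type*} [TopologicalSpace N] [ChartedSpace H N]
  [IsManifold I ∞ N]

lemma mdifferentiableAt_extChartAt_symm {p : N} {y : E} (hy : y ∈ (extChartAt I p).target) :
    MDifferentiableAt 𝓘(ℝ, E) I (extChartAt I p).symm y := by
  have := mdifferentiableWithinAt_extChartAt_symm (I := I) hy
  rwa [I.range_eq_univ, mdifferentiableWithinAt_univ] at this

lemma mdifferentiableAt_extChartAt' {p q : N} (hq : q ∈ (extChartAt I p).source) :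
    MDifferentiableAt I 𝓘(ℝ, E) (extChartAt I p) q :=
  mdifferentiableAt_extChartAt (by rwa [extChartAt_source] at hq)

lemma mfderiv_extChartAt_mfderiv_symm {p : N} {y : E} (hy : y ∈ (extChartAt I p).target) (v : E) :
    mfderiv I 𝓘(ℝ, E) (extChartAt I p) ((extChartAt I p).symm y)
      (mfderiv 𝓘(ℝ, E) I (extChartAt I p).symm y v) = v := by
  have h := mfderiv_extChartAt_comp_mfderivWithin_extChartAt_symm (I := I) hy
  rw [I.range_eq_univ, mfderivWithin_univ] at h
  exact DFunLike.congr_fun h v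

lemma mfderiv_symm_mfderiv_extChartAt {p q : N} (hq : q ∈ (extChartAt I p).source)
    (v : TangentSpace I q) :
    mfderiv 𝓘(ℝ, E) I (extChartAt I p).symm (extChartAt I p q)
      (mfderiv I 𝓘(ℝ, E) (extChartAt I p) q v) = v := by
  have h := mfderivWithin_extChartAt_symm_comp_mfderiv_extChartAt' (I := I) hq
  rw [I.range_eq_univ, mfderivWithin_univ] at h
  exact DFunLike.congr_fun h v

lemma mfderiv_extChartAt_self_apply (p : N) (v : TangentSpace I p) :
    mfderiv I 𝓘(ℝ, E) (extChartAt I p) p v = v := by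
  rw [mfderiv_extChartAt_self]; rfl

lemma mfderiv_extChartAt_symm_self_apply (p : N) (v : E) :
    mfderiv 𝓘(ℝ, E) I (extChartAt I p).symm (extChartAt I p p) v = v := by
  have h := mfderiv_symm_mfderiv_extChartAt (mem_extChartAt_source (I := I) p) v
  have h2 := mfderiv_extChartAt_self_apply (I := I) p v
  exact (congrArg (mfderiv 𝓘(ℝ, E) I (extChartAt I p).symm (extChartAt I p p)) h2).symm.trans h

/-- The expression of a vector field in the preferred chart at `p`. -/
def localField (V : ∀ x : N, TangentSpace I x) (p : N) (y : E) : E :=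
  mfderiv I 𝓘(ℝ, E) (extChartAt I p) ((extChartAt I p).symm y) (V ((extChartAt I p).symm y))

/-- `V` is a smooth vector field. -/
def IsSmoothField (V : ∀ x : N, TangentSpace I x) : Prop :=
  ContMDiff I I.tangent ∞ (fun x => (⟨x, V x⟩ : TangentBundle I N))

lemma contMDiffOn_extChartAt_iff {F : Type*} [NormedAddCommGroup F] [NormedSpace ℝ F]
    (f : N → F) (p : N) : ContMDiffOn I 𝓘(ℝ, F) ∞ f (extChartAt I p).source ↔
      ContDiffOn ℝ ∞ (f ∘ (extChartAt I p).symm) (extChartAt I p).target := by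
  constructor
  · intro h
    rw [← contMDiffOn_iff_contDiffOn]
    exact h.comp (contMDiffOn_extChartAt_symm p) fun y hy => (extChartAt I p).map_target hy
  · intro h
    rw [← contMDiffOn_iff_contDiffOn] at h
    have h2 := h.comp (contMDiffOn_extChartAt (I := I) (x := p) (n := ∞)) (by
      intro x hx
      rw [← extChartAt_source I] at hx
      exact (extChartAt I p).map_source hx)
    rw [← extChartAt_source I] at h2
    refine h2.congr fun x hx => ?_
    exact congrArg f ((extChartAt I p).left_inv hx).symm

/-- On fibres the trivialization of the tangent bundle at p is the derivative of the chart at p, so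
smoothness as a section is smoothness of the chart expressions. -/
lemma isSmoothField_iff (V : ∀ x : N, TangentSpace I x) : IsSmoothField V ↔
    ∀ p, ContDiffOn ℝ ∞ (localField V p) (extChartAt I p).target := by
  have key : ∀ p, ContMDiffOn I I.tangent ∞ (fun x => (⟨x, V x⟩ : TangentBundle I N))
      (extChartAt I p).source ↔ ContDiffOn ℝ ∞ (localField V p) (extChartAt I p).target := by
    intro p
    have h := Bundle.Trivialization.contMDiffOn_section_baseSet_iff (IB := I) (n := ∞) (s := V)
      (trivializationAt E (TangentSpace I) p)
    have hb : (trivializationAt E (TangentSpace I) p).baseSet = (extChartAt I p).source := by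
      rw [TangentBundle.trivializationAt_baseSet, extChartAt_source]
    rw [hb] at h
    refine h.trans ?_
    rw [contMDiffOn_extChartAt_iff]
    refine contDiffOn_congr fun y hy => ?_
    have hs := (extChartAt I p).map_target hy
    have h3 := TangentBundle.continuousLinearMapAt_trivializationAt (𝕜 := ℝ) (I := I) (x₀ := p)
      (x := (extChartAt I p).symm y) (by rwa [extChartAt_source] at hs)
    have h4 := DFunLike.congr_fun h3 (V ((extChartAt I p).symm y))
    rw [Bundle.Trivialization.continuousLinearMapAt_apply,
      Bundle.Trivialization.linearMapAt_def_of_mem] at h4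
    · exact h4
    · rw [hb]; exact hs
  constructor
  · exact fun h p => (key p).1 h.contMDiffOn
  · intro h p
    exact ((key p).2 (h p)).contMDiffAt (extChartAt_source_mem_nhds p)

/-- The trivialization of the cotangent bundle at p acts by composition with the derivative of the
inverse chart, which is exactly what `localForm` does. -/
lemma isSmoothForm_iff (β : ∀ x : N, TangentSpace I x →L[ℝ] ℝ) : IsSmoothForm I β ↔
    ∀ p, ContDiffOn ℝ ∞ (localForm I β p) (extChartAt I p).target := by
  have key : ∀ p, ContMDiffOn I (I.prod 𝓘(ℝ, E →L[ℝ] ℝ)) ∞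
      (fun x => Bundle.TotalSpace.mk' (E →L[ℝ] ℝ)
        (E := fun x : N => TangentSpace I x →L[ℝ] ℝ) x (β x))
      (extChartAt I p).source ↔ ContDiffOn ℝ ∞ (localForm I β p) (extChartAt I p).target := by
    intro p
    have h := Bundle.Trivialization.contMDiffOn_section_baseSet_iff (IB := I) (n := ∞) (s := β)
      (trivializationAt (E →L[ℝ] ℝ) (fun x : N => TangentSpace I x →L[ℝ] ℝ) p)
    have hb : (trivializationAt (E →L[ℝ] ℝ) (fun x : N => TangentSpace I x →L[ℝ] ℝ) p).baseSet
        = (extChartAt I p).source := by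
      rw [hom_trivializationAt_baseSet, TangentBundle.trivializationAt_baseSet, extChartAt_source]
      simp
    rw [hb] at h
    refine h.trans ?_
    rw [contMDiffOn_extChartAt_iff]
    refine contDiffOn_congr fun y hy => ?_
    have hs := (extChartAt I p).map_target hy
    have h3 := TangentBundle.symmL_trivializationAt (𝕜 := ℝ) (I := I) (x₀ := p)
      (x := (extChartAt I p).symm y) (by rwa [extChartAt_source] at hs)
    rw [I.range_eq_univ, mfderivWithin_univ, (extChartAt I p).right_inv hy] at h3
    rw [localForm, ← h3]
    rw [Function.comp_apply, hom_trivializationAt_apply]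
    ext v
    simp [ContinuousLinearMap.inCoordinates]
    rfl
  constructor
  · exact fun h p => (key p).1 h.contMDiffOn
  · intro h p
    exact ((key p).2 (h p)).contMDiffAt (extChartAt_source_mem_nhds p)

end Charts

end

noncomputable section

/-! ### Flows of vector fields on manifolds -/

section Flows

variable {E : Type*} [NormedAddCommGroup E] [NormedSpace ℝ E] [FiniteDimensional ℝ E]
  {H : Type*} [TopologicalSpace H]
  {I : ModelWithCorners ℝ E H} [I.Boundaryless] {N : Type*} [TopologicalSpace N] [ChartedSpace H N]
  [IsManifold I ∞ N]

lemma comp_smulRight_one {F G : Type*} [AddCommGroup F] [Module ℝ F] [TopologicalSpace F]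
    [IsTopologicalAddGroup F] [ContinuousSMul ℝ F] [AddCommGroup G] [Module ℝ G]
    [TopologicalSpace G] [IsTopologicalAddGroup G] [ContinuousSMul ℝ G] (A : F →L[ℝ] G) (v : F) :
    A.comp ((1 : ℝ →L[ℝ] ℝ).smulRight v) = (1 : ℝ →L[ℝ] ℝ).smulRight (A v) := by
  ext
  simp

lemma hasMFDerivAt_symm_comp {V : ∀ x : N, TangentSpace I x} {p : N} {c : ℝ → E} {t : ℝ}
    (ht : c t ∈ (extChartAt I p).target) (hc : HasDerivAt c (localField V p (c t)) t) :
    HasMFDerivAt 𝓘(ℝ, ℝ) I (fun s => (extChartAt I p).symm (c s)) t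
      ((1 : ℝ →L[ℝ] ℝ).smulRight (V ((extChartAt I p).symm (c t)))) := by
  have h1 := (mdifferentiableAt_extChartAt_symm ht).hasMFDerivAt
  have h3 := HasMFDerivAt.comp t h1 hc.hasFDerivAt.hasMFDerivAt
  have hs := (extChartAt I p).map_target ht
  have h4 := mfderiv_symm_mfderiv_extChartAt hs (V ((extChartAt I p).symm (c t)))
  rw [(extChartAt I p).right_inv ht] at h4
  refine h3.congr_mfderiv ?_
  refine (comp_smulRight_one (F := E) (G := E) _ _).trans ?_
  exact congrArg (fun v : E => (1 : ℝ →L[ℝ] ℝ).smulRight v) h4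

/-- A smooth vector field on a manifold has a smooth local flow. -/
lemma exists_local_flow {V : ∀ x : N, TangentSpace I x} (hV : IsSmoothField V) (p : N) :
    ∃ ε > 0, ∃ U ∈ nhds p, ∃ φ : ℝ → N → N,
      ContMDiffOn (𝓘(ℝ, ℝ).prod I) I ∞ (fun q : ℝ × N => φ q.1 q.2) (Ioo (-ε) ε ×ˢ U) ∧
      ∀ x ∈ U, φ 0 x = x ∧ IsMIntegralCurveOn (fun s => φ s x) V (Ioo (-ε) ε) := by
  have hcomplete : CompleteSpace E := FiniteDimensional.complete ℝ E
  set e := extChartAt I p with he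
  have hopen : IsOpen e.target := isOpen_extChartAt_target p
  have hp : e p ∈ e.target := e.map_source (mem_extChartAt_source p)
  obtain ⟨r, hr, hball⟩ := Metric.nhds_basis_closedBall.mem_iff.1 (hopen.mem_nhds hp)
  -- The bump function extends the chart expression of V by zero to a smooth field on all of E that
  -- is unchanged on the ball of radius r / 2; for short times trajectories from near p do not leave
  -- that ball.
  let b : ContDiffBump (e p) := ⟨r / 2, r, by positivity, by linarith⟩
  have hVe := (isSmoothField_iff V).1 hV p
  have hf : ContDiff ℝ ∞ fun y => b y • localField V p y := by
    rw [contDiff_iff_contDiffAt]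
    intro y
    by_cases hy : y ∈ e.target
    · exact b.contDiff.contDiffAt.smul (hVe.contDiffAt (hopen.mem_nhds hy))
    · have : y ∈ (Metric.closedBall (e p) r)ᶜ := fun h => hy (hball h)
      refine (contDiffAt_const (c := (0 : E))).congr_of_eventuallyEq ?_
      filter_upwards [Metric.isClosed_closedBall.isOpen_compl.mem_nhds this] with z hz
      have : b z = 0 := b.zero_of_le_dist (by
        simp only [mem_compl_iff, Metric.mem_closedBall, not_le] at hz
        exact hz.le)
      simp [this]
  obtain ⟨ε, hε, U, hU, φ, hφ, hφ'⟩ := exists_smooth_local_flow _ hf (e p)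
  have hnhds : Ioo (-ε) ε ×ˢ U ∈ nhds ((0 : ℝ), e p) :=
    prod_mem_nhds (Ioo_mem_nhds (by linarith) hε) hU
  have hcont : ContinuousAt (fun q : ℝ × E => φ q.1 q.2) (0, e p) :=
    (hφ.continuousOn).continuousAt hnhds
  have h0 : φ 0 (e p) = e p := (hφ' _ (mem_of_mem_nhds hU)).1
  have hev : ∀ᶠ q : ℝ × E in nhds (0, e p), φ q.1 q.2 ∈ Metric.ball (e p) (r / 2) := by
    refine hcont (Metric.isOpen_ball.mem_nhds ?_)
    simp only [h0]
    exact Metric.mem_ball_self (by positivity)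
  obtain ⟨s₁, hs₁, s₂, hs₂, hsub⟩ := mem_nhds_prod_iff.1 (Filter.inter_mem hev hnhds)
  obtain ⟨δ, hδ, hδs⟩ := Metric.mem_nhds_iff.1 hs₁
  rw [Real.ball_eq_Ioo, zero_sub, zero_add] at hδs
  have hmem : ∀ t ∈ Ioo (-δ) δ, ∀ y ∈ s₂, φ t y ∈ Metric.ball (e p) (r / 2) ∧
      (t, y) ∈ Ioo (-ε) ε ×ˢ U := fun t ht y hy => hsub (mk_mem_prod (hδs ht) hy)
  have hbt : Metric.ball (e p) (r / 2) ⊆ e.target := fun y hy => hball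
    (Metric.closedBall_subset_closedBall (by linarith) (Metric.ball_subset_closedBall hy))
  have hU' : e.source ∩ e ⁻¹' s₂ ∈ nhds p :=
    Filter.inter_mem (extChartAt_source_mem_nhds p)
      ((continuousAt_extChartAt p).preimage_mem_nhds hs₂)
  refine ⟨δ, hδ, e.source ∩ e ⁻¹' s₂, hU', fun t x => e.symm (φ t (e x)), ?_, ?_⟩
  · have h1 : ContMDiffOn (𝓘(ℝ, ℝ).prod I) (𝓘(ℝ, ℝ).prod 𝓘(ℝ, E)) ∞
        (fun q : ℝ × N => (q.1, e q.2)) (Ioo (-δ) δ ×ˢ (e.source ∩ e ⁻¹' s₂)) := by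
      refine contMDiffOn_fst.prodMk ?_
      refine (contMDiffOn_extChartAt (I := I) (x := p)).comp contMDiffOn_snd ?_
      intro q hq
      have := hq.2.1
      rwa [he, extChartAt_source] at this
    have h2 : ContMDiffOn (𝓘(ℝ, ℝ).prod 𝓘(ℝ, E)) 𝓘(ℝ, E) ∞ (fun q : ℝ × E => φ q.1 q.2)
        (Ioo (-ε) ε ×ˢ U) := by
      rw [← modelWithCornersSelf_prod, chartedSpaceSelf_prod]
      exact hφ.contMDiffOn
    have h3 := h2.comp h1 (fun q hq => (hmem q.1 hq.1 _ hq.2.2).2)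
    exact (contMDiffOn_extChartAt_symm p).comp h3
      (fun q hq => hbt (hmem q.1 hq.1 _ hq.2.2).1)
  · intro x hx
    refine ⟨?_, fun t ht => ?_⟩
    · have := (hφ' (e x) (hmem 0 ⟨by linarith, hδ⟩ _ hx.2).2.2).1
      exact (congrArg e.symm this).trans (e.left_inv hx.1)
    · obtain ⟨h1, h2⟩ := hmem t ht _ hx.2
      have h3 := (hφ' (e x) h2.2).2 t h2.1
      have h4 : b (φ t (e x)) = 1 := b.one_of_mem_closedBall (Metric.ball_subset_closedBall h1)
      rw [h4, one_smul] at h3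
      exact (hasMFDerivAt_symm_comp (hbt h1) h3).hasMFDerivWithinAt

variable [T2Space N]

/-- A family of global integral curves of a smooth vector field depends smoothly on the
initial point. -/
lemma contMDiff_flow {V : ∀ x : N, TangentSpace I x} (hV : IsSmoothField V)
    {Φ : ℝ → N → N} (h0 : ∀ x, Φ 0 x = x) (hΦ : ∀ x, IsMIntegralCurve (fun t => Φ t x) V) :
    ContMDiff (𝓘(ℝ, ℝ).prod I) I ∞ (fun q : ℝ × N => Φ q.1 q.2) := by
  have hV1 : ContMDiff I I.tangent 1 (fun x => (⟨x, V x⟩ : TangentBundle I N)) :=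
    hV.of_le (by norm_cast)
  have hadd : ∀ s t x, Φ (s + t) x = Φ s (Φ t x) := by
    intro s t x
    have h1 : IsMIntegralCurve (fun s => Φ (s + t) x) V := (hΦ x).comp_add t
    have h2 := isMIntegralCurve_Ioo_eq_of_contMDiff_boundaryless (t₀ := 0) hV1 h1 (hΦ (Φ t x))
      (by simp [h0])
    exact congrFun h2 s
  have hloc : ∀ p, ∃ ε > 0, ∃ U ∈ nhds p,
      ContMDiffOn (𝓘(ℝ, ℝ).prod I) I ∞ (fun q : ℝ × N => Φ q.1 q.2) (Ioo (-ε) ε ×ˢ U) := by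
    intro p
    obtain ⟨ε, hε, U, hU, φ, hφ, hφ'⟩ := exists_local_flow hV p
    refine ⟨ε, hε, U, hU, hφ.congr ?_⟩
    rintro ⟨t, x⟩ ⟨ht, hx⟩
    exact isMIntegralCurveOn_Ioo_eqOn_of_contMDiff_boundaryless (t₀ := 0) ⟨by linarith, hε⟩ hV1
      ((hΦ x).isMIntegralCurveOn _) (hφ' x hx).2 (by rw [h0, (hφ' x hx).1]) ht
  -- The times t such that Φ is smooth near (t, p). This set contains 0 by `hloc`; since smoothness
  -- at t' spreads to all times within a uniform distance, the set is open and closed.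
  let S : N → Set ℝ := fun p => {t | ∃ W ∈ nhds (t, p),
    ContMDiffOn (𝓘(ℝ, ℝ).prod I) I ∞ (fun q : ℝ × N => Φ q.1 q.2) W}
  -- smoothness propagates along the flow for a uniform time
  have hprop : ∀ p t₁, ∃ ε > 0, ∀ t' t, |t' - t₁| < ε → |t - t'| < ε → t' ∈ S p → t ∈ S p := by
    intro p t₁
    obtain ⟨ε, hε, U, hU, hsm⟩ := hloc (Φ t₁ p)
    have hc : ContinuousAt (fun t => Φ t p) t₁ := (hΦ p).continuous.continuousAt
    obtain ⟨δ, hδ, hδU⟩ := Metric.mem_nhds_iff.1 (hc (interior_mem_nhds.2 hU))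
    refine ⟨min ε δ, lt_min hε hδ, ?_⟩
    rintro t' t ht' ht ⟨W, hW, hsmW⟩
    have hUt' : Φ t' p ∈ interior U := hδU (by
      rw [Metric.mem_ball, Real.dist_eq]; exact ht'.trans_le (min_le_right _ _))
    obtain ⟨W₁, hW₁, W₂, hW₂, hWsub⟩ := mem_nhds_prod_iff.1 hW
    have hsm1 : ContMDiffOn I I ∞ (fun x => Φ t' x) W₂ := by
      have : ContMDiffOn I (𝓘(ℝ, ℝ).prod I) ∞ (fun x : N => (t', x)) W₂ :=
        contMDiffOn_const.prodMk contMDiffOn_id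
      exact hsmW.comp this (fun x hx => hWsub (mk_mem_prod (mem_of_mem_nhds hW₁) hx))
    have hcx : ContinuousAt (fun x => Φ t' x) p := hsm1.continuousOn.continuousAt hW₂
    have hV' : W₂ ∩ (fun x => Φ t' x) ⁻¹' (interior U) ∈ nhds p :=
      Filter.inter_mem hW₂ (hcx (isOpen_interior.mem_nhds hUt'))
    have htt : {s : ℝ | s - t' ∈ Ioo (-ε) ε} ∈ nhds t := by
      refine (isOpen_Ioo.preimage (by fun_prop : Continuous fun s : ℝ => s - t')).mem_nhds ?_
      have := ht.trans_le (min_le_left _ _)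
      exact abs_lt.1 this
    refine ⟨_, prod_mem_nhds htt hV', ?_⟩
    have h2 : ContMDiffOn (𝓘(ℝ, ℝ).prod I) (𝓘(ℝ, ℝ).prod I) ∞
        (fun q : ℝ × N => (q.1 - t', Φ t' q.2))
        ({s : ℝ | s - t' ∈ Ioo (-ε) ε} ×ˢ (W₂ ∩ (fun x => Φ t' x) ⁻¹' (interior U))) := by
      refine ContMDiffOn.prodMk ?_ ?_
      · have : ContMDiff 𝓘(ℝ, ℝ) 𝓘(ℝ, ℝ) ∞ (fun s : ℝ => s - t') := by
          rw [contMDiff_iff_contDiff]; fun_prop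
        exact this.comp_contMDiffOn contMDiffOn_fst
      · exact hsm1.comp contMDiffOn_snd (fun q hq => hq.2.1)
    have h3 := hsm.comp h2 (fun q hq => mk_mem_prod hq.1 (interior_subset hq.2.2))
    refine h3.congr fun q _ => ?_
    simp only [Function.comp_apply]
    rw [← hadd, sub_add_cancel]
  have hall : ∀ p, S p = univ := by
    intro p
    refine IsClopen.eq_univ ⟨?_, ?_⟩ ⟨0, ?_⟩
    · rw [← closure_subset_iff_isClosed]
      intro t₁ ht₁
      obtain ⟨ε, hε, h⟩ := hprop p t₁
      obtain ⟨t', ht', hd⟩ := Metric.mem_closure_iff.1 ht₁ ε hε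
      rw [Real.dist_eq] at hd
      exact h t' t₁ (by rwa [abs_sub_comm]) hd ht'
    · rw [Metric.isOpen_iff]
      intro t₁ ht₁
      obtain ⟨ε, hε, h⟩ := hprop p t₁
      refine ⟨ε, hε, fun t ht => h t₁ t (by simpa using hε) ht ht₁⟩
    · obtain ⟨ε, hε, U, hU, hsm⟩ := hloc p
      exact ⟨_, prod_mem_nhds (Ioo_mem_nhds (by linarith) hε) hU, hsm⟩
  rintro ⟨t, p⟩
  obtain ⟨W, hW, hsm⟩ : t ∈ S p := by rw [hall]; trivial
  exact hsm.contMDiffAt hW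

/-- A smooth vector field all of whose points outside of a compact set are equilibria, up to a
uniform time, is complete. -/
lemma exists_flow_of_compact {V : ∀ x : N, TangentSpace I x} (hV : IsSmoothField V)
    {C : Set N} (hC : IsCompact C) (h : ∀ x ∉ C, ∃ γ : ℝ → N, γ 0 = x ∧
      IsMIntegralCurveOn γ V (Ioo (-1) 1)) :
    ∃ Φ : ℝ → N → N, (∀ x, Φ 0 x = x) ∧ (∀ x, IsMIntegralCurve (fun t => Φ t x) V) := by
  have hV1 : ContMDiff I I.tangent 1 (fun x => (⟨x, V x⟩ : TangentBundle I N)) :=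
    hV.of_le (by norm_cast)
  -- Compactness turns the local existence times into a common one. Off C a common time is given,
  -- and a uniform existence time makes all trajectories global.
  have hex : ∃ ε > 0, ∀ x ∈ C, ∃ γ : ℝ → N, γ 0 = x ∧ IsMIntegralCurveOn γ V (Ioo (-ε) ε) := by
    refine hC.induction_on (p := fun S => ∃ ε > 0, ∀ x ∈ S, ∃ γ : ℝ → N, γ 0 = x ∧
      IsMIntegralCurveOn γ V (Ioo (-ε) ε)) ⟨1, one_pos, by simp⟩ ?_ ?_ ?_
    · rintro s t hst ⟨ε, hε, h⟩
      exact ⟨ε, hε, fun x hx => h x (hst hx)⟩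
    · rintro s t ⟨ε, hε, h⟩ ⟨ε', hε', h'⟩
      refine ⟨min ε ε', lt_min hε hε', ?_⟩
      rintro x (hx | hx)
      · obtain ⟨γ, h1, h2⟩ := h x hx
        exact ⟨γ, h1, h2.mono (Ioo_subset_Ioo (neg_le_neg (min_le_left _ _)) (min_le_left _ _))⟩
      · obtain ⟨γ, h1, h2⟩ := h' x hx
        exact ⟨γ, h1, h2.mono (Ioo_subset_Ioo (neg_le_neg (min_le_right _ _)) (min_le_right _ _))⟩
    · intro x _
      obtain ⟨ε, hε, U, hU, φ, -, hφ⟩ := exists_local_flow hV x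
      exact ⟨U, mem_nhdsWithin_of_mem_nhds hU, ε, hε, fun y hy => ⟨_, (hφ y hy).1, (hφ y hy).2⟩⟩
  obtain ⟨ε, hε, hex⟩ := hex
  have hall : ∀ x : N, ∃ γ : ℝ → N, γ 0 = x ∧
      IsMIntegralCurveOn γ V (Ioo (-(min ε 1)) (min ε 1)) := by
    intro x
    by_cases hx : x ∈ C
    · obtain ⟨γ, h1, h2⟩ := hex x hx
      exact ⟨γ, h1, h2.mono (Ioo_subset_Ioo (neg_le_neg (min_le_left _ _)) (min_le_left _ _))⟩
    · obtain ⟨γ, h1, h2⟩ := h x hx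
      exact ⟨γ, h1, h2.mono (Ioo_subset_Ioo (neg_le_neg (min_le_right _ _)) (min_le_right _ _))⟩
  choose γ hγ0 hγ using fun x => exists_isMIntegralCurve_of_isMIntegralCurveOn hV1
    (lt_min hε one_pos) hall x
  exact ⟨fun t x => γ x t, hγ0, hγ⟩

end Flows

end

noncomputable section

/-! ### The exterior derivative and its naturality -/

section VectorSpace

variable {E E' : Type*} [NormedAddCommGroup E] [NormedSpace ℝ E]
  [NormedAddCommGroup E'] [NormedSpace ℝ E']

/-- The exterior derivative of a one-form on a vector space. -/
def flatD (b : E → E →L[ℝ] ℝ) (y u v : E) : ℝ := fderiv ℝ b y u v - fderiv ℝ b y v u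

lemma flatD_congr {b b' : E → E →L[ℝ] ℝ} {y : E} (h : b =ᶠ[nhds y] b') (u v : E) :
    flatD b y u v = flatD b' y u v := by
  rw [flatD, flatD, h.fderiv_eq]

lemma fderiv_pullback_apply {b : E' → E' →L[ℝ] ℝ} {f : E → E'} {y : E}
    (hb : DifferentiableAt ℝ b (f y)) (hf : ContDiffAt ℝ 2 f y) (u v : E) :
    fderiv ℝ (fun z => (b (f z)).comp (fderiv ℝ f z)) y u v =
      fderiv ℝ b (f y) (fderiv ℝ f y u) (fderiv ℝ f y v) +
        b (f y) (fderiv ℝ (fderiv ℝ f) y u v) := by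
  have h1 : HasFDerivAt (fun z => b (f z)) _ y :=
    hb.hasFDerivAt.comp y (hf.differentiableAt (by norm_num)).hasFDerivAt
  have h2 : HasFDerivAt (fderiv ℝ f) _ y :=
    ((hf.fderiv_right (m := 1) (by norm_num)).differentiableAt (by norm_num)).hasFDerivAt
  rw [(h1.clm_comp h2).fderiv]
  simp [add_comm]

/-- The second derivative of f enters both terms through b (f y) and cancels by symmetry. -/
lemma flatD_pullback {b : E' → E' →L[ℝ] ℝ} {f : E → E'} {y : E}
    (hb : DifferentiableAt ℝ b (f y)) (hf : ContDiffAt ℝ 2 f y) (u v : E) :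
    flatD (fun z => (b (f z)).comp (fderiv ℝ f z)) y u v =
      flatD b (f y) (fderiv ℝ f y u) (fderiv ℝ f y v) := by
  have hs : fderiv ℝ (fderiv ℝ f) y u v = fderiv ℝ (fderiv ℝ f) y v u :=
    (hf.isSymmSndFDerivAt (by simp)).eq u v
  rw [flatD, flatD, fderiv_pullback_apply hb hf, fderiv_pullback_apply hb hf, hs]
  ring

end VectorSpace

section Forms

variable {E : Type*} [NormedAddCommGroup E] [NormedSpace ℝ E] {H : Type*} [TopologicalSpace H]
  {I : ModelWithCorners ℝ E H} [I.Boundaryless] {N : Type*} [TopologicalSpace N] [ChartedSpace H N]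
  [IsManifold I ∞ N]
  {E' : Type*} [NormedAddCommGroup E'] [NormedSpace ℝ E'] {H' : Type*} [TopologicalSpace H']
  {I' : ModelWithCorners ℝ E' H'} [I'.Boundaryless] {N' : Type*} [TopologicalSpace N']
  [ChartedSpace H' N'] [IsManifold I' ∞ N']

lemma localForm_apply (β : ∀ x : N, TangentSpace I x →L[ℝ] ℝ) {p q : N}
    (hq : q ∈ (extChartAt I p).source) (v : E) :
    localForm I β p (extChartAt I p q) v =
      β q (mfderiv 𝓘(ℝ, E) I (extChartAt I p).symm (extChartAt I p q) v) := by
  have h : (extChartAt I p).symm (extChartAt I p q) = q := (extChartAt I p).left_inv hq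
  exact congrArg (fun q' : N => (show E →L[ℝ] ℝ from β q')
    (mfderiv 𝓘(ℝ, E) I (extChartAt I p).symm (extChartAt I p q) v)) h

lemma localForm_mfderiv (β : ∀ x : N, TangentSpace I x →L[ℝ] ℝ) {p q : N}
    (hq : q ∈ (extChartAt I p).source) (v : TangentSpace I q) :
    localForm I β p (extChartAt I p q) (mfderiv I 𝓘(ℝ, E) (extChartAt I p) q v) = β q v :=
  (localForm_apply β hq _).trans
    (congrArg (fun w : E => (show E →L[ℝ] ℝ from β q) w) (mfderiv_symm_mfderiv_extChartAt hq v))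

/-- The pullback of a one-form. -/
def pullForm (I : ModelWithCorners ℝ E H) (I' : ModelWithCorners ℝ E' H') (f : N → N')
    (β : ∀ x : N', TangentSpace I' x →L[ℝ] ℝ) (x : N) : TangentSpace I x →L[ℝ] ℝ :=
  (β (f x)).comp (mfderiv I I' f x)

lemma hasFDerivAt_chart_comp {f : N → N'} {p : N} {p' : N'} {y : E}
    (hy : y ∈ (extChartAt I p).target) (hf : MDifferentiableAt I I' f ((extChartAt I p).symm y))
    (hfy : f ((extChartAt I p).symm y) ∈ (extChartAt I' p').source) :
    HasFDerivAt (fun z => extChartAt I' p' (f ((extChartAt I p).symm z)))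
      (show E →L[ℝ] E' from
        (mfderiv I' 𝓘(ℝ, E') (extChartAt I' p') (f ((extChartAt I p).symm y))).comp
        ((mfderiv I I' f ((extChartAt I p).symm y)).comp
        (mfderiv 𝓘(ℝ, E) I (extChartAt I p).symm y))) y := by
  have h1 := (mdifferentiableAt_extChartAt_symm hy).hasMFDerivAt
  have h2 := (mdifferentiableAt_extChartAt' (I := I') hfy).hasMFDerivAt
  have h3 := HasMFDerivAt.comp y h2 (HasMFDerivAt.comp y hf.hasMFDerivAt h1)
  exact hasMFDerivAt_iff_hasFDerivAt.1 h3

lemma localForm_pullForm {f : N → N'} {p : N} {p' : N'} {y : E}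
    (β : ∀ x : N', TangentSpace I' x →L[ℝ] ℝ)
    (hy : y ∈ (extChartAt I p).target) (hf : MDifferentiableAt I I' f ((extChartAt I p).symm y))
    (hfy : f ((extChartAt I p).symm y) ∈ (extChartAt I' p').source) :
    localForm I (pullForm I I' f β) p y =
      (localForm I' β p' (extChartAt I' p' (f ((extChartAt I p).symm y)))).comp
        (fderiv ℝ (fun z => extChartAt I' p' (f ((extChartAt I p).symm z))) y) := by
  rw [(hasFDerivAt_chart_comp hy hf hfy).fderiv]
  refine ContinuousLinearMap.ext fun v => ?_
  exact (localForm_mfderiv β hfy _).symm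

lemma contDiffAt_chart_comp {f : N → N'} {p q : N} {p' : N'} (hq : q ∈ (extChartAt I p).source)
    (hf : ContMDiffAt I I' ∞ f q) (hfq : f q ∈ (extChartAt I' p').source) :
    ContDiffAt ℝ ∞ (fun z => extChartAt I' p' (f ((extChartAt I p).symm z)))
      (extChartAt I p q) := by
  rw [← contMDiffAt_iff_contDiffAt]
  have h1 : ContMDiffAt 𝓘(ℝ, E) I ∞ (extChartAt I p).symm (extChartAt I p q) :=
    (contMDiffOn_extChartAt_symm p).contMDiffAt
      ((isOpen_extChartAt_target p).mem_nhds ((extChartAt I p).map_source hq))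
  have hs : (extChartAt I p).symm (extChartAt I p q) = q := (extChartAt I p).left_inv hq
  have h2 : ContMDiffAt I' 𝓘(ℝ, E') ∞ (extChartAt I' p') (f q) :=
    contMDiffAt_extChartAt' (by rwa [extChartAt_source] at hfq)
  refine ContMDiffAt.comp (g := extChartAt I' p')
    (f := fun z => f ((extChartAt I p).symm z)) _ (I' := I') ?_ ?_
  · rwa [hs]
  · refine ContMDiffAt.comp (g := f) (f := (extChartAt I p).symm) _ (I' := I) ?_ h1
    rwa [hs]

/-- The exterior derivative is natural under pullbacks, expressed in an arbitrary preferred chart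
of the target. -/
lemma extD_pullForm_chart {f : N → N'} {p : N} {p' : N'}
    {β : ∀ x : N', TangentSpace I' x →L[ℝ] ℝ} (hβ : IsSmoothForm I' β)
    (hf : ContMDiffAt I I' ∞ f p) (hf' : ∀ᶠ q in nhds p, MDifferentiableAt I I' f q)
    (hfp : f p ∈ (extChartAt I' p').source) (u v : TangentSpace I p) :
    extD I (pullForm I I' f β) p u v =
      flatD (localForm I' β p') (extChartAt I' p' (f p))
        (mfderiv I' 𝓘(ℝ, E') (extChartAt I' p') (f p) (mfderiv I I' f p u))
        (mfderiv I' 𝓘(ℝ, E') (extChartAt I' p') (f p) (mfderiv I I' f p v)) := by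
  set F := fun z => extChartAt I' p' (f ((extChartAt I p).symm z)) with hF
  have hp := mem_extChartAt_source (I := I) p
  have hs : (extChartAt I p).symm (extChartAt I p p) = p := (extChartAt I p).left_inv hp
  have hcont : ContinuousAt (extChartAt I p).symm (extChartAt I p p) :=
    continuousAt_extChartAt_symm p
  have hev : localForm I (pullForm I I' f β) p =ᶠ[nhds (extChartAt I p p)]
      fun z => (localForm I' β p' (F z)).comp (fderiv ℝ F z) := by
    have h1 : ∀ᶠ z in nhds (extChartAt I p p), MDifferentiableAt I I' f ((extChartAt I p).symm z) :=
      hcont.eventually (by rwa [hs])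
    have h2 : ∀ᶠ z in nhds (extChartAt I p p),
        f ((extChartAt I p).symm z) ∈ (extChartAt I' p').source := by
      refine hcont.eventually (p := fun q => f q ∈ (extChartAt I' p').source) ?_
      rw [hs]
      exact hf.continuousAt ((isOpen_extChartAt_source p').mem_nhds hfp)
    filter_upwards [h1, h2, extChartAt_target_mem_nhds p] with z hz1 hz2 hz3
    exact localForm_pullForm β hz3 hz1 hz2
  have hFs : ContDiffAt ℝ ∞ F (extChartAt I p p) := contDiffAt_chart_comp hp hf hfp
  have hFp : F (extChartAt I p p) = extChartAt I' p' (f p) := by rw [hF]; simp only; rw [hs]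
  have hb : DifferentiableAt ℝ (localForm I' β p') (F (extChartAt I p p)) := by
    rw [hFp]
    exact ((isSmoothForm_iff β).1 hβ p').contDiffAt ((isOpen_extChartAt_target p').mem_nhds
      ((extChartAt I' p').map_source hfp)) |>.differentiableAt (by simp)
  have hD : ∀ u : TangentSpace I p, fderiv ℝ F (extChartAt I p p) u =
      mfderiv I' 𝓘(ℝ, E') (extChartAt I' p') (f p) (mfderiv I I' f p u) := by
    intro u
    have h := hasFDerivAt_chart_comp (I := I) (I' := I') (p := p) (p' := p')
      (extChartAt I p |>.map_source hp)
      (by rw [hs]; exact hf.mdifferentiableAt (by simp)) (by rwa [hs])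
    rw [hF, h.fderiv]
    have h5 := mfderiv_extChartAt_symm_self_apply (I := I) p u
    refine (congrArg (fun w : E => mfderiv I' 𝓘(ℝ, E') (extChartAt I' p')
      (f ((extChartAt I p).symm (extChartAt I p p))) (mfderiv I I' f
        ((extChartAt I p).symm (extChartAt I p p)) w)) h5).trans ?_
    exact congrArg (fun q => (show E' →L[ℝ] E' from mfderiv I' 𝓘(ℝ, E') (extChartAt I' p')
      (f q)) ((show E →L[ℝ] E' from mfderiv I I' f q) u)) hs
  refine (flatD_congr hev u v).trans
    ((flatD_pullback hb (hFs.of_le (by norm_cast)) u v).trans ?_)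
  rw [hFp]
  exact congrArg₂ (flatD (localForm I' β p') (extChartAt I' p' (f p))) (hD u) (hD v)

/-- The exterior derivative in terms of an arbitrary preferred chart. -/
lemma extD_eq_flatD {p q : N} {β : ∀ x : N, TangentSpace I x →L[ℝ] ℝ} (hβ : IsSmoothForm I β)
    (hq : q ∈ (extChartAt I p).source) (u v : TangentSpace I q) :
    extD I β q u v = flatD (localForm I β p) (extChartAt I p q)
      (mfderiv I 𝓘(ℝ, E) (extChartAt I p) q u) (mfderiv I 𝓘(ℝ, E) (extChartAt I p) q v) := by
  have h := extD_pullForm_chart (f := (id : N → N)) (p := q) (p' := p) hβ contMDiffAt_id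
    (Filter.Eventually.of_forall fun _ => mdifferentiableAt_id) hq u v
  have h2 : pullForm I I id β = β := by
    funext x
    refine ContinuousLinearMap.ext fun w => ?_
    have : mfderiv I I (id : N → N) x w = w := by rw [mfderiv_id]; rfl
    exact congrArg (fun w : E => (show E →L[ℝ] ℝ from β x) w) this
  have h3 : ∀ w : TangentSpace I q, mfderiv I I (id : N → N) q w = w := fun w => by
    rw [mfderiv_id]; rfl
  rw [h2] at h
  refine h.trans ?_
  exact congrArg₂ (fun a b : E => flatD (localForm I β p) (extChartAt I p q)
    ((show E →L[ℝ] E from mfderiv I 𝓘(ℝ, E) (extChartAt I p) q) a)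
    ((show E →L[ℝ] E from mfderiv I 𝓘(ℝ, E) (extChartAt I p) q) b)) (h3 u) (h3 v)

/-- The exterior derivative commutes with pullbacks. -/
lemma extD_pullForm {f : N → N'} {p : N}
    {β : ∀ x : N', TangentSpace I' x →L[ℝ] ℝ} (hβ : IsSmoothForm I' β)
    (hf : ContMDiff I I' ∞ f) (u v : TangentSpace I p) :
    extD I (pullForm I I' f β) p u v =
      extD I' β (f p) (mfderiv I I' f p u) (mfderiv I I' f p v) := by
  rw [extD_pullForm_chart hβ hf.contMDiffAt
    (Filter.Eventually.of_forall fun q => hf.mdifferentiableAt (by simp))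
    (mem_extChartAt_source (f p)), extD_eq_flatD hβ (mem_extChartAt_source (f p))]

end Forms

end

noncomputable section

/-! ### Hamiltonian vector fields -/

section HamiltonianFields

variable {E : Type*} [NormedAddCommGroup E] [NormedSpace ℝ E] {H : Type*} [TopologicalSpace H]
  {I : ModelWithCorners ℝ E H} [I.Boundaryless] {N : Type*} [TopologicalSpace N] [ChartedSpace H N]
  [IsManifold I ∞ N]

/-- The exterior derivative of a one-form on a vector space, as a bilinear map. -/
def flatDL (b : E → E →L[ℝ] ℝ) (y : E) : E →L[ℝ] E →L[ℝ] ℝ :=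
  fderiv ℝ b y - (fderiv ℝ b y).flip

lemma flatDL_apply (b : E → E →L[ℝ] ℝ) (y u v : E) : flatDL b y u v = flatD b y u v := by
  simp [flatDL, flatD]

lemma extD_eq_flatDL (β : ∀ x : N, TangentSpace I x →L[ℝ] ℝ) (x : N) (u v : TangentSpace I x) :
    extD I β x u v = flatDL (localForm I β x) (extChartAt I x x) u v :=
  (flatDL_apply (localForm I β x) (extChartAt I x x) u v).symm

lemma extD_swap (β : ∀ x : N, TangentSpace I x →L[ℝ] ℝ) (x : N) (u v : TangentSpace I x) :
    extD I β x u v = - extD I β x v u := by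
  rw [extD, extD]; ring

/-- The exterior derivative of the one-form is nondegenerate. -/
def IsNondegenerate (β : ∀ x : N, TangentSpace I x →L[ℝ] ℝ) : Prop :=
  ∀ x, ∀ u : TangentSpace I x, (∀ v, extD I β x u v = 0) → u = 0

/-- `X` is the Hamiltonian vector field of the time-dependent function `K`. -/
def IsHamiltonianField (β : ∀ x : N, TangentSpace I x →L[ℝ] ℝ) (K : ℝ → N → ℝ)
    (X : ℝ → ∀ x : N, TangentSpace I x) : Prop :=
  ∀ t x v, extD I β x (X t x) v = - mfderiv I 𝓘(ℝ, ℝ) (K t) x v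

/-- The Hamiltonian vector field of a function. -/
def hamField (β : ∀ x : N, TangentSpace I x →L[ℝ] ℝ) (K : ℝ → N → ℝ) (t : ℝ) (x : N) :
    TangentSpace I x :=
  (flatDL (localForm I β x) (extChartAt I x x)).inverse
    (-(show E →L[ℝ] ℝ from mfderiv I 𝓘(ℝ, ℝ) (K t) x))

section

variable [FiniteDimensional ℝ E]

lemma isInvertible_of_injective (A : E →L[ℝ] E →L[ℝ] ℝ) (hA : ∀ u, (∀ v, A u v = 0) → u = 0) :
    A.IsInvertible := by
  have hinj : Function.Injective A.toLinearMap := by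
    rw [← LinearMap.ker_eq_bot, LinearMap.ker_eq_bot']
    intro u hu
    exact hA u fun v => by
      have : A u = 0 := hu
      rw [this]; rfl
  have hd : Module.finrank ℝ E = Module.finrank ℝ (E →L[ℝ] ℝ) := by
    have h1 : Module.finrank ℝ (E →L[ℝ] ℝ) = Module.finrank ℝ (E →ₗ[ℝ] ℝ) :=
      (LinearMap.toContinuousLinearMap (𝕜 := ℝ) (E := E) (F' := ℝ)).finrank_eq.symm
    rw [h1]
    exact (Subspace.dual_finrank_eq (K := ℝ) (V := E)).symm
  let e : E ≃ₗ[ℝ] (E →L[ℝ] ℝ) := LinearEquiv.ofInjectiveOfFinrankEq A.toLinearMap hinj hd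
  refine ⟨e.toContinuousLinearEquiv, ?_⟩
  ext u v
  rfl

/-- By `extD_eq_flatD` the derivative of the chart identifies the kernel of this operator with the
kernel of dβ at q; in finite dimension injectivity suffices. -/
lemma isInvertible_flatDL_localForm {β : ∀ x : N, TangentSpace I x →L[ℝ] ℝ}
    (hβ : IsSmoothForm I β) (hn : IsNondegenerate β) {p q : N}
    (hq : q ∈ (extChartAt I p).source) :
    (flatDL (localForm I β p) (extChartAt I p q)).IsInvertible := by
  refine isInvertible_of_injective _ fun u hu => ?_
  have hy := (extChartAt I p).map_source hq
  have hs : (extChartAt I p).symm (extChartAt I p q) = q := (extChartAt I p).left_inv hq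
  let D : E →L[ℝ] E := mfderiv 𝓘(ℝ, E) I (extChartAt I p).symm (extChartAt I p q)
  let D' : E →L[ℝ] E := mfderiv I 𝓘(ℝ, E) (extChartAt I p) q
  have hinv : ∀ u : E, D' (D u) = u := by
    intro u
    have := mfderiv_extChartAt_mfderiv_symm hy u
    have h2 : (fun q' : N => (show E →L[ℝ] E from mfderiv I 𝓘(ℝ, E) (extChartAt I p) q')
      (D u)) ((extChartAt I p).symm (extChartAt I p q)) = u := this
    rwa [hs] at h2
  have h1 : D u = 0 := hn q (D u) fun v =>
    (extD_eq_flatD hβ hq (D u) v).trans ((flatDL_apply (localForm I β p) (extChartAt I p q)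
      (D' (D u)) (D' v)).symm.trans ((congrArg (fun w : E => flatDL (localForm I β p)
        (extChartAt I p q) w (D' v)) (hinv u)).trans (hu _)))
  rw [← hinv u, h1, map_zero]

lemma inverse_apply_eq {A : E →L[ℝ] E →L[ℝ] ℝ} (hA : A.IsInvertible) (k : E →L[ℝ] ℝ) :
    A (A.inverse k) = k := by
  obtain ⟨e, rfl⟩ := hA
  simp

lemma eq_inverse_apply {A : E →L[ℝ] E →L[ℝ] ℝ} (hA : A.IsInvertible) {k : E →L[ℝ] ℝ} {u : E}
    (h : A u = k) : u = A.inverse k := by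
  obtain ⟨e, rfl⟩ := hA
  rw [← h]; simp

lemma isHamiltonianField_hamField {β : ∀ x : N, TangentSpace I x →L[ℝ] ℝ}
    (hβ : IsSmoothForm I β) (hn : IsNondegenerate β) (K : ℝ → N → ℝ) :
    IsHamiltonianField β K (hamField β K) := by
  intro t x v
  rw [extD_eq_flatDL]
  have h := inverse_apply_eq (isInvertible_flatDL_localForm hβ hn (mem_extChartAt_source x))
    (-(show E →L[ℝ] ℝ from mfderiv I 𝓘(ℝ, ℝ) (K t) x))
  exact DFunLike.congr_fun h v

lemma IsHamiltonianField.unique {β : ∀ x : N, TangentSpace I x →L[ℝ] ℝ}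
    (hn : IsNondegenerate β) {x : N} {u u' : TangentSpace I x}
    (h : ∀ v, extD I β x u v = extD I β x u' v) : u = u' := by
  have h1 := hn x (u - u') fun v => by
    have h2 : extD I β x (u - u') v = extD I β x u v - extD I β x u' v := by
      rw [extD_eq_flatDL, extD_eq_flatDL, extD_eq_flatDL]
      exact DFunLike.congr_fun (map_sub (flatDL (localForm I β x) (extChartAt I x x)) u u') v
    rw [h2, h v, sub_self]
  exact sub_eq_zero.1 h1

/-- The local expression of a Hamiltonian vector field. -/
lemma localField_eq_inverse {β : ∀ x : N, TangentSpace I x →L[ℝ] ℝ}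
    (hβ : IsSmoothForm I β) (hn : IsNondegenerate β) {K : ℝ → N → ℝ}
    (hK : ContMDiff (𝓘(ℝ, ℝ).prod I) 𝓘(ℝ, ℝ) ∞ (fun q : ℝ × N => K q.1 q.2))
    {X : ℝ → ∀ x : N, TangentSpace I x} (hX : IsHamiltonianField β K X) (p : N) (t : ℝ) {y : E}
    (hy : y ∈ (extChartAt I p).target) :
    localField (X t) p y = (flatDL (localForm I β p) y).inverse
      (-fderiv ℝ (fun z => K t ((extChartAt I p).symm z)) y) := by
  set q := (extChartAt I p).symm y with hq
  have hqs : q ∈ (extChartAt I p).source := (extChartAt I p).map_target hy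
  have hqy : extChartAt I p q = y := (extChartAt I p).right_inv hy
  have hinv := isInvertible_flatDL_localForm hβ hn hqs
  rw [hqy] at hinv
  refine eq_inverse_apply hinv (ContinuousLinearMap.ext fun w => ?_)
  have hKt : MDifferentiableAt I 𝓘(ℝ, ℝ) (K t) q := by
    have : ContMDiff I 𝓘(ℝ, ℝ) ∞ (K t) := hK.comp (contMDiff_const.prodMk contMDiff_id)
    exact this.mdifferentiableAt (by simp)
  let D : E →L[ℝ] E := mfderiv 𝓘(ℝ, E) I (extChartAt I p).symm y
  let D' : E →L[ℝ] E := mfderiv I 𝓘(ℝ, E) (extChartAt I p) q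
  have h1 : flatDL (localForm I β p) (extChartAt I p q) (D' (X t q)) (D' (D w)) =
      -(show E →L[ℝ] ℝ from mfderiv I 𝓘(ℝ, ℝ) (K t) q) (D w) :=
    (flatDL_apply _ _ _ _).trans ((extD_eq_flatD hβ hqs (X t q) (D w)).symm.trans (hX t q (D w)))
  rw [hqy] at h1
  have h2 := mfderiv_extChartAt_mfderiv_symm hy w
  have h3 : HasFDerivAt (fun z => K t ((extChartAt I p).symm z))
      (show E →L[ℝ] ℝ from (mfderiv I 𝓘(ℝ, ℝ) (K t) q).comp
        (mfderiv 𝓘(ℝ, E) I (extChartAt I p).symm y)) y :=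
    hasMFDerivAt_iff_hasFDerivAt.1
      (hKt.hasMFDerivAt.comp y (mdifferentiableAt_extChartAt_symm hy).hasMFDerivAt)
  rw [h3.fderiv]
  refine Eq.trans ?_ h1
  exact congrArg (fun w : E => flatDL (localForm I β p) y (localField (X t) p y) w) h2.symm

lemma contDiffOn_flatDL {β : ∀ x : N, TangentSpace I x →L[ℝ] ℝ}
    (hβ : IsSmoothForm I β) (p : N) :
    ContDiffOn ℝ ∞ (flatDL (localForm I β p)) (extChartAt I p).target := by
  have h1 : ContDiffOn ℝ ∞ (fderiv ℝ (localForm I β p)) (extChartAt I p).target :=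
    ((isSmoothForm_iff β).1 hβ p).fderiv_of_isOpen (isOpen_extChartAt_target p) (by simp)
  have h2 : ContDiffOn ℝ ∞ (fun y => (fderiv ℝ (localForm I β p) y).flip)
      (extChartAt I p).target :=
    contDiffOn_clm_apply.2 fun u => contDiffOn_clm_apply.2 fun v =>
      (h1.clm_apply contDiffOn_const).clm_apply contDiffOn_const
  exact h1.sub h2

/-- In a chart the field is the inverse of the operator of dβ applied to -dK_t. Inversion of
operators is smooth at invertible ones, and dK_t is a partial derivative of a jointly smooth
function, so the field is smooth in time and space together. -/
lemma contDiffOn_localField {β : ∀ x : N, TangentSpace I x →L[ℝ] ℝ}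
    (hβ : IsSmoothForm I β) (hn : IsNondegenerate β) {K : ℝ → N → ℝ}
    (hK : ContMDiff (𝓘(ℝ, ℝ).prod I) 𝓘(ℝ, ℝ) ∞ (fun q : ℝ × N => K q.1 q.2))
    {X : ℝ → ∀ x : N, TangentSpace I x} (hX : IsHamiltonianField β K X) (p : N) :
    ContDiffOn ℝ ∞ (fun z : ℝ × E => localField (X z.1) p z.2)
      (univ ×ˢ (extChartAt I p).target) := by
  have hcomplete : CompleteSpace E := FiniteDimensional.complete ℝ E
  have hopen : IsOpen ((univ : Set ℝ) ×ˢ (extChartAt I p).target) :=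
    isOpen_univ.prod (isOpen_extChartAt_target p)
  have h1 : ContDiffOn ℝ ∞ (fun z : ℝ × E => K z.1 ((extChartAt I p).symm z.2))
      (univ ×ˢ (extChartAt I p).target) := by
    rw [← contMDiffOn_iff_contDiffOn, modelWithCornersSelf_prod, ← chartedSpaceSelf_prod]
    refine hK.comp_contMDiffOn (contMDiffOn_fst.prodMk ?_)
    exact (contMDiffOn_extChartAt_symm p).comp contMDiffOn_snd fun z hz => hz.2
  have h2 : ContDiffOn ℝ ∞ (fun z : ℝ × E =>
      (fderiv ℝ (fun z : ℝ × E => K z.1 ((extChartAt I p).symm z.2)) z).comp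
        (ContinuousLinearMap.inr ℝ ℝ E)) (univ ×ˢ (extChartAt I p).target) :=
    (h1.fderiv_of_isOpen hopen (by simp)).clm_comp contDiffOn_const
  have h3 : ContDiffOn ℝ ∞ (fun z : ℝ × E => (flatDL (localForm I β p) z.2).inverse)
      (univ ×ˢ (extChartAt I p).target) := by
    intro z hz
    have hsymm : extChartAt I p ((extChartAt I p).symm z.2) = z.2 := (extChartAt I p).right_inv hz.2
    have hi := isInvertible_flatDL_localForm hβ hn ((extChartAt I p).map_target hz.2)
    rw [hsymm] at hi
    obtain ⟨e, he⟩ := hi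
    have h4 : ContDiffAt ℝ ∞ ContinuousLinearMap.inverse (flatDL (localForm I β p) z.2) := by
      rw [← he]; exact contDiffAt_map_inverse e
    exact h4.comp_contDiffWithinAt z (((contDiffOn_flatDL hβ p).comp contDiffOn_snd
      fun z hz => hz.2) z hz)
  refine (h3.clm_apply h2.neg).congr fun z hz => ?_
  rw [localField_eq_inverse hβ hn hK hX p z.1 hz.2]
  congr 2
  have h5 : HasFDerivAt (fun y : E => (z.1, y)) (ContinuousLinearMap.inr ℝ ℝ E) z.2 :=
    hasFDerivAt_prodMk_right z.1 z.2
  exact (HasFDerivAt.comp z.2 (f := fun y : E => (z.1, y)) (g := fun z : ℝ × E =>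
    K z.1 ((extChartAt I p).symm z.2)) ((h1.contDiffAt (hopen.mem_nhds hz)).differentiableAt
      (by simp)).hasFDerivAt h5).fderiv

end

end HamiltonianFields

end

noncomputable section

/-! ### Time-dependent fields as autonomous fields on ℝ × N -/

section Suspension

variable {E : Type*} [NormedAddCommGroup E] [NormedSpace ℝ E] {H : Type*} [TopologicalSpace H]
  {I : ModelWithCorners ℝ E H} [I.Boundaryless] {N : Type*} [TopologicalSpace N] [ChartedSpace H N]
  [IsManifold I ∞ N]

lemma hasMFDerivAt_prodMk_space {F G : Type*} [NormedAddCommGroup F] [NormedSpace ℝ F]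
    [NormedAddCommGroup G] [NormedSpace ℝ G] {f : N → F} {g : N → G} {x : N}
    {f' : TangentSpace I x →L[ℝ] F} {g' : TangentSpace I x →L[ℝ] G}
    (hf : HasMFDerivAt I 𝓘(ℝ, F) f x f') (hg : HasMFDerivAt I 𝓘(ℝ, G) g x g') :
    HasMFDerivAt I 𝓘(ℝ, F × G) (fun x => (f x, g x)) x
      (show E →L[ℝ] F × G from (show E →L[ℝ] F from f').prod (show E →L[ℝ] G from g')) :=
  ⟨hf.1.prodMk hg.1, HasFDerivWithinAt.prodMk hf.2 hg.2⟩

/-- The autonomous vector field on `ℝ × N` given by a time-dependent vector field on `N`. -/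
def suspend (X : ℝ → ∀ x : N, TangentSpace I x) (q : ℝ × N) :
    TangentSpace (𝓘(ℝ, ℝ).prod I) q :=
  show ℝ × E from ((1 : ℝ), X q.1 q.2)

lemma localField_suspend (X : ℝ → ∀ x : N, TangentSpace I x) (q : ℝ × N) (z : ℝ × E)
    (hz : z.2 ∈ (extChartAt I q.2).target) :
    localField (I := 𝓘(ℝ, ℝ).prod I) (suspend X) q z = (1, localField (X z.1) q.2 z.2) := by
  have hc : ∀ w : ℝ × N, extChartAt (𝓘(ℝ, ℝ).prod I) q w = (w.1, extChartAt I q.2 w.2) := by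
    intro w
    rw [extChartAt_prod]; rfl
  have hs : (extChartAt (𝓘(ℝ, ℝ).prod I) q).symm z = (z.1, (extChartAt I q.2).symm z.2) := by
    rw [extChartAt_prod]; rfl
  have h1 : HasMFDerivAt (𝓘(ℝ, ℝ).prod I) 𝓘(ℝ, ℝ × E) (extChartAt (𝓘(ℝ, ℝ).prod I) q)
      (z.1, (extChartAt I q.2).symm z.2) _ :=
    (hasMFDerivAt_prodMk_space (hasMFDerivAt_fst (z.1, (extChartAt I q.2).symm z.2))
      ((mdifferentiableAt_extChartAt' ((extChartAt I q.2).map_target hz)).hasMFDerivAt.comp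
        (z.1, (extChartAt I q.2).symm z.2)
        (hasMFDerivAt_snd (I := 𝓘(ℝ, ℝ)) (I' := I)
          (z.1, (extChartAt I q.2).symm z.2)))).congr_of_eventuallyEq
      (Filter.Eventually.of_forall hc)
  have h2 : localField (I := 𝓘(ℝ, ℝ).prod I) (suspend X) q z =
      (show ℝ × E →L[ℝ] ℝ × E from mfderiv (𝓘(ℝ, ℝ).prod I) 𝓘(ℝ, ℝ × E)
        (extChartAt (𝓘(ℝ, ℝ).prod I) q) (z.1, (extChartAt I q.2).symm z.2))
        (1, X z.1 ((extChartAt I q.2).symm z.2)) :=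
    congrArg (fun w : ℝ × N => (show ℝ × E →L[ℝ] ℝ × E from mfderiv (𝓘(ℝ, ℝ).prod I) 𝓘(ℝ, ℝ × E)
        (extChartAt (𝓘(ℝ, ℝ).prod I) q) w) (show ℝ × E from (1, X w.1 w.2))) hs
  refine h2.trans ?_
  rw [h1.mfderiv]
  rfl

lemma isSmoothField_suspend {X : ℝ → ∀ x : N, TangentSpace I x}
    (h : ∀ p, ContDiffOn ℝ ∞ (fun z : ℝ × E => localField (X z.1) p z.2)
      (univ ×ˢ (extChartAt I p).target)) :
    IsSmoothField (I := 𝓘(ℝ, ℝ).prod I) (suspend X) := by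
  rw [isSmoothField_iff]
  intro q
  have ht : (extChartAt (𝓘(ℝ, ℝ).prod I) q).target = univ ×ˢ (extChartAt I q.2).target := by
    rw [extChartAt_prod, PartialEquiv.prod_target, extChartAt_model_space_eq_id]; rfl
  rw [ht]
  refine ((contDiffOn_const (c := (1 : ℝ))).prodMk (h q.2)).congr fun z hz => ?_
  exact localField_suspend X q z hz.2

lemma hasMFDerivAt_suspend {X : ℝ → ∀ x : N, TangentSpace I x} {c : ℝ → N} {t s : ℝ}
    (h : HasMFDerivAt 𝓘(ℝ, ℝ) I c s ((1 : ℝ →L[ℝ] ℝ).smulRight (X (t + s) (c s)))) :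
    HasMFDerivAt 𝓘(ℝ, ℝ) (𝓘(ℝ, ℝ).prod I) (fun s => (t + s, c s)) s
      ((1 : ℝ →L[ℝ] ℝ).smulRight (suspend X (t + s, c s))) := by
  have h1 : HasMFDerivAt 𝓘(ℝ, ℝ) 𝓘(ℝ, ℝ) (fun s : ℝ => t + s) s (ContinuousLinearMap.id ℝ ℝ) :=
    ((hasFDerivAt_id s).const_add t).hasMFDerivAt
  refine (h1.prodMk h).congr_mfderiv ?_
  refine ContinuousLinearMap.ext fun (r : ℝ) => ?_
  exact Prod.ext (mul_one r).symm rfl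

/-- The suspended field has time component 1. -/
lemma eq_add_of_isMIntegralCurve_suspend {X : ℝ → ∀ x : N, TangentSpace I x} {c : ℝ → ℝ × N}
    (h : IsMIntegralCurve (I := 𝓘(ℝ, ℝ).prod I) c (suspend X)) (s : ℝ) :
    (c s).1 = (c 0).1 + s := by
  have h1 : ∀ s, HasDerivAt (fun s : ℝ => (c s).1 - s) 0 s := by
    intro s
    have h2 : HasMFDerivAt 𝓘(ℝ, ℝ) 𝓘(ℝ, ℝ) (fun s => (c s).1) s _ :=
      (hasMFDerivAt_fst (I := 𝓘(ℝ, ℝ)) (I' := I) (c s)).comp s (h s)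
    have h3 : HasDerivAt (fun s => (c s).1) 1 s := by
      have h4 : HasFDerivAt (fun s => (c s).1) ((1 : ℝ →L[ℝ] ℝ).smulRight (1 : ℝ)) s :=
        hasMFDerivAt_iff_hasFDerivAt.1 (h2.congr_mfderiv rfl)
      exact h4.hasDerivAt.congr_deriv (by simp)
    exact (h3.sub (hasDerivAt_id s)).congr_deriv (sub_self _)
  have h2 := is_const_of_deriv_eq_zero (fun s => (h1 s).differentiableAt)
    (fun s => (h1 s).deriv) s 0
  rw [sub_zero] at h2
  linarith

lemma hasMFDerivAt_snd_of_isMIntegralCurve_suspend {X : ℝ → ∀ x : N, TangentSpace I x}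
    {c : ℝ → ℝ × N} (h : IsMIntegralCurve (I := 𝓘(ℝ, ℝ).prod I) c (suspend X)) (s : ℝ) :
    HasMFDerivAt 𝓘(ℝ, ℝ) I (fun s => (c s).2) s
      ((1 : ℝ →L[ℝ] ℝ).smulRight (X ((c 0).1 + s) (c s).2)) := by
  have h2 : HasMFDerivAt 𝓘(ℝ, ℝ) I (fun s => (c s).2) s _ :=
    (hasMFDerivAt_snd (I := 𝓘(ℝ, ℝ)) (I' := I) (c s)).comp s (h s)
  rw [← eq_add_of_isMIntegralCurve_suspend h s]
  refine h2.congr_mfderiv ?_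
  rfl

variable [FiniteDimensional ℝ E] [T2Space N]

/-- A time-dependent smooth vector field on `ℝ × N` with global solutions integrates to a smooth
family of diffeomorphisms. -/
lemma exists_isotopy_of_flow {X : ℝ → ∀ x : N, TangentSpace I x}
    (hX : IsSmoothField (I := 𝓘(ℝ, ℝ).prod I) (suspend X))
    {Φ : ℝ → ℝ × N → ℝ × N} (h0 : ∀ q, Φ 0 q = q)
    (hΦ : ∀ q, IsMIntegralCurve (I := 𝓘(ℝ, ℝ).prod I) (fun t => Φ t q) (suspend X)) :
    ∃ φ : ℝ → N ≃ₘ⟮I, I⟯ N,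
      ContMDiff (𝓘(ℝ, ℝ).prod I) I ∞ (fun q : ℝ × N => φ q.1 q.2) ∧ (∀ x, φ 0 x = x) ∧
      ∀ t x, HasMFDerivAt 𝓘(ℝ, ℝ) I (fun s => φ s x) t
        ((1 : ℝ →L[ℝ] ℝ).smulRight (X t (φ t x))) := by
  have hsm := contMDiff_flow hX h0 hΦ
  have hV1 : ContMDiff (𝓘(ℝ, ℝ).prod I) (𝓘(ℝ, ℝ).prod I).tangent 1
      (fun x => (⟨x, suspend X x⟩ : TangentBundle (𝓘(ℝ, ℝ).prod I) (ℝ × N))) :=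
    hX.of_le (by norm_cast)
  have hadd : ∀ s t x, Φ (s + t) x = Φ s (Φ t x) := by
    intro s t x
    have h1 : IsMIntegralCurve (I := 𝓘(ℝ, ℝ).prod I) (fun s => Φ (s + t) x) (suspend X) :=
      (hΦ x).comp_add t
    have h2 := isMIntegralCurve_Ioo_eq_of_contMDiff_boundaryless (t₀ := 0) hV1 h1 (hΦ (Φ t x))
      (by simp [h0])
    exact congrFun h2 s
  have hfst : ∀ t q, (Φ t q).1 = q.1 + t := fun t q => by
    have := eq_add_of_isMIntegralCurve_suspend (hΦ q) t
    rwa [h0] at this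
  -- The inverse of the time t map flows backwards for time t from the slice {t} × N to {0} × N.
  have hl : ∀ t x, (Φ (-t) (t, (Φ t (0, x)).2)).2 = x := by
    intro t x
    have h1 : (t, (Φ t (0, x)).2) = Φ t (0, x) := Prod.ext (by rw [hfst]; simp) rfl
    rw [h1, ← hadd, neg_add_cancel, h0]
  have hr : ∀ t x, (Φ t (0, (Φ (-t) (t, x)).2)).2 = x := by
    intro t x
    have h1 : ((0 : ℝ), (Φ (-t) (t, x)).2) = Φ (-t) (t, x) := Prod.ext (by rw [hfst]; simp) rfl
    rw [h1, ← hadd, add_neg_cancel, h0]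
  refine ⟨fun t => ⟨⟨fun x => (Φ t (0, x)).2, fun x => (Φ (-t) (t, x)).2, hl t, hr t⟩, ?_, ?_⟩,
    ?_, fun x => congrArg Prod.snd (h0 (0, x)), fun t x => ?_⟩
  · exact (contMDiff_snd.comp hsm).comp
      (contMDiff_const.prodMk (contMDiff_const.prodMk contMDiff_id))
  · exact (contMDiff_snd.comp hsm).comp
      (contMDiff_const.prodMk (contMDiff_const.prodMk contMDiff_id))
  · exact (contMDiff_snd.comp hsm).comp
      (contMDiff_fst.prodMk (contMDiff_const.prodMk contMDiff_snd))
  · have h1 := hasMFDerivAt_snd_of_isMIntegralCurve_suspend (hΦ (0, x)) t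
    refine h1.congr_mfderiv ?_
    have h2 : (Φ 0 (0, x)).1 + t = t := by rw [h0]; simp
    exact congrArg (fun r : ℝ => (1 : ℝ →L[ℝ] ℝ).smulRight
      (show E from X r (Φ t (0, x)).2)) h2

/-- A time-dependent smooth vector field which vanishes outside of a compact set and for times
outside of `[0, 1]` integrates to a smooth family of diffeomorphisms. -/
lemma exists_isotopy_of_compact {X : ℝ → ∀ x : N, TangentSpace I x}
    (hX : ∀ p, ContDiffOn ℝ ∞ (fun z : ℝ × E => localField (X z.1) p z.2)
      (univ ×ˢ (extChartAt I p).target))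
    {C : Set N} (hC : IsCompact C) (hXC : ∀ t, ∀ x ∉ C, X t x = 0)
    (hXt : ∀ t ∉ Icc (0 : ℝ) 1, ∀ x, X t x = 0) :
    ∃ φ : ℝ → N ≃ₘ⟮I, I⟯ N,
      ContMDiff (𝓘(ℝ, ℝ).prod I) I ∞ (fun q : ℝ × N => φ q.1 q.2) ∧ (∀ x, φ 0 x = x) ∧
      ∀ t x, HasMFDerivAt 𝓘(ℝ, ℝ) I (fun s => φ s x) t
        ((1 : ℝ →L[ℝ] ℝ).smulRight (X t (φ t x))) := by
  have hs := isSmoothField_suspend hX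
  -- If (t, x) is outside [-1, 2] × C, then for |s| < 1 either x is outside C or t + s is outside
  -- [0, 1]. In both cases X vanishes, so that the solution with constant x exists for a unit of
  -- time.
  obtain ⟨Φ, h0, hΦ⟩ := exists_flow_of_compact hs
    ((isCompact_Icc (a := (-1 : ℝ)) (b := 2)).prod hC) (by
      rintro ⟨t, x⟩ hq
      refine ⟨fun s => (t + s, x), by simp, fun s hs => ?_⟩
      refine (hasMFDerivAt_suspend (c := fun _ => x) ?_).hasMFDerivWithinAt
      have h0 : X (t + s) x = 0 := by
        by_cases hx : x ∈ C
        · refine hXt _ (fun hts => hq ⟨?_, hx⟩) x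
          simp only [mem_Icc, mem_Ioo] at hts hs ⊢
          constructor <;> linarith
        · exact hXC _ x hx
      rw [h0]
      refine (hasMFDerivAt_const x s).congr_mfderiv ?_
      refine ContinuousLinearMap.ext fun (r : ℝ) => ?_
      exact (smul_zero (A := E) r).symm)
  exact exists_isotopy_of_flow hs h0 hΦ

end Suspension

/-! ### Integrals depending on parameters -/

section ParametricIntegral

variable {E : Type*} [NormedAddCommGroup E] [NormedSpace ℝ E] {H : Type*} [TopologicalSpace H]
  {I : ModelWithCorners ℝ E H} [I.Boundaryless] {N : Type*} [TopologicalSpace N] [ChartedSpace H N]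
  [IsManifold I ∞ N] [FiniteDimensional ℝ E] [T2Space N]

/-- The time-dependent vector field `F ∂_z` on `N × ℝ`. -/
def vertField (I : ModelWithCorners ℝ E H) (F : ℝ → N → ℝ) (t : ℝ) (q : N × ℝ) :
    TangentSpace (I.prod 𝓘(ℝ, ℝ)) q :=
  show E × ℝ from (0, F t q.1)

lemma localField_vertField (F : ℝ → N → ℝ) (t : ℝ) (q : N × ℝ) (z : E × ℝ)
    (hz : z.1 ∈ (extChartAt I q.1).target) :
    localField (I := I.prod 𝓘(ℝ, ℝ)) (vertField I F t) q z =
      (0, F t ((extChartAt I q.1).symm z.1)) := by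
  have hc : ∀ w : N × ℝ, extChartAt (I.prod 𝓘(ℝ, ℝ)) q w = (extChartAt I q.1 w.1, w.2) := by
    intro w
    rw [extChartAt_prod]; rfl
  have hs : (extChartAt (I.prod 𝓘(ℝ, ℝ)) q).symm z = ((extChartAt I q.1).symm z.1, z.2) := by
    rw [extChartAt_prod]; rfl
  have h1 : HasMFDerivAt (I.prod 𝓘(ℝ, ℝ)) 𝓘(ℝ, E × ℝ) (extChartAt (I.prod 𝓘(ℝ, ℝ)) q)
      ((extChartAt I q.1).symm z.1, z.2) _ :=
    (hasMFDerivAt_prodMk_space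
      ((mdifferentiableAt_extChartAt' ((extChartAt I q.1).map_target hz)).hasMFDerivAt.comp
        ((extChartAt I q.1).symm z.1, z.2)
        (hasMFDerivAt_fst (I := I) (I' := 𝓘(ℝ, ℝ)) ((extChartAt I q.1).symm z.1, z.2)))
      (hasMFDerivAt_snd ((extChartAt I q.1).symm z.1, z.2))).congr_of_eventuallyEq
      (Filter.Eventually.of_forall hc)
  have h2 : localField (I := I.prod 𝓘(ℝ, ℝ)) (vertField I F t) q z =
      (show E × ℝ →L[ℝ] E × ℝ from mfderiv (I.prod 𝓘(ℝ, ℝ)) 𝓘(ℝ, E × ℝ)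
        (extChartAt (I.prod 𝓘(ℝ, ℝ)) q) ((extChartAt I q.1).symm z.1, z.2))
        (0, F t ((extChartAt I q.1).symm z.1)) :=
    congrArg (fun w : N × ℝ => (show E × ℝ →L[ℝ] E × ℝ from
      mfderiv (I.prod 𝓘(ℝ, ℝ)) 𝓘(ℝ, E × ℝ) (extChartAt (I.prod 𝓘(ℝ, ℝ)) q) w)
        (show E × ℝ from (0, F t w.1))) hs
  refine h2.trans ?_
  rw [h1.mfderiv]
  refine Prod.ext ?_ rfl
  exact map_zero (mfderiv I 𝓘(ℝ, E) (extChartAt I q.1) ((extChartAt I q.1).symm z.1))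

/-- Integrals of smooth functions over an interval depend smoothly on parameters. -/
lemma contMDiff_integral {F : ℝ → N → ℝ}
    (hF : ContMDiff (𝓘(ℝ, ℝ).prod I) 𝓘(ℝ, ℝ) ∞ (fun q : ℝ × N => F q.1 q.2)) :
    ContMDiff I 𝓘(ℝ, ℝ) ∞ (fun x => ∫ t in (0 : ℝ)..1, F t x) := by
  have hFc : ∀ x, Continuous fun t => F t x := fun x =>
    hF.continuous.comp (continuous_id.prodMk continuous_const)
  -- The integral is a coordinate of the flow of ∂_t + F(t, x) ∂_z on ℝ × N × ℝ, so its smoothness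
  -- is an instance of the smoothness of flows.
  have hs : IsSmoothField (I := 𝓘(ℝ, ℝ).prod (I.prod 𝓘(ℝ, ℝ))) (suspend (vertField I F)) := by
    refine isSmoothField_suspend fun q => ?_
    have ht : (extChartAt (I.prod 𝓘(ℝ, ℝ)) q).target = (extChartAt I q.1).target ×ˢ univ := by
      rw [extChartAt_prod, PartialEquiv.prod_target, extChartAt_model_space_eq_id]; rfl
    rw [ht]
    have h1 : ContDiffOn ℝ ∞ (fun z : ℝ × E => F z.1 ((extChartAt I q.1).symm z.2))
        (univ ×ˢ (extChartAt I q.1).target) := by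
      rw [← contMDiffOn_iff_contDiffOn, modelWithCornersSelf_prod, ← chartedSpaceSelf_prod]
      refine hF.comp_contMDiffOn (contMDiffOn_fst.prodMk ?_)
      exact (contMDiffOn_extChartAt_symm q.1).comp contMDiffOn_snd fun z hz => hz.2
    have h2 : ContDiffOn ℝ ∞ (fun z : ℝ × E × ℝ => F z.1 ((extChartAt I q.1).symm z.2.1))
        (univ ×ˢ ((extChartAt I q.1).target ×ˢ univ)) :=
      h1.comp (f := fun z : ℝ × E × ℝ => (z.1, z.2.1)) (by fun_prop) fun z hz => ⟨hz.1, hz.2.1⟩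
    refine ((contDiffOn_const (c := (0 : E))).prodMk h2).congr fun z hz => ?_
    exact localField_vertField F z.1 q z.2 hz.2.1
  have hΦ : ∀ q : ℝ × N × ℝ, IsMIntegralCurve (I := 𝓘(ℝ, ℝ).prod (I.prod 𝓘(ℝ, ℝ)))
      (fun s => (q.1 + s, q.2.1, q.2.2 + ∫ t in q.1..(q.1 + s), F t q.2.1))
      (suspend (vertField I F)) := by
    intro q s
    refine hasMFDerivAt_suspend (c := fun s => (q.2.1, q.2.2 + ∫ t in q.1..(q.1 + s), F t q.2.1))
      ?_
    have h1 : HasDerivAt (fun s => q.2.2 + ∫ t in q.1..(q.1 + s), F t q.2.1)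
        (F (q.1 + s) q.2.1) s := by
      have h2 := intervalIntegral.integral_hasDerivAt_right
        ((hFc q.2.1).intervalIntegrable q.1 (q.1 + s))
        ((hFc q.2.1).stronglyMeasurableAtFilter _ _) (hFc q.2.1).continuousAt
      have h3 := (HasDerivAt.scomp s h2 ((hasDerivAt_id s).const_add q.1)).const_add q.2.2
      simpa using h3
    refine ((hasMFDerivAt_const q.2.1 s).prodMk h1.hasFDerivAt.hasMFDerivAt).congr_mfderiv ?_
    refine ContinuousLinearMap.ext fun (r : ℝ) => ?_
    exact Prod.ext (smul_zero (A := E) r).symm rfl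
  have hsm := contMDiff_flow hs (by simp) hΦ
  have h1 : ContMDiff I 𝓘(ℝ, ℝ) ∞ (fun x : N => ((0 : ℝ) + ∫ t in (0 : ℝ)..(0 + 1), F t x)) :=
    (contMDiff_snd.comp (contMDiff_snd.comp hsm)).comp (I := I)
      (f := fun x : N => ((1 : ℝ), (0 : ℝ), x, (0 : ℝ)))
      (contMDiff_const.prodMk (contMDiff_const.prodMk (contMDiff_id.prodMk contMDiff_const)))
  simpa using h1

end ParametricIntegral

end

noncomputable section

/-! ### Curves and tangent vectors of submanifolds -/

section Plots

variable {E : Type*} [NormedAddCommGroup E] [NormedSpace ℝ E] {H : Type*} [TopologicalSpace H]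
  {I : ModelWithCorners ℝ E H} [I.Boundaryless] {N : Type*} [TopologicalSpace N] [ChartedSpace H N]
  [IsManifold I ∞ N] [FiniteDimensional ℝ E]

/-- The derivative, as a linear map between the model spaces. -/
def mderiv {E' : Type*} [NormedAddCommGroup E'] [NormedSpace ℝ E'] {H' : Type*}
    [TopologicalSpace H'] (I : ModelWithCorners ℝ E H) (I' : ModelWithCorners ℝ E' H')
    {N N' : Type*} [TopologicalSpace N] [ChartedSpace H N] [TopologicalSpace N']
    [ChartedSpace H' N'] (f : N → N') (x : N) : E →L[ℝ] E' :=
  mfderiv I I' f x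

lemma hasDerivAt_of_smulRight {F : Type*} [NormedAddCommGroup F] [NormedSpace ℝ F] {f : ℝ → F}
    {v : F} {t : ℝ} (h : HasFDerivAt f ((1 : ℝ →L[ℝ] ℝ).smulRight v) t) : HasDerivAt f v t := by
  simpa using h.hasDerivAt

/-- The inverse of a chart, precomposed with a contraction onto a small ball. -/
lemma exists_plot {e : OpenPartialHomeomorph N H} (he : e ∈ IsManifold.maximalAtlas I ∞ N) {p : N}
    (hp : p ∈ e.source) : ∃ j : E → N, ContMDiff 𝓘(ℝ, E) I ∞ j ∧ j 0 = p ∧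
      (∀ y, j y ∈ e.source ∧ ∃ c : ℝ, e.extend I (j y) = e.extend I p + c • y) ∧
      ∀ v : E, (mderiv 𝓘(ℝ, E) I j 0)
        ((mderiv I 𝓘(ℝ, E) (e.extend I) p) v) = v := by
  have hopen : IsOpen (e.extend I).target := e.isOpen_extend_target
  have hps : p ∈ (e.extend I).source := by rwa [e.extend_source]
  have hpt : e.extend I p ∈ (e.extend I).target := (e.extend I).map_source hps
  obtain ⟨r, hr, hball⟩ := Metric.nhds_basis_closedBall.mem_iff.1 (hopen.mem_nhds hpt)
  -- The map y ↦ b y • y sends all of E into the closed ball of radius r, is the identity near 0,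
  -- and moves each point along its own line, so that it preserves linear slices.
  let b : ContDiffBump (0 : E) := ⟨r / 2, r, by positivity, by linarith⟩
  have hmem : ∀ y, e.extend I p + b y • y ∈ (e.extend I).target := by
    intro y
    refine hball ?_
    rw [Metric.mem_closedBall, dist_eq_norm, add_sub_cancel_left, norm_smul, Real.norm_eq_abs,
      abs_of_nonneg b.nonneg]
    by_cases hy : ‖y‖ ≤ r
    · exact (mul_le_of_le_one_left (norm_nonneg y) b.le_one).trans hy
    · rw [b.zero_of_le_dist (by rw [dist_zero_right]; exact (not_le.1 hy).le), zero_mul]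
      exact hr.le
  have hsm : ContMDiff 𝓘(ℝ, E) I ∞ (fun y => (e.extend I).symm (e.extend I p + b y • y)) := by
    have h1 : ContMDiff 𝓘(ℝ, E) 𝓘(ℝ, E) ∞ (fun y : E => e.extend I p + b y • y) := by
      rw [contMDiff_iff_contDiff]
      exact contDiff_const.add (b.contDiff.smul contDiff_id)
    refine ContMDiffOn.comp_contMDiff (contMDiffOn_extend_symm he) h1 fun y => ?_
    rw [← e.extend_target']
    exact hmem y
  have h0 : (e.extend I).symm (e.extend I p + b 0 • 0) = p := by
    rw [smul_zero, add_zero]; exact (e.extend I).left_inv hps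
  refine ⟨_, hsm, h0, fun y => ⟨?_, b y, (e.extend I).right_inv (hmem y)⟩, ?_⟩
  · have := (e.extend I).map_target (hmem y)
    rwa [e.extend_source] at this
  · set j : E → N := fun y => (e.extend I).symm (e.extend I p + b y • y)
    let B : E →L[ℝ] E := mfderiv 𝓘(ℝ, E) I j 0
    let A : E →L[ℝ] E := mfderiv I 𝓘(ℝ, E) (e.extend I) p
    have hA : HasMFDerivAt I 𝓘(ℝ, E) (e.extend I) (j 0)
        (show TangentSpace I (j 0) →L[ℝ] E from A) := by
      have h1 : MDifferentiableAt I 𝓘(ℝ, E) (e.extend I) p :=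
        (e.contMDiffAt_extend he hp).mdifferentiableAt (by simp)
      have h2 := h1.hasMFDerivAt
      rw [← h0] at h2
      refine h2.congr_mfderiv ?_
      exact congrArg (fun q => (mderiv I 𝓘(ℝ, E) (e.extend I) q)) h0
    have hB : HasMFDerivAt 𝓘(ℝ, E) I j 0 B := (hsm.mdifferentiableAt (by simp)).hasMFDerivAt
    have hAB : HasFDerivAt (fun y => e.extend I (j y)) (A.comp B) 0 :=
      hasMFDerivAt_iff_hasFDerivAt.1 (hA.comp 0 hB)
    have hid : HasFDerivAt (fun y => e.extend I (j y)) (ContinuousLinearMap.id ℝ E) 0 := by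
      refine ((hasFDerivAt_id (0 : E)).const_add (e.extend I p)).congr_of_eventuallyEq ?_
      filter_upwards [Metric.ball_mem_nhds (0 : E) (by positivity : 0 < r / 2)] with y hy
      have h1 : b y = 1 := b.one_of_mem_closedBall (Metric.ball_subset_closedBall hy)
      have h2 : e.extend I (j y) = e.extend I p + b y • y := (e.extend I).right_inv (hmem y)
      rw [h2, h1, one_smul]; rfl
    have h1 : A.comp B = ContinuousLinearMap.id ℝ E := hAB.unique hid
    -- In finite dimension a one-sided inverse is two-sided.
    have h2 : A.toLinearMap * B.toLinearMap = 1 :=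
      LinearMap.ext fun v => DFunLike.congr_fun h1 v
    have h3 := mul_eq_one_comm.1 h2
    exact fun v => DFunLike.congr_fun h3 v

/-- The derivative of a line under a smooth map from the model space. -/
lemma hasMFDerivAt_comp_smul {j : E → N} (hj : ContMDiff 𝓘(ℝ, E) I ∞ j) (w : E) :
    HasMFDerivAt 𝓘(ℝ, ℝ) I (fun s : ℝ => j (s • w)) 0 ((1 : ℝ →L[ℝ] ℝ).smulRight
      (show E from (mderiv 𝓘(ℝ, E) I j 0) w)) := by
  have h1 : HasMFDerivAt 𝓘(ℝ, ℝ) 𝓘(ℝ, E) (fun s : ℝ => s • w) 0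
      ((1 : ℝ →L[ℝ] ℝ).smulRight w) :=
    ((1 : ℝ →L[ℝ] ℝ).smulRight w).hasFDerivAt.hasMFDerivAt
  have h2 : HasMFDerivAt 𝓘(ℝ, E) I j ((0 : ℝ) • w) (mfderiv 𝓘(ℝ, E) I j ((0 : ℝ) • w)) :=
    (hj.mdifferentiableAt (by simp)).hasMFDerivAt
  refine (h2.comp (0 : ℝ) h1).congr_mfderiv ?_
  refine ContinuousLinearMap.ext fun (r : ℝ) => ?_
  have h3 : (mderiv 𝓘(ℝ, E) I j ((0 : ℝ) • w)) = (mderiv 𝓘(ℝ, E) I j 0) :=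
    congrArg (fun y => (mderiv 𝓘(ℝ, E) I j y)) (zero_smul ℝ w)
  change (mderiv 𝓘(ℝ, E) I j ((0 : ℝ) • w)) (r • w) =
    r • (mderiv 𝓘(ℝ, E) I j 0) w
  rw [h3, map_smul]

lemma mfderiv_one_of_hasMFDerivAt {γ : ℝ → N} {t : ℝ} {v : TangentSpace I (γ t)}
    (h : HasMFDerivAt 𝓘(ℝ, ℝ) I γ t ((1 : ℝ →L[ℝ] ℝ).smulRight v)) :
    mfderiv 𝓘(ℝ, ℝ) I γ t (1 : ℝ) = v := by
  rw [h.mfderiv]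
  exact one_smul ℝ (show E from v)

lemma hasMFDerivAt_of_mdifferentiableAt {γ : ℝ → N} {t : ℝ}
    (h : MDifferentiableAt 𝓘(ℝ, ℝ) I γ t) :
    HasMFDerivAt 𝓘(ℝ, ℝ) I γ t
      ((1 : ℝ →L[ℝ] ℝ).smulRight (mfderiv 𝓘(ℝ, ℝ) I γ t (1 : ℝ))) := by
  refine h.hasMFDerivAt.congr_mfderiv ?_
  refine ContinuousLinearMap.ext fun (r : ℝ) => ?_
  change (mderiv 𝓘(ℝ, ℝ) I γ t) r = r • (mderiv 𝓘(ℝ, ℝ) I γ t) 1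
  rw [← map_smul, smul_eq_mul, mul_one]

/-- Every tangent vector is the velocity of a smooth curve. -/
lemma exists_curve (p : N) (v : TangentSpace I p) : ∃ γ : ℝ → N, ContMDiff 𝓘(ℝ, ℝ) I ∞ γ ∧
    (⟨p, v⟩ : TangentBundle I N) = ⟨γ 0, mfderiv 𝓘(ℝ, ℝ) I γ 0 (1 : ℝ)⟩ := by
  obtain ⟨j, hj, h0, -, hD⟩ := exists_plot (I := I)
    (IsManifold.chart_mem_maximalAtlas (I := I) (n := ∞) p) (mem_chart_source H p)
  let w : E := (mderiv I 𝓘(ℝ, E) ((chartAt H p).extend I) p) v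
  have h1 : ContMDiff 𝓘(ℝ, ℝ) I ∞ (fun s : ℝ => j (s • w)) := by
    refine hj.comp ?_
    rw [contMDiff_iff_contDiff]
    exact contDiff_id.smul contDiff_const
  refine ⟨_, h1, ?_⟩
  have h2 : mfderiv 𝓘(ℝ, ℝ) I (fun s : ℝ => j (s • w)) 0 (1 : ℝ) = v :=
    (mfderiv_one_of_hasMFDerivAt (hasMFDerivAt_comp_smul hj w)).trans (hD v)
  have h3 : p = j ((0 : ℝ) • w) := by rw [zero_smul, h0]
  refine Bundle.TotalSpace.ext h3 ?_
  refine HEq.trans (b := (show E from v)) HEq.rfl ?_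
  exact heq_of_eq h2.symm

/-- In a chart which flattens a submanifold, the tangent vectors are those in the flat. -/
lemma mem_tangentVectors_iff {A : Set N} {e : OpenPartialHomeomorph N H}
    (he : e ∈ IsManifold.maximalAtlas I ∞ N) {V : Submodule ℝ E}
    (hV : ∀ q ∈ e.source, (q ∈ A ↔ e.extend I q ∈ V)) {p : N} (hp : p ∈ e.source) (hpA : p ∈ A)
    (v : TangentSpace I p) : (⟨p, v⟩ : TangentBundle I N) ∈ tangentVectors I A ↔
      (mderiv I 𝓘(ℝ, E) (e.extend I) p) v ∈ V := by
  constructor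
  · rintro ⟨γ, hγ, hγA, h⟩
    obtain rfl : p = γ 0 := congrArg Bundle.TotalSpace.proj h
    have h2 : v = mfderiv 𝓘(ℝ, ℝ) I γ 0 (1 : ℝ) := by
      have := (Bundle.TotalSpace.mk.inj h).2
      exact eq_of_heq this
    have h1 : MDifferentiableAt I 𝓘(ℝ, E) (e.extend I) (γ 0) :=
      (e.contMDiffAt_extend he hp).mdifferentiableAt (by simp)
    have h3 := hasMFDerivAt_of_mdifferentiableAt
      (hγ.mdifferentiableAt (x := 0) (by simp) : MDifferentiableAt 𝓘(ℝ, ℝ) I γ 0)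
    have h4 : HasFDerivAt (fun s => e.extend I (γ s)) _ 0 :=
      hasMFDerivAt_iff_hasFDerivAt.1 (h1.hasMFDerivAt.comp (0 : ℝ) h3)
    have h5 : HasDerivAt (fun s => e.extend I (γ s))
        ((mderiv I 𝓘(ℝ, E) (e.extend I) (γ 0)) v) 0 := by
      have h6 : HasFDerivAt (fun s => e.extend I (γ s)) ((1 : ℝ →L[ℝ] ℝ).smulRight
          ((mderiv I 𝓘(ℝ, E) (e.extend I) (γ 0)) v)) 0 := by
        rw [h2]
        exact h4.congr_fderiv (comp_smulRight_one (F := E) (G := E) _ _)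
      exact hasDerivAt_of_smulRight h6
    have h7 : ∀ᶠ s in nhds (0 : ℝ), e.extend I (γ s) ∈ V := by
      filter_upwards [hγ.continuous.continuousAt (e.open_source.mem_nhds hp)] with s hs
      exact (hV _ hs).1 (hγA s)
    -- V is closed, hence contains the limit of the difference quotients.
    have hcl : IsClosed (V : Set E) := V.closed_of_finiteDimensional
    have h8 := h5.tendsto_slope_zero
    refine hcl.mem_of_tendsto h8 ?_
    have h9 : ∀ᶠ s in nhdsWithin (0 : ℝ) {0}ᶜ, e.extend I (γ (0 + s)) ∈ V := by
      simp only [zero_add]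
      exact h7.filter_mono nhdsWithin_le_nhds
    filter_upwards [h9] with s hs
    exact V.smul_mem _ (V.sub_mem hs h7.self_of_nhds)
  · intro h
    -- A line in the slice, seen through the plot, is a curve that stays in A for all times and has
    -- the prescribed velocity.
    obtain ⟨j, hj, h0, hjs, hD⟩ := exists_plot he hp
    let w : E := (mderiv I 𝓘(ℝ, E) (e.extend I) p) v
    have h1 : ContMDiff 𝓘(ℝ, ℝ) I ∞ (fun s : ℝ => j (s • w)) := by
      refine hj.comp ?_
      rw [contMDiff_iff_contDiff]
      exact contDiff_id.smul contDiff_const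
    refine ⟨_, h1, fun t => ?_, ?_⟩
    · obtain ⟨hs, c, hc⟩ := hjs (t • w)
      rw [hV _ hs, hc]
      exact V.add_mem ((hV _ hp).1 hpA) (V.smul_mem _ (V.smul_mem _ h))
    · have h2 : mfderiv 𝓘(ℝ, ℝ) I (fun s : ℝ => j (s • w)) 0 (1 : ℝ) = v :=
        (mfderiv_one_of_hasMFDerivAt (hasMFDerivAt_comp_smul hj w)).trans (hD v)
      have h3 : p = j ((0 : ℝ) • w) := by rw [zero_smul, h0]
      refine Bundle.TotalSpace.ext h3 ?_
      refine HEq.trans (b := (show E from v)) HEq.rfl ?_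
      exact heq_of_eq h2.symm

end Plots

/-! ### Primitives of one-forms on submanifolds -/

section Primitives

variable {E : Type*} [NormedAddCommGroup E] [NormedSpace ℝ E] {H : Type*} [TopologicalSpace H]
  {I : ModelWithCorners ℝ E H} [I.Boundaryless] {N : Type*} [TopologicalSpace N] [ChartedSpace H N]
  [IsManifold I ∞ N] [FiniteDimensional ℝ E]

lemma localForm_vectorSpace (b : E → E →L[ℝ] ℝ) (y : E) :
    localForm 𝓘(ℝ, E) (fun x => (show TangentSpace 𝓘(ℝ, E) x →L[ℝ] ℝ from b x)) y = b := by
  funext z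
  refine ContinuousLinearMap.ext fun v => ?_
  have h1 : mfderiv 𝓘(ℝ, E) 𝓘(ℝ, E) (extChartAt 𝓘(ℝ, E) y).symm z v = v := by
    rw [extChartAt_model_space_eq_id]
    exact congrArg (fun L : E →L[ℝ] E => L v)
      ((hasFDerivAt_id (𝕜 := ℝ) z).hasMFDerivAt.mfderiv)
  have h2 : (extChartAt 𝓘(ℝ, E) y).symm z = z := by rw [extChartAt_model_space_eq_id]; rfl
  exact congrArg₂ (fun (z v : E) => b z v) h2 h1

lemma extD_vectorSpace (b : E → E →L[ℝ] ℝ) (y u v : E) :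
    extD 𝓘(ℝ, E) (fun x => (show TangentSpace 𝓘(ℝ, E) x →L[ℝ] ℝ from b x)) y u v =
      flatD b y u v := by
  have h1 : extChartAt 𝓘(ℝ, E) y y = y := by rw [extChartAt_model_space_eq_id]; rfl
  have h2 := localForm_vectorSpace b y
  refine (congrArg₂ (fun (c : E → E →L[ℝ] ℝ) (z : E) => fderiv ℝ c z u v - fderiv ℝ c z v u)
    h2 h1 :)

/-- `g` is a primitive of the restriction of the one-form `β` to `A`. -/
def IsPrimitiveOn (β : ∀ x : N, TangentSpace I x →L[ℝ] ℝ) (A : Set N) (g : N → ℝ) : Prop :=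
  ∀ γ : ℝ → N, ContMDiff 𝓘(ℝ, ℝ) I ∞ γ → (∀ t, γ t ∈ A) →
    HasDerivAt (fun t => g (γ t)) (β (γ 0) (mfderiv 𝓘(ℝ, ℝ) I γ 0 (1 : ℝ))) 0

lemma hasDerivAt_comp_curve {g : N → ℝ} {γ : ℝ → N} {t : ℝ} {v : TangentSpace I (γ t)}
    (hg : MDifferentiableAt I 𝓘(ℝ, ℝ) g (γ t))
    (h : HasMFDerivAt 𝓘(ℝ, ℝ) I γ t ((1 : ℝ →L[ℝ] ℝ).smulRight v)) :
    HasDerivAt (fun t => g (γ t)) ((mderiv I 𝓘(ℝ, ℝ) g (γ t)) v) t := by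
  have h1 : HasFDerivAt (fun t => g (γ t)) ((1 : ℝ →L[ℝ] ℝ).smulRight
      ((mderiv I 𝓘(ℝ, ℝ) g (γ t)) v)) t :=
    (hasMFDerivAt_iff_hasFDerivAt.1 (hg.hasMFDerivAt.comp t h)).congr_fderiv
      (comp_smulRight_one (F := E) (G := ℝ) _ _)
  exact hasDerivAt_of_smulRight h1

/-- The formulation along curves involves only the values of g on A. It is therefore the one in
which primitives are modified off A, glued and transported. -/
lemma isPrimitiveOn_iff {β : ∀ x : N, TangentSpace I x →L[ℝ] ℝ} {A : Set N} {g : N → ℝ}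
    (hg : ContMDiff I 𝓘(ℝ, ℝ) ∞ g) : IsPrimitiveOn β A g ↔
      ∀ w ∈ tangentVectors I A, β w.1 w.2 = mfderiv I 𝓘(ℝ, ℝ) g w.1 w.2 := by
  constructor
  · rintro h _ ⟨γ, hγ, hγA, rfl⟩
    have h3 := hasMFDerivAt_of_mdifferentiableAt
      (hγ.mdifferentiableAt (x := 0) (by simp) : MDifferentiableAt 𝓘(ℝ, ℝ) I γ 0)
    have h4 := hasDerivAt_comp_curve (hg.mdifferentiableAt (x := γ 0) (by simp)) h3
    exact (h γ hγ hγA).unique h4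
  · intro h γ hγ hγA
    have h3 := hasMFDerivAt_of_mdifferentiableAt
      (hγ.mdifferentiableAt (x := 0) (by simp) : MDifferentiableAt 𝓘(ℝ, ℝ) I γ 0)
    exact (hasDerivAt_comp_curve (hg.mdifferentiableAt (by simp)) h3).congr_deriv
      (h _ ⟨γ, hγ, hγA, rfl⟩).symm

lemma IsPrimitiveOn.congr {β : ∀ x : N, TangentSpace I x →L[ℝ] ℝ} {A : Set N} {g g' : N → ℝ}
    (h : IsPrimitiveOn β A g) (hgg' : ∀ x ∈ A, g' x = g x) : IsPrimitiveOn β A g' := by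
  intro γ hγ hγA
  have : (fun t => g' (γ t)) = fun t => g (γ t) := funext fun t => hgg' _ (hγA t)
  rw [this]
  exact h γ hγ hγA

/-- The derivative of the primitive along smooth families. -/
lemma IsPrimitiveOn.hasFDerivAt {β : ∀ x : N, TangentSpace I x →L[ℝ] ℝ} {A : Set N} {g : N → ℝ}
    (h : IsPrimitiveOn β A g) (hg : ContMDiff I 𝓘(ℝ, ℝ) ∞ g) {F : ℝ × ℝ → N}
    (hF : ContMDiff 𝓘(ℝ, ℝ × ℝ) I ∞ F) (hFA : ∀ z, F z ∈ A) (z : ℝ × ℝ) :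
    pullForm 𝓘(ℝ, ℝ × ℝ) I F β z = fderiv ℝ (fun z => g (F z)) z := by
  refine ContinuousLinearMap.ext fun (w : ℝ × ℝ) => ?_
  have hl : ContMDiff 𝓘(ℝ, ℝ) 𝓘(ℝ, ℝ × ℝ) ∞ (fun t : ℝ => z + t • w) := by
    rw [contMDiff_iff_contDiff]
    exact contDiff_const.add (contDiff_id.smul contDiff_const)
  have hl' : HasDerivAt (fun t : ℝ => z + t • w) w 0 := by
    simpa using ((hasDerivAt_id (0 : ℝ)).smul_const w).const_add z
  have hgF : ContDiff ℝ ∞ (fun z => g (F z)) := by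
    rw [← contMDiff_iff_contDiff]; exact hg.comp hF
  have h1 := h (fun t => F (z + t • w)) (hF.comp hl) fun t => hFA _
  have hz : z + (0 : ℝ) • w = z := by simp
  have h2 : HasDerivAt (fun t : ℝ => g (F (z + t • w))) (fderiv ℝ (fun z => g (F z)) z w) 0 := by
    have h3 : HasFDerivAt (fun z => g (F z)) (fderiv ℝ (fun z => g (F z)) z) (z + (0 : ℝ) • w) := by
      rw [hz]; exact (hgF.differentiable (by simp) z).hasFDerivAt
    exact h3.comp_hasDerivAt (0 : ℝ) hl'
  have h4 : mfderiv 𝓘(ℝ, ℝ) I (fun t : ℝ => F (z + t • w)) 0 (1 : ℝ) =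
      (mderiv 𝓘(ℝ, ℝ × ℝ) I F z) w := by
    have h5 : HasMFDerivAt 𝓘(ℝ, ℝ × ℝ) I F (z + (0 : ℝ) • w) _ :=
      (hF.mdifferentiableAt (by simp)).hasMFDerivAt
    have h6 : HasMFDerivAt 𝓘(ℝ, ℝ) I (fun t : ℝ => F (z + t • w)) 0 _ :=
      h5.comp (0 : ℝ) hl'.hasFDerivAt.hasMFDerivAt
    rw [h6.mfderiv]
    change (mderiv 𝓘(ℝ, ℝ × ℝ) I F (z + (0 : ℝ) • w)) ((1 : ℝ) • w) = _
    rw [one_smul]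
    exact congrArg (fun z => (mderiv 𝓘(ℝ, ℝ × ℝ) I F z) w) hz
  have h7 := h1.unique h2
  refine Eq.trans ?_ h7
  have h8 := congrArg (fun z' : ℝ × ℝ => (β (F z') : E →L[ℝ] ℝ)
    ((mderiv 𝓘(ℝ, ℝ × ℝ) I F z) w)) hz
  refine h8.symm.trans ?_
  exact congrArg (fun v : E => (β (F (z + (0 : ℝ) • w)) : E →L[ℝ] ℝ) v) h4.symm

/-- The exterior derivative vanishes on submanifolds on which the form is exact. -/
lemma IsPrimitiveOn.isotropic {β : ∀ x : N, TangentSpace I x →L[ℝ] ℝ} (hβ : IsSmoothForm I β)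
    {A : Set N} {k : ℕ} (hA : IsSubmanifold I k A) {g : N → ℝ}
    (hg : ContMDiff I 𝓘(ℝ, ℝ) ∞ g) (h : IsPrimitiveOn β A g) (p : N) (u v : TangentSpace I p)
    (hu : (⟨p, u⟩ : TangentBundle I N) ∈ tangentVectors I A)
    (hv : (⟨p, v⟩ : TangentBundle I N) ∈ tangentVectors I A) : extD I β p u v = 0 := by
  have hpA : p ∈ A := by
    obtain ⟨γ, -, hγA, hw⟩ := hu
    have : p = γ 0 := congrArg Bundle.TotalSpace.proj hw
    rw [this]; exact hγA 0
  obtain ⟨e, he, hp, V, -, hV⟩ := hA p hpA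
  rw [mem_tangentVectors_iff he hV hp hpA] at hu hv
  obtain ⟨j, hj, h0, hjs, hD⟩ := exists_plot he hp
  let u' : E := (mderiv I 𝓘(ℝ, E) (e.extend I) p) u
  let v' : E := (mderiv I 𝓘(ℝ, E) (e.extend I) p) v
  -- Through the plot this gives a map from ℝ × ℝ into A with partial derivatives u and v at the
  -- origin. The pullback of β under it is the differential of g along it, whose exterior derivative
  -- vanishes.
  let L : ℝ × ℝ →L[ℝ] E := (ContinuousLinearMap.fst ℝ ℝ ℝ).smulRight u' +
    (ContinuousLinearMap.snd ℝ ℝ ℝ).smulRight v'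
  have hL : ∀ z, L z ∈ V := fun z => V.add_mem (V.smul_mem _ hu) (V.smul_mem _ hv)
  have hF : ContMDiff 𝓘(ℝ, ℝ × ℝ) I ∞ (fun z => j (L z)) := hj.comp L.contDiff.contMDiff
  have hFA : ∀ z, j (L z) ∈ A := fun z => by
    obtain ⟨hs, c, hc⟩ := hjs (L z)
    rw [hV _ hs, hc]
    exact V.add_mem ((hV _ hp).1 hpA) (V.smul_mem _ (hL z))
  have hgF : ContDiff ℝ ∞ (fun z => g (j (L z))) := by
    rw [← contMDiff_iff_contDiff]; exact hg.comp hF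
  have hpull : pullForm 𝓘(ℝ, ℝ × ℝ) I (fun z => j (L z)) β =
      fun z => fderiv ℝ (fun z => g (j (L z))) z := funext fun z => h.hasFDerivAt hg hF hFA z
  have h1 := extD_pullForm (p := (0 : ℝ × ℝ)) hβ hF (1, 0) (0, 1)
  rw [hpull] at h1
  have h2 := extD_vectorSpace (fderiv ℝ (fun z => g (j (L z)))) 0 (1, 0) (0, 1)
  have h3 : flatD (fderiv ℝ (fun z => g (j (L z)))) 0 (1, 0) (0, 1) = 0 := by
    rw [flatD, sub_eq_zero]
    exact ((hgF.of_le (by norm_cast) : ContDiff ℝ 2 _).contDiffAt.isSymmSndFDerivAt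
      (by simp)).eq (1, 0) (0, 1)
  have hDF : ∀ w : ℝ × ℝ, (mderiv 𝓘(ℝ, ℝ × ℝ) I (fun z => j (L z)) 0) w =
      (mderiv 𝓘(ℝ, E) I j 0) (L w) := by
    intro w
    have h5 : HasMFDerivAt 𝓘(ℝ, E) I j (L 0) _ := (hj.mdifferentiableAt (by simp)).hasMFDerivAt
    have h6 : HasMFDerivAt 𝓘(ℝ, ℝ × ℝ) I (fun z => j (L z)) 0 _ :=
      h5.comp (0 : ℝ × ℝ) L.hasFDerivAt.hasMFDerivAt
    have h7 : mderiv 𝓘(ℝ, ℝ × ℝ) I (fun z => j (L z)) 0 = (mderiv 𝓘(ℝ, E) I j (L 0)).comp L :=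
      h6.mfderiv
    rw [h7, map_zero]; rfl
  have h4 := h1.symm.trans (h2.trans h3)
  have hu' : (mderiv 𝓘(ℝ, ℝ × ℝ) I (fun z => j (L z)) 0) (1, 0) = u := by
    rw [hDF]
    have : L (1, 0) = u' := by simp [L]
    rw [this]; exact hD u
  have hv' : (mderiv 𝓘(ℝ, ℝ × ℝ) I (fun z => j (L z)) 0) (0, 1) = v := by
    rw [hDF]
    have : L (0, 1) = v' := by simp [L]
    rw [this]; exact hD v
  have h5 : extD I β (j (L 0)) (show E from u) (show E from v) = 0 := by
    refine Eq.trans ?_ h4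
    exact (congrArg₂ (fun a b : E => extD I β (j (L 0)) a b) hu' hv').symm
  have h6 : j (L 0) = p := by rw [map_zero, h0]
  exact (congrArg (fun q => extD I β q (show E from u) (show E from v)) h6).symm.trans h5

end Primitives

end

noncomputable section

/-! ### Velocities of curves -/

section Velocity

variable {E : Type*} [NormedAddCommGroup E] [NormedSpace ℝ E] {H : Type*} [TopologicalSpace H]
  {I : ModelWithCorners ℝ E H} {N : Type*} [TopologicalSpace N] [ChartedSpace H N]
  {E' : Type*} [NormedAddCommGroup E'] [NormedSpace ℝ E'] {H' : Type*} [TopologicalSpace H']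
  {I' : ModelWithCorners ℝ E' H'} {N' : Type*} [TopologicalSpace N'] [ChartedSpace H' N']
  {E'' : Type*} [NormedAddCommGroup E''] [NormedSpace ℝ E''] {H'' : Type*} [TopologicalSpace H'']
  {I'' : ModelWithCorners ℝ E'' H''} {N'' : Type*} [TopologicalSpace N''] [ChartedSpace H'' N'']

variable (I) in
/-- The curve `γ` has velocity `v` at time `t`. -/
def HasVelocityAt (γ : ℝ → N) (v : E) (t : ℝ) : Prop :=
  HasMFDerivAt 𝓘(ℝ, ℝ) I γ t ((1 : ℝ →L[ℝ] ℝ).smulRight (show TangentSpace I (γ t) from v))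

lemma HasVelocityAt.congr_velocity {γ : ℝ → N} {v v' : E} {t : ℝ} (h : HasVelocityAt I γ v t)
    (hv : v = v') : HasVelocityAt I γ v' t := hv ▸ h

lemma HasVelocityAt.unique {γ : ℝ → N} {v v' : E} {t : ℝ} (h : HasVelocityAt I γ v t)
    (h' : HasVelocityAt I γ v' t) : v = v' := by
  have h1 : (1 : ℝ →L[ℝ] ℝ).smulRight v = (1 : ℝ →L[ℝ] ℝ).smulRight v' :=
    hasMFDerivAt_unique h h'
  simpa using DFunLike.congr_fun h1 1

lemma HasVelocityAt.congr_of_eventuallyEq {γ γ' : ℝ → N} {v : E} {t : ℝ}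
    (h : HasVelocityAt I γ v t) (hγ : γ' =ᶠ[nhds t] γ) : HasVelocityAt I γ' v t := by
  have h1 : HasMFDerivAt 𝓘(ℝ, ℝ) I γ t
    ((1 : ℝ →L[ℝ] ℝ).smulRight (show TangentSpace I (γ t) from v)) := h
  exact h1.congr_of_eventuallyEq hγ

lemma hasVelocityAt_const (x : N) (t : ℝ) : HasVelocityAt I (fun _ => x) (0 : E) t := by
  refine (hasMFDerivAt_const x t).congr_mfderiv ?_
  refine ContinuousLinearMap.ext fun (r : ℝ) => ?_
  exact (smul_zero (A := E) r).symm

lemma hasVelocityAt_iff_hasDerivAt {γ : ℝ → E'} {v : E'} {t : ℝ} :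
    HasVelocityAt 𝓘(ℝ, E') γ v t ↔ HasDerivAt γ v t := by
  constructor
  · exact fun h => hasDerivAt_of_smulRight (hasMFDerivAt_iff_hasFDerivAt.1 h)
  · intro h
    refine h.hasFDerivAt.hasMFDerivAt

lemma HasVelocityAt.map {γ : ℝ → N} {v : E} {t : ℝ} {f : N → N'} (h : HasVelocityAt I γ v t)
    (hf : MDifferentiableAt I I' f (γ t)) :
    HasVelocityAt I' (fun s => f (γ s)) (mderiv I I' f (γ t) v) t :=
  (hf.hasMFDerivAt.comp t h).congr_mfderiv (comp_smulRight_one (F := E) (G := E') _ _)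

lemma HasVelocityAt.hasDerivAt_comp {γ : ℝ → N} {v : E} {t : ℝ} {f : N → E'}
    (h : HasVelocityAt I γ v t) (hf : MDifferentiableAt I 𝓘(ℝ, E') f (γ t)) :
    HasDerivAt (fun s => f (γ s)) (mderiv I 𝓘(ℝ, E') f (γ t) v) t :=
  hasVelocityAt_iff_hasDerivAt.1 (h.map hf)

lemma HasVelocityAt.comp_real {γ : ℝ → N} {v : E} {t θ' : ℝ} {θ : ℝ → ℝ}
    (h : HasVelocityAt I γ v (θ t)) (hθ : HasDerivAt θ θ' t) :
    HasVelocityAt I (fun s => γ (θ s)) (θ' • v) t := by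
  refine (HasMFDerivAt.comp t h hθ.hasFDerivAt.hasMFDerivAt).congr_mfderiv ?_
  refine ContinuousLinearMap.ext fun (r : ℝ) => ?_
  change (r • θ') • v = r • θ' • v
  rw [smul_smul, smul_eq_mul]

lemma HasVelocityAt.prodMk {γ : ℝ → N} {v : E} {t : ℝ} {γ' : ℝ → N'} {v' : E'}
    (h : HasVelocityAt I γ v t) (h' : HasVelocityAt I' γ' v' t) :
    HasVelocityAt (I.prod I') (fun s => (γ s, γ' s)) (v, v') t := by
  refine (HasMFDerivAt.prodMk h h').congr_mfderiv ?_
  exact ContinuousLinearMap.ext fun (r : ℝ) => rfl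

lemma hasVelocityAt_of_mdifferentiableAt {γ : ℝ → N} {t : ℝ}
    (h : MDifferentiableAt 𝓘(ℝ, ℝ) I γ t) :
    HasVelocityAt I γ (mderiv 𝓘(ℝ, ℝ) I γ t 1) t := by
  refine h.hasMFDerivAt.congr_mfderiv ?_
  refine ContinuousLinearMap.ext fun (r : ℝ) => ?_
  change mderiv 𝓘(ℝ, ℝ) I γ t r = r • mderiv 𝓘(ℝ, ℝ) I γ t 1
  rw [← map_smul, smul_eq_mul, mul_one]

lemma HasVelocityAt.mderiv_eq {γ : ℝ → N} {v : E} {t : ℝ} (h : HasVelocityAt I γ v t) :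
    mderiv 𝓘(ℝ, ℝ) I γ t 1 = v :=
  (hasVelocityAt_of_mdifferentiableAt (HasMFDerivAt.mdifferentiableAt h)).unique h

lemma mderiv_comp {f : N → N'} {g : N' → N''} {x : N} (hg : MDifferentiableAt I' I'' g (f x))
    (hf : MDifferentiableAt I I' f x) (v : E) :
    mderiv I I'' (fun x => g (f x)) x v = mderiv I' I'' g (f x) (mderiv I I' f x v) :=
  DFunLike.congr_fun (show mderiv I I'' (fun x => g (f x)) x =
    (mderiv I' I'' g (f x)).comp (mderiv I I' f x) from mfderiv_comp x hg hf) v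

lemma mderiv_of_eventuallyEq_const {f : N → N'} {x : N} {c : N'} (h : f =ᶠ[nhds x] fun _ => c) :
    mderiv I I' f x = 0 := by
  have h1 : HasMFDerivAt I I' (fun _ : N => c) x _ := hasMFDerivAt_const c x
  exact (h1.congr_of_eventuallyEq h).mfderiv

/-- The velocity of a curve under a smooth family of maps. -/
lemma HasVelocityAt.map_family {Ψ : ℝ → N → N'}
    (hΨ : ContMDiff (𝓘(ℝ, ℝ).prod I) I' ∞ (fun q : ℝ × N => Ψ q.1 q.2))
    {a : ℝ → ℝ} {a' t : ℝ} {c : ℝ → N} {v : E} {w : E'} (ha : HasDerivAt a a' t)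
    (hc : HasVelocityAt I c v t) (hw : HasVelocityAt I' (fun s => Ψ s (c t)) w (a t)) :
    HasVelocityAt I' (fun s => Ψ (a s) (c s)) (a' • w + mderiv I I' (Ψ (a t)) (c t) v) t := by
  have hd : MDifferentiableAt (𝓘(ℝ, ℝ).prod I) I' (fun q : ℝ × N => Ψ q.1 q.2) (a t, c t) :=
    hΨ.mdifferentiableAt (by simp)
  have h1 := (((hasVelocityAt_iff_hasDerivAt (E' := ℝ)).2 ha).prodMk hc).map
    (f := fun q : ℝ × N => Ψ q.1 q.2) hd
  refine h1.congr_velocity ?_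
  -- The velocity splits into its time and space parts, which are computed with the other variable
  -- frozen.
  have h2 : ((a', v) : ℝ × E) = a' • ((1 : ℝ), (0 : E)) + ((0 : ℝ), v) := by simp
  rw [h2, map_add, map_smul]
  congr 1
  · congr 1
    have h3 : HasVelocityAt I' (fun s => Ψ s (c t)) _ (a t) :=
      (((hasVelocityAt_iff_hasDerivAt (E' := ℝ)).2 (hasDerivAt_id (a t))).prodMk
      (hasVelocityAt_const (I := I) (c t) (a t))).map (f := fun q : ℝ × N => Ψ q.1 q.2) hd
    exact h3.unique hw
  · have h4 : HasMFDerivAt I (𝓘(ℝ, ℝ).prod I) (fun x : N => (a t, x)) (c t)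
        (show E →L[ℝ] ℝ × E from (0 : E →L[ℝ] ℝ).prod (ContinuousLinearMap.id ℝ E)) :=
      (hasMFDerivAt_const (a t) (c t)).prodMk (hasMFDerivAt_id (c t))
    have h5 := (hd.hasMFDerivAt.comp (c t) h4).mfderiv
    exact (DFunLike.congr_fun (show mderiv I I' (Ψ (a t)) (c t) =
      (mderiv (𝓘(ℝ, ℝ).prod I) I' (fun q : ℝ × N => Ψ q.1 q.2) (a t, c t)).comp
      ((0 : E →L[ℝ] ℝ).prod (ContinuousLinearMap.id ℝ E)) from h5) v).symm

end Velocity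

/-! ### Hamiltonian isotopies: operations, existence, uniqueness -/

section Isotopies

variable {E : Type*} [NormedAddCommGroup E] [NormedSpace ℝ E] {H : Type*} [TopologicalSpace H]
  {I : ModelWithCorners ℝ E H} [I.Boundaryless] {N : Type*} [TopologicalSpace N]
  [ChartedSpace H N] [IsManifold I ∞ N] {β : ∀ x : N, TangentSpace I x →L[ℝ] ℝ}

/-- `v` is the value at `x` of the Hamiltonian vector field of `k`. -/
def IsHamVec (β : ∀ x : N, TangentSpace I x →L[ℝ] ℝ) (k : N → ℝ) (x : N) (v : E) : Prop :=
  ∀ w : E, extD I β x v w = - mderiv I 𝓘(ℝ, ℝ) k x w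

variable (β) in
/-- A Hamiltonian isotopy, defined for all times. -/
structure HamIsotopy where
  map : ℝ → N ≃ₘ⟮I, I⟯ N
  ham : ℝ → N → ℝ
  smooth : ContMDiff (𝓘(ℝ, ℝ).prod I) I ∞ (fun q : ℝ × N => map q.1 q.2)
  map_zero : ∀ x, map 0 x = x
  ham_smooth : ContMDiff (𝓘(ℝ, ℝ).prod I) 𝓘(ℝ, ℝ) ∞ (fun q : ℝ × N => ham q.1 q.2)
  velocity : ∀ t x, ∃ v : E, HasVelocityAt I (fun s => map s x) v t ∧ IsHamVec β (ham t) (map t x) v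

lemma contMDiff_uncurry_right {E' : Type*} [NormedAddCommGroup E'] [NormedSpace ℝ E'] {H' : Type*}
    [TopologicalSpace H'] {I' : ModelWithCorners ℝ E' H'} {N' : Type*} [TopologicalSpace N']
    [ChartedSpace H' N'] {F : ℝ → N → N'}
    (hF : ContMDiff (𝓘(ℝ, ℝ).prod I) I' ∞ (fun q : ℝ × N => F q.1 q.2)) (t : ℝ) :
    ContMDiff I I' ∞ (F t) :=
  hF.comp (contMDiff_const.prodMk contMDiff_id)

lemma IsHamVec.smul {k : N → ℝ} {x : N} {v : E} (h : IsHamVec β k x v)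
    (hk : MDifferentiableAt I 𝓘(ℝ, ℝ) k x) (c : ℝ) :
    IsHamVec β (fun y => c * k y) x (c • v) := by
  intro w
  have h1 : mderiv I 𝓘(ℝ, ℝ) (fun y => c * k y) x w = c * mderiv I 𝓘(ℝ, ℝ) k x w := by
    have h2 : HasMFDerivAt I 𝓘(ℝ, ℝ) (fun y => c * k y) x
        (show E →L[ℝ] ℝ from c • mderiv I 𝓘(ℝ, ℝ) k x) := hk.hasMFDerivAt.const_smul c
    exact DFunLike.congr_fun (show mderiv I 𝓘(ℝ, ℝ) (fun y => c * k y) x = _ from h2.mfderiv) w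
  have h3 : extD I β x (c • v) w = c * extD I β x v w := by
    refine (extD_eq_flatDL β x (c • v) w).trans ?_
    rw [map_smul]
    exact congrArg (fun r => c * r) (extD_eq_flatDL β x v w).symm
  rw [h1, h3, h w]; ring

lemma IsHamVec.congr {k k' : N → ℝ} {x : N} {v : E} (h : IsHamVec β k x v)
    (hk : mderiv I 𝓘(ℝ, ℝ) k' x = mderiv I 𝓘(ℝ, ℝ) k x) : IsHamVec β k' x v := by
  intro w
  rw [hk, h w]

lemma isHamVec_zero {k : N → ℝ} {x : N} (hk : mderiv I 𝓘(ℝ, ℝ) k x = 0) :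
    IsHamVec β k x (0 : E) := by
  intro w
  rw [hk]
  refine (extD_eq_flatDL β x (0 : E) w).trans ?_
  simp

lemma IsHamVec.unique [FiniteDimensional ℝ E] (hn : IsNondegenerate β) {k : N → ℝ}
    {x : N} {v v' : E}
    (h : IsHamVec β k x v) (h' : IsHamVec β k x v') : v = v' :=
  IsHamiltonianField.unique hn fun w => (h w).trans (h' w).symm

namespace HamIsotopy

lemma contMDiff_ham (φ : HamIsotopy β) (t : ℝ) : ContMDiff I 𝓘(ℝ, ℝ) ∞ (φ.ham t) :=
  contMDiff_uncurry_right φ.ham_smooth t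

/-- Reparametrization in time. -/
def reparam (φ : HamIsotopy β) (θ : ℝ → ℝ) (hθ : ContDiff ℝ ∞ θ) (h0 : θ 0 = 0) :
    HamIsotopy β where
  map t := φ.map (θ t)
  ham t x := deriv θ t * φ.ham (θ t) x
  smooth := φ.smooth.comp ((hθ.contMDiff.comp contMDiff_fst).prodMk contMDiff_snd)
  map_zero x := by rw [h0, φ.map_zero]
  ham_smooth := by
    have h1 : ContDiff ℝ ∞ (deriv θ) := hθ.deriv'
    exact (h1.contMDiff.comp contMDiff_fst).mul
      (φ.ham_smooth.comp ((hθ.contMDiff.comp contMDiff_fst).prodMk contMDiff_snd))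
  velocity t x := by
    obtain ⟨v, h1, h2⟩ := φ.velocity (θ t) x
    exact ⟨_, h1.comp_real ((hθ.differentiable (by simp)) t).hasDerivAt,
      h2.smul ((φ.contMDiff_ham _).mdifferentiableAt (by simp)) _⟩

/-- The isotopy traversed backwards. -/
def reverse (φ : HamIsotopy β) : HamIsotopy β where
  map t := (φ.map 1).symm.trans (φ.map (1 - t))
  ham t x := -φ.ham (1 - t) x
  smooth := φ.smooth.comp (((contDiff_const.sub contDiff_id).contMDiff.comp contMDiff_fst).prodMk
    ((φ.map 1).symm.contMDiff.comp contMDiff_snd))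
  map_zero x := by simp
  ham_smooth := (φ.ham_smooth.comp (((contDiff_const.sub contDiff_id).contMDiff.comp
    contMDiff_fst).prodMk contMDiff_snd)).neg
  velocity t x := by
    obtain ⟨v, h1, h2⟩ := φ.velocity (1 - t) ((φ.map 1).symm x)
    refine ⟨_, h1.comp_real ((hasDerivAt_id t).const_sub 1), ?_⟩
    have h3 := h2.smul ((φ.contMDiff_ham _).mdifferentiableAt (by simp)) (-1)
    refine h3.congr ?_
    congr 1
    funext y
    ring

lemma reverse_map (φ : HamIsotopy β) (t : ℝ) (x : N) :
    φ.reverse.map t x = φ.map (1 - t) ((φ.map 1).symm x) := rfl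

/-- First `φ`, then `ψ`. -/
def trans (φ ψ : HamIsotopy β) : HamIsotopy β where
  -- φ runs for t in [0, 1/3] and ψ for t in [2/3, 1]; in between both rest, so the concatenation is
  -- smooth.
  map t := (φ.map (Real.smoothTransition (3 * t))).trans
    (ψ.map (Real.smoothTransition (3 * t - 2)))
  ham t x := deriv (fun s => Real.smoothTransition (3 * s)) t *
      φ.ham (Real.smoothTransition (3 * t)) x +
    deriv (fun s => Real.smoothTransition (3 * s - 2)) t *
      ψ.ham (Real.smoothTransition (3 * t - 2)) x
  smooth := by
    have h1 : ContDiff ℝ ∞ fun t : ℝ => Real.smoothTransition (3 * t) :=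
      Real.smoothTransition.contDiff.comp (contDiff_const.mul contDiff_id)
    have h2 : ContDiff ℝ ∞ fun t : ℝ => Real.smoothTransition (3 * t - 2) :=
      Real.smoothTransition.contDiff.comp ((contDiff_const.mul contDiff_id).sub contDiff_const)
    exact ψ.smooth.comp ((h2.contMDiff.comp contMDiff_fst).prodMk
      (φ.smooth.comp ((h1.contMDiff.comp contMDiff_fst).prodMk contMDiff_snd)))
  map_zero x := by
    have h1 : Real.smoothTransition (3 * 0) = 0 := by simp
    have h2 : Real.smoothTransition (3 * 0 - 2) = 0 :=
      Real.smoothTransition.zero_of_nonpos (by norm_num)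
    rw [h1, h2]
    exact (ψ.map_zero _).trans (φ.map_zero x)
  ham_smooth := by
    have h1 : ContDiff ℝ ∞ fun t : ℝ => Real.smoothTransition (3 * t) :=
      Real.smoothTransition.contDiff.comp (contDiff_const.mul contDiff_id)
    have h2 : ContDiff ℝ ∞ fun t : ℝ => Real.smoothTransition (3 * t - 2) :=
      Real.smoothTransition.contDiff.comp ((contDiff_const.mul contDiff_id).sub contDiff_const)
    exact ((h1.deriv'.contMDiff.comp contMDiff_fst).mul
      (φ.ham_smooth.comp ((h1.contMDiff.comp contMDiff_fst).prodMk contMDiff_snd))).add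
      ((h2.deriv'.contMDiff.comp contMDiff_fst).mul
      (ψ.ham_smooth.comp ((h2.contMDiff.comp contMDiff_fst).prodMk contMDiff_snd)))
  velocity t x := by
    have h1 : ContDiff ℝ ∞ fun t : ℝ => Real.smoothTransition (3 * t) :=
      Real.smoothTransition.contDiff.comp (contDiff_const.mul contDiff_id)
    have h2 : ContDiff ℝ ∞ fun t : ℝ => Real.smoothTransition (3 * t - 2) :=
      Real.smoothTransition.contDiff.comp ((contDiff_const.mul contDiff_id).sub contDiff_const)
    -- Near a time below 2/3 the second isotopy has not started; near a time from 2/3 on the first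
    -- one is over. In each case only one Hamiltonian contributes.
    rcases lt_or_ge t (2 / 3) with ht | ht
    · obtain ⟨v, hv, hk⟩ := φ.velocity (Real.smoothTransition (3 * t)) x
      have hz : ∀ᶠ s in nhds t, Real.smoothTransition (3 * s - 2) = 0 := by
        filter_upwards [Iio_mem_nhds ht] with s hs
        exact Real.smoothTransition.zero_of_nonpos (by rw [mem_Iio] at hs; linarith)
      have hd : deriv (fun s => Real.smoothTransition (3 * s - 2)) t = 0 := by
        have : (fun s => Real.smoothTransition (3 * s - 2)) =ᶠ[nhds t] fun _ => 0 := hz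
        rw [this.deriv_eq, deriv_const]
      refine ⟨_, (hv.comp_real (θ := fun s => Real.smoothTransition (3 * s))
        ((h1.differentiable (by simp)) t).hasDerivAt).congr_of_eventuallyEq
        ?_, ?_⟩
      · filter_upwards [hz] with s hs
        change ψ.map (Real.smoothTransition (3 * s - 2)) _ = _
        rw [hs, ψ.map_zero]
        rfl
      · have h3 := hk.smul ((φ.contMDiff_ham _).mdifferentiableAt (by simp))
          (deriv (fun s => Real.smoothTransition (3 * s)) t)
        have h4 : (φ.map (Real.smoothTransition (3 * t))).trans
            (ψ.map (Real.smoothTransition (3 * t - 2))) x =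
            φ.map (Real.smoothTransition (3 * t)) x := by
          change ψ.map (Real.smoothTransition (3 * t - 2)) _ = _
          rw [hz.self_of_nhds, ψ.map_zero]
          rfl
        rw [h4]
        refine h3.congr ?_
        simp only [hd, zero_mul, add_zero]
    · obtain ⟨v, hv, hk⟩ := ψ.velocity (Real.smoothTransition (3 * t - 2)) (φ.map 1 x)
      have hz : ∀ᶠ s in nhds t, Real.smoothTransition (3 * s) = 1 := by
        filter_upwards [Ioi_mem_nhds (show (1 / 3 : ℝ) < t by linarith)] with s hs
        exact Real.smoothTransition.one_of_one_le (by rw [mem_Ioi] at hs; linarith)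
      have hd : deriv (fun s => Real.smoothTransition (3 * s)) t = 0 := by
        have : (fun s => Real.smoothTransition (3 * s)) =ᶠ[nhds t] fun _ => 1 := hz
        rw [this.deriv_eq, deriv_const]
      refine ⟨_, (hv.comp_real
        (θ := fun s => Real.smoothTransition (3 * s - 2))
        ((h2.differentiable (by simp)) t).hasDerivAt).congr_of_eventuallyEq
        ?_, ?_⟩
      · filter_upwards [hz] with s hs
        change ψ.map (Real.smoothTransition (3 * s - 2)) (φ.map (Real.smoothTransition (3 * s)) x)
          = _
        rw [hs]
      · have h3 := hk.smul ((ψ.contMDiff_ham _).mdifferentiableAt (by simp))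
          (deriv (fun s => Real.smoothTransition (3 * s - 2)) t)
        have h4 : (φ.map (Real.smoothTransition (3 * t))).trans
            (ψ.map (Real.smoothTransition (3 * t - 2))) x =
            ψ.map (Real.smoothTransition (3 * t - 2)) (φ.map 1 x) := by
          change ψ.map (Real.smoothTransition (3 * t - 2)) (φ.map (Real.smoothTransition (3 * t)) x)
            = _
          rw [hz.self_of_nhds]
        rw [h4]
        refine h3.congr ?_
        simp only [hd, zero_mul, zero_add]

lemma trans_map (φ ψ : HamIsotopy β) (t : ℝ) (x : N) : (φ.trans ψ).map t x =
    ψ.map (Real.smoothTransition (3 * t - 2)) (φ.map (Real.smoothTransition (3 * t)) x) := rfl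

lemma trans_map_one (φ ψ : HamIsotopy β) (x : N) :
    (φ.trans ψ).map 1 x = ψ.map 1 (φ.map 1 x) := by
  rw [trans_map, Real.smoothTransition.one_of_one_le (by norm_num),
    Real.smoothTransition.one_of_one_le (by norm_num)]

variable [FiniteDimensional ℝ E] [T2Space N]

/-- Functions whose differentials have compact support in space and time generate isotopies. -/
lemma exists_of_compact (hβ : IsSmoothForm I β) (hn : IsNondegenerate β) {K : ℝ → N → ℝ}
    (hK : ContMDiff (𝓘(ℝ, ℝ).prod I) 𝓘(ℝ, ℝ) ∞ (fun q : ℝ × N => K q.1 q.2))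
    {C : Set N} (hC : IsCompact C) (hKC : ∀ t, ∀ x ∉ C, mderiv I 𝓘(ℝ, ℝ) (K t) x = 0)
    (hKt : ∀ t ∉ Icc (0 : ℝ) 1, ∀ x, mderiv I 𝓘(ℝ, ℝ) (K t) x = 0) :
    ∃ φ : HamIsotopy β, φ.ham = K := by
  have hX := isHamiltonianField_hamField hβ hn K
  -- By nondegeneracy the Hamiltonian field vanishes wherever the differential does, so the support
  -- of the differential controls that of the field.
  have h0 : ∀ t x, mderiv I 𝓘(ℝ, ℝ) (K t) x = 0 → hamField β K t x = 0 := fun t x h =>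
    IsHamVec.unique hn (k := K t) (hX t x) (isHamVec_zero h)
  obtain ⟨φ, h1, h2, h3⟩ := exists_isotopy_of_compact (contDiffOn_localField hβ hn hK hX) hC
    (fun t x hx => h0 t x (hKC t x hx)) (fun t ht x => h0 t x (hKt t ht x))
  exact ⟨⟨φ, K, h1, h2, hK, fun t x => ⟨_, h3 t x, hX t _⟩⟩, rfl⟩

/-- Uniqueness of trajectories. -/
lemma eq_map (hβ : IsSmoothForm I β) (hn : IsNondegenerate β) (φ : HamIsotopy β) {c : ℝ → N}
    {a b t₀ : ℝ} (ht₀ : t₀ ∈ Ioo a b) (hc : ∀ t ∈ Ioo a b, ∃ v, HasVelocityAt I c v t ∧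
      IsHamVec β (φ.ham t) (c t) v) {x : N} (h0 : c t₀ = φ.map t₀ x) :
    ∀ t ∈ Ioo a b, c t = φ.map t x := by
  have hX := isHamiltonianField_hamField hβ hn φ.ham
  have hs := isSmoothField_suspend (contDiffOn_localField hβ hn φ.ham_smooth hX)
  have hV1 : ContMDiff (𝓘(ℝ, ℝ).prod I) (𝓘(ℝ, ℝ).prod I).tangent 1
      (fun x => (⟨x, suspend (hamField β φ.ham) x⟩ : TangentBundle (𝓘(ℝ, ℝ).prod I) (ℝ × N))) :=
    hs.of_le (by norm_cast)
  have key : ∀ d : ℝ → N, (∀ t ∈ Ioo a b, ∃ v, HasVelocityAt I d v t ∧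
      IsHamVec β (φ.ham t) (d t) v) → IsMIntegralCurveOn (I := 𝓘(ℝ, ℝ).prod I)
      (fun s => (0 + s, d s)) (suspend (hamField β φ.ham)) (Ioo a b) := by
    intro d hd t ht
    obtain ⟨v, hv, hk⟩ := hd t ht
    refine (hasMFDerivAt_suspend ?_).hasMFDerivWithinAt
    rw [zero_add]
    have h1 : v = hamField β φ.ham t (d t) := IsHamVec.unique hn hk (hX t _)
    exact hv.congr_velocity h1
  have h2 := isMIntegralCurveOn_Ioo_eqOn_of_contMDiff_boundaryless ht₀ hV1 (key c hc)
    (key (fun t => φ.map t x) fun t _ => φ.velocity t x) (by simp [h0])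
  intro t ht
  exact congrArg Prod.snd (h2 ht)

lemma map_eq_self (hβ : IsSmoothForm I β) (hn : IsNondegenerate β) (φ : HamIsotopy β) {x : N}
    (h : ∀ t, mderiv I 𝓘(ℝ, ℝ) (φ.ham t) x = 0) (t : ℝ) : φ.map t x = x := by
  refine (eq_map hβ hn φ (c := fun _ => x) (a := -|t| - 1) (b := |t| + 1) (t₀ := 0) ?_ ?_ ?_ t
    ?_).symm
  · constructor <;> linarith [abs_nonneg t]
  · exact fun s _ => ⟨0, hasVelocityAt_const x s, isHamVec_zero (h s)⟩
  · rw [φ.map_zero]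
  · constructor <;> linarith [le_abs_self t, neg_abs_le t]

/-- The differential of the generating function vanishes at stationary points. -/
lemma mderiv_ham_eq_zero (φ : HamIsotopy β) {x : N} (h : ∀ t, φ.map t x = x) (t : ℝ) :
    mderiv I 𝓘(ℝ, ℝ) (φ.ham t) x = 0 := by
  obtain ⟨v, hv, hk⟩ := φ.velocity t x
  have h1 : HasVelocityAt I (fun s => φ.map s x) (0 : E) t :=
    (hasVelocityAt_const x t).congr_of_eventuallyEq (Filter.Eventually.of_forall h)
  have h2 : v = 0 := hv.unique h1
  subst h2
  rw [h t] at hk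
  refine ContinuousLinearMap.ext fun w => ?_
  have h3 := hk w
  have h4 : extD I β x (0 : E) w = 0 := (extD_eq_flatDL β x (0 : E) w).trans (by simp)
  have h5 : -mderiv I 𝓘(ℝ, ℝ) (φ.ham t) x w = 0 := h3.symm.trans h4
  simpa using h5

end HamIsotopy

end Isotopies

end

noncomputable section

/-! ### The action of a Hamiltonian isotopy -/

section Action

/-- Differentiation of an integral of a smooth function which is a mixed partial derivative. -/
lemma hasDerivAt_integral_of_fderiv_eq {P Q : ℝ × ℝ → ℝ} (hP : ContDiff ℝ ∞ P)
    (hQ : ContDiff ℝ ∞ Q) (h : ∀ z, fderiv ℝ P z (1, 0) = fderiv ℝ Q z (0, 1)) :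
    HasDerivAt (fun s => ∫ t in (0 : ℝ)..1, Q (t, s)) (P (1, 0) - P (0, 0)) 0 := by
  have hQ' : Continuous fun z : ℝ × ℝ => fderiv ℝ Q z (0, 1) :=
    (hQ.continuous_fderiv (by simp)).clm_apply continuous_const
  obtain ⟨C, hC⟩ := ((isCompact_Icc (a := (0 : ℝ)) (b := 1)).prod
    (isCompact_Icc (a := (-1 : ℝ)) (b := 1))).exists_bound_of_continuousOn hQ'.continuousOn
  have h1 := intervalIntegral.hasDerivAt_integral_of_dominated_loc_of_deriv_le
    (μ := MeasureTheory.volume) (𝕜 := ℝ) (a := 0) (b := 1) (F := fun s t => Q (t, s))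
    (F' := fun s t => fderiv ℝ Q (t, s) (0, 1)) (x₀ := 0) (s := Icc (-1) 1) (bound := fun _ => C)
    (Icc_mem_nhds (by norm_num) (by norm_num))
    (Filter.Eventually.of_forall fun s =>
      (hQ.continuous.comp (by fun_prop : Continuous fun t : ℝ => (t, s))).aestronglyMeasurable)
    ((hQ.continuous.comp (by fun_prop : Continuous fun t : ℝ => (t, (0 : ℝ)))).intervalIntegrable
      0 1)
    ((hQ'.comp (by fun_prop : Continuous fun t : ℝ => (t, (0 : ℝ)))).aestronglyMeasurable)
    (Filter.Eventually.of_forall fun t ht s hs => by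
      rw [uIoc_of_le zero_le_one] at ht
      exact hC (t, s) ⟨⟨ht.1.le, ht.2⟩, hs⟩)
    intervalIntegrable_const
    (Filter.Eventually.of_forall fun t ht s hs => by
      have h2 : HasDerivAt (fun s : ℝ => (t, s)) ((0 : ℝ), (1 : ℝ)) s :=
        (hasDerivAt_const s t).prodMk (hasDerivAt_id s)
      exact ((hQ.differentiable (by simp) (t, s)).hasFDerivAt).comp_hasDerivAt s h2)
  have h3 : ∫ t in (0 : ℝ)..1, fderiv ℝ Q (t, 0) (0, 1) = P (1, 0) - P (0, 0) := by
    refine intervalIntegral.integral_eq_sub_of_hasDerivAt (f := fun t => P (t, 0)) (fun t _ => ?_)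
      ((hQ'.comp (by fun_prop : Continuous fun t : ℝ => (t, (0 : ℝ)))).intervalIntegrable 0 1)
    rw [← h]
    have h2 : HasDerivAt (fun t : ℝ => (t, (0 : ℝ))) ((1 : ℝ), (0 : ℝ)) t :=
      (hasDerivAt_id t).prodMk (hasDerivAt_const t 0)
    exact ((hP.differentiable (by simp) (t, 0)).hasFDerivAt).comp_hasDerivAt t h2
  rw [← h3]
  exact h1.2

variable {E : Type*} [NormedAddCommGroup E] [NormedSpace ℝ E] {H : Type*} [TopologicalSpace H]
  {I : ModelWithCorners ℝ E H} [I.Boundaryless] {N : Type*} [TopologicalSpace N]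
  [ChartedSpace H N] [IsManifold I ∞ N] {β : ∀ x : N, TangentSpace I x →L[ℝ] ℝ}
  {E' : Type*} [NormedAddCommGroup E'] [NormedSpace ℝ E'] {H' : Type*} [TopologicalSpace H']
  {I' : ModelWithCorners ℝ E' H'} [I'.Boundaryless] {N' : Type*} [TopologicalSpace N']
  [ChartedSpace H' N'] [IsManifold I' ∞ N']

lemma isSmoothForm_pullForm {β : ∀ x : N', TangentSpace I' x →L[ℝ] ℝ} (hβ : IsSmoothForm I' β)
    {f : N → N'} (hf : ContMDiff I I' ∞ f) : IsSmoothForm I (pullForm I I' f β) := by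
  rw [isSmoothForm_iff]
  intro p y hy
  refine ContDiffAt.contDiffWithinAt ?_
  set q := (extChartAt I p).symm y with hq
  have hqs : q ∈ (extChartAt I p).source := (extChartAt I p).map_target hy
  have hqy : extChartAt I p q = y := (extChartAt I p).right_inv hy
  have hF := contDiffAt_chart_comp hqs hf.contMDiffAt (mem_extChartAt_source (I := I') (f q))
  rw [hqy] at hF
  have hb : ContDiffAt ℝ ∞ (localForm I' β (f q)) (extChartAt I' (f q) (f q)) :=
    ((isSmoothForm_iff β).1 hβ (f q)).contDiffAt (extChartAt_target_mem_nhds (f q))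
  have h1 : ContDiffAt ℝ ∞ (fun z => (localForm I' β (f q)
      (extChartAt I' (f q) (f ((extChartAt I p).symm z)))).comp
      (fderiv ℝ (fun z => extChartAt I' (f q) (f ((extChartAt I p).symm z))) z)) y :=
    (ContDiffAt.comp (f := fun z => extChartAt I' (f q) (f ((extChartAt I p).symm z)))
      y hb hF).clm_comp (hF.fderiv_right (m := ∞) (by simp))
  refine h1.congr_of_eventuallyEq ?_
  have hc : ContinuousAt (extChartAt I p).symm y :=
    (continuousOn_extChartAt_symm p).continuousAt ((isOpen_extChartAt_target p).mem_nhds hy)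
  have h2 : ∀ᶠ z in nhds y, f ((extChartAt I p).symm z) ∈ (extChartAt I' (f q)).source :=
    (hf.continuous.continuousAt.comp hc).eventually
      ((isOpen_extChartAt_source (f q)).mem_nhds (mem_extChartAt_source (f q)))
  filter_upwards [h2, (isOpen_extChartAt_target p).mem_nhds hy] with z hz hz'
  exact localForm_pullForm β hz' (hf.mdifferentiableAt (by simp)) hz

lemma contMDiff_form_apply (hβ : IsSmoothForm I β) {V : ∀ x : N, TangentSpace I x}
    (hV : IsSmoothField V) : ContMDiff I 𝓘(ℝ, ℝ) ∞ (fun x => β x (V x)) := by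
  intro p
  refine ContMDiffOn.contMDiffAt ?_ (extChartAt_source_mem_nhds (I := I) p)
  rw [contMDiffOn_extChartAt_iff]
  refine (((isSmoothForm_iff β).1 hβ p).clm_apply ((isSmoothField_iff V).1 hV p)).congr
    fun y hy => ?_
  have hs := (extChartAt I p).map_target hy
  have h1 := localForm_mfderiv β hs (V ((extChartAt I p).symm y))
  rw [(extChartAt I p).right_inv hy] at h1
  exact h1.symm

/-- `f` changes the form `β` by the differential of `G`. -/
def IsExactMap (β : ∀ x : N, TangentSpace I x →L[ℝ] ℝ) (f : N → N) (G : N → ℝ) : Prop :=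
  ContMDiff I I ∞ f ∧ ContMDiff I 𝓘(ℝ, ℝ) ∞ G ∧ ∀ (x : N) (v : E),
    β (f x) (mderiv I I f x v) = β x v + mderiv I 𝓘(ℝ, ℝ) G x v

lemma exists_velocity_curve [FiniteDimensional ℝ E] (p : N) (v : E) :
    ∃ γ : ℝ → N, ContMDiff 𝓘(ℝ, ℝ) I ∞ γ ∧ γ 0 = p ∧ HasVelocityAt I γ v 0 := by
  obtain ⟨γ, hγ, h⟩ := exists_curve (I := I) p v
  have h0 : p = γ 0 := congrArg Bundle.TotalSpace.proj h
  subst h0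
  refine ⟨γ, hγ, rfl, ?_⟩
  have h2 : v = mderiv 𝓘(ℝ, ℝ) I γ 0 1 := eq_of_heq (Bundle.TotalSpace.mk.inj h).2
  rw [h2]
  exact hasVelocityAt_of_mdifferentiableAt (hγ.mdifferentiableAt (by simp))

/-- By Cartan's formula the time derivative of φ_t^*β is φ_t^* d(β(X_t) - K_t), so φ_1^*β - β = dG
where G is the integral over [0, 1] of (β(X_t) - K_t) ∘ φ_t. The identity is verified on one vector
v at a time, along the map F(t, s) = φ_t(c(s)) for a curve c with velocity v. -/
lemma HamIsotopy.exists_action [FiniteDimensional ℝ E] [T2Space N] (hβ : IsSmoothForm I β)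
    (φ : HamIsotopy β) : ∃ G : N → ℝ, IsExactMap β (φ.map 1) G := by
  let Φ : ℝ × N → N := fun q => φ.map q.1 q.2
  have hΦ : ContMDiff (𝓘(ℝ, ℝ).prod I) I ∞ Φ := φ.smooth
  have hμ := isSmoothForm_pullForm hβ hΦ
  have h0 : IsSmoothField (I := 𝓘(ℝ, ℝ).prod I)
      (suspend fun (_ : ℝ) (x : N) => (0 : TangentSpace I x)) := by
    refine isSmoothField_suspend fun p => ?_
    refine (contDiffOn_const (c := (0 : E))).congr fun z _ => ?_
    exact _root_.map_zero (mderiv I 𝓘(ℝ, E) (extChartAt I p) ((extChartAt I p).symm z.2))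
  let f : ℝ → N → ℝ := fun t x => β (φ.map t x) (mderiv (𝓘(ℝ, ℝ).prod I) I Φ (t, x) (1, 0)) -
    φ.ham t (φ.map t x)
  have hf : ContMDiff (𝓘(ℝ, ℝ).prod I) 𝓘(ℝ, ℝ) ∞ (fun q : ℝ × N => f q.1 q.2) :=
    (contMDiff_form_apply hμ h0).sub (φ.ham_smooth.comp (contMDiff_fst.prodMk hΦ))
  have hG := contMDiff_integral hf
  refine ⟨_, (φ.map 1).contMDiff, hG, fun x v => ?_⟩
  obtain ⟨c, hc, rfl, hcv⟩ := exists_velocity_curve (I := I) x v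
  have hF : ContMDiff 𝓘(ℝ, ℝ × ℝ) I ∞ (fun z : ℝ × ℝ => φ.map z.1 (c z.2)) := by
    have h1 : ContMDiff 𝓘(ℝ, ℝ × ℝ) 𝓘(ℝ, ℝ) ∞ (Prod.fst : ℝ × ℝ → ℝ) := contDiff_fst.contMDiff
    have h2 : ContMDiff 𝓘(ℝ, ℝ × ℝ) 𝓘(ℝ, ℝ) ∞ (Prod.snd : ℝ × ℝ → ℝ) := contDiff_snd.contMDiff
    exact φ.smooth.comp (h1.prodMk (hc.comp h2))
  set F : ℝ × ℝ → N := fun z => φ.map z.1 (c z.2) with hFdef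
  let b : ℝ × ℝ → ℝ × ℝ →L[ℝ] ℝ := fun z => pullForm 𝓘(ℝ, ℝ × ℝ) I F β z
  have hb : ContDiff ℝ ∞ b := by
    have h1 := (isSmoothForm_iff _).1 (isSmoothForm_pullForm hβ hF) 0
    have h2 := localForm_vectorSpace b 0
    rw [extChartAt_model_space_eq_id] at h1
    have h3 : ContDiffOn ℝ ∞ b univ := h2 ▸ h1
    exact contDiffOn_univ.1 h3
  have hb_apply : ∀ z w, b z w = β (F z) (mderiv 𝓘(ℝ, ℝ × ℝ) I F z w) := fun z w => rfl
  have hline1 : ∀ t s : ℝ, HasVelocityAt I (fun t => φ.map t (c s))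
      (mderiv 𝓘(ℝ, ℝ × ℝ) I F (t, s) (1, 0)) t := fun t s => by
    have h1 : HasDerivAt (fun t : ℝ => (t, s)) ((1 : ℝ), (0 : ℝ)) t :=
      (hasDerivAt_id t).prodMk (hasDerivAt_const t s)
    exact (hasVelocityAt_iff_hasDerivAt.2 h1).map (hF.mdifferentiableAt (by simp))
  have hline2 : ∀ t s : ℝ, HasVelocityAt I (fun s => φ.map t (c s))
      (mderiv 𝓘(ℝ, ℝ × ℝ) I F (t, s) (0, 1)) s := fun t s => by
    have h1 : HasDerivAt (fun s : ℝ => (t, s)) ((0 : ℝ), (1 : ℝ)) s :=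
      (hasDerivAt_const s t).prodMk (hasDerivAt_id s)
    exact (hasVelocityAt_iff_hasDerivAt.2 h1).map (hF.mdifferentiableAt (by simp))
  have hKF : ContDiff ℝ ∞ (fun z : ℝ × ℝ => φ.ham z.1 (F z)) := by
    rw [← contMDiff_iff_contDiff]
    have h1 : ContMDiff 𝓘(ℝ, ℝ × ℝ) 𝓘(ℝ, ℝ) ∞ (Prod.fst : ℝ × ℝ → ℝ) := contDiff_fst.contMDiff
    exact φ.ham_smooth.comp (h1.prodMk hF)
  let P : ℝ × ℝ → ℝ := fun z => b z (0, 1)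
  let Q : ℝ × ℝ → ℝ := fun z => b z (1, 0) - φ.ham z.1 (F z)
  have hP : ContDiff ℝ ∞ P := hb.clm_apply contDiff_const
  have hQ1 : ContDiff ℝ ∞ fun z => b z (1, 0) := hb.clm_apply contDiff_const
  have hQ : ContDiff ℝ ∞ Q := hQ1.sub hKF
  -- dβ(∂_t F, ∂_s F) equals ∂_t β(∂_s F) - ∂_s β(∂_t F) by naturality, and -∂_s (K_t ∘ F) because
  -- ∂_t F is the Hamiltonian field.
  have hPQ : ∀ z, fderiv ℝ P z (1, 0) = fderiv ℝ Q z (0, 1) := by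
    rintro ⟨t, s⟩
    have h1 : extD I β (F (t, s)) (mderiv 𝓘(ℝ, ℝ × ℝ) I F (t, s) (1, 0))
        (mderiv 𝓘(ℝ, ℝ × ℝ) I F (t, s) (0, 1)) = flatD b (t, s) (1, 0) (0, 1) :=
      (extD_pullForm hβ hF (1, 0) (0, 1)).symm.trans (extD_vectorSpace b (t, s) (1, 0) (0, 1))
    obtain ⟨X, hX, hXK⟩ := φ.velocity t (c s)
    have h2 : mderiv 𝓘(ℝ, ℝ × ℝ) I F (t, s) (1, 0) = X := (hline1 t s).unique hX
    rw [h2] at h1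
    have h3 := (hXK (mderiv 𝓘(ℝ, ℝ × ℝ) I F (t, s) (0, 1))).symm.trans h1
    have h4 : HasDerivAt (fun s => φ.ham t (F (t, s))) (mderiv I 𝓘(ℝ, ℝ) (φ.ham t) (F (t, s))
        (mderiv 𝓘(ℝ, ℝ × ℝ) I F (t, s) (0, 1))) s :=
      (hline2 t s).hasDerivAt_comp ((φ.contMDiff_ham t).mdifferentiableAt (by simp))
    have h5 : fderiv ℝ (fun z : ℝ × ℝ => φ.ham z.1 (F z)) (t, s) (0, 1) =
        mderiv I 𝓘(ℝ, ℝ) (φ.ham t) (F (t, s)) (mderiv 𝓘(ℝ, ℝ × ℝ) I F (t, s) (0, 1)) := by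
      have h6 : HasDerivAt (fun s : ℝ => (t, s)) ((0 : ℝ), (1 : ℝ)) s :=
        (hasDerivAt_const s t).prodMk (hasDerivAt_id s)
      exact (((hKF.differentiable (by simp) (t, s)).hasFDerivAt).comp_hasDerivAt s h6).unique h4
    have hbd := hb.differentiable (by simp) (t, s)
    have h7 : fderiv ℝ P (t, s) (1, 0) = fderiv ℝ b (t, s) (1, 0) (0, 1) := by
      have := hbd.hasFDerivAt.clm_apply (hasFDerivAt_const ((0 : ℝ), (1 : ℝ)) (t, s))
      rw [show fderiv ℝ P (t, s) = _ from this.fderiv]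
      simp
    have h8 : fderiv ℝ (fun z => b z (1, 0)) (t, s) (0, 1) = fderiv ℝ b (t, s) (0, 1) (1, 0) := by
      have := hbd.hasFDerivAt.clm_apply (hasFDerivAt_const ((1 : ℝ), (0 : ℝ)) (t, s))
      rw [this.fderiv]
      simp
    have h9 : fderiv ℝ Q (t, s) = fderiv ℝ (fun z => b z (1, 0)) (t, s) -
        fderiv ℝ (fun z : ℝ × ℝ => φ.ham z.1 (F z)) (t, s) :=
      fderiv_sub (hQ1.differentiable (by simp) _) (hKF.differentiable (by simp) _)
    rw [h9, h7, sub_apply, h8, h5]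
    rw [flatD] at h3
    change -(mderiv I 𝓘(ℝ, ℝ) (φ.ham t) (F (t, s)) (mderiv 𝓘(ℝ, ℝ × ℝ) I F (t, s) (0, 1))) = _
      at h3
    linarith
  have h1 := hasDerivAt_integral_of_fderiv_eq hP hQ hPQ
  have hQf : ∀ t s, Q (t, s) = f t (c s) := by
    intro t s
    have h2 : mderiv 𝓘(ℝ, ℝ × ℝ) I F (t, s) (1, 0) =
        mderiv (𝓘(ℝ, ℝ).prod I) I Φ (t, c s) (1, 0) := by
      have h3 : HasVelocityAt I (fun t => φ.map t (c s)) _ t :=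
        (((hasVelocityAt_iff_hasDerivAt (E' := ℝ)).2 (hasDerivAt_id t)).prodMk
        (hasVelocityAt_const (I := I) (c s) t)).map (f := Φ) (hΦ.mdifferentiableAt (by simp))
      exact (hline1 t s).unique h3
    exact congrArg (fun w : E => β (φ.map t (c s)) w - φ.ham t (φ.map t (c s))) h2
  have h2 : HasDerivAt (fun s => ∫ t in (0 : ℝ)..1, f t (c s)) (P (1, 0) - P (0, 0)) 0 := by
    simpa only [hQf] using h1
  have h3 := h2.unique (hcv.hasDerivAt_comp (hG.mdifferentiableAt (by simp)))
  have h4 : P (1, 0) = β (φ.map 1 (c 0)) (mderiv I I (φ.map 1) (c 0) v) := by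
    have h5 := (hline2 1 0).unique (hcv.map (f := φ.map 1)
      ((φ.map 1).contMDiff.mdifferentiableAt (by simp)))
    exact congrArg (fun w : E => β (φ.map 1 (c 0)) w) h5
  have h5 : P (0, 0) = β (c 0) v := by
    have h6 : HasVelocityAt I (fun s => φ.map 0 (c s)) v 0 :=
      hcv.congr_of_eventuallyEq (Filter.Eventually.of_forall fun s => φ.map_zero (c s))
    have h7 := (hline2 0 0).unique h6
    refine (congrArg (fun w : E => β (φ.map 0 (c 0)) w) h7).trans ?_
    exact congrArg (fun x : N => β x (show E from v)) (φ.map_zero (c 0))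
  rw [h4, h5] at h3
  linarith

end Action

end

noncomputable section

/-! ### Local nature of submanifolds and primitives -/

section Locality

variable {E : Type*} [NormedAddCommGroup E] [NormedSpace ℝ E] {H : Type*} [TopologicalSpace H]
  {I : ModelWithCorners ℝ E H} [I.Boundaryless] {N : Type*} [TopologicalSpace N]
  [ChartedSpace H N] [IsManifold I ∞ N] {β : ∀ x : N, TangentSpace I x →L[ℝ] ℝ}

lemma IsSubmanifold.of_locally {k : ℕ} {A : Set N} (h : ∀ p ∈ A, ∃ U : Set N, IsOpen U ∧ p ∈ U ∧
    ∃ B : Set N, IsSubmanifold I k B ∧ ∀ q ∈ U, q ∈ A ↔ q ∈ B) : IsSubmanifold I k A := by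
  intro p hp
  obtain ⟨U, hU, hpU, B, hB, hAB⟩ := h p hp
  obtain ⟨e, he, hpe, V, hV, heV⟩ := hB p ((hAB p hpU).1 hp)
  refine ⟨e.restr U, restr_mem_maximalAtlas _ he hU, ?_, V, hV, ?_⟩
  · rw [e.restr_source' U hU]; exact ⟨hpe, hpU⟩
  · intro q hq
    rw [e.restr_source' U hU] at hq
    rw [hAB q hq.2, heV q hq.1]
    rfl

lemma IsSubmanifold.image {k : ℕ} {A : Set N} (hA : IsSubmanifold I k A) (f : N ≃ₘ⟮I, I⟯ N) :
    IsSubmanifold I k (f '' A) := by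
  rintro _ ⟨p, hp, rfl⟩
  obtain ⟨e, he, hpe, V, hV, heV⟩ := hA p hp
  rw [IsManifold.mem_maximalAtlas_iff_contMDiffOn] at he
  refine ⟨f.symm.toHomeomorph.toOpenPartialHomeomorph.trans e, ?_, ?_, V, hV, ?_⟩
  · rw [IsManifold.mem_maximalAtlas_iff_contMDiffOn]
    constructor
    · refine he.1.comp f.symm.contMDiff.contMDiffOn ?_
      intro q hq
      simpa using hq
    · refine f.contMDiff.comp_contMDiffOn (he.2.mono ?_)
      intro q hq
      simpa using hq
  · simpa using hpe
  · intro q hq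
    have hq' : f.symm q ∈ e.source := by simpa using hq
    have h1 : q ∈ f '' A ↔ f.symm q ∈ A := by
      constructor
      · rintro ⟨y, hy, rfl⟩; simpa using hy
      · exact fun h => ⟨_, h, by simp⟩
    rw [h1, heV _ hq']
    rfl

/-- A smooth curve can be confined to a small time interval without changing its germ at zero
to first order. -/
lemma exists_slow_curve (ε : ℝ) (hε : 0 < ε) : ∃ ρ : ℝ → ℝ, ContDiff ℝ ∞ ρ ∧ ρ 0 = 0 ∧
    HasDerivAt ρ 1 0 ∧ ∀ t, |ρ t| ≤ ε := by
  refine ⟨fun t => ε * Real.sin (t / ε), by fun_prop, by simp, ?_, fun t => ?_⟩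
  · have h1 : HasDerivAt (fun t : ℝ => t / ε) (1 / ε) 0 := (hasDerivAt_id 0).div_const ε
    have h2 := (h1.sin).const_mul ε
    simpa [hε.ne'] using h2
  · rw [abs_mul, abs_of_pos hε]
    have := Real.abs_sin_le_one (t / ε)
    nlinarith

/-- Primitives are tested on curves that stay in the set for all times. A curve in A is therefore
slowed down so as to remain in U, with the same velocity at 0; since the change of time is locally
invertible, the derivative passes back to the original curve. -/
lemma IsPrimitiveOn.of_locally {A : Set N} {g : N → ℝ} (h : ∀ p ∈ A, ∃ U : Set N, IsOpen U ∧
    p ∈ U ∧ ∃ B : Set N, ∃ g' : N → ℝ, IsPrimitiveOn β B g' ∧ ∀ q ∈ U, q ∈ A → q ∈ B ∧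
      g q = g' q) : IsPrimitiveOn β A g := by
  intro γ hγ hγA
  obtain ⟨U, hU, hpU, B, g', hB, hAB⟩ := h (γ 0) (hγA 0)
  obtain ⟨ε, hε, hεU⟩ := Metric.mem_nhds_iff.1
    ((hU.preimage hγ.continuous).mem_nhds hpU)
  obtain ⟨ρ, hρ, hρ0, hρd, hρb⟩ := exists_slow_curve (ε / 2) (by positivity)
  have hmem : ∀ t, γ (ρ t) ∈ U := fun t => hεU (by
    rw [Metric.mem_ball, Real.dist_eq, sub_zero]
    have := hρb t
    linarith)
  have h1 := hB (fun t => γ (ρ t)) (hγ.comp hρ.contMDiff)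
    (fun t => (hAB _ (hmem t) (hγA _)).1)
  have hv : HasVelocityAt I γ (mderiv 𝓘(ℝ, ℝ) I γ 0 1) (ρ 0) := by
    rw [hρ0]
    exact hasVelocityAt_of_mdifferentiableAt (hγ.mdifferentiableAt (by simp))
  have h2 : mderiv 𝓘(ℝ, ℝ) I (fun t => γ (ρ t)) 0 1 = mderiv 𝓘(ℝ, ℝ) I γ 0 1 := by
    rw [(hv.comp_real hρd).mderiv_eq, one_smul]
  have h3 : β (γ (ρ 0)) (mderiv 𝓘(ℝ, ℝ) I (fun t => γ (ρ t)) 0 1) =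
      β (γ 0) (mderiv 𝓘(ℝ, ℝ) I γ 0 1) := by
    refine (congrArg (fun w : E => β (γ (ρ 0)) w) h2).trans ?_
    exact congrArg (fun x => β x (show E from mderiv 𝓘(ℝ, ℝ) I γ 0 1)) (congrArg γ hρ0)
  have h4 : HasDerivAt (fun t => g' (γ (ρ t))) (β (γ 0) (mderiv 𝓘(ℝ, ℝ) I γ 0 1)) 0 :=
    h1.congr_deriv h3
  -- undo the reparametrization
  have hloc : ∃ σ : ℝ → ℝ, HasDerivAt σ 1 0 ∧ σ 0 = 0 ∧ ∀ᶠ t in nhds 0, ρ (σ t) = t := by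
    have hs : HasStrictDerivAt ρ 1 0 := hρ.contDiffAt.hasStrictDerivAt' hρd (by simp)
    refine ⟨hs.localInverse ρ 1 0 one_ne_zero, ?_, ?_, ?_⟩
    · have := hs.to_localInverse one_ne_zero
      rw [hρ0, inv_one] at this
      exact this.hasDerivAt
    · have := (hs.hasStrictFDerivAt_equiv one_ne_zero).localInverse_apply_image
      rw [hρ0] at this
      exact this
    · have := (hs.hasStrictFDerivAt_equiv one_ne_zero).eventually_right_inverse
      rw [hρ0] at this
      exact this
  obtain ⟨σ, hσ, hσ0, hσρ⟩ := hloc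
  have h5 : HasDerivAt (fun t => g' (γ (ρ (σ t)))) (β (γ 0) (mderiv 𝓘(ℝ, ℝ) I γ 0 1)) 0 := by
    have h6 : HasDerivAt (fun t => g' (γ (ρ t))) (β (γ 0) (mderiv 𝓘(ℝ, ℝ) I γ 0 1)) (σ 0) := by
      rwa [hσ0]
    have := h6.comp 0 hσ
    rwa [mul_one] at this
  refine h5.congr_of_eventuallyEq ?_
  filter_upwards [hσρ, (hU.preimage hγ.continuous).mem_nhds hpU] with t ht htU
  rw [ht]
  exact (hAB _ htU (hγA t)).2

/-- A function with vanishing differential on a connected open set is constant there. -/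
lemma eq_of_mderiv_eq_zero {U : Set N} (hU : IsOpen U) (hc : IsPreconnected U) {g : N → ℝ}
    (hg : ContMDiff I 𝓘(ℝ, ℝ) ∞ g) (h : ∀ x ∈ U, mderiv I 𝓘(ℝ, ℝ) g x = 0) {x y : N}
    (hx : x ∈ U) (hy : y ∈ U) : g y = g x := by
  have hloc : ∀ z ∈ U, ∀ᶠ w in nhds z, g w = g z := by
    intro z hz
    have ht : (extChartAt I z).target ∩ (extChartAt I z).symm ⁻¹' U ∈ nhds (extChartAt I z z) := by
      refine Filter.inter_mem (extChartAt_target_mem_nhds z) ?_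
      refine (continuousAt_extChartAt_symm z).preimage_mem_nhds ?_
      rw [extChartAt_to_inv z]
      exact hU.mem_nhds hz
    obtain ⟨r, hr, hball⟩ := Metric.mem_nhds_iff.1 ht
    have hd : ∀ y ∈ Metric.ball (extChartAt I z z) r,
        HasFDerivAt (fun y => g ((extChartAt I z).symm y)) (0 : E →L[ℝ] ℝ) y := by
      intro y hy
      obtain ⟨hy1, hy2⟩ := hball hy
      have h1 : HasFDerivAt (fun y => g ((extChartAt I z).symm y))
          ((mderiv I 𝓘(ℝ, ℝ) g ((extChartAt I z).symm y)).comp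
            (mderiv 𝓘(ℝ, E) I (extChartAt I z).symm y)) y :=
        hasMFDerivAt_iff_hasFDerivAt.1 ((hg.mdifferentiableAt (by simp)).hasMFDerivAt.comp y
          (mdifferentiableAt_extChartAt_symm hy1).hasMFDerivAt)
      rw [h _ hy2] at h1
      exact h1
    have hcont : ContinuousAt (extChartAt I z) z := continuousAt_extChartAt z
    filter_upwards [hcont (Metric.ball_mem_nhds _ hr), extChartAt_source_mem_nhds (I := I) z]
      with w hw hws
    have h2 := (convex_ball (extChartAt I z z) r).is_const_of_fderivWithin_eq_zero (𝕜 := ℝ)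
      (f := fun y => g ((extChartAt I z).symm y))
      (fun y hy => (hd y hy).differentiableAt.differentiableWithinAt) (fun y hy => by
        rw [fderivWithin_of_isOpen Metric.isOpen_ball hy, (hd y hy).fderiv])
      hw (Metric.mem_ball_self hr)
    simp only [extChartAt_to_inv z, (extChartAt I z).left_inv hws] at h2
    exact h2
  have h1 : IsOpen {z | z ∈ U ∧ g z = g x} := by
    rw [isOpen_iff_mem_nhds]
    rintro z ⟨hz, hzx⟩
    filter_upwards [hU.mem_nhds hz, hloc z hz] with w hw hwz
    exact ⟨hw, hwz.trans hzx⟩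
  have h2 : IsOpen {z | g z ≠ g x} := isOpen_ne_fun hg.continuous continuous_const
  have h3 := hc.subset_left_of_subset_union h1 h2
    (by
      rw [Set.disjoint_left]
      rintro z ⟨-, hz⟩ hz'
      exact hz' hz)
    (fun z hz => by
      by_cases hzx : g z = g x
      · exact Or.inl ⟨hz, hzx⟩
      · exact Or.inr hzx) ⟨x, hx, hx, rfl⟩
  exact (h3 hy).2

end Locality

/-! ### Maps that change the form by an exact one -/

section ExactMaps

variable {E : Type*} [NormedAddCommGroup E] [NormedSpace ℝ E] {H : Type*} [TopologicalSpace H]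
  {I : ModelWithCorners ℝ E H} [I.Boundaryless] {N : Type*} [TopologicalSpace N]
  [ChartedSpace H N] [IsManifold I ∞ N] {β : ∀ x : N, TangentSpace I x →L[ℝ] ℝ}

lemma mderiv_add {g g' : N → ℝ} (hg : ContMDiff I 𝓘(ℝ, ℝ) ∞ g) (hg' : ContMDiff I 𝓘(ℝ, ℝ) ∞ g')
    (x : N) (v : E) : mderiv I 𝓘(ℝ, ℝ) (fun x => g x + g' x) x v =
      mderiv I 𝓘(ℝ, ℝ) g x v + mderiv I 𝓘(ℝ, ℝ) g' x v := by
  have h1 : HasMFDerivAt I 𝓘(ℝ, ℝ) (fun x => g x + g' x) x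
      (show E →L[ℝ] ℝ from mderiv I 𝓘(ℝ, ℝ) g x + mderiv I 𝓘(ℝ, ℝ) g' x) :=
    (hg.mdifferentiableAt (by simp)).hasMFDerivAt.add (hg'.mdifferentiableAt (by simp)).hasMFDerivAt
  exact DFunLike.congr_fun (show mderiv I 𝓘(ℝ, ℝ) (fun x => g x + g' x) x = _ from h1.mfderiv) v

lemma mderiv_const_mul {g : N → ℝ} (hg : ContMDiff I 𝓘(ℝ, ℝ) ∞ g) (c : ℝ) (x : N) :
    mderiv I 𝓘(ℝ, ℝ) (fun x => c * g x) x = c • mderiv I 𝓘(ℝ, ℝ) g x := by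
  have h1 : HasMFDerivAt I 𝓘(ℝ, ℝ) (fun x => c * g x) x
      (show E →L[ℝ] ℝ from c • mderiv I 𝓘(ℝ, ℝ) g x) :=
    (hg.mdifferentiableAt (by simp)).hasMFDerivAt.const_smul c
  exact h1.mfderiv

/-- Pulling back in two stages, the differential of G' is itself pulled back by f. -/
lemma IsExactMap.comp {f f' : N → N} {G G' : N → ℝ} (h' : IsExactMap β f' G')
    (h : IsExactMap β f G) : IsExactMap β (fun x => f' (f x)) (fun x => G x + G' (f x)) := by
  refine ⟨h'.1.comp h.1, h.2.1.add (h'.2.1.comp h.1), fun x v => ?_⟩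
  have h1 := mderiv_comp (I := I) (I' := I) (I'' := I) (f := f) (g := f') (x := x)
    (h'.1.mdifferentiableAt (by simp)) (h.1.mdifferentiableAt (by simp)) v
  have h2 := mderiv_comp (I := I) (I' := I) (I'' := 𝓘(ℝ, ℝ)) (f := f) (g := G') (x := x)
    (h'.2.1.mdifferentiableAt (by simp)) (h.1.mdifferentiableAt (by simp)) v
  have h3 := mderiv_add h.2.1 (h'.2.1.comp h.1) x v
  refine (congrArg (fun w : E => β (f' (f x)) w) h1).trans ((h'.2.2 _ _).trans ?_)
  rw [h.2.2]
  refine Eq.trans ?_ (congrArg (fun r => β x v + r) h3.symm)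
  rw [← h2, add_assoc]
  rfl

lemma mderiv_symm_mderiv (f : N ≃ₘ⟮I, I⟯ N) (x : N) (v : E) :
    mderiv I I f (f.symm x) (mderiv I I f.symm x v) = v := by
  have h1 := mderiv_comp (I := I) (I' := I) (I'' := I) (f := f.symm) (g := f) (x := x)
    (f.contMDiff.mdifferentiableAt (by simp)) (f.symm.contMDiff.mdifferentiableAt (by simp)) v
  rw [← h1]
  have h2 : (fun x => f (f.symm x)) = id := funext fun x => f.apply_symm_apply x
  rw [h2]
  exact congrArg (fun L : E →L[ℝ] E => L v) (mfderiv_id (I := I) (x := x))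

lemma IsExactMap.symm {f : N ≃ₘ⟮I, I⟯ N} {G : N → ℝ} (h : IsExactMap β f G) :
    IsExactMap β f.symm (fun x => - G (f.symm x)) := by
  have hG : ContMDiff I 𝓘(ℝ, ℝ) ∞ (fun x => G (f.symm x)) := h.2.1.comp f.symm.contMDiff
  refine ⟨f.symm.contMDiff, hG.neg, fun x v => ?_⟩
  have h1 := h.2.2 (f.symm x) (mderiv I I f.symm x v)
  have h2 := mderiv_comp (I := I) (I' := I) (I'' := 𝓘(ℝ, ℝ)) (f := f.symm) (g := G) (x := x)
    (h.2.1.mdifferentiableAt (by simp)) (f.symm.contMDiff.mdifferentiableAt (by simp)) v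
  rw [← h2] at h1
  have h3 : β (f (f.symm x)) (mderiv I I f (f.symm x) (mderiv I I f.symm x v)) = β x v :=
    (congrArg (fun w : E => β (f (f.symm x)) w) (mderiv_symm_mderiv f x v)).trans
      (congrArg (fun y => β y (show E from v)) (f.apply_symm_apply x))
  have h4 : (fun x => -G (f.symm x)) = fun x => (-1) * G (f.symm x) := by funext x; ring
  rw [h4, mderiv_const_mul hG]
  have h5 := h3.symm.trans h1
  rw [h5]
  change _ = β (f.symm x) (mderiv I I f.symm x v) + mderiv I 𝓘(ℝ, ℝ) (fun x => G (f.symm x)) x v +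
    (-1) * mderiv I 𝓘(ℝ, ℝ) (fun x => G (f.symm x)) x v
  ring

/-- Actions of maps which agree on a connected open set differ there by a constant. -/
lemma IsExactMap.sub_eq {f f' : N → N} {G G' : N → ℝ} (h : IsExactMap β f G)
    (h' : IsExactMap β f' G') {U : Set N} (hU : IsOpen U) (hc : IsPreconnected U)
    (hff' : ∀ x ∈ U, f x = f' x) {x y : N} (hx : x ∈ U) (hy : y ∈ U) :
    G y - G' y = G x - G' x := by
  have hG' : ContMDiff I 𝓘(ℝ, ℝ) ∞ fun x => (-1) * G' x := contMDiff_const.mul h'.2.1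
  have h1 := eq_of_mderiv_eq_zero hU hc (h.2.1.add hG') (fun z hz => ?_) hx hy
  · simp only [Pi.add_apply] at h1
    linarith
  · refine ContinuousLinearMap.ext fun v => ?_
    have h2 : f =ᶠ[nhds z] f' := by
      filter_upwards [hU.mem_nhds hz] with w hw using hff' w hw
    have h3 : mderiv I I f z = mderiv I I f' z := h2.mfderiv_eq
    have h4 := h.2.2 z v
    have h5 := h'.2.2 z v
    have h6 : β (f z) (mderiv I I f z v) = β (f' z) (mderiv I I f' z v) :=
      (congrArg (fun L : E →L[ℝ] E => β (f z) (L v)) h3).trans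
        (congrArg (fun y => β y (show E from mderiv I I f' z v)) (hff' z hz))
    refine (mderiv_add h.2.1 hG' z v).trans ?_
    rw [mderiv_const_mul h'.2.1]
    change mderiv I 𝓘(ℝ, ℝ) G z v + (-1) * mderiv I 𝓘(ℝ, ℝ) G' z v = 0
    linarith [h4.symm.trans (h6.trans h5)]

/-- As f^*β = β + dG, transporting a primitive by f adds the action, transported in the same way. -/
lemma IsPrimitiveOn.image {A : Set N} {g : N → ℝ} (hA : IsPrimitiveOn β A g)
    {f : N ≃ₘ⟮I, I⟯ N} {G : N → ℝ} (h : IsExactMap β f G) :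
    IsPrimitiveOn β (f '' A) (fun x => g (f.symm x) + G (f.symm x)) := by
  intro γ hγ hγA
  have hA' : ∀ t, f.symm (γ t) ∈ A := by
    intro t
    obtain ⟨y, hy, hyt⟩ := hγA t
    rw [← hyt]; simpa using hy
  have h1 := hA (fun t => f.symm (γ t)) (f.symm.contMDiff.comp hγ) hA'
  have hv : HasVelocityAt I γ (mderiv 𝓘(ℝ, ℝ) I γ 0 1) 0 :=
    hasVelocityAt_of_mdifferentiableAt (hγ.mdifferentiableAt (by simp))
  have hv' := hv.map (f := f.symm) (f.symm.contMDiff.mdifferentiableAt (by simp))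
  have h2 := hv'.hasDerivAt_comp (f := G) (h.2.1.mdifferentiableAt (by simp))
  have h3 := h.2.2 (f.symm (γ 0)) (mderiv I I f.symm (γ 0) (mderiv 𝓘(ℝ, ℝ) I γ 0 1))
  have h4 : β (f (f.symm (γ 0))) (mderiv I I f (f.symm (γ 0))
      (mderiv I I f.symm (γ 0) (mderiv 𝓘(ℝ, ℝ) I γ 0 1))) =
      β (γ 0) (mderiv 𝓘(ℝ, ℝ) I γ 0 1) :=
    (congrArg (fun w : E => β (f (f.symm (γ 0))) w) (mderiv_symm_mderiv f (γ 0) _)).trans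
      (congrArg (fun y => β y (show E from mderiv 𝓘(ℝ, ℝ) I γ 0 1)) (f.apply_symm_apply (γ 0)))
  refine (h1.add h2).congr_deriv ?_
  have h5 : mderiv 𝓘(ℝ, ℝ) I (fun t => f.symm (γ t)) 0 1 = _ := hv'.mderiv_eq
  refine Eq.trans ?_ (h3.symm.trans h4)
  exact congrArg (fun w : E => β (f.symm (γ 0)) w + _) h5

end ExactMaps

/-! ### Conjugation by conformal diffeomorphisms -/

section Conformal

variable {E : Type*} [NormedAddCommGroup E] [NormedSpace ℝ E] {H : Type*} [TopologicalSpace H]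
  {I : ModelWithCorners ℝ E H} [I.Boundaryless] {N : Type*} [TopologicalSpace N]
  [ChartedSpace H N] [IsManifold I ∞ N] {β : ∀ x : N, TangentSpace I x →L[ℝ] ℝ}

/-- The diffeomorphism `σ` multiplies the form `β` by the constant `c`. -/
def IsConformal (β : ∀ x : N, TangentSpace I x →L[ℝ] ℝ) (σ : N ≃ₘ⟮I, I⟯ N) (c : ℝ) : Prop :=
  ∀ (x : N) (v : E), β (σ x) (mderiv I I σ x v) = c * β x v

lemma IsConformal.extD (hβ : IsSmoothForm I β) {σ : N ≃ₘ⟮I, I⟯ N} {c : ℝ}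
    (h : IsConformal β σ c) (x : N) (u v : E) :
    extD I β (σ x) (mderiv I I σ x u) (mderiv I I σ x v) = c * extD I β x u v := by
  have h1 := extD_pullForm (p := x) hβ σ.contMDiff u v
  refine h1.symm.trans ?_
  have h2 : pullForm I I σ β = fun x => c • β x :=
    funext fun x => ContinuousLinearMap.ext fun v => h x v
  rw [h2]
  have h3 : localForm I (fun x => c • β x) x = fun y => c • localForm I β x y := by
    funext y
    exact ContinuousLinearMap.ext fun w => rfl
  have hd : DifferentiableAt ℝ (localForm I β x) (extChartAt I x x) :=
    (((isSmoothForm_iff β).1 hβ x).contDiffAt (extChartAt_target_mem_nhds x)).differentiableAt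
      (by simp)
  have h4 : fderiv ℝ (localForm I (fun x => c • β x) x) (extChartAt I x x) =
      c • fderiv ℝ (localForm I β x) (extChartAt I x x) := by
    rw [h3]; exact fderiv_const_smul hd c
  have h5 : ∀ a b : E, fderiv ℝ (localForm I (fun x => c • β x) x) (extChartAt I x x) a b =
      c * fderiv ℝ (localForm I β x) (extChartAt I x x) a b := by
    intro a b
    rw [h4]; rfl
  have h6 := h5 u v
  have h7 := h5 v u
  unfold _root_.extD
  exact (congrArg₂ (fun a b : ℝ => a - b) h6 h7).trans (mul_sub c _ _).symm

/-- The conjugate of an isotopy by a conformal diffeomorphism. -/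
def HamIsotopy.conj (hβ : IsSmoothForm I β) (φ : HamIsotopy β) (σ : N ≃ₘ⟮I, I⟯ N) {c : ℝ}
    (h : IsConformal β σ c) : HamIsotopy β where
  map t := (σ.symm.trans (φ.map t)).trans σ
  ham t x := c * φ.ham t (σ.symm x)
  smooth := σ.contMDiff.comp (φ.smooth.comp
    (contMDiff_fst.prodMk (σ.symm.contMDiff.comp contMDiff_snd)))
  map_zero x := by
    change σ (φ.map 0 (σ.symm x)) = x
    rw [φ.map_zero, σ.apply_symm_apply]
  ham_smooth := contMDiff_const.mul (φ.ham_smooth.comp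
    (contMDiff_fst.prodMk (σ.symm.contMDiff.comp contMDiff_snd)))
  velocity t x := by
    obtain ⟨v, hv, hk⟩ := φ.velocity t (σ.symm x)
    refine ⟨_, hv.map (σ.contMDiff.mdifferentiableAt (by simp)), fun w => ?_⟩
    set y := φ.map t (σ.symm x) with hy
    change _root_.extD I β (σ y) (mderiv I I σ y v) w = _
    set w' := mderiv I I σ.symm (σ y) w with hw'
    have h1 : mderiv I I σ y w' = w := by
      have := mderiv_symm_mderiv σ (σ y) w
      rwa [σ.symm_apply_apply] at this
    have h2 := h.extD hβ y v w'
    rw [h1] at h2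
    refine h2.trans ?_
    have h3 : mderiv I 𝓘(ℝ, ℝ) (fun x => c * φ.ham t (σ.symm x)) (σ y) w =
        c * mderiv I 𝓘(ℝ, ℝ) (φ.ham t) y w' := by
      rw [mderiv_const_mul (g := fun x => φ.ham t (σ.symm x))
        ((φ.contMDiff_ham t).comp σ.symm.contMDiff)]
      have h4 := mderiv_comp (I := I) (I' := I) (I'' := 𝓘(ℝ, ℝ)) (f := σ.symm) (g := φ.ham t)
        (x := σ y) ((φ.contMDiff_ham t).mdifferentiableAt (by simp))
        (σ.symm.contMDiff.mdifferentiableAt (by simp)) w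
      rw [σ.symm_apply_apply] at h4
      exact congrArg (fun r => c * r) h4
    have h5 := hk w'
    refine (congrArg (fun r => c * r) h5).trans ?_
    refine Eq.trans ?_ (congrArg (fun r => -r) h3).symm
    ring

lemma HamIsotopy.conj_map (hβ : IsSmoothForm I β) (φ : HamIsotopy β) (σ : N ≃ₘ⟮I, I⟯ N) {c : ℝ}
    (h : IsConformal β σ c) (t : ℝ) (x : N) :
    (φ.conj hβ σ h).map t x = σ (φ.map t (σ.symm x)) := rfl

/-- The factor c is the point: conjugation by the Liouville flow rescales actions, which
`exists_action_eq_zero` exploits to cancel them. -/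
lemma IsExactMap.conj {f : N ≃ₘ⟮I, I⟯ N} {G : N → ℝ} (hf : IsExactMap β f G)
    {σ : N ≃ₘ⟮I, I⟯ N} {c : ℝ} (h : IsConformal β σ c) :
    IsExactMap β (fun x => σ (f (σ.symm x))) (fun x => c * G (σ.symm x)) := by
  refine ⟨σ.contMDiff.comp (f.contMDiff.comp σ.symm.contMDiff),
    contMDiff_const.mul (hf.2.1.comp σ.symm.contMDiff), fun x v => ?_⟩
  have h1 := mderiv_comp (I := I) (I' := I) (I'' := I) (f := fun x => f (σ.symm x)) (g := σ)
    (x := x) (σ.contMDiff.mdifferentiableAt (by simp))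
    ((f.contMDiff.comp σ.symm.contMDiff).mdifferentiableAt (by simp)) v
  have h2 := mderiv_comp (I := I) (I' := I) (I'' := I) (f := σ.symm) (g := f)
    (x := x) (f.contMDiff.mdifferentiableAt (by simp))
    (σ.symm.contMDiff.mdifferentiableAt (by simp)) v
  have h3 := mderiv_comp (I := I) (I' := I) (I'' := 𝓘(ℝ, ℝ)) (f := σ.symm) (g := G)
    (x := x) (hf.2.1.mdifferentiableAt (by simp))
    (σ.symm.contMDiff.mdifferentiableAt (by simp)) v
  have h4 := h (σ.symm x) (mderiv I I σ.symm x v)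
  have h5 : β (σ (σ.symm x)) (mderiv I I σ (σ.symm x) (mderiv I I σ.symm x v)) = β x v :=
    (congrArg (fun w : E => β (σ (σ.symm x)) w) (mderiv_symm_mderiv σ x v)).trans
      (congrArg (fun y => β y (show E from v)) (σ.apply_symm_apply x))
  refine (congrArg (fun w : E => β (σ (f (σ.symm x))) w) h1).trans ((h _ _).trans ?_)
  refine (congrArg (fun w : E => c * β (f (σ.symm x)) w) h2).trans ?_
  have h6 : mderiv I 𝓘(ℝ, ℝ) (fun x => c * G (σ.symm x)) x v =
      c * mderiv I 𝓘(ℝ, ℝ) (fun x => G (σ.symm x)) x v :=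
    congrArg (fun l : E →L[ℝ] ℝ => l v)
      (mderiv_const_mul (g := fun x => G (σ.symm x)) (hf.2.1.comp σ.symm.contMDiff) c x)
  refine (congrArg (fun r : ℝ => c * r) (hf.2.2 (σ.symm x) _)).trans ((mul_add c _ _).trans ?_)
  refine congrArg₂ (fun a b : ℝ => a + b) (h4.symm.trans h5) ?_
  exact (congrArg (fun r => c * r) h3.symm).trans h6.symm

end Conformal

end

noncomputable section

/-! ### Invariant submanifolds and Lagrangian linear algebra -/

section Invariance

variable {E : Type*} [NormedAddCommGroup E] [NormedSpace ℝ E] {H : Type*} [TopologicalSpace H]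
  {I : ModelWithCorners ℝ E H} [I.Boundaryless] {N : Type*} [TopologicalSpace N]
  [ChartedSpace H N] [IsManifold I ∞ N] {β : ∀ x : N, TangentSpace I x →L[ℝ] ℝ}
  [FiniteDimensional ℝ E]

/-- The inverses of an isotopy depend smoothly on time as well. -/
lemma HamIsotopy.contMDiff_symm [T2Space N] (hβ : IsSmoothForm I β) (hn : IsNondegenerate β)
    (φ : HamIsotopy β) :
    ContMDiff (𝓘(ℝ, ℝ).prod I) I ∞ (fun q : ℝ × N => (φ.map q.1).symm q.2) := by
  have hX := isHamiltonianField_hamField hβ hn φ.ham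
  have hs := isSmoothField_suspend (contDiffOn_localField hβ hn φ.ham_smooth hX)
  -- The trajectory through x at time t is s ↦ φ_(t+s)(φ_t⁻¹ x). This is a flow on ℝ × N, hence
  -- smooth, and s = -t gives the inverse of φ_t.
  have h1 := contMDiff_flow hs
    (Φ := fun s q => (q.1 + s, φ.map (q.1 + s) ((φ.map q.1).symm q.2))) (fun q => by simp) ?_
  · have h2 : ContMDiff (𝓘(ℝ, ℝ).prod I) (𝓘(ℝ, ℝ).prod (𝓘(ℝ, ℝ).prod I)) ∞
        (fun q : ℝ × N => (-q.1, q)) :=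
      (contDiff_neg.contMDiff.comp contMDiff_fst).prodMk contMDiff_id
    have h3 := contMDiff_snd.comp (h1.comp h2)
    refine h3.congr fun q => ?_
    simp [φ.map_zero]
  · rintro ⟨t, x⟩ s
    refine hasMFDerivAt_suspend ?_
    obtain ⟨v, hv, hk⟩ := φ.velocity (t + s) ((φ.map t).symm x)
    have h1 : v = hamField β φ.ham (t + s) _ := IsHamVec.unique hn hk (hX _ _)
    have h2 : HasDerivAt (fun r : ℝ => t + r) 1 s := (hasDerivAt_id s).const_add t
    have h3 := hv.comp_real h2
    rw [one_smul] at h3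
    exact h3.congr_velocity h1

lemma contMDiffAt_mderiv_apply {F : Type*} [NormedAddCommGroup F] [NormedSpace ℝ F]
    {Y : ∀ x : N, TangentSpace I x} (hY : IsSmoothField Y) {f : N → F} {U : Set N} (hU : IsOpen U)
    (hf : ContMDiffOn I 𝓘(ℝ, F) ∞ f U) {p : N} (hp : p ∈ U) :
    ContMDiffAt I 𝓘(ℝ, F) ∞ (fun q => mderiv I 𝓘(ℝ, F) f q (Y q)) p := by
  set g : E → F := fun y => f ((extChartAt I p).symm y) with hg
  have hT : IsOpen (extChartAt I p).target := isOpen_extChartAt_target p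
  set W : Set E := (extChartAt I p).target ∩ (extChartAt I p).symm ⁻¹' U with hW
  have hWo : IsOpen W := (continuousOn_extChartAt_symm p).isOpen_inter_preimage hT hU
  have hgs : ContDiffOn ℝ ∞ g W := by
    rw [← contMDiffOn_iff_contDiffOn]
    exact hf.comp ((contMDiffOn_extChartAt_symm p).mono inter_subset_left) inter_subset_right
  have hpW : extChartAt I p p ∈ W :=
    ⟨mem_extChartAt_target p, by simpa using hp⟩
  have hk : ContDiffOn ℝ ∞ (fun y => fderiv ℝ g y (localField Y p y)) W :=
    ((hgs.fderiv_of_isOpen hWo (by norm_cast)).clm_apply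
      (((isSmoothField_iff Y).1 hY p).mono inter_subset_left))
  have hk' : ContMDiffAt I 𝓘(ℝ, F) ∞
      (fun q => fderiv ℝ g (extChartAt I p q) (localField Y p (extChartAt I p q))) p :=
    ((hk.contDiffAt (hWo.mem_nhds hpW)).contMDiffAt).comp p (contMDiffAt_extChartAt)
  refine hk'.congr_of_eventuallyEq ?_
  have hS : (extChartAt I p).source ∩ U ∈ nhds p :=
    Filter.inter_mem (extChartAt_source_mem_nhds p) (hU.mem_nhds hp)
  filter_upwards [hS] with q hq
  have hqW : extChartAt I p q ∈ W :=
    ⟨(extChartAt I p).map_source hq.1, by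
      rw [mem_preimage, (extChartAt I p).left_inv hq.1]; exact hq.2⟩
  have h1 : f =ᶠ[nhds q] fun x => g (extChartAt I p x) := by
    filter_upwards [(isOpen_extChartAt_source p).mem_nhds hq.1] with x hx
    rw [hg]
    simp only [(extChartAt I p).left_inv hx]
  have h2 := mderiv_comp (I := I) (I' := 𝓘(ℝ, E)) (I'' := 𝓘(ℝ, F)) (f := extChartAt I p) (g := g)
    (x := q) ((hgs.contDiffAt (hWo.mem_nhds hqW)).contMDiffAt.mdifferentiableAt (by simp))
    (mdifferentiableAt_extChartAt' hq.1) (Y q)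
  have h3 : mderiv I 𝓘(ℝ, F) f q = mderiv I 𝓘(ℝ, F) (fun x => g (extChartAt I p x)) q :=
    h1.mfderiv_eq
  have h4 : mderiv 𝓘(ℝ, E) 𝓘(ℝ, F) g (extChartAt I p q) = fderiv ℝ g (extChartAt I p q) :=
    mfderiv_eq_fderiv
  have h5 : localField Y p (extChartAt I p q) = mderiv I 𝓘(ℝ, E) (extChartAt I p) q (Y q) := by
    have : ∀ x, x = q → mderiv I 𝓘(ℝ, E) (extChartAt I p) x (Y x) =
      mderiv I 𝓘(ℝ, E) (extChartAt I p) q (Y q) := fun x h => by rw [h]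
    exact this _ ((extChartAt I p).left_inv hq.1)
  rw [h5, ← h4]
  exact (congrArg (fun l : E →L[ℝ] F => l (Y q)) h3).trans h2

/-- A curve whose velocity is proportional to a field tangent to a closed submanifold does not
leave the submanifold. -/
lemma IsSubmanifold.mem_of_velocity {k : ℕ} {A : Set N} (hA : IsSubmanifold I k A)
    (hAc : IsClosed A) {Y : ∀ x : N, TangentSpace I x} (hY : IsSmoothField Y)
    (hYA : ∀ x ∈ A, (⟨x, Y x⟩ : TangentBundle I N) ∈ tangentVectors I A)
    {q : ℝ → N} {c : ℝ → ℝ} (hc : Continuous c)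
    (hq : ∀ t, HasVelocityAt I q (c t • (show E from Y (q t))) t)
    (h0 : q 0 ∈ A) {T : ℝ} (hT : 0 ≤ T) : q T ∈ A := by
  have hqc : Continuous q := continuous_iff_continuousAt.2 fun t =>
    HasMFDerivAt.continuousAt (hq t)
  have hsub : Icc 0 T ⊆ q ⁻¹' A := by
    -- The times at which the curve is in A form a closed set, so it suffices to continue slightly
    -- beyond each of them.
    refine IsClosed.Icc_subset_of_forall_mem_nhdsWithin
      ((hAc.preimage hqc).inter isClosed_Icc) h0 ?_
    rintro t₀ ⟨ht₀, -⟩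
    obtain ⟨e, he, hpe, V, -, hV⟩ := hA _ ht₀
    obtain ⟨V', hV'⟩ := V.exists_isCompl
    -- P has kernel V, so inside the chart A is the zero set of P ∘ κ.
    set P : E →L[ℝ] E := LinearMap.toContinuousLinearMap (V'.projection V hV'.symm) with hPdef
    have hP : ∀ x, P x = 0 ↔ x ∈ V := fun x => Submodule.projection_apply_eq_zero_iff hV'.symm
    have hP' : ∀ x, x - P x ∈ V := fun x => Submodule.sub_projection_mem hV'.symm x
    set κ : N → E := fun x => e.extend I x with hκ
    have hκs : ContMDiffOn I 𝓘(ℝ, E) ∞ κ e.source := fun x hx =>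
      (e.contMDiffAt_extend he hx).contMDiffWithinAt
    have hus : ContMDiffOn I 𝓘(ℝ, E) ∞ (fun x => P (κ x)) e.source :=
      P.contDiff.contMDiff.comp_contMDiffOn hκs
    set w : N → E := fun x => mderiv I 𝓘(ℝ, E) (fun x => P (κ x)) x (Y x) with hw
    have hws : ContMDiffAt I 𝓘(ℝ, E) ∞ w (q t₀) :=
      contMDiffAt_mderiv_apply hY e.open_source hus hpe
    have hwA : ∀ x ∈ e.source, x ∈ A → w x = 0 := by
      intro x hx hxA
      have h1 := mderiv_comp (I := I) (I' := 𝓘(ℝ, E)) (I'' := 𝓘(ℝ, E)) (f := κ) (g := P) (x := x)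
        (P.contDiff.contMDiff (n := ∞) |>.mdifferentiableAt (by simp))
        ((hκs.contMDiffAt (e.open_source.mem_nhds hx)).mdifferentiableAt (by simp)) (Y x)
      have h2 : mderiv 𝓘(ℝ, E) 𝓘(ℝ, E) P (κ x) = P :=
        (mfderiv_eq_fderiv).trans P.fderiv
      rw [h2] at h1
      exact h1.trans ((hP _).2 ((mem_tangentVectors_iff he hV hx hxA (Y x)).1 (hYA x hxA)))
    have hto : IsOpen (e.extend I).target := e.isOpen_extend_target
    have hpt : κ (q t₀) ∈ (e.extend I).target :=
      (e.extend I).map_source (by rwa [e.extend_source])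
    have hinv : ∀ x ∈ e.source, (e.extend I).symm (κ x) = x := fun x hx =>
      (e.extend I).left_inv (by rwa [e.extend_source])
    -- The derivative w of P ∘ κ along Y vanishes on A and is Lipschitz in the chart. Comparing a
    -- point with its projection to V gives ‖w‖ ≤ K ‖P ∘ κ‖, and Grönwall's inequality then keeps P
    -- ∘ κ equal to zero along the curve.
    have hWs : ContDiffAt ℝ 1 (fun y => w ((e.extend I).symm y)) (κ (q t₀)) := by
      rw [← contMDiffAt_iff_contDiffAt]
      have h1 : ContMDiffAt 𝓘(ℝ, E) I ∞ (e.extend I).symm (κ (q t₀)) :=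
        (contMDiffOn_extend_symm he).contMDiffAt (by
          rw [← e.extend_target']; exact hto.mem_nhds hpt)
      have h2 : ContMDiffAt I 𝓘(ℝ, E) ∞ w ((e.extend I).symm (κ (q t₀))) := by
        rw [hinv _ hpe]; exact hws
      exact (h2.comp _ h1).of_le (by norm_cast)
    obtain ⟨K, s, hs, hLip⟩ := hWs.exists_lipschitzOnWith
    have hmap : Filter.Tendsto (fun x => κ x - P (κ x)) (nhds (q t₀)) (nhds (κ (q t₀))) := by
      have h1 : ContinuousAt κ (q t₀) := hκs.continuousOn.continuousAt (e.open_source.mem_nhds hpe)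
      have h2 : ContinuousAt (fun x => κ x - P (κ x)) (q t₀) :=
        h1.sub (P.continuous.continuousAt.comp h1)
      have h3 : P (κ (q t₀)) = 0 := (hP _).2 ((hV _ hpe).1 ht₀)
      simpa [ContinuousAt, h3] using h2
    have hκc : Filter.Tendsto κ (nhds (q t₀)) (nhds (κ (q t₀))) :=
      hκs.continuousOn.continuousAt (e.open_source.mem_nhds hpe)
    have hbd : ∀ᶠ x in nhds (q t₀), x ∈ e.source ∧ ‖w x‖ ≤ K * ‖P (κ x)‖ := by
      filter_upwards [e.open_source.mem_nhds hpe, hmap hs, hmap (hto.mem_nhds hpt), hκc hs]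
        with x hx h1 h2 h3
      refine ⟨hx, ?_⟩
      set y := κ x - P (κ x) with hy
      have h4 : (e.extend I).symm y ∈ e.source := by
        rw [← e.extend_source (I := I)]; exact (e.extend I).map_target h2
      have h5 : κ ((e.extend I).symm y) = y := (e.extend I).right_inv h2
      have h6 : w ((e.extend I).symm y) = 0 := by
        refine hwA _ h4 ((hV _ h4).2 ?_)
        change κ ((e.extend I).symm y) ∈ V
        rw [h5]; exact hP' _
      have h7 := hLip.norm_sub_le h3 h1
      have h8 : κ x - y = P (κ x) := sub_sub_cancel _ _
      rw [h6, hinv _ hx, sub_zero] at h7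
      exact h7.trans_eq (congrArg (fun v => (K : ℝ) * ‖v‖) h8)
    have hcb : ∀ᶠ t in nhds t₀, |c t| ≤ |c t₀| + 1 := by
      have h1 : ∀ᶠ t in nhds t₀, |c t| < |c t₀| + 1 :=
        (hc.abs.continuousAt (x := t₀)).eventually (gt_mem_nhds (by linarith))
      exact h1.mono fun t h => h.le
    obtain ⟨δ, hδ, hδs⟩ := Metric.eventually_nhds_iff.1
      ((hqc.continuousAt (x := t₀)).eventually hbd |>.and hcb)
    have hball : ∀ t ∈ Icc t₀ (t₀ + δ / 2), dist t t₀ < δ := by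
      intro t ht
      rw [Real.dist_eq, abs_of_nonneg (by linarith [ht.1])]
      linarith [ht.2]
    have hder : ∀ t ∈ Icc t₀ (t₀ + δ / 2),
        HasDerivAt (fun s => P (κ (q s))) (c t • w (q t)) t := by
      intro t ht
      have h1 := (hδs (hball t ht)).1.1
      have h2 := (hq t).hasDerivAt_comp (f := fun x => P (κ x))
        ((hus.contMDiffAt (e.open_source.mem_nhds h1)).mdifferentiableAt (by simp))
      rw [map_smul] at h2
      exact h2
    have hz := eq_zero_of_abs_deriv_le_mul_abs_self_of_eq_zero_right
      (f := fun s => P (κ (q s))) (f' := fun t => c t • w (q t)) (K := (|c t₀| + 1) * K)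
      (a := t₀) (b := t₀ + δ / 2)
      (fun t ht => (hder t ht).continuousAt.continuousWithinAt)
      (fun t ht => (hder t ⟨ht.1, ht.2.le⟩).hasDerivWithinAt) ((hP _).2 ((hV _ hpe).1 ht₀))
      (fun t ht => by
        have h1 := hδs (hball t ⟨ht.1, ht.2.le⟩)
        rw [norm_smul, mul_assoc, Real.norm_eq_abs]
        exact mul_le_mul h1.2 h1.1.2 (norm_nonneg _) (by positivity))
    have hmem : Ioo t₀ (t₀ + δ / 2) ∈ nhdsWithin t₀ (Ioi t₀) :=
      Ioo_mem_nhdsGT (by linarith)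
    filter_upwards [hmem] with t ht
    have h1 := (hδs (hball t ⟨ht.1.le, ht.2.le⟩)).1.1
    exact (hV _ h1).2 ((hP _).1 (hz t ⟨ht.1.le, ht.2.le⟩))
  exact hsub ⟨hT, le_rfl⟩

/-- A vector orthogonal to the tangent space of a Lagrangian submanifold is tangent to it. -/
lemma IsSubmanifold.mem_tangentVectors_of_orthogonal {k : ℕ} {A : Set N}
    (hA : IsSubmanifold I k A) (hE : Module.finrank ℝ E = 2 * k) (hn : IsNondegenerate β) {p : N}
    (hp : p ∈ A) (hiso : ∀ u v : TangentSpace I p,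
      (⟨p, u⟩ : TangentBundle I N) ∈ tangentVectors I A →
      (⟨p, v⟩ : TangentBundle I N) ∈ tangentVectors I A → extD I β p u v = 0)
    {y : E} (hy : ∀ v : TangentSpace I p, (⟨p, v⟩ : TangentBundle I N) ∈ tangentVectors I A →
      extD I β p y v = 0) : (⟨p, y⟩ : TangentBundle I N) ∈ tangentVectors I A := by
  obtain ⟨e, he, hpe, V, hVk, hV⟩ := hA p hp
  set D : E →L[ℝ] E := mderiv I 𝓘(ℝ, E) (e.extend I) p with hD
  obtain ⟨j, -, -, -, hj⟩ := exists_plot he hpe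
  set D' : E →L[ℝ] E := mderiv 𝓘(ℝ, E) I j 0 with hD'
  have hinj : Function.Injective D := Function.LeftInverse.injective (g := D') hj
  set T : Submodule ℝ E := V.comap D.toLinearMap with hT
  have hTmem : ∀ v : E, v ∈ T ↔ (⟨p, v⟩ : TangentBundle I N) ∈ tangentVectors I A := fun v =>
    (mem_tangentVectors_iff he hV hpe hp v).symm
  have hTk : Module.finrank ℝ T = k := by
    have h1 : T.map (LinearEquiv.ofInjectiveEndo D.toLinearMap hinj).toLinearMap = V := by
      apply le_antisymm
      · rintro _ ⟨v, hv, rfl⟩; exact hv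
      · intro v hv
        obtain ⟨u, hu⟩ := (LinearEquiv.ofInjectiveEndo D.toLinearMap hinj).surjective v
        exact ⟨u, by change D u ∈ V; rw [show D u = v from hu]; exact hv, hu⟩
    rw [← hVk, ← h1]
    exact (LinearEquiv.finrank_map_eq _ T).symm
  set B : LinearMap.BilinForm ℝ E := LinearMap.mk₂ ℝ
    (fun u v => flatDL (localForm I β p) (extChartAt I p p) u v) (by simp) (by simp) (by simp)
    (by simp) with hB
  have hBe : ∀ u v : E, B u v = extD I β p u v := fun u v => (extD_eq_flatDL β p u v).symm
  have hBr : B.IsRefl := fun u v h => by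
    rw [hBe] at h ⊢
    exact (extD_swap β p v u).trans (by rw [h, neg_zero])
  have hle : T ≤ B.orthogonal T := fun u hu v hv => by
    change B v u = 0
    rw [hBe]
    exact hiso v u ((hTmem v).1 hv) ((hTmem u).1 hu)
  have hker : T ⊓ B.orthogonal ⊤ = ⊥ := by
    rw [eq_bot_iff]
    rintro u ⟨-, hu⟩
    refine (Submodule.mem_bot ℝ).2 (hn p u fun v => ?_)
    exact (hBe u v).symm.trans (hBr _ _ (hu v trivial))
  -- The dimensions of T and of its orthogonal add up to 2k, so the isotropic space T, of dimension
  -- k, is its own orthogonal.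
  have hfin := LinearMap.BilinForm.finrank_add_finrank_orthogonal hBr T
  rw [hker, finrank_bot, hTk, hE] at hfin
  have hTeq : T = B.orthogonal T := Submodule.eq_of_le_of_finrank_eq hle (by omega)
  refine (hTmem y).1 ?_
  rw [hTeq]
  intro v hv
  change B v y = 0
  refine hBr _ _ ?_
  rw [hBe]
  exact hy v ((hTmem v).1 hv)

end Invariance

end

noncomputable section

/-! ### Liouville flows and the sliding of exact Lagrangians -/

section Liouville

variable {E : Type*} [NormedAddCommGroup E] [NormedSpace ℝ E] {H : Type*} [TopologicalSpace H]
  {I : ModelWithCorners ℝ E H} [I.Boundaryless] {N : Type*} [TopologicalSpace N]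
  [ChartedSpace H N] [IsManifold I ∞ N] {β : ∀ x : N, TangentSpace I x →L[ℝ] ℝ}
  [FiniteDimensional ℝ E]

/-- In a chart the field is the partial derivative in time, at time zero, of a jointly smooth map.
-/
lemma isSmoothField_of_velocity {Φ : ℝ → N → N}
    (hΦ : ContMDiff (𝓘(ℝ, ℝ).prod I) I ∞ (fun q : ℝ × N => Φ q.1 q.2)) (h0 : ∀ x, Φ 0 x = x)
    {V : ∀ x : N, TangentSpace I x} (hV : ∀ x, HasVelocityAt I (fun s => Φ s x) (V x) 0) :
    IsSmoothField V := by
  rw [isSmoothField_iff]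
  intro p
  set W : Set (ℝ × E) := (univ ×ˢ (extChartAt I p).target) ∩
    (fun z : ℝ × E => Φ z.1 ((extChartAt I p).symm z.2)) ⁻¹' (extChartAt I p).source with hW
  have hTo : IsOpen (extChartAt I p).target := isOpen_extChartAt_target p
  have hF : ContMDiffOn 𝓘(ℝ, ℝ × E) I ∞ (fun z : ℝ × E => Φ z.1 ((extChartAt I p).symm z.2))
      (univ ×ˢ (extChartAt I p).target) := by
    have h1 : ContMDiffOn 𝓘(ℝ, ℝ × E) 𝓘(ℝ, ℝ) ∞ (fun z : ℝ × E => z.1)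
      (univ ×ˢ (extChartAt I p).target) := contDiff_fst.contMDiff.contMDiffOn
    have h2 : ContMDiffOn 𝓘(ℝ, ℝ × E) I ∞ (fun z : ℝ × E => (extChartAt I p).symm z.2)
      (univ ×ˢ (extChartAt I p).target) :=
      (contMDiffOn_extChartAt_symm p).comp contDiff_snd.contMDiff.contMDiffOn fun z hz => hz.2
    exact hΦ.comp_contMDiffOn (h1.prodMk h2)
  have hWo : IsOpen W := hF.continuousOn.isOpen_inter_preimage (isOpen_univ.prod hTo)
    (isOpen_extChartAt_source p)
  have hG : ContDiffOn ℝ ∞ (fun z : ℝ × E =>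
      extChartAt I p (Φ z.1 ((extChartAt I p).symm z.2))) W := by
    rw [← contMDiffOn_iff_contDiffOn]
    have h1 : ContMDiffOn I 𝓘(ℝ, E) ∞ (extChartAt I p) (extChartAt I p).source := by
      rw [extChartAt_source]; exact contMDiffOn_extChartAt
    exact h1.comp (hF.mono inter_subset_left) inter_subset_right
  have h0W : ∀ y ∈ (extChartAt I p).target, ((0 : ℝ), y) ∈ W := fun y hy =>
    ⟨⟨trivial, hy⟩, by
      change Φ 0 ((extChartAt I p).symm y) ∈ (extChartAt I p).source
      rw [h0]; exact (extChartAt I p).map_target hy⟩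
  have hk : ContDiffOn ℝ ∞ (fun y : E => fderiv ℝ
      (fun z : ℝ × E => extChartAt I p (Φ z.1 ((extChartAt I p).symm z.2))) ((0 : ℝ), y)
        ((1 : ℝ), (0 : E))) (extChartAt I p).target :=
    ((hG.fderiv_of_isOpen hWo (by norm_cast)).comp
      (contDiff_const.prodMk contDiff_id).contDiffOn h0W).clm_apply contDiffOn_const
  refine hk.congr fun y hy => ?_
  have h1 := (hV ((extChartAt I p).symm y)).hasDerivAt_comp (f := extChartAt I p) (by
    rw [h0]; exact mdifferentiableAt_extChartAt' ((extChartAt I p).map_target hy))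
  have h2 := (((hG.contDiffAt (hWo.mem_nhds (h0W y hy))).differentiableAt (by simp)).hasFDerivAt
    (x := ((0 : ℝ), y))).comp_hasDerivAt (0 : ℝ) ((hasDerivAt_id (0 : ℝ)).prodMk
      (hasDerivAt_const (0 : ℝ) y))
  refine Eq.trans ?_ (h1.unique h2)
  change mderiv I 𝓘(ℝ, E) (extChartAt I p) _ _ = _
  rw [h0]

variable (β) in
/-- An exact symplectic manifold whose Liouville field has a flow along which a proper function
with connected fibres increases at unit speed. -/
structure LiouvilleCyl where
  smooth_form : IsSmoothForm I β
  nondegenerate : IsNondegenerate β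
  push : ℝ → N → N
  smooth : ContMDiff (𝓘(ℝ, ℝ).prod I) I ∞ (fun q : ℝ × N => push q.1 q.2)
  push_zero : ∀ x, push 0 x = x
  push_add : ∀ s t x, push (s + t) x = push s (push t x)
  push_form : ∀ t x (v : E), β (push t x) (mderiv I I (push t) x v) = Real.exp t * β x v
  vec : ∀ x : N, TangentSpace I x
  vec_velocity : ∀ x, HasVelocityAt I (fun t => push t x) (vec x) 0
  extD_vec : ∀ x (w : E), extD I β x (vec x) w = β x w
  height : N → ℝ
  height_smooth : ContMDiff I 𝓘(ℝ, ℝ) ∞ height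
  height_push : ∀ t x, height (push t x) = height x + t
  isCompact_preimage : ∀ a b : ℝ, IsCompact (height ⁻¹' Icc a b)
  isPreconnected_preimage : ∀ s : Set ℝ, IsPreconnected s → IsPreconnected (height ⁻¹' s)
  nonempty : Nonempty N

namespace LiouvilleCyl

variable (S : LiouvilleCyl β)

lemma push_neg_push (t : ℝ) (x : N) : S.push (-t) (S.push t x) = x := by
  rw [← S.push_add, neg_add_cancel, S.push_zero]

lemma push_push_neg (t : ℝ) (x : N) : S.push t (S.push (-t) x) = x := by
  rw [← S.push_add, add_neg_cancel, S.push_zero]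

/-- The Liouville flow as a family of diffeomorphisms. -/
def pushDiffeo (t : ℝ) : N ≃ₘ⟮I, I⟯ N where
  toFun := S.push t
  invFun := S.push (-t)
  left_inv := S.push_neg_push t
  right_inv := S.push_push_neg t
  contMDiff_toFun := contMDiff_uncurry_right S.smooth t
  contMDiff_invFun := contMDiff_uncurry_right S.smooth (-t)

lemma isConformal_pushDiffeo (t : ℝ) : IsConformal β (S.pushDiffeo t) (Real.exp t) :=
  S.push_form t

lemma velocity_push (t : ℝ) (x : N) :
    HasVelocityAt I (fun s => S.push s x) (S.vec (S.push t x)) t := by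
  have h1 : HasDerivAt (fun s : ℝ => s - t) 1 t := (hasDerivAt_id t).sub_const t
  have h2 := S.vec_velocity (S.push t x)
  rw [← sub_self t] at h2
  have h3 := HasVelocityAt.comp_real (θ := fun s : ℝ => s - t) h2 h1
  have h3 := h3.congr_velocity (one_smul ℝ (show E from S.vec (S.push t x)))
  have h4 : (fun s => S.push (s - t) (S.push t x)) = fun s => S.push s x := by
    funext s
    rw [← S.push_add, sub_add_cancel]
  exact h4 ▸ h3

lemma isSmoothField_vec : IsSmoothField S.vec :=
  isSmoothField_of_velocity S.smooth S.push_zero S.vec_velocity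

lemma mem_push_image {t : ℝ} {A : Set N} {x : N} : x ∈ S.push t '' A ↔ S.push (-t) x ∈ A := by
  constructor
  · rintro ⟨y, hy, rfl⟩
    rwa [S.push_neg_push]
  · exact fun h => ⟨_, h, S.push_push_neg t x⟩

lemma form_vec (x : N) : β x (S.vec x) = 0 := by
  have h1 := S.extD_vec x (S.vec x)
  have h2 := extD_swap β x (S.vec x) (S.vec x)
  have h3 : extD I β x (S.vec x) (S.vec x) = 0 := by linarith
  exact h1.symm.trans h3

/-- A closed Lagrangian submanifold with a primitive of the Liouville form whose differential is
supported in a compact set is moved by an isotopy in the same way as by the Liouville flow. -/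
lemma exists_slide [T2Space N] {k : ℕ} (hE : Module.finrank ℝ E = 2 * k) {C : Set N}
    (hC : IsSubmanifold I k C) (hCc : IsClosed C) {g : N → ℝ} (hg : ContMDiff I 𝓘(ℝ, ℝ) ∞ g)
    (hp : IsPrimitiveOn β C g) {S₀ : Set N} (hS₀ : IsCompact S₀)
    (hgS : ∀ x ∉ S₀, mderiv I 𝓘(ℝ, ℝ) g x = 0) {T : ℝ} (hT : 0 ≤ T) :
    ∃ φ : HamIsotopy β, (∀ x, (∀ τ ∈ Icc 0 T, S.push (-τ) x ∉ S₀) → ∀ t, φ.map t x = x) ∧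
      φ.map 1 '' C = S.push T '' C := by
  have hβ := S.smooth_form
  have hn := S.nondegenerate
  -- At time t the isotopy is to carry C to its translate by τ t. As τ is constant outside [0, 1],
  -- the Hamiltonian vanishes there.
  set τ : ℝ → ℝ := fun t => T * Real.smoothTransition t with hτ
  have hτs : ContDiff ℝ ∞ τ := contDiff_const.mul Real.smoothTransition.contDiff
  have hτI : ∀ t, τ t ∈ Icc 0 T := fun t =>
    ⟨mul_nonneg hT (Real.smoothTransition.nonneg t),
      mul_le_of_le_one_right hT (Real.smoothTransition.le_one t)⟩
  have hτd : ∀ t ∉ Icc (0 : ℝ) 1, deriv τ t = 0 := by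
    intro t ht
    rcases lt_or_ge t 0 with h | h
    · have h1 : τ =ᶠ[nhds t] fun _ => 0 := by
        filter_upwards [gt_mem_nhds h] with s hs
        simp [hτ, Real.smoothTransition.zero_of_nonpos hs.le]
      rw [h1.deriv_eq, deriv_const]
    · have h0 : 1 < t := by
        by_contra h2
        exact ht ⟨h, not_lt.1 h2⟩
      have h1 : τ =ᶠ[nhds t] fun _ => T := by
        filter_upwards [lt_mem_nhds h0] with s hs
        simp [hτ, Real.smoothTransition.one_of_one_le hs.le]
      rw [h1.deriv_eq, deriv_const]
  have hτ' : ContDiff ℝ ∞ (deriv τ) := hτs.deriv'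
  set c : ℝ → ℝ := fun t => -(deriv τ t * Real.exp (τ t)) with hc
  have hcs : ContDiff ℝ ∞ c := (hτ'.mul (Real.contDiff_exp.comp hτs)).neg
  -- The primitive transported to the translate of C, where the form has been multiplied by e^τ,
  -- times the speed of τ; the sign comes from the convention ω(X, ·) = -dK.
  set K : ℝ → N → ℝ := fun t x => c t * g (S.push (-τ t) x) with hK
  have hKs : ContMDiff (𝓘(ℝ, ℝ).prod I) 𝓘(ℝ, ℝ) ∞ (fun q : ℝ × N => K q.1 q.2) :=
    (hcs.contMDiff.comp contMDiff_fst).mul (hg.comp (S.smooth.comp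
      ((hτs.neg.contMDiff.comp contMDiff_fst).prodMk contMDiff_snd)))
  have hKd : ∀ t x (w : E), mderiv I 𝓘(ℝ, ℝ) (K t) x w = c t * mderiv I 𝓘(ℝ, ℝ) g
      (S.push (-τ t) x) (mderiv I I (S.push (-τ t)) x w) := by
    intro t x w
    have h1 : ContMDiff I I ∞ (S.push (-τ t)) := contMDiff_uncurry_right S.smooth _
    have h2 := mderiv_comp (I := I) (I' := I) (I'' := 𝓘(ℝ, ℝ)) (f := S.push (-τ t))
      (g := g) (x := x)
      (hg.mdifferentiableAt (by simp)) (h1.mdifferentiableAt (by simp)) w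
    have h3 := mderiv_const_mul (g := fun x => g (S.push (-τ t) x)) (hg.comp h1) (c t) x
    exact (congrArg (fun l : E →L[ℝ] ℝ => l w) h3).trans (congrArg (fun r => c t * r) h2)
  have hK0 : ∀ x, (∀ τ ∈ Icc 0 T, S.push (-τ) x ∉ S₀) → ∀ t, mderiv I 𝓘(ℝ, ℝ) (K t) x = 0 := by
    intro x hx t
    refine ContinuousLinearMap.ext fun w => ?_
    rw [hKd, hgS _ (hx _ (hτI t))]
    simp
  have hC₀ : IsCompact ((fun q : ℝ × N => S.push q.1 q.2) '' (Icc 0 T ×ˢ S₀)) :=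
    (isCompact_Icc.prod hS₀).image S.smooth.continuous
  obtain ⟨φ, hφ⟩ := HamIsotopy.exists_of_compact hβ hn hKs hC₀
    (fun t x hx => hK0 x (fun τ hτ h => hx ⟨(τ, S.push (-τ) x), ⟨hτ, h⟩, S.push_push_neg τ x⟩) t)
    (fun t ht x => ContinuousLinearMap.ext fun w => by rw [hKd]; simp [hc, hτd t ht])
  refine ⟨φ, fun x hx t => φ.map_eq_self hβ hn (fun t => by rw [hφ]; exact hK0 x hx t) t, ?_⟩
  set X : ∀ x : N, TangentSpace I x := hamField β (fun _ x => -g x) 0 with hXdef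
  have hgn : ContMDiff (𝓘(ℝ, ℝ).prod I) 𝓘(ℝ, ℝ) ∞ (fun q : ℝ × N => -g q.2) :=
    (hg.comp contMDiff_snd).neg
  have hX : ∀ x (w : E), extD I β x (X x) w = mderiv I 𝓘(ℝ, ℝ) g x w := by
    intro x w
    have h1 := isHamiltonianField_hamField hβ hn (fun _ x => -g x) 0 x w
    refine h1.trans ?_
    have h2 := congrArg (fun l : E →L[ℝ] ℝ => l w) (mderiv_const_mul hg (-1) x)
    have h3 : (fun x => -g x) = fun x => (-1) * g x := by funext x; ring
    change -(mderiv I 𝓘(ℝ, ℝ) (fun x => -g x) x w) = _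
    rw [h3]
    have h4 : (mderiv I 𝓘(ℝ, ℝ) (fun x => (-1) * g x) x) w = -1 * mderiv I 𝓘(ℝ, ℝ) g x w := h2
    rw [h4]; ring
  have hXs : IsSmoothField X := by
    rw [isSmoothField_iff]
    intro p
    exact (contDiffOn_localField hβ hn hgn
      (isHamiltonianField_hamField hβ hn (fun _ x => -g x)) p).comp
      (contDiff_const.prodMk contDiff_id).contDiffOn (fun y hy => ⟨trivial, hy⟩)
  -- ω(Y, ·) = dg - β vanishes on vectors tangent to C. As C is Lagrangian, Y is tangent to C: along
  -- C the Liouville field and the Hamiltonian field of -g move C in the same way.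
  set Y : ∀ x : N, TangentSpace I x := fun x => X x - S.vec x with hY
  have hYs : IsSmoothField Y := by
    rw [isSmoothField_iff] at hXs ⊢
    intro p
    refine ((hXs p).sub ((isSmoothField_iff _).1 S.isSmoothField_vec p)).congr fun y _ => ?_
    exact map_sub (mderiv I 𝓘(ℝ, E) (extChartAt I p) ((extChartAt I p).symm y)) _ _
  have hYe : ∀ x (w : E), extD I β x (Y x) w = mderiv I 𝓘(ℝ, ℝ) g x w - β x w := by
    intro x w
    rw [← hX, ← S.extD_vec]
    refine (extD_eq_flatDL β x (Y x) w).trans ?_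
    refine Eq.trans ?_ (congrArg₂ (fun a b : ℝ => a - b) (extD_eq_flatDL β x (X x) w)
      (extD_eq_flatDL β x (S.vec x) w)).symm
    exact congrArg (fun l : E →L[ℝ] ℝ => l w)
      (map_sub (flatDL (localForm I β x) (extChartAt I x x)) (X x : E) (S.vec x))
  have hYC : ∀ x ∈ C, (⟨x, Y x⟩ : TangentBundle I N) ∈ tangentVectors I C := by
    intro x hx
    refine hC.mem_tangentVectors_of_orthogonal hE hn hx (hp.isotropic hβ hC hg x) fun v hv => ?_
    refine (hYe x v).trans (sub_eq_zero.2 ?_)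
    exact ((isPrimitiveOn_iff hg).1 hp _ hv).symm
  -- Brought back by the Liouville flow, a trajectory of φ follows the field Y at speed τ': the
  -- factor e^τ in K cancels the conformal factor e^(-τ). Hence it stays in C once it starts there.
  have hq : ∀ p t, HasVelocityAt I (fun t => S.push (-τ t) (φ.map t p))
      (deriv τ t • (show E from Y (S.push (-τ t) (φ.map t p)))) t := by
    intro p t
    obtain ⟨v, hv, hk⟩ := φ.velocity t p
    set x := φ.map t p with hx
    set y := S.push (-τ t) x with hy
    have h1 : HasDerivAt (fun t => -τ t) (-deriv τ t) t :=
      ((hτs.differentiable (by simp)) t).hasDerivAt.neg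
    have h2 := HasVelocityAt.map_family S.smooth h1 hv (S.velocity_push (-τ t) x)
    refine h2.congr_velocity ?_
    have h3 : mderiv I I (S.push (-τ t)) x v = deriv τ t • (show E from X y) := by
      refine IsHamVec.unique hn (k := fun x => deriv τ t * -g x) (x := y) ?_ ?_
      · intro w
        set w' := mderiv I I (S.push (τ t)) y w with hw'
        have h4 : mderiv I I (S.push (-τ t)) x w' = w := by
          have h5 := mderiv_symm_mderiv (S.pushDiffeo (-τ t)) y w
          have h6 : (S.pushDiffeo (-τ t)).symm y = x := (S.pushDiffeo (-τ t)).symm_apply_apply x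
          rw [h6] at h5
          refine Eq.trans ?_ h5
          rw [hw']
          have h7 : S.push (τ t) = (S.pushDiffeo (-τ t)).symm := by
            change S.push (τ t) = S.push (- -τ t)
            rw [neg_neg]
          rw [h7]; rfl
        have h8 := (S.isConformal_pushDiffeo (-τ t)).extD hβ x v w'
        have h9 : extD I β y (mderiv I I (S.push (-τ t)) x v) (mderiv I I (S.push (-τ t)) x w') =
          Real.exp (-τ t) * extD I β x v w' := h8
        rw [h4] at h9
        refine h9.trans ?_
        have h10 := hk w'
        rw [hφ, hKd, h4] at h10
        refine (congrArg (fun r => Real.exp (-τ t) * r) h10).trans ?_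
        have h11 : mderiv I 𝓘(ℝ, ℝ) (fun x => deriv τ t * -g x) y w =
            -(deriv τ t * mderiv I 𝓘(ℝ, ℝ) g y w) := by
          have h12 : (fun x => deriv τ t * -g x) = fun x => (-deriv τ t) * g x := by
            funext x; ring
          rw [h12, mderiv_const_mul hg]
          change -deriv τ t * mderiv I 𝓘(ℝ, ℝ) g y w = _
          ring
        refine Eq.trans ?_ (congrArg (fun r => -r) h11).symm
        change Real.exp (-τ t) * -(-(deriv τ t * Real.exp (τ t)) * mderiv I 𝓘(ℝ, ℝ) g y w) = _
        have h13 : Real.exp (-τ t) * Real.exp (τ t) = 1 := by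
          rw [← Real.exp_add, neg_add_cancel, Real.exp_zero]
        linear_combination (deriv τ t * mderiv I 𝓘(ℝ, ℝ) g y w) * h13
      · exact IsHamVec.smul (k := fun x => -g x) (v := (show E from X y))
          (isHamiltonianField_hamField hβ hn (fun _ x => -g x) 0 y)
          (hg.neg.mdifferentiableAt (by simp)) _
    rw [h3]
    have h4 : ∀ u v : E, -deriv τ t • u + deriv τ t • v = deriv τ t • (v - u) := fun u v => by
      rw [smul_sub, neg_smul]
      abel
    exact h4 (S.vec y) (X y)
  have hτ0 : τ 0 = 0 := by simp [hτ]
  have hτ1 : τ 1 = T := by simp [hτ]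
  ext x
  rw [S.mem_push_image]
  constructor
  · rintro ⟨p, hpC, rfl⟩
    have h1 := hC.mem_of_velocity hCc hYs hYC hτ'.continuous (hq p)
      (by rw [hτ0, neg_zero, S.push_zero, φ.map_zero]; exact hpC) zero_le_one
    rwa [hτ1] at h1
  · intro hx
    set p := (φ.map 1).symm x with hpdef
    have hpx : φ.map 1 p = x := (φ.map 1).apply_symm_apply x
    -- The same curve run backwards, from time 1 to time 0.
    have h1 : ∀ t, HasVelocityAt I (fun t => S.push (-τ (1 - t)) (φ.map (1 - t) p))
        ((-deriv τ (1 - t)) • (show E from Y (S.push (-τ (1 - t)) (φ.map (1 - t) p)))) t := by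
      intro t
      have h2 := (hq p (1 - t)).comp_real (t := t) (θ := fun t => 1 - t)
        ((hasDerivAt_id t).const_sub 1)
      refine h2.congr_velocity ?_
      rw [smul_smul, neg_one_mul]
    have h3 := hC.mem_of_velocity hCc hYs hYC (c := fun t => -deriv τ (1 - t))
      (hτ'.continuous.comp (continuous_const.sub continuous_id)).neg h1
      (by rw [sub_zero, hτ1, hpx]; exact hx) zero_le_one
    rw [sub_self, hτ0, neg_zero, S.push_zero, φ.map_zero] at h3
    exact ⟨p, h3, hpx⟩

end LiouvilleCyl

end Liouville

end

noncomputable section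

/-! ### Cobordisms between cylinders and their compositions -/

section Cobordisms

variable {E : Type*} [NormedAddCommGroup E] [NormedSpace ℝ E] {H : Type*} [TopologicalSpace H]
  {I : ModelWithCorners ℝ E H} [I.Boundaryless] {N : Type*} [TopologicalSpace N]
  [ChartedSpace H N] [IsManifold I ∞ N] {β : ∀ x : N, TangentSpace I x →L[ℝ] ℝ}
  [FiniteDimensional ℝ E]

lemma IsPrimitiveOn.image_conformal {A : Set N} {g : N → ℝ} (hA : IsPrimitiveOn β A g)
    {σ : N ≃ₘ⟮I, I⟯ N} {c : ℝ} (h : IsConformal β σ c) :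
    IsPrimitiveOn β (σ '' A) (fun x => c * g (σ.symm x)) := by
  intro γ hγ hγA
  have hA' : ∀ t, σ.symm (γ t) ∈ A := by
    intro t
    obtain ⟨y, hy, hyt⟩ := hγA t
    rw [← hyt]; simpa using hy
  have h1 := hA (fun t => σ.symm (γ t)) (σ.symm.contMDiff.comp hγ) hA'
  have hv : HasVelocityAt I γ (mderiv 𝓘(ℝ, ℝ) I γ 0 1) 0 :=
    hasVelocityAt_of_mdifferentiableAt (hγ.mdifferentiableAt (by simp))
  have hv' := hv.map (f := σ.symm) (σ.symm.contMDiff.mdifferentiableAt (by simp))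
  have h3 := h (σ.symm (γ 0)) (mderiv I I σ.symm (γ 0) (mderiv 𝓘(ℝ, ℝ) I γ 0 1))
  have h4 : β (σ (σ.symm (γ 0))) (mderiv I I σ (σ.symm (γ 0))
      (mderiv I I σ.symm (γ 0) (mderiv 𝓘(ℝ, ℝ) I γ 0 1))) =
      β (γ 0) (mderiv 𝓘(ℝ, ℝ) I γ 0 1) :=
    (congrArg (fun w : E => β (σ (σ.symm (γ 0))) w) (mderiv_symm_mderiv σ (γ 0) _)).trans
      (congrArg (fun y => β y (show E from mderiv 𝓘(ℝ, ℝ) I γ 0 1)) (σ.apply_symm_apply (γ 0)))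
  refine (h1.const_mul c).congr_deriv ?_
  have h5 : mderiv 𝓘(ℝ, ℝ) I (fun t => σ.symm (γ t)) 0 1 = _ := hv'.mderiv_eq
  refine Eq.trans ?_ (h3.symm.trans h4)
  exact congrArg (fun w : E => c * β (σ.symm (γ 0)) w) h5

/-- A bijection that fixes F pointwise also preserves its complement, so images may be compared
separately on the two parts. -/
lemma image_eq_of_fixed {X : Type*} {f : X ≃ X} {F A B A' B' : Set X} (hf : ∀ x ∈ F, f x = x)
    (h : f '' A = B) (hA : ∀ x ∉ F, x ∈ A' ↔ x ∈ A) (hB : ∀ x ∉ F, x ∈ B' ↔ x ∈ B)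
    (hF : ∀ x ∈ F, x ∈ A' ↔ x ∈ B') : f '' A' = B' := by
  ext x
  rw [f.image_eq_preimage_symm, mem_preimage]
  by_cases hx : x ∈ F
  · have h1 : f.symm x = x := by rw [f.symm_apply_eq]; exact (hf x hx).symm
    rw [h1]; exact hF x hx
  · have h1 : f.symm x ∉ F := fun h2 => by
      have h3 := hf _ h2
      rw [f.apply_symm_apply] at h3
      rw [← h3] at h2
      exact hx h2
    rw [hA _ h1, hB x hx, ← h, f.image_eq_preimage_symm, mem_preimage]

namespace LiouvilleCyl

variable (S : LiouvilleCyl β)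

/-- The sets `A` and `B` are isotopic by a Hamiltonian isotopy supported in `a < height < b`. -/
def RelIsotopic (a b : ℝ) (A B : Set N) : Prop :=
  ∃ φ : HamIsotopy β, (∀ t x, S.height x ≤ a ∨ b ≤ S.height x → φ.map t x = x) ∧ φ.map 1 '' A = B

variable {S}

lemma RelIsotopic.mono {a b a' b' : ℝ} {A B : Set N} (h : S.RelIsotopic a b A B) (ha : a' ≤ a)
    (hb : b ≤ b') : S.RelIsotopic a' b' A B := by
  obtain ⟨φ, h1, h2⟩ := h
  exact ⟨φ, fun t x hx => h1 t x (hx.imp (fun h => h.trans ha) fun h => hb.trans h), h2⟩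

lemma RelIsotopic.symm {a b : ℝ} {A B : Set N} (h : S.RelIsotopic a b A B) :
    S.RelIsotopic a b B A := by
  obtain ⟨φ, h1, h2⟩ := h
  refine ⟨φ.reverse, fun t x hx => ?_, ?_⟩
  · have h3 : (φ.map 1).symm x = x := by
      conv_lhs => rw [← h1 1 x hx]
      exact (φ.map 1).symm_apply_apply x
    rw [HamIsotopy.reverse_map, h3, h1 _ x hx]
  · rw [← h2, image_image]
    refine (image_congr fun x _ => ?_).trans (image_id A)
    rw [HamIsotopy.reverse_map, sub_self, φ.map_zero]
    exact (φ.map 1).symm_apply_apply x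

lemma RelIsotopic.trans {a b : ℝ} {A B C : Set N} (h : S.RelIsotopic a b A B)
    (h' : S.RelIsotopic a b B C) : S.RelIsotopic a b A C := by
  obtain ⟨φ, h1, h2⟩ := h
  obtain ⟨ψ, h3, h4⟩ := h'
  refine ⟨φ.trans ψ, fun t x hx => ?_, ?_⟩
  · rw [HamIsotopy.trans_map, h1 _ x hx, h3 _ x hx]
  · rw [← h4, ← h2, image_image]
    exact image_congr fun x _ => HamIsotopy.trans_map_one φ ψ x

lemma RelIsotopic.push {a b : ℝ} {A B : Set N} (h : S.RelIsotopic a b A B) (t : ℝ) :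
    S.RelIsotopic (a + t) (b + t) (S.push t '' A) (S.push t '' B) := by
  obtain ⟨φ, h1, h2⟩ := h
  refine ⟨φ.conj S.smooth_form (S.pushDiffeo t) (S.isConformal_pushDiffeo t), fun s x hx => ?_, ?_⟩
  · rw [HamIsotopy.conj_map]
    change S.push t (φ.map s (S.push (-t) x)) = x
    rw [h1, S.push_push_neg]
    rw [S.height_push]
    exact hx.imp (fun h => by linarith) fun h => by linarith
  · rw [← h2, image_image, image_image]
    refine image_congr fun x _ => ?_
    rw [HamIsotopy.conj_map]
    change S.push t (φ.map 1 (S.push (-t) (S.push t x))) = _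
    rw [S.push_neg_push]

/-- Only the traces in the slab are moved; outside of it both sets may be replaced, provided that
the replacements still match each other. This is how an isotopy of one piece is used inside a longer
composition. -/
lemma RelIsotopic.congr {a b : ℝ} {A B A' B' : Set N} (h : S.RelIsotopic a b A B)
    (hA : ∀ x, a < S.height x → S.height x < b → (x ∈ A' ↔ x ∈ A))
    (hB : ∀ x, a < S.height x → S.height x < b → (x ∈ B' ↔ x ∈ B))
    (hAB : ∀ x, S.height x ≤ a ∨ b ≤ S.height x → (x ∈ A' ↔ x ∈ B')) :
    S.RelIsotopic a b A' B' := by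
  obtain ⟨φ, h1, h2⟩ := h
  refine ⟨φ, h1, image_eq_of_fixed (f := (φ.map 1).toEquiv)
    (F := {x | S.height x ≤ a ∨ b ≤ S.height x}) (fun x hx => h1 1 x hx) h2 ?_ ?_ hAB⟩
  · intro x hx
    simp only [mem_ofPred_eq, not_or, not_le] at hx
    exact hA x hx.1 hx.2
  · intro x hx
    simp only [mem_ofPred_eq, not_or, not_le] at hx
    exact hB x hx.1 hx.2

variable (S)

/-- Closed exact Lagrangian submanifolds invariant under the Liouville flow. -/
structure IsCylinder (k : ℕ) (Z : Set N) : Prop where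
  submanifold : IsSubmanifold I k Z
  isClosed : IsClosed Z
  push_mem : ∀ t, ∀ x ∈ Z, S.push t x ∈ Z
  primitive : IsPrimitiveOn β Z (fun _ => 0)

/-- Closed Lagrangian submanifolds that coincide with `Z` below height `-R` and with `Z'` above
height `R`, with a primitive of the Liouville form that is constant on both ends. -/
structure IsCob (k : ℕ) (Z Z' : Set N) (R : ℝ) (L : Set N) : Prop where
  submanifold : IsSubmanifold I k L
  isClosed : IsClosed L
  bot : ∀ x, S.height x ≤ -R → (x ∈ L ↔ x ∈ Z)
  top : ∀ x, R ≤ S.height x → (x ∈ L ↔ x ∈ Z')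
  exists_primitive : ∃ g : N → ℝ, ContMDiff I 𝓘(ℝ, ℝ) ∞ g ∧ IsPrimitiveOn β L g ∧
    (∃ c, ∀ x ∈ L, S.height x ≤ -R → g x = c) ∧ ∃ c, ∀ x ∈ L, R ≤ S.height x → g x = c

variable {S}

lemma IsCylinder.push_mem_iff {k : ℕ} {Z : Set N} (hZ : S.IsCylinder k Z) (t : ℝ) (x : N) :
    S.push t x ∈ Z ↔ x ∈ Z :=
  ⟨fun h => by rw [← S.push_neg_push t x]; exact hZ.push_mem _ _ h, hZ.push_mem t x⟩

lemma IsCob.mono {k : ℕ} {Z Z' L : Set N} {R R' : ℝ} (h : S.IsCob k Z Z' R L) (hR : R ≤ R') :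
    S.IsCob k Z Z' R' L := by
  obtain ⟨g, h1, h2, ⟨c, hc⟩, c', hc'⟩ := h.exists_primitive
  exact ⟨h.submanifold, h.isClosed, fun x hx => h.bot x (by linarith),
    fun x hx => h.top x (by linarith), g, h1, h2, ⟨c, fun x hxL hx => hc x hxL (by linarith)⟩,
    c', fun x hxL hx => hc' x hxL (by linarith)⟩

/-- A primitive is constant along the parts of the trajectories of the Liouville flow that run
inside the submanifold. -/
lemma eq_of_push_mem {A : Set N} {g : N → ℝ} (hg : ContMDiff I 𝓘(ℝ, ℝ) ∞ g)
    (hp : IsPrimitiveOn β A g) {x : N} {s : ℝ} (hs : 0 ≤ s)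
    (hA : ∀ r ∈ Icc 0 s, S.push (-r) x ∈ A) : g x = g (S.push (-s) x) := by
  rcases hs.eq_or_lt with rfl | hs'
  · rw [neg_zero, S.push_zero]
  set f : ℝ → ℝ := fun r => g (S.push (-r) x) with hf
  have hd : ∀ r, HasDerivAt f (mderiv I 𝓘(ℝ, ℝ) g (S.push (-r) x)
      ((-1 : ℝ) • (show E from S.vec (S.push (-r) x)))) r := by
    intro r
    have h1 := (S.velocity_push (-r) x).comp_real (θ := fun r => -r) (hasDerivAt_neg r)
    exact h1.hasDerivAt_comp (hg.mdifferentiableAt (by simp))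
  have hd0 : ∀ r ∈ Ioo 0 s, HasDerivAt f 0 r := by
    intro r hr
    refine (hd r).congr_deriv ?_
    obtain ⟨ρ, hρ, h0, hρ', hb⟩ := exists_slow_curve (min r (s - r))
      (lt_min hr.1 (by linarith [hr.2]))
    have h1 := hp (fun t => S.push (-r + ρ t) x) ((S.smooth.comp ((contDiff_const.add
      hρ).contMDiff.prodMk contMDiff_const))) (fun t => by
        have h2 : -r + ρ t = -(r - ρ t) := by ring
        rw [h2]
        have h3 := abs_le.1 (hb t)
        refine hA _ ⟨?_, ?_⟩
        · linarith [h3.2, min_le_left r (s - r)]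
        · linarith [h3.1, min_le_right r (s - r)])
    have h2 : HasDerivAt (fun t => -r + ρ t) 1 0 := hρ'.const_add (-r)
    have h3 := S.velocity_push (-r) x
    have h30 : -r = -r + ρ 0 := by rw [h0, add_zero]
    rw [h30] at h3
    have h4 := h3.comp_real (θ := fun t => -r + ρ t) h2
    have h5 : mderiv 𝓘(ℝ, ℝ) I (fun t => S.push (-r + ρ t) x) 0 1 =
      (1 : ℝ) • (show E from S.vec (S.push (-r + ρ 0) x)) := h4.mderiv_eq
    rw [one_smul] at h5
    have h6 : HasDerivAt (fun t => g (S.push (-r + ρ t) x)) 0 0 := by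
      refine h1.congr_deriv ?_
      exact (congrArg (fun v : E => β (S.push (-r + ρ 0) x) v) h5).trans (S.form_vec _)
    have h7 : mderiv I 𝓘(ℝ, ℝ) g (S.push (-r + ρ 0) x)
        ((1 : ℝ) • (show E from S.vec (S.push (-r + ρ 0) x))) = 0 :=
      (h4.hasDerivAt_comp (f := g) (hg.mdifferentiableAt (by simp))).unique h6
    rw [map_smul, one_smul, ← h30] at h7
    rw [map_smul, h7, smul_zero]
  have hcont : ContinuousOn f (Icc 0 s) := fun r _ => (hd r).continuousAt.continuousWithinAt
  obtain ⟨c, hc, h⟩ := exists_deriv_eq_slope f hs' hcont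
    (fun r hr => (hd r).differentiableAt.differentiableWithinAt)
  rw [(hd0 c hc).deriv] at h
  have h1 : f s = f 0 := by
    have h2 : s - 0 ≠ 0 := by linarith
    field_simp at h
    linarith
  rw [hf] at h1
  simp only [neg_zero, S.push_zero] at h1
  exact h1.symm

/-- The difference of the two functions is invariant under the Liouville flow, hence determined by
its values on the compact level of height 0. -/
lemma exists_bound {u : N → ℝ} (hu : ContMDiff I 𝓘(ℝ, ℝ) ∞ u)
    (hup : ∀ t x, u (S.push t x) = u x + t) : ∃ B, 0 ≤ B ∧ ∀ x, |u x - S.height x| ≤ B := by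
  obtain ⟨B, hB⟩ := (S.isCompact_preimage 0 0).exists_bound_of_continuousOn
    (f := u) hu.continuous.continuousOn
  refine ⟨max B 0, le_max_right _ _, fun x => ?_⟩
  have h1 := hB (S.push (-S.height x) x) (by simp [S.height_push])
  rw [hup] at h1
  exact (show |u x - S.height x| ≤ B from h1).trans (le_max_left _ _)

variable (S)

/-- The set `L` followed by the set `L'`, pushed up by `t`. -/
def comp (L L' : Set N) (t : ℝ) : Set N :=
  {x | (S.height x ≤ t / 2 ∧ x ∈ L) ∨ (t / 2 < S.height x ∧ S.push (-t) x ∈ L')}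

variable {S}

lemma mem_comp_of_le {L L' : Set N} {t : ℝ} {x : N} (h : S.height x ≤ t / 2) :
    x ∈ S.comp L L' t ↔ x ∈ L := by
  simp [comp, h, h.not_gt]

lemma mem_comp_of_lt {L L' : Set N} {t : ℝ} {x : N} (h : t / 2 < S.height x) :
    x ∈ S.comp L L' t ↔ S.push (-t) x ∈ L' := by
  simp [comp, h, h.not_ge]

/-- Increasing the distance between two cobordisms does not change the isotopy class of their
composition. -/
lemma exists_relIsotopic_comp [T2Space N] {k : ℕ} (hE : Module.finrank ℝ E = 2 * k)
    {Z' Z'' L L' Q : Set N} (hZ' : S.IsCylinder k Z') {R : ℝ} (hL' : S.IsCob k Z' Z'' R L')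
    {u : N → ℝ} (hu : ContMDiff I 𝓘(ℝ, ℝ) ∞ u) (hup : ∀ t x, u (S.push t x) = u x + t)
    {ε t₀ : ℝ} (hε : 0 < ε) (hLu : ∀ x, 0 ≤ u x → (x ∈ L ↔ x ∈ Z'))
    (hLu' : ∀ x, u x ≤ ε → (S.push (-t₀) x ∈ L' ↔ x ∈ Z')) {a₀ b₀ : ℝ}
    (h : S.RelIsotopic a₀ b₀ {x | (u x ≤ 0 ∧ x ∈ L) ∨ (0 < u x ∧ S.push (-t₀) x ∈ L')} Q) :
    ∃ a b t₁ : ℝ, ∀ t, t₁ ≤ t → S.RelIsotopic a (b + t) (S.comp L L' t) Q := by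
  obtain ⟨B, hB0, hB⟩ := S.exists_bound hu hup
  obtain ⟨g, hg, hpg, ⟨cb, hcb⟩, ct, hct⟩ := hL'.exists_primitive
  -- Only the upper piece is moved. It is slid up by t - t₀ with `exists_slide`, after its primitive
  -- has been extended so that nothing moves where u < 0.
  set C : Set N := S.push t₀ '' L' with hCdef
  have hCm : ∀ x, x ∈ C ↔ S.push (-t₀) x ∈ L' := fun x => S.mem_push_image
  have hC : IsSubmanifold I k C := hL'.submanifold.image (S.pushDiffeo t₀)
  have hCc : IsClosed C := (S.pushDiffeo t₀).toHomeomorph.isClosedMap _ hL'.isClosed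
  set G : N → ℝ := fun x => Real.exp t₀ * g (S.push (-t₀) x) with hG
  have hGs : ContMDiff I 𝓘(ℝ, ℝ) ∞ G :=
    contMDiff_const.mul (hg.comp (contMDiff_uncurry_right S.smooth (-t₀)))
  have hGp : IsPrimitiveOn β C G := hpg.image_conformal (S.isConformal_pushDiffeo t₀)
  -- Above height R + t₀ the primitive on C is constant; r ≥ B places the region u < 0 below height
  -- r.
  set r : ℝ := max (max (R + t₀) B) 0 with hr
  have hr1 : R + t₀ ≤ r := (le_max_left _ _).trans (le_max_left _ _)
  have hr2 : B ≤ r := (le_max_right _ _).trans (le_max_left _ _)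
  have hr3 : 0 ≤ r := le_max_right _ _
  have hGt : ∀ x ∈ C, r ≤ S.height x → G x = Real.exp t₀ * ct := by
    intro x hx hxr
    rw [hG]
    simp only
    rw [hct _ ((hCm x).1 hx) (by rw [S.height_push]; linarith)]
  -- Where u ≤ ε, C is the cylinder Z'. Descending along the Liouville flow within it one reaches
  -- the bottom end of the translate of L', and by `eq_of_push_mem` the primitive does not change on
  -- the way.
  have hGb : ∀ x ∈ C, u x ≤ ε → G x = Real.exp t₀ * cb := by
    intro x hx hxu
    have hxZ : x ∈ Z' := (hLu' x hxu).1 ((hCm x).1 hx)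
    have hmem : ∀ s, 0 ≤ s → S.push (-s) x ∈ C := fun s hs => by
      rw [hCm, hLu' _ (by rw [hup]; linarith), hZ'.push_mem_iff]
      exact hxZ
    set s : ℝ := max 0 (S.height x - t₀ + R) with hs
    rw [eq_of_push_mem (S := S) hGs hGp (le_max_left 0 (S.height x - t₀ + R))
      (fun r hr => hmem r hr.1)]
    have h1 := hmem s (le_max_left _ _)
    rw [hG]
    simp only
    rw [hcb _ ((hCm _).1 h1)]
    rw [S.height_push, S.height_push]
    linarith [le_max_right 0 (S.height x - t₀ + R)]
  set χ : N → ℝ := fun x => Real.smoothTransition (u x / ε) with hχ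
  set κ : N → ℝ := fun x => Real.smoothTransition (r + 1 - S.height x) with hκ
  have hχs : ContMDiff I 𝓘(ℝ, ℝ) ∞ χ :=
    (Real.smoothTransition.contDiff.comp (contDiff_id.div_const ε)).contMDiff.comp hu
  have hκs : ContMDiff I 𝓘(ℝ, ℝ) ∞ κ :=
    (Real.smoothTransition.contDiff.comp (contDiff_const.sub contDiff_id)).contMDiff.comp
      S.height_smooth
  set cb' := Real.exp t₀ * cb with hcb'
  set ct' := Real.exp t₀ * ct with hct'
  -- On C nothing changes, since there G equals cb' where χ < 1 and ct' where κ < 1. On the whole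
  -- manifold g' is now locally constant outside the compact set S₀.
  set g' : N → ℝ := fun x => ct' + κ x * (cb' + χ x * (G x - cb') - ct') with hg'
  have hg's : ContMDiff I 𝓘(ℝ, ℝ) ∞ g' := by
    have h1 : ContMDiff I 𝓘(ℝ, ℝ) ∞ fun x => G x - cb' := hGs.sub contMDiff_const
    have h2 : ContMDiff I 𝓘(ℝ, ℝ) ∞ fun x => cb' + χ x * (G x - cb') - ct' :=
      (contMDiff_const.add (hχs.mul h1)).sub contMDiff_const
    exact contMDiff_const.add (hκs.mul h2)
  have hκ1 : ∀ x, S.height x ≤ r → κ x = 1 := fun x hx =>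
    Real.smoothTransition.one_of_one_le (by linarith)
  have hg'p : IsPrimitiveOn β C g' := by
    refine hGp.congr fun x hx => ?_
    have h1 : cb' + χ x * (G x - cb') = G x := by
      rcases le_or_gt (u x) ε with h | h
      · rw [hGb x hx h]; ring
      · have h2 : χ x = 1 := Real.smoothTransition.one_of_one_le (by
          rw [le_div_iff₀ hε, one_mul]; exact h.le)
        rw [h2]; ring
    rw [hg']
    simp only
    rw [h1]
    rcases le_or_gt (S.height x) r with h | h
    · rw [hκ1 x h]; ring
    · rw [hGt x hx h.le]; ring
  set S₀ : Set N := {x | 0 ≤ u x ∧ S.height x ≤ r + 1} with hS₀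
  have hS₀c : IsCompact S₀ := by
    refine (S.isCompact_preimage (-B) (r + 1)).of_isClosed_subset
      ((isClosed_le continuous_const hu.continuous).inter
        (isClosed_le S.height_smooth.continuous continuous_const)) ?_
    rintro x ⟨h1, h2⟩
    exact ⟨by linarith [(abs_le.1 (hB x)).2], h2⟩
  have hd : ∀ x ∉ S₀, mderiv I 𝓘(ℝ, ℝ) g' x = 0 := by
    intro x hx
    rcases lt_or_ge (u x) 0 with h1 | h1
    · refine mderiv_of_eventuallyEq_const (c := cb') ?_
      filter_upwards [(isOpen_lt hu.continuous continuous_const).mem_nhds h1] with y hy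
      have hy' : u y < 0 := hy
      have h2 : χ y = 0 := Real.smoothTransition.zero_of_nonpos
        (div_nonpos_of_nonpos_of_nonneg hy'.le hε.le)
      rw [hg']
      simp only
      rw [h2, hκ1 y (by linarith [(abs_le.1 (hB y)).1])]
      ring
    · have h2 : r + 1 < S.height x := by
        by_contra h3
        exact hx ⟨h1, not_lt.1 h3⟩
      refine mderiv_of_eventuallyEq_const (c := ct') ?_
      filter_upwards [(isOpen_lt continuous_const S.height_smooth.continuous).mem_nhds h2] with y hy
      have hy' : r + 1 < S.height y := hy
      have h3 : κ y = 0 := Real.smoothTransition.zero_of_nonpos (by linarith)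
      rw [hg']
      simp only
      rw [h3]; ring
  -- A height of at most -B - 1 forces u < 0, and heights from r + 2 + (t - t₀) on lie above all
  -- translates of S₀. Moreover t ≥ t₀ makes the slide go upwards, t / 2 ≥ R puts the cut of `comp`
  -- where the translate of L' is cylindrical, and t / 2 ≥ B puts it above the region u < 0.
  refine ⟨min a₀ (-B - 1), max (max b₀ 0) (r + 2 - t₀), max (max t₀ 0) (2 * max R B),
    fun t ht => ?_⟩
  have ht0 : t₀ ≤ t := ((le_max_left _ _).trans (le_max_left _ _)).trans ht
  have ht1 : 0 ≤ t := ((le_max_right _ _).trans (le_max_left _ _)).trans ht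
  have htR : R ≤ t / 2 := by
    have := (le_max_right _ _).trans ht
    linarith [le_max_left R B]
  have htB : B ≤ t / 2 := by
    have := (le_max_right _ _).trans ht
    linarith [le_max_right R B]
  obtain ⟨φ, hφ, hφC⟩ := S.exists_slide hE hC hCc hg's hg'p hS₀c hd (T := t - t₀) (by linarith)
  have hfix : ∀ x, u x < 0 ∨ r + 1 + (t - t₀) < S.height x → ∀ s, φ.map s x = x := by
    intro x hx
    refine hφ x fun τ hτ hmem => ?_
    have h1 : 0 ≤ u (S.push (-τ) x) := hmem.1
    have h2 : S.height (S.push (-τ) x) ≤ r + 1 := hmem.2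
    rw [hup] at h1
    rw [S.height_push] at h2
    rcases hx with h | h
    · linarith [hτ.1]
    · linarith [hτ.2]
  have hstep : S.RelIsotopic (min a₀ (-B - 1)) (max (max b₀ 0) (r + 2 - t₀) + t)
      {x | (u x ≤ 0 ∧ x ∈ L) ∨ (0 < u x ∧ S.push (-t₀) x ∈ L')} (S.comp L L' t) := by
    refine ⟨φ, fun s x hx => hfix x ?_ s, image_eq_of_fixed (f := (φ.map 1).toEquiv)
      -- Where u < 0 the slide is the identity and both compositions are L. Elsewhere the first
      -- composition is C and the second one is the translate of C.
      (F := {x | u x < 0}) (fun x hx => hfix x (Or.inl hx) 1) hφC ?_ ?_ ?_⟩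
    · refine hx.imp (fun h => ?_) fun h => ?_
      · linarith [min_le_right a₀ (-B - 1), (abs_le.1 (hB x)).2]
      · linarith [le_max_right (max b₀ 0) (r + 2 - t₀)]
    · intro x hx
      have hx' : 0 ≤ u x := not_lt.1 hx
      rw [hCm]
      rcases hx'.eq_or_lt with h0 | h0
      · rw [hLu' x (by linarith), ← hLu x hx']
        simp [← h0]
      · simp [h0, h0.not_ge]
    · intro x hx
      have hx' : 0 ≤ u x := not_lt.1 hx
      have h1 : x ∈ S.push (t - t₀) '' C ↔ S.push (-t) x ∈ L' := by
        rw [S.mem_push_image, hCm, ← S.push_add]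
        have h2 : -t₀ + -(t - t₀) = -t := by ring
        rw [h2]
      rw [h1]
      rcases le_or_gt (S.height x) (t / 2) with h | h
      · rw [mem_comp_of_le h, hLu x hx', hL'.bot _ (by rw [S.height_push]; linarith),
          hZ'.push_mem_iff]
      · rw [mem_comp_of_lt h]
    · intro x hx
      have hx' : u x < 0 := hx
      rw [mem_comp_of_le (by linarith [(abs_le.1 (hB x)).1])]
      simp [hx'.le, hx'.not_gt]
  refine hstep.symm.trans (h.mono (min_le_left _ _) ?_)
  linarith [le_max_left (max b₀ 0) (r + 2 - t₀), le_max_left b₀ 0]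

end LiouvilleCyl

end Cobordisms

end

noncomputable section

/-! ### Periodic concatenation and the swindle -/

section Periodization

variable {E : Type*} [NormedAddCommGroup E] [NormedSpace ℝ E] {H : Type*} [TopologicalSpace H]
  {I : ModelWithCorners ℝ E H} [I.Boundaryless] {N : Type*} [TopologicalSpace N]
  [ChartedSpace H N] [IsManifold I ∞ N] {β : ∀ x : N, TangentSpace I x →L[ℝ] ℝ}
  [FiniteDimensional ℝ E]

lemma HamIsotopy.reverse_image {φ : HamIsotopy β} {A B : Set N} (h : φ.map 1 '' A = B) :
    φ.reverse.map 1 '' B = A := by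
  rw [← h, image_image]
  refine (image_congr fun x _ => ?_).trans (image_id A)
  rw [HamIsotopy.reverse_map, sub_self, φ.map_zero]
  exact (φ.map 1).symm_apply_apply x

lemma HamIsotopy.trans_image {φ ψ : HamIsotopy β} {A B C : Set N} (h : φ.map 1 '' A = B)
    (h' : ψ.map 1 '' B = C) : (φ.trans ψ).map 1 '' A = C := by
  rw [← h', ← h, image_image]
  exact image_congr fun x _ => HamIsotopy.trans_map_one φ ψ x

namespace LiouvilleCyl

variable (S : LiouvilleCyl β)

/-- The number of the window `[d + k T, d + (k + 1) T)` in which the height of a point lies. -/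
def window (d T : ℝ) (x : N) : ℤ := ⌊(S.height x - d) / T⌋

/-- The periodic set which coincides with `A` in the window `[d, d + T)`. -/
def perSet (d T : ℝ) (A : Set N) : Set N :=
  {x | S.push (-(S.window d T x * T)) x ∈ A}

/-- The periodic extension of a map of the window `[d, d + T)`. -/
def perMap (d T : ℝ) (F : N → N) (x : N) : N :=
  S.push (S.window d T x * T) (F (S.push (-(S.window d T x * T)) x))

variable {S}

lemma window_eq_iff {d T : ℝ} (hT : 0 < T) {x : N} {k : ℤ} :
    S.window d T x = k ↔ d + k * T ≤ S.height x ∧ S.height x < d + (k + 1) * T := by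
  rw [window, Int.floor_eq_iff, le_div_iff₀ hT, div_lt_iff₀ hT]
  constructor <;> rintro ⟨h1, h2⟩ <;> constructor <;> linarith

variable {a b d T : ℝ}

lemma window_cases (hT : 0 < T) (hda : d < a) (hab : a ≤ b) (hbT : b < d + T) {x : N} {k : ℤ}
    (h1 : b + (k - 1) * T < S.height x) (h2 : S.height x < a + (k + 1) * T) :
    S.window d T x = k ∨ (S.window d T x = k - 1 ∧ S.height x < d + k * T) ∨
      (S.window d T x = k + 1 ∧ d + (k + 1) * T ≤ S.height x) := by
  rw [window_eq_iff hT, window_eq_iff hT, window_eq_iff hT]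
  push_cast
  rcases lt_or_ge (S.height x) (d + k * T) with h | h
  · refine Or.inr (Or.inl ⟨⟨?_, ?_⟩, h⟩) <;> linarith
  · rcases lt_or_ge (S.height x) (d + (k + 1) * T) with h' | h'
    · exact Or.inl ⟨h, h'⟩
    · refine Or.inr (Or.inr ⟨⟨?_, ?_⟩, h'⟩) <;> linarith

/-- Near the seams of the windows F is the identity, so the formula of window k remains valid some
way into the neighbouring windows. Every point thus has a neighbourhood on which the periodic map is
given by a single formula, whence its smoothness. -/
lemma perMap_eq (hT : 0 < T) (hda : d < a) (hab : a ≤ b) (hbT : b < d + T) {F : N → N}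
    (hF : ∀ x, S.height x ≤ a ∨ b ≤ S.height x → F x = x) {x : N} {k : ℤ}
    (h1 : b + (k - 1) * T < S.height x) (h2 : S.height x < a + (k + 1) * T) :
    S.perMap d T F x = S.push (k * T) (F (S.push (-(k * T)) x)) := by
  rw [perMap]
  rcases window_cases hT hda hab hbT h1 h2 with h | ⟨h, h'⟩ | ⟨h, h'⟩
  · rw [h]
  · rw [h, hF, S.push_push_neg, hF, S.push_push_neg]
    · left; rw [S.height_push]; linarith
    · right; rw [S.height_push]; push_cast; linarith
  · rw [h, hF, S.push_push_neg, hF, S.push_push_neg]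
    · right; rw [S.height_push]; linarith
    · left; rw [S.height_push]; push_cast; linarith

/-- Inside a window f preserves the slab a < height < b and fixes the rest, so that no point changes
its window. In particular the periodic extension of the inverse is the inverse. -/
lemma window_perMap (hT : 0 < T) (hda : d < a) (hbT : b < d + T) (f : N ≃ N)
    (hF : ∀ x, S.height x ≤ a ∨ b ≤ S.height x → f x = x) (x : N) :
    S.window d T (S.perMap d T f x) = S.window d T x := by
  obtain ⟨h1, h2⟩ := (window_eq_iff hT).1 (rfl : S.window d T x = S.window d T x)
  rw [window_eq_iff hT]
  rw [perMap, S.height_push]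
  set k := S.window d T x
  set z := S.push (-(k * T)) x with hz
  have hzh : S.height z = S.height x - k * T := by rw [hz, S.height_push]; ring
  have h3 : f z = z ∨ (a < S.height (f z) ∧ S.height (f z) < b) := by
    by_cases h : S.height (f z) ≤ a ∨ b ≤ S.height (f z)
    · exact Or.inl (f.injective (hF _ h))
    · exact Or.inr (by simpa using h)
  rcases h3 with h3 | h3
  · rw [h3, hzh]; constructor <;> linarith
  · constructor <;> linarith [h3.1, h3.2]

lemma perMap_symm_perMap (hT : 0 < T) (hda : d < a) (hbT : b < d + T) (f : N ≃ N)
    (hF : ∀ x, S.height x ≤ a ∨ b ≤ S.height x → f x = x) (x : N) :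
    S.perMap d T f.symm (S.perMap d T f x) = x := by
  have h1 := window_perMap hT hda hbT f hF x
  rw [perMap, h1, perMap, S.push_neg_push, f.symm_apply_apply, S.push_push_neg]

lemma fixed_symm {f : N ≃ N} (hF : ∀ x, S.height x ≤ a ∨ b ≤ S.height x → f x = x) (x : N)
    (hx : S.height x ≤ a ∨ b ≤ S.height x) : f.symm x = x := by
  rw [f.symm_apply_eq]; exact (hF x hx).symm

lemma mem_perSet_perMap (hT : 0 < T) (hda : d < a) (hbT : b < d + T) (f : N ≃ N)
    (hF : ∀ x, S.height x ≤ a ∨ b ≤ S.height x → f x = x) {A : Set N} (x : N) :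
    S.perMap d T f x ∈ S.perSet d T (f '' A) ↔ x ∈ S.perSet d T A := by
  rw [perSet, perSet, mem_ofPred_eq, mem_ofPred_eq, window_perMap hT hda hbT f hF, perMap,
    S.push_neg_push]
  exact f.injective.mem_set_image

/-- A function is constant between two heights if its differential vanishes there. -/
lemma exists_eq_of_mderiv_eq_zero {K : ℝ → N → ℝ}
    (hK : ContMDiff (𝓘(ℝ, ℝ).prod I) 𝓘(ℝ, ℝ) ∞ (fun q : ℝ × N => K q.1 q.2)) {s : Set ℝ}
    (hs : IsOpen s) (hc : IsPreconnected s) (hne : s.Nonempty)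
    (hd : ∀ t x, S.height x ∈ s → mderiv I 𝓘(ℝ, ℝ) (K t) x = 0) :
    ∃ κ : ℝ → ℝ, ContDiff ℝ ∞ κ ∧ ∀ t x, S.height x ∈ s → K t x = κ t := by
  obtain ⟨r, hr⟩ := hne
  obtain ⟨x₀⟩ := S.nonempty
  set x₁ := S.push (r - S.height x₀) x₀ with hx₁
  have h1 : S.height x₁ ∈ s := by rw [hx₁, S.height_push, add_sub_cancel]; exact hr
  refine ⟨fun t => K t x₁, ?_, fun t x hx => ?_⟩
  · rw [← contMDiff_iff_contDiff]
    exact hK.comp (contMDiff_id.prodMk contMDiff_const)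
  · exact eq_of_mderiv_eq_zero (hs.preimage S.height_smooth.continuous)
      (S.isPreconnected_preimage s hc) (contMDiff_uncurry_right hK t) (fun y hy => hd t y hy) h1 hx

/-- An isotopy supported in one window extends periodically, with a Hamiltonian that is rescaled
from window to window. -/
theorem exists_isotopy_perSet [T2Space N] {A B : Set N} (h : S.RelIsotopic a b A B) (hT : 0 < T)
    (hda : d < a)     (hab : a ≤ b) (hbT : b < d + T) :
    ∃ Φ : HamIsotopy β, Φ.map 1 '' S.perSet d T A = S.perSet d T B := by
  obtain ⟨φ, hφ, rfl⟩ := h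
  have hd : ∀ t x, S.height x < a ∨ b < S.height x → mderiv I 𝓘(ℝ, ℝ) (φ.ham t) x = 0 :=
    fun t x hx => φ.mderiv_ham_eq_zero (fun t => hφ t x (hx.imp le_of_lt le_of_lt)) t
  obtain ⟨κb, hκb, hKb⟩ := exists_eq_of_mderiv_eq_zero (S := S) φ.ham_smooth isOpen_Iio
    isPreconnected_Iio ⟨a - 1, by simp⟩ (fun t x (hx : S.height x < a) => hd t x (Or.inl hx))
  obtain ⟨κt, hκt, hKt⟩ := exists_eq_of_mderiv_eq_zero (S := S) φ.ham_smooth isOpen_Ioi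
    isPreconnected_Ioi ⟨b + 1, by simp⟩ (fun t x (hx : b < S.height x) => hd t x (Or.inr hx))
  have heT : Real.exp T - 1 ≠ 0 := by
    have := Real.add_one_lt_exp hT.ne'
    linarith
  -- At the seam below window k the two Hamiltonians are e^((k-1)T)(κt + c) and e^(kT)(κb + c).
  -- Adding a function of time does not affect the field, and this choice of c makes them agree; it
  -- is possible because e^T ≠ 1.
  set c : ℝ → ℝ := fun t => (κt t - Real.exp T * κb t) / (Real.exp T - 1) with hc
  have hcs : ContDiff ℝ ∞ c := (hκt.sub (contDiff_const.mul hκb)).div_const _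
  have hcc : ∀ t, κt t + c t = Real.exp T * (κb t + c t) := by
    intro t
    rw [hc]
    field_simp
    ring
  set K : ℝ → N → ℝ := fun t x => Real.exp (S.window d T x * T) *
    (φ.ham t (S.push (-(S.window d T x * T)) x) + c t) with hK
  have hKe : ∀ (k : ℤ) t x, b + (k - 1) * T < S.height x → S.height x < a + (k + 1) * T →
      K t x = Real.exp (k * T) * (φ.ham t (S.push (-(k * T)) x) + c t) := by
    intro k t x h1 h2
    rw [hK]
    simp only
    rcases window_cases hT hda hab hbT h1 h2 with h | ⟨h, h'⟩ | ⟨h, h'⟩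
    · rw [h]
    · rw [h, hKt, hKb, hcc, ← mul_assoc, ← Real.exp_add]
      · congr 2; push_cast; ring
      · rw [mem_Iio, S.height_push]; linarith
      · rw [mem_Ioi, S.height_push]; push_cast; linarith
    · rw [h, hKb, hKt, hcc, ← mul_assoc, ← Real.exp_add]
      · congr 2; push_cast; ring
      · rw [mem_Ioi, S.height_push]; linarith
      · rw [mem_Iio, S.height_push]; push_cast; linarith
  have hU : ∀ x, b + (S.window d T x - 1) * T < S.height x ∧
      S.height x < a + (S.window d T x + 1) * T := by
    intro x
    obtain ⟨h1, h2⟩ := (window_eq_iff hT).1 (rfl : S.window d T x = S.window d T x)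
    constructor <;> linarith
  have hUn : ∀ x, ∀ᶠ y in nhds x, b + (S.window d T x - 1) * T < S.height y ∧
      S.height y < a + (S.window d T x + 1) * T := by
    intro x
    have hh := S.height_smooth.continuous.continuousAt (x := x)
    exact (hh.eventually (lt_mem_nhds (hU x).1)).and (hh.eventually (gt_mem_nhds (hU x).2))
  have hUn' : ∀ q : ℝ × N, ∀ᶠ r in nhds q, b + (S.window d T q.2 - 1) * T < S.height r.2 ∧
      S.height r.2 < a + (S.window d T q.2 + 1) * T := fun q =>
    (continuous_snd.tendsto q).eventually (hUn q.2)
  have hφs : ∀ t x, S.height x ≤ a ∨ b ≤ S.height x → (φ.map t).symm x = x := fun t =>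
    fixed_symm (f := (φ.map t).toEquiv) (hφ t)
  have hs : ContMDiff (𝓘(ℝ, ℝ).prod I) I ∞ (fun q : ℝ × N => S.perMap d T (φ.map q.1) q.2) := by
    intro q
    have h1 : ContMDiff (𝓘(ℝ, ℝ).prod I) I ∞ (fun r : ℝ × N => S.push (S.window d T q.2 * T)
        (φ.map r.1 (S.push (-(S.window d T q.2 * T)) r.2))) :=
      (contMDiff_uncurry_right S.smooth _).comp (φ.smooth.comp
        (contMDiff_fst.prodMk ((contMDiff_uncurry_right S.smooth _).comp contMDiff_snd)))
    refine (h1 q).congr_of_eventuallyEq ?_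
    filter_upwards [hUn' q] with r hr
    exact perMap_eq hT hda hab hbT (hφ r.1) hr.1 hr.2
  have hs' : ∀ t, ContMDiff I I ∞ (S.perMap d T (φ.map t).symm) := by
    intro t x
    have h1 : ContMDiff I I ∞ (fun y => S.push (S.window d T x * T)
        ((φ.map t).symm (S.push (-(S.window d T x * T)) y))) :=
      (contMDiff_uncurry_right S.smooth _).comp ((φ.map t).symm.contMDiff.comp
        (contMDiff_uncurry_right S.smooth _))
    refine (h1 x).congr_of_eventuallyEq ?_
    filter_upwards [hUn x] with y hy
    exact perMap_eq hT hda hab hbT (hφs t) hy.1 hy.2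
  refine ⟨⟨fun t => ⟨⟨S.perMap d T (φ.map t), S.perMap d T (φ.map t).symm, fun x =>
      perMap_symm_perMap hT hda hbT (φ.map t).toEquiv (hφ t) x, fun x =>
      perMap_symm_perMap hT hda hbT (φ.map t).symm.toEquiv (hφs t) x⟩,
      contMDiff_uncurry_right (F := fun t => S.perMap d T (φ.map t)) hs t, hs' t⟩,
      K, hs, fun x => ?_, fun q => ?_, fun t x => ?_⟩, ?_⟩
  · change S.perMap d T (φ.map 0) x = x
    rw [perMap, φ.map_zero, S.push_push_neg]
  · have h1 : ContMDiff (𝓘(ℝ, ℝ).prod I) 𝓘(ℝ, ℝ) ∞ (fun r : ℝ × N =>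
        Real.exp (S.window d T q.2 * T) *
          (φ.ham r.1 (S.push (-(S.window d T q.2 * T)) r.2) + c r.1)) :=
      contMDiff_const.mul ((φ.ham_smooth.comp
        (contMDiff_fst.prodMk ((contMDiff_uncurry_right S.smooth _).comp contMDiff_snd))).add
        (hcs.contMDiff.comp contMDiff_fst))
    refine (h1 q).congr_of_eventuallyEq ?_
    filter_upwards [hUn' q] with r hr
    exact hKe _ _ _ hr.1 hr.2
  · set k := S.window d T x with hk
    -- Within window k the periodic isotopy is φ conjugated by a power of the translation, and its
    -- Hamiltonian differs from that of the conjugate by a function of time only.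
    set ψ := φ.conj S.smooth_form (S.pushDiffeo (k * T)) (S.isConformal_pushDiffeo (k * T)) with hψ
    have h1 : ∀ s, S.perMap d T (φ.map s) x = ψ.map s x := fun s => rfl
    obtain ⟨v, hv, hkv⟩ := ψ.velocity t x
    refine ⟨v, hv, IsHamVec.congr hkv ?_⟩
    change mderiv I 𝓘(ℝ, ℝ) (K t) (ψ.map t x) = _
    have h2 : S.window d T (ψ.map t x) = k :=
      window_perMap hT hda hbT (φ.map t).toEquiv (hφ t) x
    have h3 := hUn (ψ.map t x)
    rw [h2] at h3
    have h4 : K t =ᶠ[nhds (ψ.map t x)] fun y => ψ.ham t y + Real.exp (k * T) * c t := by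
      filter_upwards [h3] with y hy
      rw [hKe k t y hy.1 hy.2, mul_add]
      rfl
    refine ContinuousLinearMap.ext fun w => ?_
    have h5 : mderiv I 𝓘(ℝ, ℝ) (K t) (ψ.map t x) =
      mderiv I 𝓘(ℝ, ℝ) (fun y => ψ.ham t y + Real.exp (k * T) * c t) (ψ.map t x) := h4.mfderiv_eq
    rw [h5, mderiv_add (ψ.contMDiff_ham t) contMDiff_const, mderiv_of_eventuallyEq_const
      (f := fun _ : N => Real.exp (k * T) * c t) (Filter.EventuallyEq.refl _ _)]
    exact add_zero _
  · ext x
    constructor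
    · rintro ⟨y, hy, rfl⟩
      exact (mem_perSet_perMap hT hda hbT (φ.map 1).toEquiv (hφ 1) y).2 hy
    · intro hx
      have h1 := perMap_symm_perMap hT hda hbT (φ.map 1).symm.toEquiv (hφs 1) x
      refine ⟨S.perMap d T (φ.map 1).symm x, ?_, h1⟩
      refine (mem_perSet_perMap hT hda hbT (φ.map 1).toEquiv (hφ 1) _).1 ?_
      exact h1.symm ▸ hx

lemma perSet_cylinder {k : ℕ} {Z : Set N} (hZ : S.IsCylinder k Z) : S.perSet d T Z = Z := by
  ext x
  exact hZ.push_mem_iff _ x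

/-- The two alternating periodic concatenations of two cobordisms differ by a translation. -/
lemma perSet_comp {k : ℕ} {Z Z' L L' : Set N} (hZ : S.IsCylinder k Z) (hZ' : S.IsCylinder k Z')
    {R t : ℝ} (hL : S.IsCob k Z Z' R L) (hL' : S.IsCob k Z' Z R L') (hT : 0 < T)
    (ht : 2 * R ≤ t) (htT : 2 * R ≤ T - t) (ht0 : 0 < t) (htT0 : t < T) :
    S.perSet (-((T - t) / 2)) T (S.comp L L' t) =
      S.push t '' S.perSet (-(t / 2)) T (S.comp L' L (T - t)) := by
  ext x
  rw [S.mem_push_image, perSet, perSet, mem_ofPred_eq, mem_ofPred_eq]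
  obtain ⟨h1, h2⟩ := (window_eq_iff hT).1
    (rfl : S.window (-((T - t) / 2)) T x = S.window (-((T - t) / 2)) T x)
  set n := S.window (-((T - t) / 2)) T x with hn
  set z := S.push (-(n * T)) x with hz
  have hzh : S.height z = S.height x - n * T := by rw [hz, S.height_push]; ring
  -- In each window of the first chain, L is below and L' above the level t / 2. In the second chain
  -- the copy of L' opens a window with the same number, while the copy of L closes the window
  -- before it. At the levels where pieces meet, both are cylindrical.
  rcases le_or_gt (t / 2) (S.height z) with h | h
  · have hw : S.window (-(t / 2)) T (S.push (-t) x) = n := by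
      rw [window_eq_iff hT, S.height_push]
      constructor <;> linarith
    have hp : S.push (-(n * T)) (S.push (-t) x) = S.push (-t) z := by
      rw [hz, ← S.push_add, ← S.push_add, add_comm]
    rw [hw, hp, mem_comp_of_le (x := S.push (-t) z) (by rw [S.height_push]; linarith)]
    rcases h.eq_or_lt with h' | h'
    · rw [mem_comp_of_le h'.symm.le, hL.top z (by linarith),
        hL'.bot _ (by rw [S.height_push]; linarith), hZ'.push_mem_iff (-t) z]
    · rw [mem_comp_of_lt h']
  · have hw : S.window (-(t / 2)) T (S.push (-t) x) = n - 1 := by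
      rw [window_eq_iff hT, S.height_push]
      push_cast
      constructor <;> linarith
    have hp : S.push (-((n - 1 : ℤ) * T)) (S.push (-t) x) = S.push (T - t) z := by
      rw [hz, ← S.push_add, ← S.push_add]
      congr 1
      push_cast
      ring
    rw [hw, hp, mem_comp_of_le h.le]
    rcases eq_or_lt_of_le (show (T - t) / 2 ≤ S.height (S.push (T - t) z) by
      rw [S.height_push]; linarith) with h' | h'
    · rw [mem_comp_of_le h'.symm.le, hL'.top _ (by linarith), hZ.push_mem_iff,
        hL.bot z (by rw [S.height_push] at h'; linarith)]
    · rw [mem_comp_of_lt h', ← S.push_add, neg_add_cancel, S.push_zero]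

/-- The ends of an invertible cobordism are isotopic. -/
theorem exists_isotopy_of_invertible [T2Space N] {k : ℕ} {Z Z' L L' : Set N} (hZ : S.IsCylinder k Z)
    (hZ' : S.IsCylinder k Z') {R : ℝ} (hL : S.IsCob k Z Z' R L) (hL' : S.IsCob k Z' Z R L')
    (h : ∃ a b t₁ : ℝ, ∀ t, t₁ ≤ t → S.RelIsotopic a (b + t) (S.comp L L' t) Z)
    (h' : ∃ a b t₁ : ℝ, ∀ t, t₁ ≤ t → S.RelIsotopic a (b + t) (S.comp L' L t) Z') :
    ∃ Φ : HamIsotopy β, Φ.map 1 '' Z = Z' := by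
  obtain ⟨a, b, t₁, h⟩ := h
  obtain ⟨a', b', t₁', h'⟩ := h'
  -- The period is t + s, where t is the shift in L ⊙ L' and s the one in L' ⊙ L. The windows are
  -- [-s/2, t + s/2) for the first grouping and [-t/2, s + t/2) for the second; to contain the
  -- supports one needs s/2 > |a|, |b| and t/2 > |a'|, |b'|.
  set t := |t₁| + 2 * |a'| + 2 * |b'| + 2 * |R| + |a| + 1 with ht
  set s := |t₁'| + 2 * |a| + 2 * |b| + 2 * |R| + |a'| + 1 with hs
  have e1 := neg_abs_le a
  have e2 := neg_abs_le a'
  have e3 := le_abs_self b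
  have e4 := le_abs_self b'
  have e5 := le_abs_self t₁
  have e6 := le_abs_self t₁'
  have e7 := le_abs_self R
  have e8 := le_abs_self a
  have e9 := le_abs_self a'
  have f1 := abs_nonneg a
  have f2 := abs_nonneg a'
  have f3 := abs_nonneg b
  have f4 := abs_nonneg b'
  have f5 := abs_nonneg t₁
  have f6 := abs_nonneg t₁'
  have f7 := abs_nonneg R
  have g1 := (h t (by linarith)).mono le_rfl
    (show b + t ≤ |b| + t by linarith)
  have g2 := (h' s (by linarith)).mono le_rfl
    (show b' + s ≤ |b'| + s by linarith)
  -- Φ carries the infinite chain, grouped as copies of L ⊙ L', to Z. Below, Ψ carries the chain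
  -- grouped as copies of L' ⊙ L to Z', and conjugation by `push t` aligns the two chains.
  obtain ⟨Φ, hΦ⟩ := exists_isotopy_perSet (d := -((t + s - t) / 2)) (T := t + s) g1 (by linarith)
    (by linarith) (by linarith) (by linarith)
  obtain ⟨Ψ, hΨ⟩ := exists_isotopy_perSet (d := -(t / 2)) (T := t + s) g2 (by linarith)
    (by linarith) (by linarith) (by linarith)
  rw [perSet_cylinder hZ, perSet_comp hZ hZ' hL hL' (by linarith) (by linarith) (by linarith)
    (by linarith) (by linarith), add_sub_cancel_left] at hΦ
  rw [perSet_cylinder hZ'] at hΨ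
  set Ψ' := Ψ.conj S.smooth_form (S.pushDiffeo t) (S.isConformal_pushDiffeo t) with hΨ'
  have h3 : Ψ'.map 1 '' (S.push t '' S.perSet (-(t / 2)) (t + s) (S.comp L' L s)) = Z' := by
    have h4 : S.push t '' Z' = Z' := by
      ext x
      rw [S.mem_push_image, hZ'.push_mem_iff]
    rw [← h4, ← hΨ, image_image, image_image]
    refine image_congr fun x _ => ?_
    rw [hΨ', HamIsotopy.conj_map]
    change S.push t (Ψ.map 1 (S.push (-t) (S.push t x))) = _
    rw [S.push_neg_push]
  exact ⟨Φ.reverse.trans Ψ', HamIsotopy.trans_image (HamIsotopy.reverse_image hΦ) h3⟩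

end LiouvilleCyl

end Periodization

end

noncomputable section

/-! ### One-sided inverses and gluing of cobordisms -/

section Inverses

variable {E : Type*} [NormedAddCommGroup E] [NormedSpace ℝ E] {H : Type*} [TopologicalSpace H]
  {I : ModelWithCorners ℝ E H} [I.Boundaryless] {N : Type*} [TopologicalSpace N]
  [ChartedSpace H N] [IsManifold I ∞ N] {β : ∀ x : N, TangentSpace I x →L[ℝ] ℝ}
  [FiniteDimensional ℝ E]

namespace LiouvilleCyl

variable {S : LiouvilleCyl β}

lemma IsCylinder.push_image {k : ℕ} {Z : Set N} (hZ : S.IsCylinder k Z) (t : ℝ) :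
    S.push t '' Z = Z := by
  ext x
  rw [S.mem_push_image, hZ.push_mem_iff]

/-- If a cobordism has a left inverse and a right inverse, then its right inverse is also a left
inverse. -/
theorem exists_relIsotopic_comp_swap {k : ℕ} {Z Z' P L L' : Set N} (hZ : S.IsCylinder k Z)
    (hZ' : S.IsCylinder k Z') {R : ℝ} (hP : S.IsCob k Z' Z R P) (hL : S.IsCob k Z Z' R L)
    (hL' : S.IsCob k Z' Z R L')
    (h₁ : ∃ a b t₁ : ℝ, ∀ t, t₁ ≤ t → S.RelIsotopic a (b + t) (S.comp P L t) Z')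
    (h₂ : ∃ a b t₁ : ℝ, ∀ t, t₁ ≤ t → S.RelIsotopic a (b + t) (S.comp L L' t) Z) :
    ∃ a b t₁ : ℝ, ∀ t, t₁ ≤ t → S.RelIsotopic a (b + t) (S.comp L' L t) Z' := by
  obtain ⟨a₁, b₁, t₁, h₁⟩ := h₁
  obtain ⟨a₂, b₂, t₂, h₂⟩ := h₂
  set B : ℝ := |a₁| + |b₁| + |a₂| + |b₂| + |R| + 1 with hB
  have e1 := neg_abs_le a₁
  have e2 := le_abs_self b₁
  have e3 := neg_abs_le a₂
  have e4 := le_abs_self b₂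
  have e5 := le_abs_self R
  have f1 := abs_nonneg a₁
  have f2 := abs_nonneg b₁
  have f3 := abs_nonneg a₂
  have f4 := abs_nonneg b₂
  have f5 := abs_nonneg R
  -- The spacing exceeds both thresholds, and its half exceeds R, so that all cuts are made in
  -- cylindrical parts.
  set s : ℝ := |t₁| + |t₂| + 2 * B with hs
  have e6 := le_abs_self t₁
  have e7 := le_abs_self t₂
  have f6 := abs_nonneg t₁
  have f7 := abs_nonneg t₂
  refine ⟨-B - 2 * s, B, s, fun t ht => ?_⟩
  -- The fourfold composition P ⊙ L ⊙ L' ⊙ L, with its pieces based at heights 0, s, 2s and 2s + t.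
  set W : Set N := {x | (S.height x ≤ 3 * s / 2 ∧ x ∈ S.comp P L s) ∨
    (3 * s / 2 < S.height x ∧ S.push (-(2 * s)) x ∈ S.comp L' L t)} with hW
  have hWl : ∀ x, S.height x ≤ 3 * s / 2 → (x ∈ W ↔ x ∈ S.comp P L s) := fun x hx => by
    simp [hW, hx, hx.not_gt]
  have hWr : ∀ x, 3 * s / 2 < S.height x → (x ∈ W ↔ S.push (-(2 * s)) x ∈ S.comp L' L t) :=
    fun x hx => by simp [hW, hx, hx.not_ge]
  have hpp : ∀ c d e x, c + d = e → S.push (-c) (S.push (-d) x) = S.push (-e) x := by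
    intro c d e x h
    rw [← S.push_add, ← h, neg_add]
  -- Contracting P ⊙ L to the cylinder Z' leaves L' ⊙ L.
  have step1 : S.RelIsotopic (-B) (B + s) W (S.push (2 * s) '' S.comp L' L t) := by
    refine ((h₁ s (by linarith)).mono (by linarith) (by linarith)).congr ?_ ?_ ?_
    · intro x h1 h2
      exact hWl x (by linarith)
    · intro x h1 h2
      rw [S.mem_push_image, mem_comp_of_le (by rw [S.height_push]; linarith),
        hL'.bot _ (by rw [S.height_push]; linarith), hZ'.push_mem_iff]
    · intro x hx
      rw [S.mem_push_image]
      rcases le_or_gt (S.height x) (3 * s / 2) with h | h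
      · rw [hWl x h, mem_comp_of_le (x := S.push (-(2 * s)) x) (by rw [S.height_push]; linarith),
          hL'.bot _ (by rw [S.height_push]; linarith), hZ'.push_mem_iff]
        rcases hx with hx | hx
        · rw [mem_comp_of_le (by linarith), hP.bot x (by linarith)]
        · rw [mem_comp_of_lt (by linarith), hL.top _ (by rw [S.height_push]; linarith),
            hZ'.push_mem_iff]
      · exact hWr x h
  -- Contracting L ⊙ L' in the middle to the cylinder Z leaves P ⊙ L with a larger shift, which is
  -- in turn contracted to Z'.
  have step2 : S.RelIsotopic (-B + s) (B + 2 * s) W (S.comp P L (2 * s + t)) := by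
    refine (((h₂ s (by linarith)).push s).mono (by linarith) (by linarith)).congr ?_ ?_ ?_
    · intro x h1 h2
      rw [S.mem_push_image]
      rcases le_or_gt (S.height x) (3 * s / 2) with h | h
      · rw [hWl x h, mem_comp_of_lt (by linarith),
          mem_comp_of_le (by rw [S.height_push]; linarith)]
      · rw [hWr x h, mem_comp_of_lt (x := S.push (-s) x) (by rw [S.height_push]; linarith),
          mem_comp_of_le (by rw [S.height_push]; linarith), hpp s s (2 * s) x (by ring)]
    · intro x h1 h2
      rw [hZ.push_image]
      rcases le_or_gt (S.height x) ((2 * s + t) / 2) with h | h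
      · rw [mem_comp_of_le h, hP.top x (by linarith)]
      · rw [mem_comp_of_lt h, hL.bot _ (by rw [S.height_push]; linarith), hZ.push_mem_iff]
    · intro x hx
      rcases le_or_gt (S.height x) (3 * s / 2) with h | h
      · rw [hWl x h, mem_comp_of_le (t := 2 * s + t) (by linarith)]
        rcases le_or_gt (S.height x) (s / 2) with h' | h'
        · rw [mem_comp_of_le h']
        · rw [mem_comp_of_lt h', hP.top x (by linarith), hL.bot _ (by
            rw [S.height_push]; rcases hx with hx | hx <;> linarith), hZ.push_mem_iff]
      · rw [hWr x h]
        have hx' : B + 2 * s ≤ S.height x := hx.resolve_left (by linarith)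
        rcases le_or_gt (S.height x) (2 * s + t / 2) with h' | h'
        · rw [mem_comp_of_le (x := S.push (-(2 * s)) x) (by rw [S.height_push]; linarith),
            hL'.top _ (by rw [S.height_push]; linarith), hZ.push_mem_iff]
          rcases le_or_gt (S.height x) ((2 * s + t) / 2) with h'' | h''
          · rw [mem_comp_of_le h'', hP.top x (by linarith)]
          · rw [mem_comp_of_lt h'', hL.bot _ (by rw [S.height_push]; linarith), hZ.push_mem_iff]
        · rw [mem_comp_of_lt (x := S.push (-(2 * s)) x) (by rw [S.height_push]; linarith),
            mem_comp_of_lt (by linarith), hpp t (2 * s) (2 * s + t) x (by ring)]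
  have step3 : S.RelIsotopic (-B) (B + (2 * s + t)) (S.comp P L (2 * s + t)) Z' :=
    (h₁ _ (by linarith)).mono (by linarith) (by linarith)
  have h := ((step1.mono le_rfl (show B + s ≤ B + (2 * s + t) by linarith)).symm.trans
    ((step2.mono (by linarith) (show B + 2 * s ≤ B + (2 * s + t) by linarith)).trans step3)).push
    (-(2 * s))
  rw [hZ'.push_image, image_image] at h
  have h' : (fun x => S.push (-(2 * s)) (S.push (2 * s) x)) '' S.comp L' L t = S.comp L' L t :=
    (image_congr fun x _ => S.push_neg_push _ x).trans (image_id _)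
  rw [h'] at h
  exact h.mono (by linarith) (by linarith)

/-- Cutting a Lagrangian at a level near which it is cylindrical, and continuing it upwards by the
cylinder. -/
lemma isCob_glue_top {k : ℕ} {Z W A : Set N} (hW : S.IsCylinder k W) {R : ℝ}
    (hA : IsSubmanifold I k A) (hAc : IsClosed A) (hbot : ∀ x, S.height x ≤ -R → (x ∈ A ↔ x ∈ Z))
    {g : N → ℝ} (hg : ContMDiff I 𝓘(ℝ, ℝ) ∞ g) (hp : IsPrimitiveOn β A g) {cb : ℝ}
    (hcb : ∀ x ∈ A, S.height x ≤ -R → g x = cb) {l c : ℝ}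
    (hAW : ∀ x, |S.height x - l| ≤ 1 → (x ∈ A ↔ x ∈ W))
    (hgc : ∀ x ∈ A, |S.height x - l| < 1 → g x = c) (hl1 : -R ≤ l) (hl2 : l + 1 ≤ R) :
    S.IsCob k Z W R {x | (S.height x ≤ l ∧ x ∈ A) ∨ (l < S.height x ∧ x ∈ W)} := by
  set L : Set N := {x | (S.height x ≤ l ∧ x ∈ A) ∨ (l < S.height x ∧ x ∈ W)} with hL
  have hLA : ∀ x, S.height x < l + 1 → (x ∈ L ↔ x ∈ A) := by
    intro x hx
    rcases le_or_gt (S.height x) l with h | h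
    · simp [hL, h, h.not_gt]
    · rw [hAW x (abs_le.2 ⟨by linarith, by linarith⟩)]
      simp [hL, h, h.not_ge]
  have hLW : ∀ x, l - 1 < S.height x → (x ∈ L ↔ x ∈ W) := by
    intro x hx
    rcases le_or_gt (S.height x) l with h | h
    · rw [← hAW x (abs_le.2 ⟨by linarith, by linarith⟩)]
      simp [hL, h, h.not_gt]
    · simp [hL, h, h.not_ge]
  have hc := S.height_smooth.continuous
  have ho1 : IsOpen {x | S.height x < l + 1} := isOpen_lt hc continuous_const
  have ho2 : IsOpen {x | l - 1 < S.height x} := isOpen_lt continuous_const hc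
  -- In the collar around the level l the primitive is already equal to c on A, so cutting it off to
  -- the constant c there does not change it on L.
  set κ : N → ℝ := fun x => Real.smoothTransition (l + 1 - S.height x) with hκ
  have hκs : ContMDiff I 𝓘(ℝ, ℝ) ∞ κ :=
    (Real.smoothTransition.contDiff.comp (contDiff_const.sub contDiff_id)).contMDiff.comp
      S.height_smooth
  have hκ1 : ∀ x, S.height x ≤ l → κ x = 1 := fun x hx =>
    Real.smoothTransition.one_of_one_le (by linarith)
  have hκ0 : ∀ x, l + 1 ≤ S.height x → κ x = 0 := fun x hx =>
    Real.smoothTransition.zero_of_nonpos (by linarith)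
  set g' : N → ℝ := fun x => κ x * (g x - c) + c with hg'
  have hg's : ContMDiff I 𝓘(ℝ, ℝ) ∞ g' := (hκs.mul (hg.sub contMDiff_const)).add contMDiff_const
  have hgA : ∀ x ∈ A, S.height x < l + 1 → g' x = g x := by
    intro x hx h
    rcases le_or_gt (S.height x) l with h' | h'
    · simp only [hg', hκ1 x h']; ring
    · simp only [hg', hgc x hx (abs_lt.2 ⟨by linarith, by linarith⟩)]; ring
  have hgW : ∀ x ∈ L, l - 1 < S.height x → g' x = c := by
    intro x hx h
    rcases lt_or_ge (S.height x) (l + 1) with h' | h'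
    · rw [hgA x ((hLA x h').1 hx) h', hgc x ((hLA x h').1 hx) (abs_lt.2 ⟨by linarith, by linarith⟩)]
    · simp only [hg', hκ0 x h']; ring
  have hWp : IsPrimitiveOn β W fun _ => c := by
    intro γ hγ hγW
    have := (hW.primitive γ hγ hγW).add_const c
    simpa using this
  refine ⟨IsSubmanifold.of_locally fun p _ => ?_, ?_, ?_, ?_, g', hg's, ?_, ⟨cb, ?_⟩, c, ?_⟩
  · rcases lt_or_ge (S.height p) (l + 1) with h | h
    · exact ⟨_, ho1, h, A, hA, hLA⟩
    · exact ⟨_, ho2, show l - 1 < S.height p by linarith, W, hW.submanifold, hLW⟩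
  · rw [← isOpen_compl_iff, isOpen_iff_mem_nhds]
    intro x hx
    rcases lt_or_ge (S.height x) (l + 1) with h | h
    · filter_upwards [ho1.mem_nhds h, hAc.isOpen_compl.mem_nhds (fun h' => hx ((hLA x h).2 h'))]
        with y hy hy' h'
      exact hy' ((hLA y hy).1 h')
    · have h2 : l - 1 < S.height x := by linarith
      filter_upwards [ho2.mem_nhds h2, hW.isClosed.isOpen_compl.mem_nhds
        (fun h' => hx ((hLW x h2).2 h'))] with y hy hy' h'
      exact hy' ((hLW y hy).1 h')
  · intro x hx
    rw [hLA x (by linarith), hbot x hx]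
  · exact fun x hx => hLW x (by linarith)
  · refine IsPrimitiveOn.of_locally fun p _ => ?_
    rcases lt_or_ge (S.height p) (l + 1) with h | h
    · exact ⟨_, ho1, h, A, g, hp, fun q hq hqL => ⟨(hLA q hq).1 hqL, hgA q ((hLA q hq).1 hqL) hq⟩⟩
    · exact ⟨_, ho2, show l - 1 < S.height p by linarith, W, _, hWp,
        fun q hq hqL => ⟨(hLW q hq).1 hqL, hgW q hqL hq⟩⟩
  · intro x hx h
    have h1 := (hLA x (by linarith)).1 hx
    rw [hgA x h1 (by linarith), hcb x h1 h]
  · exact fun x hx h => hgW x hx (by linarith)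

/-- Cutting a Lagrangian at a level near which it is cylindrical, and continuing it downwards by the
cylinder. -/
lemma isCob_glue_bot {k : ℕ} {Z W A : Set N} (hW : S.IsCylinder k W) {R : ℝ}
    (hA : IsSubmanifold I k A) (hAc : IsClosed A) (htop : ∀ x, R ≤ S.height x → (x ∈ A ↔ x ∈ Z))
    {g : N → ℝ} (hg : ContMDiff I 𝓘(ℝ, ℝ) ∞ g) (hp : IsPrimitiveOn β A g) {ct : ℝ}
    (hct : ∀ x ∈ A, R ≤ S.height x → g x = ct) {l c : ℝ}
    (hAW : ∀ x, |S.height x - l| ≤ 1 → (x ∈ A ↔ x ∈ W))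
    (hgc : ∀ x ∈ A, |S.height x - l| < 1 → g x = c) (hl1 : -R ≤ l - 1) (hl2 : l < R) :
    S.IsCob k W Z R {x | (S.height x ≤ l ∧ x ∈ W) ∨ (l < S.height x ∧ x ∈ A)} := by
  set L : Set N := {x | (S.height x ≤ l ∧ x ∈ W) ∨ (l < S.height x ∧ x ∈ A)} with hL
  have hLA : ∀ x, l - 1 < S.height x → (x ∈ L ↔ x ∈ A) := by
    intro x hx
    rcases le_or_gt (S.height x) l with h | h
    · rw [hAW x (abs_le.2 ⟨by linarith, by linarith⟩)]
      simp [hL, h, h.not_gt]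
    · simp [hL, h, h.not_ge]
  have hLW : ∀ x, S.height x < l + 1 → (x ∈ L ↔ x ∈ W) := by
    intro x hx
    rcases le_or_gt (S.height x) l with h | h
    · simp [hL, h, h.not_gt]
    · rw [← hAW x (abs_le.2 ⟨by linarith, by linarith⟩)]
      simp [hL, h, h.not_ge]
  have hc := S.height_smooth.continuous
  have ho1 : IsOpen {x | l - 1 < S.height x} := isOpen_lt continuous_const hc
  have ho2 : IsOpen {x | S.height x < l + 1} := isOpen_lt hc continuous_const
  set κ : N → ℝ := fun x => Real.smoothTransition (S.height x - (l - 1)) with hκ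
  have hκs : ContMDiff I 𝓘(ℝ, ℝ) ∞ κ :=
    (Real.smoothTransition.contDiff.comp (contDiff_id.sub contDiff_const)).contMDiff.comp
      S.height_smooth
  have hκ1 : ∀ x, l ≤ S.height x → κ x = 1 := fun x hx =>
    Real.smoothTransition.one_of_one_le (by linarith)
  have hκ0 : ∀ x, S.height x ≤ l - 1 → κ x = 0 := fun x hx =>
    Real.smoothTransition.zero_of_nonpos (by linarith)
  set g' : N → ℝ := fun x => κ x * (g x - c) + c with hg'
  have hg's : ContMDiff I 𝓘(ℝ, ℝ) ∞ g' := (hκs.mul (hg.sub contMDiff_const)).add contMDiff_const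
  have hgA : ∀ x ∈ A, l - 1 < S.height x → g' x = g x := by
    intro x hx h
    rcases le_or_gt l (S.height x) with h' | h'
    · simp only [hg', hκ1 x h']; ring
    · simp only [hg', hgc x hx (abs_lt.2 ⟨by linarith, by linarith⟩)]; ring
  have hgW : ∀ x ∈ L, S.height x < l + 1 → g' x = c := by
    intro x hx h
    rcases lt_or_ge (l - 1) (S.height x) with h' | h'
    · rw [hgA x ((hLA x h').1 hx) h', hgc x ((hLA x h').1 hx) (abs_lt.2 ⟨by linarith, by linarith⟩)]
    · simp only [hg', hκ0 x h']; ring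
  have hWp : IsPrimitiveOn β W fun _ => c := by
    intro γ hγ hγW
    have := (hW.primitive γ hγ hγW).add_const c
    simpa using this
  refine ⟨IsSubmanifold.of_locally fun p _ => ?_, ?_, ?_, ?_, g', hg's, ?_, ⟨c, ?_⟩, ct, ?_⟩
  · rcases lt_or_ge (l - 1) (S.height p) with h | h
    · exact ⟨_, ho1, h, A, hA, hLA⟩
    · exact ⟨_, ho2, show S.height p < l + 1 by linarith, W, hW.submanifold, hLW⟩
  · rw [← isOpen_compl_iff, isOpen_iff_mem_nhds]
    intro x hx
    rcases lt_or_ge (l - 1) (S.height x) with h | h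
    · filter_upwards [ho1.mem_nhds h, hAc.isOpen_compl.mem_nhds (fun h' => hx ((hLA x h).2 h'))]
        with y hy hy' h'
      exact hy' ((hLA y hy).1 h')
    · have h2 : S.height x < l + 1 := by linarith
      filter_upwards [ho2.mem_nhds h2, hW.isClosed.isOpen_compl.mem_nhds
        (fun h' => hx ((hLW x h2).2 h'))] with y hy hy' h'
      exact hy' ((hLW y hy).1 h')
  · exact fun x hx => hLW x (by linarith)
  · intro x hx
    rw [hLA x (by linarith), htop x hx]
  · refine IsPrimitiveOn.of_locally fun p _ => ?_
    rcases lt_or_ge (l - 1) (S.height p) with h | h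
    · exact ⟨_, ho1, h, A, g, hp, fun q hq hqL => ⟨(hLA q hq).1 hqL, hgA q ((hLA q hq).1 hqL) hq⟩⟩
    · exact ⟨_, ho2, show S.height p < l + 1 by linarith, W, _, hWp,
        fun q hq hqL => ⟨(hLW q hq).1 hqL, hgW q hqL hq⟩⟩
  · exact fun x hx h => hgW x hx (by linarith)
  · intro x hx h
    have h1 := (hLA x (by linarith)).1 hx
    rw [hgA x h1 (by linarith), hct x h1 h]

/-- The image of a cylinder under an isotopy of bounded support, with its primitive. -/
lemma exists_primitive_image [T2Space N] {k : ℕ} {W : Set N} (hW : S.IsCylinder k W)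
    {η : HamIsotopy β} {R : ℝ}
    (hη : ∀ t x, S.height x ≤ -R ∨ R ≤ S.height x → η.map t x = x) {G : N → ℝ}
    (hG : IsExactMap β (η.map 1) G) :
    IsSubmanifold I k (η.map 1 '' W) ∧ IsClosed (η.map 1 '' W) ∧
    (∀ x, S.height x ≤ -R ∨ R ≤ S.height x → (x ∈ η.map 1 '' W ↔ x ∈ W)) ∧
    ContMDiff I 𝓘(ℝ, ℝ) ∞ (fun x => G ((η.map 1).symm x)) ∧
    IsPrimitiveOn β (η.map 1 '' W) (fun x => G ((η.map 1).symm x)) ∧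
    (∃ c, ∀ x, S.height x < -R → G ((η.map 1).symm x) = c) ∧
    ∃ c, ∀ x, R < S.height x → G ((η.map 1).symm x) = c := by
  have hsymm : ∀ x, S.height x ≤ -R ∨ R ≤ S.height x → (η.map 1).symm x = x :=
    fixed_symm (f := (η.map 1).toEquiv) (hη 1)
  have hid : IsExactMap β (fun x : N => x) (fun _ => (0 : ℝ)) := by
    refine ⟨contMDiff_id, contMDiff_const, fun x v => ?_⟩
    have h1 : mderiv I I (fun x : N => x) x = ContinuousLinearMap.id ℝ E := mfderiv_id
    have h2 : mderiv I 𝓘(ℝ, ℝ) (fun _ : N => (0 : ℝ)) x = 0 :=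
      mderiv_of_eventuallyEq_const (Filter.EventuallyEq.refl _ _)
    rw [h1, h2]
    exact (add_zero _).symm
  -- On a connected region where the isotopy is the identity, its action differs from that of the
  -- identity by a constant.
  have hconst : ∀ s : Set ℝ, IsOpen s → IsPreconnected s → s.Nonempty →
      (∀ r ∈ s, r ≤ -R ∨ R ≤ r) → ∃ c, ∀ x, S.height x ∈ s → G ((η.map 1).symm x) = c := by
    intro s hs hc ⟨r, hr⟩ hsR
    obtain ⟨x₀⟩ := S.nonempty
    set x₁ := S.push (r - S.height x₀) x₀ with hx₁
    have h1 : S.height x₁ ∈ s := by rw [hx₁, S.height_push, add_sub_cancel]; exact hr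
    refine ⟨G x₁, fun x hx => ?_⟩
    rw [hsymm x (hsR _ hx)]
    have h2 := IsExactMap.sub_eq hG hid (hs.preimage S.height_smooth.continuous)
      (S.isPreconnected_preimage s hc) (fun y hy => hη 1 y (hsR _ hy)) h1 hx
    linarith
  refine ⟨hW.submanifold.image _, (η.map 1).toHomeomorph.isClosedMap _ hW.isClosed, ?_,
    hG.2.1.comp (η.map 1).symm.contMDiff, ?_, ?_, ?_⟩
  · intro x hx
    constructor
    · rintro ⟨y, hy, rfl⟩
      have h1 := hsymm _ hx
      rw [(η.map 1).symm_apply_apply] at h1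
      rwa [← h1]
    · exact fun h => ⟨x, h, hη 1 x hx⟩
  · have h1 := hW.primitive.image hG
    simpa using h1
  · exact hconst (Iio (-R)) isOpen_Iio isPreconnected_Iio ⟨-R - 1, by simp⟩ fun r hr => Or.inl hr.le
  · exact hconst (Ioi R) isOpen_Ioi isPreconnected_Ioi ⟨R + 1, by simp⟩ fun r hr => Or.inr hr.le

end LiouvilleCyl

end Inverses

end

noncomputable section

/-! ### Normalizing the action and cutting off Hamiltonians -/

section Cutoffs

variable {E : Type*} [NormedAddCommGroup E] [NormedSpace ℝ E] {H : Type*} [TopologicalSpace H]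
  {I : ModelWithCorners ℝ E H} [I.Boundaryless] {N : Type*} [TopologicalSpace N]
  [ChartedSpace H N] [IsManifold I ∞ N] {β : ∀ x : N, TangentSpace I x →L[ℝ] ℝ}
  [FiniteDimensional ℝ E]

/-- Two primitives of the same form differ by a constant along curves. -/
lemma IsPrimitiveOn.eq_of_curve {A : Set N} {g : N → ℝ} (hg : IsPrimitiveOn β A g)
    (h0 : IsPrimitiveOn β A fun _ => 0) {γ : ℝ → N} (hγ : ContMDiff 𝓘(ℝ, ℝ) I ∞ γ)
    (hγA : ∀ t, γ t ∈ A) (s t : ℝ) : g (γ s) = g (γ t) := by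
  have hd : ∀ t, HasDerivAt (fun s => g (γ s)) 0 t := by
    intro t
    have hs : ContMDiff 𝓘(ℝ, ℝ) I ∞ fun s => γ (t + s) :=
      hγ.comp (contDiff_const.add contDiff_id).contMDiff
    have h1 := hg _ hs fun s => hγA _
    have h2 := (h0 _ hs fun s => hγA _).unique (hasDerivAt_const (0 : ℝ) (0 : ℝ))
    have h3 : HasDerivAt (fun s => g (γ (t + s))) 0 (t - t) := by
      rw [sub_self]; exact h1.congr_deriv h2
    have h30 : HasDerivAt (fun s : ℝ => s - t) 1 t := (hasDerivAt_id t).sub_const t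
    have h4 := HasDerivAt.comp (h := fun s : ℝ => s - t) t h3 h30
    have h5 : (fun s => g (γ (t + s))) ∘ (fun s : ℝ => s - t) = fun s => g (γ s) := by
      funext s; simp
    rw [h5] at h4
    simpa using h4
  exact is_const_of_deriv_eq_zero (fun t => (hd t).differentiableAt) (fun t => (hd t).deriv) s t

/-- Two isotopies that are generated by the same differentials along a trajectory. -/
lemma HamIsotopy.map_eq_map [T2Space N] (hβ : IsSmoothForm I β) (hn : IsNondegenerate β)
    {φ ψ : HamIsotopy β} {x y : N} {t₀ : ℝ} (h0 : φ.map t₀ x = ψ.map t₀ y)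
    (h : ∀ t, mderiv I 𝓘(ℝ, ℝ) (ψ.ham t) (φ.map t x) = mderiv I 𝓘(ℝ, ℝ) (φ.ham t) (φ.map t x))
    (t : ℝ) : φ.map t x = ψ.map t y := by
  refine ψ.eq_map hβ hn (c := fun t => φ.map t x) (a := -(|t| + |t₀| + 1)) (b := |t| + |t₀| + 1)
    (t₀ := t₀) ?_ (fun s _ => ?_) h0 t ?_
  · constructor <;> linarith [neg_abs_le t₀, le_abs_self t₀, abs_nonneg t]
  · obtain ⟨v, hv, hk⟩ := φ.velocity s x
    exact ⟨v, hv, hk.congr (h s)⟩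
  · constructor <;> linarith [neg_abs_le t, le_abs_self t, abs_nonneg t₀]

lemma HamIsotopy.symm_map_zero (φ : HamIsotopy β) (x : N) : (φ.map 0).symm x = x := by
  conv_lhs => rw [← φ.map_zero x]
  exact (φ.map 0).symm_apply_apply x

namespace LiouvilleCyl

variable {S : LiouvilleCyl β}

/-- An isotopy between two cylinders can be chosen so that its time one map has an action that
vanishes on the first one. -/
lemma exists_action_eq_zero [T2Space N] {k : ℕ} {Z Z' : Set N} (hZ : S.IsCylinder k Z)
    (hZ' : S.IsCylinder k Z') {φ : HamIsotopy β} (h : φ.map 1 '' Z = Z') :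
    ∃ ψ : HamIsotopy β, ψ.map 1 '' Z = Z' ∧
      ∃ G, IsExactMap β (ψ.map 1) G ∧ ∀ x ∈ Z, G x = 0 := by
  obtain ⟨G, hG⟩ := φ.exists_action S.smooth_form
  -- G is only locally constant on Z, so no single constant need make it vanish on all components.
  -- Instead φ' is φ conjugated by `push c` with e^c = 2, which doubles the action; then φ ∘ φ'⁻¹ ∘
  -- φ still carries Z to Z', with action G - 2G + G.
  set c : ℝ := Real.log 2 with hc
  have hec : Real.exp c = 2 := Real.exp_log (by norm_num)
  set σ := S.pushDiffeo c with hσ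
  set φ' := φ.conj S.smooth_form σ (S.isConformal_pushDiffeo c) with hφ'
  have hG' : IsExactMap β (φ'.map 1) (fun x => Real.exp c * G (σ.symm x)) :=
    hG.conj (S.isConformal_pushDiffeo c)
  have hφ's : ∀ x, (φ'.map 1).symm x = S.push c ((φ.map 1).symm (S.push (-c) x)) := by
    intro x
    refine (φ'.map 1).injective (((φ'.map 1).apply_symm_apply x).trans ?_)
    change x = S.push c (φ.map 1 (S.push (-c) _))
    rw [S.push_neg_push, (φ.map 1).apply_symm_apply, S.push_push_neg]
  have hrev : ∀ x, φ'.reverse.map 1 x = (φ'.map 1).symm x := fun x => by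
    rw [HamIsotopy.reverse_map, sub_self, φ'.map_zero]
  set ψ := (φ.trans φ'.reverse).trans φ with hψ
  have hψ1 : ∀ x, ψ.map 1 x = φ.map 1 ((φ'.map 1).symm (φ.map 1 x)) := fun x => by
    rw [hψ, HamIsotopy.trans_map_one, HamIsotopy.trans_map_one, hrev]
  have hφ'Z : φ'.map 1 '' Z = Z' := by
    conv_rhs => rw [← hZ'.push_image c, ← h]
    conv_lhs => rw [← hZ.push_image c]
    rw [image_image, image_image]
    refine image_congr fun x _ => ?_
    change S.push c (φ.map 1 (S.push (-c) (S.push c x))) = _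
    rw [S.push_neg_push]
  have hA : IsPrimitiveOn β Z' fun x => G ((φ.map 1).symm x) := by
    have h1 := hZ.primitive.image hG
    rw [h] at h1
    simpa using h1
  refine ⟨ψ, HamIsotopy.trans_image (HamIsotopy.trans_image h (HamIsotopy.reverse_image hφ'Z)) h,
    fun x => (G x + -(Real.exp c * G (σ.symm ((φ'.map 1).symm (φ.map 1 x))))) +
      G ((φ'.map 1).symm (φ.map 1 x)), ?_, ?_⟩
  · have h1 := hG.comp (hG'.symm.comp hG)
    have h2 : (ψ.map 1 : N → N) = fun x => φ.map 1 ((φ'.map 1).symm (φ.map 1 x)) := funext hψ1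
    rw [h2]
    exact h1
  · intro x hx
    have hy : φ.map 1 x ∈ Z' := h ▸ mem_image_of_mem _ hx
    set y := φ.map 1 x with hyd
    set v := (φ.map 1).symm (S.push (-c) y) with hv
    have hmem : ∀ y ∈ Z', (φ.map 1).symm y ∈ Z := by
      intro y hy
      rw [← h] at hy
      obtain ⟨z, hz, rfl⟩ := hy
      rwa [(φ.map 1).symm_apply_apply]
    have hvZ : v ∈ Z := hmem _ (hZ'.push_mem _ _ hy)
    -- G ∘ φ⁻¹ is a primitive on Z', where β vanishes, so it is constant along curves in Z'. Such
    -- curves join the images of the three points of Z at which G is evaluated.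
    have hxv : G v = G x := by
      have h1 := hA.eq_of_curve hZ'.primitive (γ := fun τ => S.push τ y)
        (S.smooth.comp (contMDiff_id.prodMk contMDiff_const)) (fun t => hZ'.push_mem _ _ hy) (-c) 0
      rw [S.push_zero, hyd, (φ.map 1).symm_apply_apply] at h1
      exact h1
    have hvw : G (S.push c v) = G v := by
      have h1 := hA.eq_of_curve hZ'.primitive (γ := fun τ => φ.map 1 (S.push τ v))
        ((φ.map 1).contMDiff.comp (S.smooth.comp (contMDiff_id.prodMk contMDiff_const)))
        (fun t => h ▸ mem_image_of_mem _ (hZ.push_mem _ _ hvZ)) c 0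
      rw [S.push_zero, (φ.map 1).symm_apply_apply, (φ.map 1).symm_apply_apply] at h1
      exact h1
    have hσv : σ.symm (S.push c v) = v := S.push_neg_push c v
    have h1 := hφ's (φ.map 1 x)
    rw [← hyd, ← hv] at h1
    beta_reduce
    rw [← hyd, h1, hσv, hec, hvw, hxv]
    ring

variable (S) in
/-- A function of the height that is one between `-r` and `r'`, and zero below `-r - 1` and
above `r' + 1`. -/
def cutoff (r r' : ℝ) (x : N) : ℝ :=
  Real.smoothTransition (S.height x + r + 1) * Real.smoothTransition (r' + 1 - S.height x)

lemma contMDiff_cutoff (r r' : ℝ) : ContMDiff I 𝓘(ℝ, ℝ) ∞ (S.cutoff r r') := by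
  have h1 : ContDiff ℝ ∞ fun s : ℝ =>
      Real.smoothTransition (s + r + 1) * Real.smoothTransition (r' + 1 - s) :=
    (Real.smoothTransition.contDiff.comp ((contDiff_id.add contDiff_const).add contDiff_const)).mul
      (Real.smoothTransition.contDiff.comp (contDiff_const.sub contDiff_id))
  exact h1.contMDiff.comp S.height_smooth

lemma cutoff_eq_zero {r r' : ℝ} {x : N} (h : S.height x ≤ -(r + 1) ∨ r' + 1 ≤ S.height x) :
    S.cutoff r r' x = 0 := by
  rw [cutoff]
  rcases h with h | h
  · rw [Real.smoothTransition.zero_of_nonpos (by linarith), zero_mul]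
  · rw [Real.smoothTransition.zero_of_nonpos (x := r' + 1 - S.height x) (by linarith), mul_zero]

lemma cutoff_of_le {r r' : ℝ} {x : N} (h : -r ≤ S.height x) :
    S.cutoff r r' x = Real.smoothTransition (r' + 1 - S.height x) := by
  rw [cutoff, Real.smoothTransition.one_of_one_le (by linarith), one_mul]

lemma cutoff_eq_one {r r' : ℝ} {x : N} (h : -r ≤ S.height x) (h' : S.height x ≤ r') :
    S.cutoff r r' x = 1 := by
  rw [cutoff_of_le h, Real.smoothTransition.one_of_one_le (by linarith)]

/-- The cut off Hamiltonian is zero from the distance r + 1 on; the further unit ensures that its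
differential vanishes at the points declared fixed. -/
lemma exists_cutoff_isotopy [T2Space N] {ψ : HamIsotopy β}
    (hψ : ∀ t ∉ Icc (0 : ℝ) 1, ∀ x, ψ.ham t x = 0) (r r' : ℝ) :
    ∃ η : HamIsotopy β, (η.ham = fun t x => S.cutoff r r' x * ψ.ham t x) ∧
      ∀ t x, S.height x ≤ -(r + 2) ∨ r' + 2 ≤ S.height x → η.map t x = x := by
  have hc := S.height_smooth.continuous
  have hK : ContMDiff (𝓘(ℝ, ℝ).prod I) 𝓘(ℝ, ℝ) ∞
      (fun q : ℝ × N => S.cutoff r r' q.2 * ψ.ham q.1 q.2) :=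
    ((contMDiff_cutoff r r').comp contMDiff_snd).mul ψ.ham_smooth
  have h0 : ∀ t x, S.height x < -(r + 1) ∨ r' + 1 < S.height x →
      mderiv I 𝓘(ℝ, ℝ) (fun x => S.cutoff r r' x * ψ.ham t x) x = 0 := by
    intro t x hx
    refine mderiv_of_eventuallyEq_const (c := (0 : ℝ)) ?_
    rcases hx with hx | hx
    · filter_upwards [(isOpen_lt hc continuous_const).mem_nhds hx] with y hy
      rw [cutoff_eq_zero (Or.inl (le_of_lt hy)), zero_mul]
    · filter_upwards [(isOpen_lt continuous_const hc).mem_nhds hx] with y hy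
      rw [cutoff_eq_zero (Or.inr (le_of_lt hy)), zero_mul]
  have h1 : ∀ t x, x ∉ S.height ⁻¹' Icc (-(r + 1)) (r' + 1) →
      mderiv I 𝓘(ℝ, ℝ) (fun x => S.cutoff r r' x * ψ.ham t x) x = 0 := by
    intro t x hx
    refine h0 t x ?_
    by_contra! h
    exact hx ⟨h.1, h.2⟩
  have h2 : ∀ t ∉ Icc (0 : ℝ) 1, ∀ x,
      mderiv I 𝓘(ℝ, ℝ) (fun x => S.cutoff r r' x * ψ.ham t x) x = 0 := by
    intro t ht x
    refine mderiv_of_eventuallyEq_const (c := (0 : ℝ)) (Filter.Eventually.of_forall fun y => ?_)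
    beta_reduce
    rw [hψ t ht, mul_zero]
  obtain ⟨η, hη⟩ := HamIsotopy.exists_of_compact S.smooth_form S.nondegenerate
    (K := fun t x => S.cutoff r r' x * ψ.ham t x) hK
    (S.isCompact_preimage (-(r + 1)) (r' + 1)) h1 h2
  refine ⟨η, hη, fun t x hx => η.map_eq_self S.smooth_form S.nondegenerate (fun s => ?_) t⟩
  rw [hη]
  exact h0 s x (hx.imp (fun h => by linarith) fun h => by linarith)

/-- A bound for the height of the trajectories that start in a slab. -/
lemma exists_height_bound {F : ℝ → N → N} (hF : Continuous fun q : ℝ × N => F q.1 q.2)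
    (hFt : ∀ t, ∃ s ∈ Icc (0 : ℝ) 1, F t = F s) (a b : ℝ) :
    ∃ r : ℝ, ∀ t x, a ≤ S.height x → S.height x ≤ b → |S.height (F t x)| < r := by
  obtain ⟨C, hC⟩ := (isCompact_Icc.prod (S.isCompact_preimage a b)).exists_bound_of_continuousOn
    (f := fun q : ℝ × N => S.height (F q.1 q.2)) (s := Icc (0 : ℝ) 1 ×ˢ (S.height ⁻¹' Icc a b))
    (S.height_smooth.continuous.comp hF).continuousOn
  refine ⟨C + 1, fun t x h1 h2 => ?_⟩
  obtain ⟨s, hs, hts⟩ := hFt t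
  rw [hts]
  have h3 : |S.height (F s x)| ≤ C := hC (s, x) ⟨hs, h1, h2⟩
  linarith

/-! ### The moving slab as a barrier -/

section Barrier

variable [T2Space N] {ψ η : HamIsotopy β} {r : ℝ}

/-- Label a point x at time t by the height which its ψ-trajectory reaches at time one. Points with
labels in [-1, 1] form a moving slab that always stays within heights below r in absolute value. A
fixed x at height at most -r is never in that slab, and its label is at most -r < -1 at t = 1; by
the intermediate value theorem the label stays below -1 for all t. -/
lemma height_lt_of_le_neg (hr : ∀ y, |S.height y| ≤ 1 → ∀ t,
      |S.height (ψ.map t ((ψ.map 1).symm y))| < r) (hr1 : 1 < r) {x : N} (hx : S.height x ≤ -r)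
    (t : ℝ) : S.height (ψ.map 1 ((ψ.map t).symm x)) < -1 := by
  by_contra! h
  have hcont : Continuous fun s => S.height (ψ.map 1 ((ψ.map s).symm x)) :=
    S.height_smooth.continuous.comp ((ψ.map 1).contMDiff.continuous.comp
      ((ψ.contMDiff_symm S.smooth_form S.nondegenerate).continuous.comp
        (continuous_id.prodMk continuous_const)))
  have h1 : S.height (ψ.map 1 ((ψ.map 1).symm x)) ≤ -1 := by
    rw [(ψ.map 1).apply_symm_apply]; linarith
  obtain ⟨s, hs⟩ := mem_range_of_exists_le_of_exists_ge hcont ⟨1, h1⟩ ⟨t, h⟩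
  beta_reduce at hs
  have h2 := hr (ψ.map 1 ((ψ.map s).symm x)) (by rw [hs]; norm_num) s
  rw [(ψ.map 1).symm_apply_apply, (ψ.map s).apply_symm_apply] at h2
  linarith [(abs_lt.1 h2).1]

lemma lt_height_of_le (hr : ∀ y, |S.height y| ≤ 1 → ∀ t,
      |S.height (ψ.map t ((ψ.map 1).symm y))| < r) (hr1 : 1 < r) {x : N} (hx : r ≤ S.height x)
    (t : ℝ) : 1 < S.height (ψ.map 1 ((ψ.map t).symm x)) := by
  by_contra! h
  have hcont : Continuous fun s => S.height (ψ.map 1 ((ψ.map s).symm x)) :=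
    S.height_smooth.continuous.comp ((ψ.map 1).contMDiff.continuous.comp
      ((ψ.contMDiff_symm S.smooth_form S.nondegenerate).continuous.comp
        (continuous_id.prodMk continuous_const)))
  have h1 : 1 ≤ S.height (ψ.map 1 ((ψ.map 1).symm x)) := by
    rw [(ψ.map 1).apply_symm_apply]; linarith
  obtain ⟨s, hs⟩ := mem_range_of_exists_le_of_exists_ge hcont ⟨t, h⟩ ⟨1, h1⟩
  beta_reduce at hs
  have h2 := hr (ψ.map 1 ((ψ.map s).symm x)) (by rw [hs]; norm_num) s
  rw [(ψ.map 1).symm_apply_apply, (ψ.map s).apply_symm_apply] at h2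
  linarith [(abs_lt.1 h2).2]

/-- The ψ-trajectory that ends at y remains where η and ψ have the same generating differentials, so
it is also an η-trajectory. By uniqueness, an η-trajectory that meets the moving slab once is such a
trajectory for all times. -/
lemma map_eq_of_abs_le (hr : ∀ y, |S.height y| ≤ 1 → ∀ t,
      |S.height (ψ.map t ((ψ.map 1).symm y))| < r)
    (hη : ∀ t x, |S.height x| < r →
      mderiv I 𝓘(ℝ, ℝ) (η.ham t) x = mderiv I 𝓘(ℝ, ℝ) (ψ.ham t) x)
    {p y : N} (hy : |S.height y| ≤ 1) {t₀ : ℝ}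
    (h : η.map t₀ p = ψ.map t₀ ((ψ.map 1).symm y)) (t : ℝ) :
    η.map t p = ψ.map t ((ψ.map 1).symm y) :=
  (HamIsotopy.map_eq_map S.smooth_form S.nondegenerate h.symm (fun t => hη t _ (hr y hy t)) t).symm

lemma map_eq_of_abs_height_map_le (hr : ∀ y, |S.height y| ≤ 1 → ∀ t,
      |S.height (ψ.map t ((ψ.map 1).symm y))| < r)
    (hη : ∀ t x, |S.height x| < r →
      mderiv I 𝓘(ℝ, ℝ) (η.ham t) x = mderiv I 𝓘(ℝ, ℝ) (ψ.ham t) x)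
    {p : N} (hp : |S.height (ψ.map 1 p)| ≤ 1) (t : ℝ) : η.map t p = ψ.map t p := by
  have h := map_eq_of_abs_le hr hη (p := p) hp (t₀ := 0) (by
    rw [η.map_zero, ψ.map_zero, (ψ.map 1).symm_apply_apply]) t
  rwa [(ψ.map 1).symm_apply_apply] at h

lemma continuous_height_symm (p : N) :
    Continuous fun t => S.height (ψ.map 1 ((ψ.map t).symm (η.map t p))) :=
  S.height_smooth.continuous.comp ((ψ.map 1).contMDiff.continuous.comp
    ((ψ.contMDiff_symm S.smooth_form S.nondegenerate).continuous.comp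
      (continuous_id.prodMk (η.smooth.continuous.comp (continuous_id.prodMk continuous_const)))))

lemma height_eq_of_abs_le (hr : ∀ y, |S.height y| ≤ 1 → ∀ t,
      |S.height (ψ.map t ((ψ.map 1).symm y))| < r)
    (hη : ∀ t x, |S.height x| < r →
      mderiv I 𝓘(ℝ, ℝ) (η.ham t) x = mderiv I 𝓘(ℝ, ℝ) (ψ.ham t) x) {p : N} {t : ℝ}
    (h : |S.height (ψ.map 1 ((ψ.map t).symm (η.map t p)))| ≤ 1) :
    S.height (ψ.map 1 ((ψ.map t).symm (η.map t p))) = S.height (ψ.map 1 p) := by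
  have h1 := map_eq_of_abs_le hr hη (p := p) h (t₀ := t) (by
    rw [(ψ.map 1).symm_apply_apply, (ψ.map t).apply_symm_apply]) 0
  rw [(ψ.map 1).symm_apply_apply, η.map_zero, ψ.map_zero] at h1
  rw [← h1]

/-- To come down, the label would have to take the value 1 at some time; but inside the slab the
η-trajectory follows ψ, so its label would be the initial one, which is greater than 1. -/
lemma one_lt_height_map (hr : ∀ y, |S.height y| ≤ 1 → ∀ t,
      |S.height (ψ.map t ((ψ.map 1).symm y))| < r)
    (hη : ∀ t x, |S.height x| < r →
      mderiv I 𝓘(ℝ, ℝ) (η.ham t) x = mderiv I 𝓘(ℝ, ℝ) (ψ.ham t) x)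
    {p : N} (hp : 1 < S.height (ψ.map 1 p)) (t : ℝ) :
    1 < S.height (ψ.map 1 ((ψ.map t).symm (η.map t p))) := by
  by_contra! h
  obtain ⟨s, hs⟩ := mem_range_of_exists_le_of_exists_ge (continuous_height_symm (S := S) (ψ := ψ)
    (η := η) p) ⟨t, h⟩ ⟨0, by rw [η.map_zero, ψ.symm_map_zero]; exact hp.le⟩
  beta_reduce at hs
  have h1 := height_eq_of_abs_le hr hη (p := p) (t := s) (by rw [hs]; norm_num)
  linarith

/-- The same barrier seen from below. -/
lemma height_map_lt_neg_one (hr : ∀ y, |S.height y| ≤ 1 → ∀ t,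
      |S.height (ψ.map t ((ψ.map 1).symm y))| < r)
    (hη : ∀ t x, |S.height x| < r →
      mderiv I 𝓘(ℝ, ℝ) (η.ham t) x = mderiv I 𝓘(ℝ, ℝ) (ψ.ham t) x)
    {p : N} (hp : S.height (ψ.map 1 p) < -1) (t : ℝ) :
    S.height (ψ.map 1 ((ψ.map t).symm (η.map t p))) < -1 := by
  by_contra! h
  obtain ⟨s, hs⟩ := mem_range_of_exists_le_of_exists_ge (continuous_height_symm (S := S) (ψ := ψ)
    (η := η) p) ⟨0, by rw [η.map_zero, ψ.symm_map_zero]; exact hp.le⟩ ⟨t, h⟩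
  beta_reduce at hs
  have h1 := height_eq_of_abs_le hr hη (p := p) (t := s) (by rw [hs]; norm_num)
  linarith

end Barrier

end LiouvilleCyl

end Cutoffs

end

noncomputable section

/-! ### From an isotopy of cylinders to an invertible cobordism -/

section Cutting

variable {E : Type*} [NormedAddCommGroup E] [NormedSpace ℝ E] {H : Type*} [TopologicalSpace H]
  {I : ModelWithCorners ℝ E H} [I.Boundaryless] {N : Type*} [TopologicalSpace N]
  [ChartedSpace H N] [IsManifold I ∞ N] {β : ∀ x : N, TangentSpace I x →L[ℝ] ℝ}
  [FiniteDimensional ℝ E]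

namespace LiouvilleCyl

variable {S : LiouvilleCyl β}

/-- On the connected slab the actions of two maps that agree there differ by a constant, and the
second one vanishes on A. The constant is thus the same on all components of A in the slab, as
needed for gluing in a cylinder. -/
lemma exists_action_const {f f' : N → N} {G G' : N → ℝ} (h : IsExactMap β f G)
    (h' : IsExactMap β f' G') {A : Set N} {l : ℝ}
    (hff' : ∀ x, |S.height x - l| < 1 → f x = f' x)
    (hA : ∀ x ∈ A, |S.height x - l| < 1 → G' x = 0) :
    ∃ c, ∀ x ∈ A, |S.height x - l| < 1 → G x = c := by
  by_cases hne : ∃ x ∈ A, |S.height x - l| < 1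
  · obtain ⟨x, hxA, hx⟩ := hne
    have hUe : {x | |S.height x - l| < 1} = S.height ⁻¹' Ioo (l - 1) (l + 1) := by
      ext y
      rw [mem_preimage, mem_Ioo, mem_ofPred_eq, abs_lt]
      constructor <;> intro h <;> constructor <;> linarith [h.1, h.2]
    have hU : IsOpen {x | |S.height x - l| < 1} := by
      rw [hUe]; exact isOpen_Ioo.preimage S.height_smooth.continuous
    have hc : IsPreconnected {x | |S.height x - l| < 1} := by
      rw [hUe]; exact S.isPreconnected_preimage _ isPreconnected_Ioo
    refine ⟨G x, fun y hyA hy => ?_⟩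
    have h1 := h.sub_eq h' hU hc hff' (x := x) (y := y) hx hy
    rw [hA x hxA hx, hA y hyA hy] at h1
    linarith
  · push Not at hne
    exact ⟨0, fun x hxA hx => absurd hx (not_lt.2 (hne x hxA))⟩

lemma mderiv_cutoff_eq {ψ : HamIsotopy β} {r r' s s' : ℝ} {t : ℝ} {x : N}
    (h : ∀ᶠ y in nhds x, S.cutoff r r' y = S.cutoff s s' y) :
    mderiv I 𝓘(ℝ, ℝ) (fun x => S.cutoff r r' x * ψ.ham t x) x =
      mderiv I 𝓘(ℝ, ℝ) (fun x => S.cutoff s s' x * ψ.ham t x) x := by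
  refine Filter.EventuallyEq.mfderiv_eq ?_
  filter_upwards [h] with y hy
  rw [hy]

lemma mderiv_cutoff_mul {ψ : HamIsotopy β} {r r' : ℝ} (t : ℝ) {x : N} (h : -r < S.height x)
    (h' : S.height x < r') :
    mderiv I 𝓘(ℝ, ℝ) (fun x => S.cutoff r r' x * ψ.ham t x) x =
      mderiv I 𝓘(ℝ, ℝ) (ψ.ham t) x := by
  refine Filter.EventuallyEq.mfderiv_eq ?_
  filter_upwards [(isOpen_lt continuous_const S.height_smooth.continuous).mem_nhds h,
    (isOpen_lt S.height_smooth.continuous continuous_const).mem_nhds h'] with y hy hy'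
  rw [cutoff_eq_one (le_of_lt hy) (le_of_lt hy'), one_mul]

section Core

variable [T2Space N] {ψ ηA ηB : HamIsotopy β} {r s : ℝ}

/-- How the cut off isotopies compare with the original one. -/
structure IsCutPair (S : LiouvilleCyl β) (ψ ηA ηB : HamIsotopy β) (r s : ℝ) : Prop where
  one_lt : 1 < r
  le : r ≤ s
  bound : ∀ y, |S.height y| ≤ 1 → ∀ t, |S.height (ψ.map t ((ψ.map 1).symm y))| < r
  bound' : ∀ t x, -(r + 4) ≤ S.height x → S.height x ≤ r → |S.height (ψ.map t x)| < s
  hamA : ηA.ham = fun t x => S.cutoff s r x * ψ.ham t x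
  hamB : ηB.ham = fun t x => S.cutoff r r x * ψ.ham t x
  fixA : ∀ t x, S.height x ≤ -(s + 2) ∨ r + 2 ≤ S.height x → ηA.map t x = x
  fixB : ∀ t x, S.height x ≤ -(r + 2) ∨ r + 2 ≤ S.height x → ηB.map t x = x

namespace IsCutPair

lemma mderivA (h : S.IsCutPair ψ ηA ηB r s) (t : ℝ) (x : N) (h1 : -s < S.height x)
    (h2 : S.height x < r) :
    mderiv I 𝓘(ℝ, ℝ) (ηA.ham t) x = mderiv I 𝓘(ℝ, ℝ) (ψ.ham t) x := by
  rw [h.hamA]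
  exact mderiv_cutoff_mul t h1 h2

lemma mderivA_of_abs (h : S.IsCutPair ψ ηA ηB r s) (t : ℝ) (x : N) (hx : |S.height x| < r) :
    mderiv I 𝓘(ℝ, ℝ) (ηA.ham t) x = mderiv I 𝓘(ℝ, ℝ) (ψ.ham t) x :=
  h.mderivA t x (by linarith [(abs_lt.1 hx).1, h.le]) (abs_lt.1 hx).2

lemma mderivB_of_abs (h : S.IsCutPair ψ ηA ηB r s) (t : ℝ) (x : N) (hx : |S.height x| < r) :
    mderiv I 𝓘(ℝ, ℝ) (ηB.ham t) x = mderiv I 𝓘(ℝ, ℝ) (ψ.ham t) x := by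
  rw [h.hamB]
  exact mderiv_cutoff_mul t (abs_lt.1 hx).1 (abs_lt.1 hx).2

/-- The two cutoffs have the same upper level and both lower levels are at most -r. -/
lemma mderivA_eq_mderivB (h : S.IsCutPair ψ ηA ηB r s) (t : ℝ) (x : N) (hx : -r < S.height x) :
    mderiv I 𝓘(ℝ, ℝ) (ηA.ham t) x = mderiv I 𝓘(ℝ, ℝ) (ηB.ham t) x := by
  rw [h.hamA, h.hamB]
  refine mderiv_cutoff_eq ?_
  filter_upwards [(isOpen_lt continuous_const S.height_smooth.continuous).mem_nhds hx] with y hy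
  rw [cutoff_of_le (le_of_lt hy), cutoff_of_le (by linarith [h.le, (show -r < S.height y from hy)])]

/-- The trajectory of ψ ending at y keeps within the heights where nothing is cut off. -/
lemma symmB_eq (h : S.IsCutPair ψ ηA ηB r s) {y : N} (hy : |S.height y| ≤ 1) :
    (ηB.map 1).symm y = (ψ.map 1).symm y := by
  have h1 := map_eq_of_abs_le h.bound h.mderivB_of_abs (p := (ηB.map 1).symm y) hy (t₀ := 1)
    (by rw [(ηB.map 1).apply_symm_apply, (ψ.map 1).apply_symm_apply]) 0
  rwa [ηB.map_zero, ψ.map_zero] at h1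

/-- Where the original isotopy ends near height zero, it agrees with the two cut off ones. -/
lemma map_eq_of_abs (h : S.IsCutPair ψ ηA ηB r s) {p : N} (hp : |S.height (ψ.map 1 p)| ≤ 1) :
    ηA.map 1 p = ψ.map 1 p ∧ ηB.map 1 p = ψ.map 1 p :=
  ⟨map_eq_of_abs_height_map_le h.bound h.mderivA_of_abs hp 1,
    map_eq_of_abs_height_map_le h.bound h.mderivB_of_abs hp 1⟩

/-- Such a trajectory of ηB remains above the moving slab. Points at height at most -r are below the
slab at all times, so the trajectory never gets to where the two cutoffs differ. -/
lemma map_eq_of_one_lt (h : S.IsCutPair ψ ηA ηB r s) {p : N} (hp : 1 < S.height (ψ.map 1 p)) :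
    ηA.map 1 p = ηB.map 1 p ∧ 1 < S.height (ηB.map 1 p) := by
  have h1 := one_lt_height_map h.bound h.mderivB_of_abs hp
  constructor
  · refine (HamIsotopy.map_eq_map S.smooth_form S.nondegenerate (φ := ηB) (ψ := ηA) (t₀ := 0)
      (by rw [ηA.map_zero, ηB.map_zero]) (fun t => h.mderivA_eq_mderivB t _ ?_) 1).symm
    by_contra! h2
    linarith [h1 t, height_lt_of_le_neg h.bound h.one_lt h2 t]
  · have h2 := h1 1
    rwa [(ψ.map 1).apply_symm_apply] at h2

/-- The trajectory of ψ from p lies below the moving slab, hence never reaches height r. If it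
starts no lower than -(r + 4), it also stays above -s, so that ηA does not cut it. -/
lemma map_eq_of_lt_neg_one (h : S.IsCutPair ψ ηA ηB r s) {p : N} (hp : S.height (ψ.map 1 p) < -1) :
    (-(r + 4) ≤ S.height p → ηA.map 1 p = ψ.map 1 p) ∧ S.height (ηB.map 1 p) < -1 := by
  have hlt : ∀ t, S.height (ψ.map t p) < r := by
    intro t
    by_contra! h2
    have h3 := lt_height_of_le h.bound h.one_lt h2 t
    rw [(ψ.map t).symm_apply_apply] at h3
    linarith
  constructor
  · intro hp4
    have hpr := hlt 0
    rw [ψ.map_zero] at hpr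
    refine (HamIsotopy.map_eq_map S.smooth_form S.nondegenerate (φ := ψ) (ψ := ηA) (t₀ := 0)
      (by rw [ηA.map_zero, ψ.map_zero]) (fun t => h.mderivA t _ ?_ (hlt t)) 1).symm
    exact (abs_lt.1 (h.bound' t p hp4 hpr.le)).1
  · have h2 := height_map_lt_neg_one h.bound h.mderivB_of_abs hp 1
    rwa [(ψ.map 1).apply_symm_apply] at h2

/-- The image of `Z'` under the first isotopy backward followed by the second one. -/
lemma mapA_symmB_of_neg_one_le (h : S.IsCutPair ψ ηA ηB r s) {y : N} (hy : -1 ≤ S.height y) :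
    ηA.map 1 ((ηB.map 1).symm y) = y := by
  set p := (ηB.map 1).symm y with hp
  have hpy : ηB.map 1 p = y := (ηB.map 1).apply_symm_apply y
  rcases le_or_gt |S.height (ψ.map 1 p)| 1 with h1 | h1
  · obtain ⟨h2, h3⟩ := h.map_eq_of_abs h1
    rw [h2, ← h3, hpy]
  · rcases lt_abs.1 h1 with h1 | h1
    · rw [(h.map_eq_of_one_lt h1).1, hpy]
    · have h2 := (h.map_eq_of_lt_neg_one (p := p) (by linarith)).2
      rw [hpy] at h2
      linarith

/-- Everything below -(r + 2) is fixed by ηB, so no point crosses the level -(r + 4). -/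
lemma height_symmB (h : S.IsCutPair ψ ηA ηB r s) {y : N} (h1 : -(r + 4) ≤ S.height y) :
    -(r + 4) ≤ S.height ((ηB.map 1).symm y) := by
  by_contra! h2
  have h3 := h.fixB 1 ((ηB.map 1).symm y) (Or.inl (by linarith))
  rw [(ηB.map 1).apply_symm_apply] at h3
  rw [← h3] at h2
  linarith

/-- The preimage of y under ηB does not end above the slab, since it would then be sent above height
1 by ηB; in the two remaining cases ηA and ψ agree on it. -/
lemma mapA_symmB_of_lt (h : S.IsCutPair ψ ηA ηB r s) {y : N} (h1 : -(r + 4) ≤ S.height y)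
    (hy : S.height y < -1) :
    ηA.map 1 ((ηB.map 1).symm y) = ψ.map 1 ((ηB.map 1).symm y) := by
  have h4 := h.height_symmB h1
  set p := (ηB.map 1).symm y with hp
  have hpy : ηB.map 1 p = y := (ηB.map 1).apply_symm_apply y
  rcases le_or_gt |S.height (ψ.map 1 p)| 1 with h1 | h1
  · exact (h.map_eq_of_abs h1).1
  · rcases lt_abs.1 h1 with h1 | h1
    · have h2 := (h.map_eq_of_one_lt h1).2
      rw [hpy] at h2
      linarith
    · exact (h.map_eq_of_lt_neg_one (p := p) (by linarith)).1 h4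

end IsCutPair

end Core

/-- First r is chosen to bound the trajectories that end within heights -1 and 1, then s to bound
those that start between -(r + 4) and r. Only the finite time interval matters, so compactness of
slabs gives both bounds. -/
lemma exists_isCutPair [T2Space N] {ψ : HamIsotopy β}
    (hψ : ∀ t ∉ Icc (0 : ℝ) 1, ∀ x, ψ.ham t x = 0)
    (hψt : ∀ t, ∃ s ∈ Icc (0 : ℝ) 1, ψ.map t = ψ.map s) :
    ∃ ηA ηB r s, S.IsCutPair ψ ηA ηB r s := by
  obtain ⟨r, hr⟩ := S.exists_height_bound (F := fun t x => ψ.map t ((ψ.map 1).symm x))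
    (ψ.smooth.comp (contMDiff_fst.prodMk ((ψ.map 1).symm.contMDiff.comp contMDiff_snd))).continuous
    (fun t => by
      obtain ⟨s, hs, hst⟩ := hψt t
      exact ⟨s, hs, by rw [hst]⟩) (-1) 1
  have hr' : ∀ y, |S.height y| ≤ 1 → ∀ t,
      |S.height (ψ.map t ((ψ.map 1).symm y))| < max r 2 := fun y hy t =>
    (hr t y (abs_le.1 hy).1 (abs_le.1 hy).2).trans_le (le_max_left _ _)
  set r' := max r 2 with hr2
  obtain ⟨s, hs⟩ := S.exists_height_bound (F := fun t x => ψ.map t x) ψ.smooth.continuous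
    (fun t => by
      obtain ⟨s, hs, hst⟩ := hψt t
      exact ⟨s, hs, by rw [hst]⟩) (-(r' + 4)) r'
  obtain ⟨ηA, h1, h2⟩ := S.exists_cutoff_isotopy hψ (max s r') r'
  obtain ⟨ηB, h3, h4⟩ := S.exists_cutoff_isotopy hψ r' r'
  exact ⟨ηA, ηB, r', max s r', lt_of_lt_of_le (by norm_num) (le_max_right r 2), le_max_right _ _,
    hr', fun t x hx hx' => (hs t x hx hx').trans_le (le_max_left _ _), h1, h3, h2, h4⟩

/-- Isotopic cylinders are the ends of an invertible cobordism. -/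
theorem exists_invertible_of_isotopy [T2Space N] {k : ℕ} (hE : Module.finrank ℝ E = 2 * k)
    {Z Z' : Set N} (hZ : S.IsCylinder k Z) (hZ' : S.IsCylinder k Z') {φ : HamIsotopy β}
    (hφ : φ.map 1 '' Z = Z') :
    ∃ R L L', S.IsCob k Z Z' R L ∧ S.IsCob k Z' Z R L' ∧
      (∃ a b t₁ : ℝ, ∀ t, t₁ ≤ t → S.RelIsotopic a (b + t) (S.comp L L' t) Z) ∧
      ∃ a b t₁ : ℝ, ∀ t, t₁ ≤ t → S.RelIsotopic a (b + t) (S.comp L' L t) Z' := by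
  obtain ⟨φ₁, hφ₁, G, hG, hG0⟩ := exists_action_eq_zero hZ hZ' hφ
  -- The reparametrized isotopy rests outside [0, 1], with vanishing Hamiltonian there, and has the
  -- same time one map.
  set ψ := φ₁.reparam Real.smoothTransition Real.smoothTransition.contDiff
    Real.smoothTransition.zero with hψd
  have hψ1 : ψ.map 1 = φ₁.map 1 :=
    congrArg φ₁.map (Real.smoothTransition.one_of_one_le le_rfl)
  rw [← hψ1] at hφ₁ hG
  obtain ⟨ηA, ηB, r, s, h⟩ := S.exists_isCutPair (ψ := ψ) (fun t ht x => by
    have h1 : deriv Real.smoothTransition t = 0 := by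
      rw [mem_Icc, not_and_or, not_le, not_le] at ht
      rcases ht with ht | ht
      · have h2 : Real.smoothTransition =ᶠ[nhds t] fun _ => 0 := by
          filter_upwards [Iio_mem_nhds ht] with s hs
          exact Real.smoothTransition.zero_of_nonpos (le_of_lt hs)
        rw [h2.deriv_eq, deriv_const]
      · have h2 : Real.smoothTransition =ᶠ[nhds t] fun _ => 1 := by
          filter_upwards [Ioi_mem_nhds ht] with s hs
          exact Real.smoothTransition.one_of_one_le (le_of_lt hs)
        rw [h2.deriv_eq, deriv_const]
    change deriv Real.smoothTransition t * _ = 0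
    rw [h1, zero_mul]) (fun t => by
    rcases le_or_gt t 0 with ht | ht
    · exact ⟨0, ⟨le_rfl, zero_le_one⟩, congrArg φ₁.map (by
        rw [Real.smoothTransition.zero_of_nonpos ht, Real.smoothTransition.zero])⟩
    · rcases le_or_gt t 1 with ht' | ht'
      · exact ⟨t, ⟨ht.le, ht'⟩, rfl⟩
      · exact ⟨1, ⟨zero_le_one, le_rfl⟩, congrArg φ₁.map (by
          rw [Real.smoothTransition.one_of_one_le ht'.le,
            Real.smoothTransition.one_of_one_le le_rfl])⟩)
  have hr := h.one_lt
  have hrs := h.le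
  have hmem : ∀ x, ψ.map 1 x ∈ Z' ↔ x ∈ Z := fun x => by
    rw [← hφ₁]; exact (ψ.map 1).injective.mem_set_image
  have hmem' : ∀ x, (ψ.map 1).symm x ∈ Z ↔ x ∈ Z' := fun x => by
    rw [← hmem, (ψ.map 1).apply_symm_apply]
  set R := r + s + 5 with hR
  -- B is Z far up and far down, and Z' at heights between -1 and 1, where ηB⁻¹ and ψ⁻¹ agree.
  set B := ηB.map 1 '' Z with hB
  have hBmem : ∀ x, x ∈ B ↔ (ηB.map 1).symm x ∈ Z := fun x => by
    rw [hB]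
    conv_lhs => rw [← (ηB.map 1).apply_symm_apply x]
    exact (ηB.map 1).injective.mem_set_image
  obtain ⟨GB, hGB⟩ := ηB.exists_action S.smooth_form
  obtain ⟨hB1, hB2, hB3, hB4, hB5, ⟨cb, hcb⟩, ct, hct⟩ := exists_primitive_image hZ h.fixB hGB
  rw [← hB] at hB1 hB2 hB3 hB5
  have hBZ' : ∀ x, |S.height x| ≤ 1 → (x ∈ B ↔ x ∈ Z') := fun x hx => by
    rw [hBmem, h.symmB_eq hx, hmem']
  -- The vanishing of the action of ψ on Z is used here: on B near height 0 the primitive is a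
  -- single constant, so that each half of B remains exact, with constant primitive at the ends,
  -- when continued by the cylinder.
  obtain ⟨c, hc⟩ := S.exists_action_const hGB.symm hG.symm (A := B) (l := 0)
    (fun x hx => by rw [sub_zero] at hx; exact h.symmB_eq hx.le)
    (fun x hxB hx => by
      rw [sub_zero] at hx
      rw [hG0 _ ((hmem' x).2 ((hBZ' x hx.le).1 hxB)), neg_zero])
  have hc' : ∀ x ∈ B, |S.height x - 0| < 1 → GB ((ηB.map 1).symm x) = -c := fun x hx hx' => by
    linarith [hc x hx hx']
  set L := {x | (S.height x ≤ 0 ∧ x ∈ B) ∨ (0 < S.height x ∧ x ∈ Z')} with hL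
  set L' := {x | (S.height x ≤ 0 ∧ x ∈ Z') ∨ (0 < S.height x ∧ x ∈ B)} with hL'
  have hBZ0 : ∀ x, |S.height x - 0| ≤ 1 → (x ∈ B ↔ x ∈ Z') := fun x hx =>
    hBZ' x (by rwa [sub_zero] at hx)
  have hLcob : S.IsCob k Z Z' R L := isCob_glue_top hZ' hB1 hB2
    (fun x hx => hB3 x (Or.inl (by linarith))) hB4 hB5 (fun x _ hx => hcb x (by linarith)) hBZ0 hc'
    (by linarith) (by linarith)
  have hLcob' : S.IsCob k Z' Z R L' := isCob_glue_bot hZ' hB1 hB2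
    (fun x hx => hB3 x (Or.inr (by linarith))) hB4 hB5 (fun x _ hx => hct x (by linarith)) hBZ0 hc'
    (by linarith) (by linarith)
  -- Composed without any shift, L and L' give back B, which the reverse of ηB carries to Z.
  have h₂ : ∃ a b t₁ : ℝ, ∀ t, t₁ ≤ t → S.RelIsotopic a (b + t) (S.comp L L' t) Z := by
    refine exists_relIsotopic_comp hE hZ' hLcob' S.height_smooth S.height_push (ε := 1) (t₀ := 0)
      zero_lt_one (fun x hx => ?_) (fun x hx => ?_) (a₀ := -(r + 2)) (b₀ := r + 2) ?_
    · rcases hx.eq_or_lt with hx | hx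
      · simp only [hL, mem_ofPred_eq, ← hx, le_refl, lt_irrefl, true_and, false_and, or_false]
        exact hBZ' x (by rw [← hx]; norm_num)
      · simp only [hL, mem_ofPred_eq, not_le.2 hx, hx, true_and, false_and, false_or]
    · rw [neg_zero, S.push_zero]
      rcases le_or_gt (S.height x) 0 with h0 | h0
      · simp only [hL', mem_ofPred_eq, not_lt.2 h0, h0, true_and, false_and, or_false]
      · simp only [hL', mem_ofPred_eq, not_le.2 h0, h0, true_and, false_and, false_or]
        exact hBZ' x (abs_le.2 ⟨by linarith, hx⟩)
    · have h1 : {x | (S.height x ≤ 0 ∧ x ∈ L) ∨ (0 < S.height x ∧ S.push (-0) x ∈ L')} = B := by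
        ext x
        rw [mem_ofPred_eq, neg_zero, S.push_zero]
        rcases le_or_gt (S.height x) 0 with h0 | h0
        · simp only [hL, mem_ofPred_eq, not_lt.2 h0, h0, true_and, false_and, or_false]
        · simp only [hL', mem_ofPred_eq, not_le.2 h0, h0, true_and, false_and, false_or]
      rw [h1]
      exact RelIsotopic.symm ⟨ηB, h.fixB, rfl⟩
  -- For the left inverse, Q = ηB ηA⁻¹(Z') is compared with B. It equals Z' above height -1 and B
  -- between -(r + 4) and 0, in particular Z around -(r + 3). So cutting Q at -(r + 3) leaves P
  -- below the cut and L above it, and χ has bounded support.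
  set χ := ηA.reverse.trans ηB with hχ
  have hχ1 : ∀ x, χ.map 1 x = ηB.map 1 ((ηA.map 1).symm x) := fun x => by
    rw [hχ, HamIsotopy.trans_map_one, HamIsotopy.reverse_map, sub_self, ηA.map_zero]
  have hχs : ∀ x, (χ.map 1).symm x = ηA.map 1 ((ηB.map 1).symm x) := fun x => by
    refine (χ.map 1).injective (((χ.map 1).apply_symm_apply x).trans ?_)
    refine Eq.trans ?_ (hχ1 _).symm
    rw [(ηA.map 1).symm_apply_apply, (ηB.map 1).apply_symm_apply]
  have hχf : ∀ t x, S.height x ≤ -(s + 2) ∨ s + 2 ≤ S.height x → χ.map t x = x := by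
    intro t x hx
    have hA : ∀ t, ηA.map t x = x := fun t =>
      h.fixA t x (hx.imp id fun hx => by linarith)
    have hAs : (ηA.map 1).symm x = x := by
      conv_lhs => rw [← hA 1]
      exact (ηA.map 1).symm_apply_apply x
    rw [hχ, HamIsotopy.trans_map, HamIsotopy.reverse_map, hAs, hA,
      h.fixB _ x (hx.imp (fun hx => by linarith) fun hx => by linarith)]
  set Q := χ.map 1 '' Z' with hQ
  have hQmem : ∀ x, x ∈ Q ↔ ηA.map 1 ((ηB.map 1).symm x) ∈ Z' := fun x => by
    rw [hQ, ← hχs]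
    conv_lhs => rw [← (χ.map 1).apply_symm_apply x]
    exact (χ.map 1).injective.mem_set_image
  obtain ⟨GQ, hGQ⟩ := χ.exists_action S.smooth_form
  obtain ⟨hQ1, hQ2, hQ3, hQ4, hQ5, ⟨cq, hcq⟩, -⟩ := exists_primitive_image hZ' hχf hGQ
  rw [← hQ] at hQ1 hQ2 hQ3 hQ5
  have hQZ' : ∀ x, -1 ≤ S.height x → (x ∈ Q ↔ x ∈ Z') := fun x hx => by
    rw [hQmem, h.mapA_symmB_of_neg_one_le hx]
  have hQB : ∀ x, -(r + 4) ≤ S.height x → S.height x ≤ 0 → (x ∈ Q ↔ x ∈ B) := by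
    intro x hx hx0
    rcases lt_or_ge (S.height x) (-1) with h1 | h1
    · rw [hQmem, h.mapA_symmB_of_lt hx h1, hmem, hBmem]
    · rw [hQZ' x h1, hBZ' x (abs_le.2 ⟨h1, by linarith⟩)]
  have hBsymm : ∀ x, S.height x ≤ -(r + 2) → (ηB.map 1).symm x = x := fun x hx => by
    conv_lhs => rw [← h.fixB 1 x (Or.inl hx)]
    exact (ηB.map 1).symm_apply_apply x
  have hQZ : ∀ x, |S.height x - -(r + 3)| ≤ 1 → (x ∈ Q ↔ x ∈ Z) := by
    intro x hx
    obtain ⟨hx1, hx2⟩ := abs_le.1 hx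
    rw [hQB x (by linarith) (by linarith), hB3 x (Or.inl (by linarith))]
  -- Around height -(r + 3) the inverse of χ is ψ itself, because ηB is the identity and ηA is not
  -- yet cut off. The action of ψ vanishes on Z, so the primitive on Q is constant at the new cut as
  -- well.
  obtain ⟨d, hd⟩ := S.exists_action_const hGQ.symm hG (A := Q) (l := -(r + 3))
    (fun x hx => by
      obtain ⟨hx1, hx2⟩ := abs_lt.1 hx
      rw [hχs, h.mapA_symmB_of_lt (by linarith) (by linarith), hBsymm x (by linarith)])
    (fun x hxQ hx => hG0 x ((hQZ x hx.le).1 hxQ))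
  have hd' : ∀ x ∈ Q, |S.height x - -(r + 3)| < 1 → GQ ((χ.map 1).symm x) = -d :=
    fun x hx hx' => by linarith [hd x hx hx']
  set P := {x | (S.height x ≤ -(r + 3) ∧ x ∈ Q) ∨ (-(r + 3) < S.height x ∧ x ∈ Z)} with hP
  have hPcob : S.IsCob k Z' Z R P := isCob_glue_top hZ hQ1 hQ2
    (fun x hx => hQ3 x (Or.inl (by linarith))) hQ4 hQ5 (fun x _ hx => hcq x (by linarith)) hQZ hd'
    (by linarith) (by linarith)
  have h₁ : ∃ a b t₁ : ℝ, ∀ t, t₁ ≤ t → S.RelIsotopic a (b + t) (S.comp P L t) Z' := by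
    have hu : ContMDiff I 𝓘(ℝ, ℝ) ∞ fun x => S.height x + (r + 3) :=
      S.height_smooth.add contMDiff_const
    refine exists_relIsotopic_comp hE hZ hLcob hu
      (fun t x => by rw [S.height_push]; ring) (ε := 1) (t₀ := 0)
      zero_lt_one (fun x hx => ?_) (fun x hx => ?_) (a₀ := -(s + 2)) (b₀ := s + 2) ?_
    · rcases hx.eq_or_lt with hx | hx
      · have hx' : S.height x = -(r + 3) := by linarith
        simp only [hP, mem_ofPred_eq, hx', le_refl, lt_irrefl, true_and, false_and, or_false]
        exact hQZ x (by rw [hx']; norm_num)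
      · have hx' : -(r + 3) < S.height x := by linarith
        simp only [hP, mem_ofPred_eq, not_le.2 hx', hx', true_and, false_and, false_or]
    · rw [neg_zero, S.push_zero]
      have h0 : S.height x ≤ 0 := by linarith
      simp only [hL, mem_ofPred_eq, not_lt.2 h0, h0, true_and, false_and, or_false]
      exact hB3 x (Or.inl (by linarith))
    · have h1 : {x | (S.height x + (r + 3) ≤ 0 ∧ x ∈ P) ∨
          (0 < S.height x + (r + 3) ∧ S.push (-0) x ∈ L)} = Q := by
        ext x
        rw [mem_ofPred_eq, neg_zero, S.push_zero]
        rcases le_or_gt (S.height x + (r + 3)) 0 with h0 | h0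
        · have h0' : S.height x ≤ -(r + 3) := by linarith
          simp only [hP, mem_ofPred_eq, not_lt.2 h0, h0, h0', not_lt.2 h0', true_and, false_and,
            or_false]
        · simp only [not_le.2 h0, h0, true_and, false_and, false_or]
          rcases le_or_gt (S.height x) 0 with h0' | h0'
          · simp only [hL, mem_ofPred_eq, not_lt.2 h0', h0', true_and, false_and, or_false]
            exact (hQB x (by linarith) h0').symm
          · simp only [hL, mem_ofPred_eq, not_le.2 h0', h0', true_and, false_and, false_or]
            exact (hQZ' x (by linarith)).symm
      rw [h1]
      exact RelIsotopic.symm ⟨χ, hχf, rfl⟩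
  -- P is a left and L' a right inverse of L, so L' is inverse on both sides.
  exact ⟨R, L, L', hLcob, hLcob', h₂, exists_relIsotopic_comp_swap hZ hZ' hPcob hLcob hLcob' h₁ h₂⟩

end LiouvilleCyl

end Cutting

end

noncomputable section

/-! ### Products of functions and one-forms -/

section ScaledForms

variable {E : Type*} [NormedAddCommGroup E] [NormedSpace ℝ E] {H : Type*} [TopologicalSpace H]
  {I : ModelWithCorners ℝ E H} [I.Boundaryless] {N : Type*} [TopologicalSpace N]
  [ChartedSpace H N] [IsManifold I ∞ N] {β : ∀ x : N, TangentSpace I x →L[ℝ] ℝ} {f : N → ℝ}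

lemma localForm_smul (p : N) (y : E) : localForm I (fun x => f x • β x) p y =
    f ((extChartAt I p).symm y) • localForm I β p y :=
  ContinuousLinearMap.ext fun _ => rfl

lemma IsSmoothForm.smul (hβ : IsSmoothForm I β) (hf : ContMDiff I 𝓘(ℝ, ℝ) ∞ f) :
    IsSmoothForm I fun x => f x • β x := by
  rw [isSmoothForm_iff] at hβ ⊢
  intro p
  have h1 := (contMDiffOn_extChartAt_iff f p).1 hf.contMDiffOn
  exact (h1.smul (hβ p)).congr fun y _ => localForm_smul p y

/-- The exterior derivative of the product of a function and a one-form. -/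
lemma extD_smul (hβ : IsSmoothForm I β) (hf : ContMDiff I 𝓘(ℝ, ℝ) ∞ f) (x : N) (u v : E) :
    extD I (fun x => f x • β x) x u v = mderiv I 𝓘(ℝ, ℝ) f x u * β x v -
      mderiv I 𝓘(ℝ, ℝ) f x v * β x u + f x * extD I β x u v := by
  set y := extChartAt I x x with hy
  have hyt : y ∈ (extChartAt I x).target := mem_extChartAt_target x
  have hn : (extChartAt I x).target ∈ nhds y := (isOpen_extChartAt_target x).mem_nhds hyt
  have hF : HasFDerivAt (fun z => f ((extChartAt I x).symm z))
      (fderiv ℝ (fun z => f ((extChartAt I x).symm z)) y) y :=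
    (((contMDiffOn_extChartAt_iff f x).1 hf.contMDiffOn).contDiffAt hn).differentiableAt
      (by simp) |>.hasFDerivAt
  have hb : HasFDerivAt (localForm I β x) (fderiv ℝ (localForm I β x) y) y :=
    (((isSmoothForm_iff β).1 hβ x).contDiffAt hn).differentiableAt (by simp) |>.hasFDerivAt
  have h1 : localForm I (fun x => f x • β x) x =
      fun z => f ((extChartAt I x).symm z) • localForm I β x z := funext fun z => localForm_smul x z
  have h2 : ∀ w : E, fderiv ℝ (fun z => f ((extChartAt I x).symm z)) y w =
      mderiv I 𝓘(ℝ, ℝ) f x w := by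
    intro w
    have h3 : mderiv I 𝓘(ℝ, ℝ) f x = fderivWithin ℝ (writtenInExtChartAt I 𝓘(ℝ, ℝ) x f)
        (range I) y := (hf.mdifferentiableAt (by simp)).mfderiv
    rw [h3, I.range_eq_univ, fderivWithin_univ]
    rfl
  have h4 : ∀ w : E, localForm I β x y w = β x w := by
    intro w
    refine (localForm_apply β (mem_extChartAt_source x) w).trans ?_
    exact congrArg (fun w : E => β x w) (mfderiv_extChartAt_symm_self_apply x w)
  have hfy : f ((extChartAt I x).symm y) = f x := by rw [hy, extChartAt_to_inv]
  have h5 : ∀ u v : E, fderiv ℝ (localForm I (fun x => f x • β x) x) y u v =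
      f x * fderiv ℝ (localForm I β x) y u v + mderiv I 𝓘(ℝ, ℝ) f x u * β x v := by
    intro u v
    have h8 : fderiv ℝ (localForm I (fun x => f x • β x) x) y =
        f ((extChartAt I x).symm y) • fderiv ℝ (localForm I β x) y +
          (fderiv ℝ (fun z => f ((extChartAt I x).symm z)) y).smulRight (localForm I β x y) := by
      rw [h1]
      exact (hF.smul hb).fderiv
    rw [h8, hfy]
    exact congrArg₂ (fun a b => f x * fderiv ℝ (localForm I β x) y u v + a * b) (h2 u) (h4 v)
  have h6 : extD I (fun x => f x • β x) x u v =
      fderiv ℝ (localForm I (fun x => f x • β x) x) y u v -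
        fderiv ℝ (localForm I (fun x => f x • β x) x) y v u := rfl
  have h7 : extD I β x u v = fderiv ℝ (localForm I β x) y u v -
      fderiv ℝ (localForm I β x) y v u := rfl
  rw [h6, h7, h5, h5]
  ring

/-- The quotient of two proportional smooth forms is smooth. -/
lemma contMDiff_of_smul (hβ : IsSmoothForm I β) (h0 : ∀ x, β x ≠ 0)
    (hf : IsSmoothForm I fun x => f x • β x) : ContMDiff I 𝓘(ℝ, ℝ) ∞ f := by
  intro p
  -- In the chart both forms are evaluated on a constant vector v on which β does not vanish near p;
  -- f is the quotient of the two smooth functions.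
  obtain ⟨v, hv⟩ : ∃ v : E, localForm I β p (extChartAt I p p) v ≠ 0 := by
    by_contra! hc
    refine h0 p (ContinuousLinearMap.ext fun (w : E) => ?_)
    refine Eq.trans ?_ (hc w)
    refine ((localForm_apply β (mem_extChartAt_source p) w).trans ?_).symm
    exact congrArg (fun w : E => β p w) (mfderiv_extChartAt_symm_self_apply p w)
  have hn : (extChartAt I p).target ∈ nhds (extChartAt I p p) :=
    (isOpen_extChartAt_target p).mem_nhds (mem_extChartAt_target p)
  have h1 := (((isSmoothForm_iff _).1 hβ p).contDiffAt hn).clm_apply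
    (contDiffAt_const (c := v))
  have h2 := (((isSmoothForm_iff _).1 hf p).contDiffAt hn).clm_apply
    (contDiffAt_const (c := v))
  have h3 := (h2.div h1 hv).contMDiffAt.comp p
    (contMDiffAt_extChartAt (I := I) (x := p) (n := ∞))
  refine h3.congr_of_eventuallyEq ?_
  have hne : ∀ᶠ y in nhds (extChartAt I p p), localForm I β p y v ≠ 0 :=
    h1.continuousAt.eventually_ne hv
  filter_upwards [(continuousAt_extChartAt p).eventually hne, extChartAt_source_mem_nhds (I := I) p]
    with q hq hqs
  change f q = localForm I (fun x => f x • β x) p (extChartAt I p q) v /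
    localForm I β p (extChartAt I p q) v
  rw [localForm_smul, (extChartAt I p).left_inv hqs, smul_apply, smul_eq_mul, mul_div_assoc,
    div_self hq, mul_one]

end ScaledForms

/-! ### Coordinates on the symplectization -/

namespace ContactStructure

variable {m : ℕ} {M : Type*} [TopologicalSpace M]
  [ChartedSpace (EuclideanSpace ℝ (Fin (2 * m + 1))) M] [IsManifold (𝓡 (2 * m + 1)) ∞ M]
  {ξ : ContactStructure m M}

/-- In a change of coordinates the trivialization cancels against its inverse, leaving one of M × ℝ.
-/
lemma trans_mem_maximalAtlas
    {e : OpenPartialHomeomorph (M × ℝ) (ModelProd (EuclideanSpace ℝ (Fin (2 * m + 1))) ℝ)}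
    (he : e ∈ IsManifold.maximalAtlas (sympModel m) ∞ (M × ℝ)) :
    ξ.trivializationHomeo.toOpenPartialHomeomorph.trans e ∈
      IsManifold.maximalAtlas (sympModel m) ∞ ξ.Symp := by
  rw [IsManifold.mem_maximalAtlas_iff] at he ⊢
  rintro _ ⟨c, hc, rfl⟩
  obtain ⟨h1, h2⟩ := he c hc
  have h3 : ∀ a b : OpenPartialHomeomorph (M × ℝ)
      (ModelProd (EuclideanSpace ℝ (Fin (2 * m + 1))) ℝ),
      a.symm.trans b ∈ contDiffGroupoid ∞ (sympModel m) →
      (ξ.trivializationHomeo.toOpenPartialHomeomorph.trans a).symm.trans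
        (ξ.trivializationHomeo.toOpenPartialHomeomorph.trans b) ∈
        contDiffGroupoid ∞ (sympModel m) := by
    intro a b hab
    refine (contDiffGroupoid ∞ (sympModel m)).mem_of_eqOnSource hab ?_
    constructor
    · ext y
      simp
    · intro y hy
      simp
  exact ⟨h3 _ _ h1, h3 _ _ h2⟩

lemma contMDiff_trivialization :
    ContMDiff (sympModel m) (sympModel m) ∞ (ξ.trivialization : ξ.Symp → M × ℝ) := by
  intro p
  set c := chartAt (ModelProd (EuclideanSpace ℝ (Fin (2 * m + 1))) ℝ) (ξ.trivializationHomeo p)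
  have h1 : ContMDiffAt (sympModel m) (sympModel m) ∞
      (chartAt (ModelProd (EuclideanSpace ℝ (Fin (2 * m + 1))) ℝ) p) p :=
    contMDiffOn_chart.contMDiffAt (chart_source_mem_nhds _ p)
  have hc : ξ.trivializationHomeo p ∈ c.source := mem_chart_source _ _
  have h2 : ContMDiffAt (sympModel m) (sympModel m) ∞ c.symm (c (ξ.trivializationHomeo p)) :=
    contMDiffOn_chart_symm.contMDiffAt (c.open_target.mem_nhds (c.map_source hc))
  refine (h2.comp p h1).congr_of_eventuallyEq ?_
  filter_upwards [ξ.trivializationHomeo.continuous.continuousAt.preimage_mem_nhds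
    (c.open_source.mem_nhds hc)] with q hq
  exact (c.left_inv hq).symm

lemma contMDiff_trivialization_symm :
    ContMDiff (sympModel m) (sympModel m) ∞ (ξ.trivialization.symm : M × ℝ → ξ.Symp) := by
  intro q
  set p := ξ.trivialization.symm q with hp
  have hpq : ξ.trivializationHomeo p = q := ξ.trivialization.apply_symm_apply q
  set c' := chartAt (ModelProd (EuclideanSpace ℝ (Fin (2 * m + 1))) ℝ) p
  set c := chartAt (ModelProd (EuclideanSpace ℝ (Fin (2 * m + 1))) ℝ) (ξ.trivializationHomeo p)
  have hc : q ∈ c.source := by rw [← hpq]; exact mem_chart_source _ _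
  have h1 : ContMDiffAt (sympModel m) (sympModel m) ∞ c q :=
    contMDiffOn_chart.contMDiffAt (c.open_source.mem_nhds hc)
  have h2 : ContMDiffAt (sympModel m) (sympModel m) ∞ c'.symm (c q) := by
    refine contMDiffOn_chart_symm.contMDiffAt (c'.open_target.mem_nhds ?_)
    have h3 := c'.map_source (mem_chart_source _ p)
    have h4 : c' p = c q := congrArg c hpq
    rwa [h4] at h3
  refine (h2.comp q h1).congr_of_eventuallyEq ?_
  filter_upwards [c.open_source.mem_nhds hc] with z hz
  exact congrArg ξ.trivialization.symm (c.left_inv hz).symm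

lemma contMDiff_base : ContMDiff (sympModel m) (𝓡 (2 * m + 1)) ∞ (Symp.base : ξ.Symp → M) :=
  contMDiff_fst.comp contMDiff_trivialization

/-- The logarithm of the ratio of a covector and the contact form. -/
def Symp.height (p : ξ.Symp) : ℝ := (ξ.trivialization p).2

lemma contMDiff_height : ContMDiff (sympModel m) 𝓘(ℝ, ℝ) ∞ (Symp.height : ξ.Symp → ℝ) :=
  contMDiff_snd.comp contMDiff_trivialization

lemma Symp.covector_eq (p : ξ.Symp) : p.covector = Real.exp p.height • ξ.someForm p.base := by
  have h : p.height = Real.log (p.covector (ξ.someVec p.base)) := rfl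
  rw [h, Real.exp_log p.positive.apply_someVec_pos]
  exact p.positive.eq_smul

/-- The preferred chart at p is the product chart composed with the trivialization, so in the
preferred charts the trivialization is the identity. -/
lemma mderiv_trivialization (p : ξ.Symp) (v : EuclideanSpace ℝ (Fin (2 * m + 1)) × ℝ) :
    mderiv (sympModel m) (sympModel m) (ξ.trivialization : ξ.Symp → M × ℝ) p v = v := by
  have h1 : mderiv (sympModel m) (sympModel m) (ξ.trivialization : ξ.Symp → M × ℝ) p =
      fderivWithin ℝ (writtenInExtChartAt (sympModel m) (sympModel m) p ξ.trivialization)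
        (range (sympModel m)) (extChartAt (sympModel m) p p) :=
    (contMDiff_trivialization.mdifferentiableAt (by simp)).mfderiv
  rw [h1, (sympModel m).range_eq_univ, fderivWithin_univ]
  have h2 : writtenInExtChartAt (sympModel m) (sympModel m) p ξ.trivialization
      =ᶠ[nhds (extChartAt (sympModel m) p p)] id := by
    filter_upwards [(isOpen_extChartAt_target p).mem_nhds (mem_extChartAt_target p)] with y hy
    exact (extChartAt (sympModel m) p).right_inv hy
  rw [h2.fderiv_eq, fderiv_id]
  rfl

lemma mderiv_base (p : ξ.Symp) (v : EuclideanSpace ℝ (Fin (2 * m + 1)) × ℝ) :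
    mderiv (sympModel m) (𝓡 (2 * m + 1)) (Symp.base : ξ.Symp → M) p v = v.1 := by
  have h := mderiv_comp (I := sympModel m) (I' := sympModel m) (I'' := 𝓡 (2 * m + 1))
    (f := (ξ.trivialization : ξ.Symp → M × ℝ)) (g := Prod.fst) (x := p)
    (contMDiff_fst.mdifferentiableAt (n := ∞) (by simp))
    (contMDiff_trivialization.mdifferentiableAt (by simp)) v
  rw [mderiv_trivialization] at h
  refine Eq.trans h ?_
  have h2 : mderiv (sympModel m) (𝓡 (2 * m + 1)) (Prod.fst : M × ℝ → M) (ξ.trivialization p) =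
    ContinuousLinearMap.fst ℝ (EuclideanSpace ℝ (Fin (2 * m + 1))) ℝ := mfderiv_fst
  rw [h2]
  rfl

lemma mderiv_height (p : ξ.Symp) (v : EuclideanSpace ℝ (Fin (2 * m + 1)) × ℝ) :
    mderiv (sympModel m) 𝓘(ℝ, ℝ) (Symp.height : ξ.Symp → ℝ) p v = v.2 := by
  have h := mderiv_comp (I := sympModel m) (I' := sympModel m) (I'' := 𝓘(ℝ, ℝ))
    (f := (ξ.trivialization : ξ.Symp → M × ℝ)) (g := Prod.snd) (x := p)
    (contMDiff_snd.mdifferentiableAt (n := ∞) (by simp))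
    (contMDiff_trivialization.mdifferentiableAt (by simp)) v
  rw [mderiv_trivialization] at h
  refine Eq.trans h ?_
  have h2 : mderiv (sympModel m) 𝓘(ℝ, ℝ) (Prod.snd : M × ℝ → ℝ) (ξ.trivialization p) =
    ContinuousLinearMap.snd ℝ (EuclideanSpace ℝ (Fin (2 * m + 1))) ℝ := mfderiv_snd
  rw [h2]
  rfl

end ContactStructure

end

noncomputable section

/-! ### The symplectization as a Liouville manifold -/

namespace ContactStructure

variable {m : ℕ} {M : Type*} [TopologicalSpace M]
  [ChartedSpace (EuclideanSpace ℝ (Fin (2 * m + 1))) M] [IsManifold (𝓡 (2 * m + 1)) ∞ M]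
  {ξ : ContactStructure m M}

lemma isContactForm_someForm (ξ : ContactStructure m M) : IsContactForm ξ.someForm :=
  ξ.exists_form.choose_spec.1

/-- The pullback of the contact form to the symplectization. -/
def pullSomeForm (ξ : ContactStructure m M) : ∀ p : ξ.Symp, TangentSpace (sympModel m) p →L[ℝ] ℝ :=
  pullForm (sympModel m) (𝓡 (2 * m + 1)) (Symp.base : ξ.Symp → M) ξ.someForm

lemma canForm_eq : ξ.canForm = fun p => Real.exp p.height • ξ.pullSomeForm p := by
  funext p
  rw [canForm, Symp.covector_eq]
  rfl

lemma isSmoothForm_pullSomeForm : IsSmoothForm (sympModel m) ξ.pullSomeForm :=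
  isSmoothForm_pullForm ξ.isContactForm_someForm.smooth contMDiff_base

lemma contMDiff_exp_height :
    ContMDiff (sympModel m) 𝓘(ℝ, ℝ) ∞ fun p : ξ.Symp => Real.exp p.height :=
  Real.contDiff_exp.contMDiff.comp contMDiff_height

lemma isSmoothForm_canForm : IsSmoothForm (sympModel m) ξ.canForm := by
  rw [canForm_eq]
  exact isSmoothForm_pullSomeForm.smul contMDiff_exp_height

lemma pullSomeForm_apply (p : ξ.Symp) (v : EuclideanSpace ℝ (Fin (2 * m + 1)) × ℝ) :
    ξ.pullSomeForm p v = ξ.someForm p.base v.1 :=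
  congrArg (fun w : EuclideanSpace ℝ (Fin (2 * m + 1)) => ξ.someForm p.base w) (mderiv_base p v)

lemma canForm_apply (p : ξ.Symp) (v : EuclideanSpace ℝ (Fin (2 * m + 1)) × ℝ) :
    ξ.canForm p v = Real.exp p.height * ξ.someForm p.base v.1 := by
  have h : ξ.canForm p v = Real.exp p.height * ξ.pullSomeForm p v := by rw [canForm_eq]; rfl
  rw [h, pullSomeForm_apply]

lemma mderiv_exp_height (p : ξ.Symp) (v : EuclideanSpace ℝ (Fin (2 * m + 1)) × ℝ) :
    mderiv (sympModel m) 𝓘(ℝ, ℝ) (fun p : ξ.Symp => Real.exp p.height) p v =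
      Real.exp p.height * v.2 := by
  have h := mderiv_comp (I := sympModel m) (I' := 𝓘(ℝ, ℝ)) (I'' := 𝓘(ℝ, ℝ))
    (f := (Symp.height : ξ.Symp → ℝ)) (g := Real.exp) (x := p)
    (Real.differentiable_exp _).mdifferentiableAt
    (contMDiff_height.mdifferentiableAt (by simp)) v
  rw [mderiv_height] at h
  refine h.trans ?_
  have h2 : mderiv 𝓘(ℝ, ℝ) 𝓘(ℝ, ℝ) Real.exp p.height = fderiv ℝ Real.exp p.height :=
    mfderiv_eq_fderiv
  rw [h2, (Real.hasDerivAt_exp _).hasFDerivAt.fderiv]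
  simp [mul_comm]

/-- With h the height and α the fixed contact form, λ = e^h α and dλ = e^h (dh ∧ α + dα). -/
lemma extD_canForm (p : ξ.Symp) (u v : EuclideanSpace ℝ (Fin (2 * m + 1)) × ℝ) :
    extD (sympModel m) ξ.canForm p u v = Real.exp p.height *
      (u.2 * ξ.someForm p.base v.1 - v.2 * ξ.someForm p.base u.1 +
        extD (𝓡 (2 * m + 1)) ξ.someForm p.base u.1 v.1) := by
  have h1 := extD_smul isSmoothForm_pullSomeForm contMDiff_exp_height p u v
  have h2 : extD (sympModel m) ξ.pullSomeForm p u v =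
      extD (𝓡 (2 * m + 1)) ξ.someForm p.base u.1 v.1 := by
    refine (extD_pullForm ξ.isContactForm_someForm.smooth contMDiff_base u v).trans ?_
    exact congrArg₂ (fun a b : EuclideanSpace ℝ (Fin (2 * m + 1)) =>
      extD (𝓡 (2 * m + 1)) ξ.someForm p.base a b) (mderiv_base p u) (mderiv_base p v)
  rw [← canForm_eq, pullSomeForm_apply, pullSomeForm_apply, mderiv_exp_height, mderiv_exp_height,
    h2] at h1
  rw [h1]
  ring

lemma extD_someForm_zero_right (x : M) (u : EuclideanSpace ℝ (Fin (2 * m + 1))) :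
    extD (𝓡 (2 * m + 1)) ξ.someForm x u (0 : EuclideanSpace ℝ (Fin (2 * m + 1))) = 0 :=
  (extD_eq_flatDL ξ.someForm x u (0 : EuclideanSpace ℝ (Fin (2 * m + 1)))).trans (map_zero _)

lemma extD_someForm_zero_left (x : M) (u : EuclideanSpace ℝ (Fin (2 * m + 1))) :
    extD (𝓡 (2 * m + 1)) ξ.someForm x (0 : EuclideanSpace ℝ (Fin (2 * m + 1))) u = 0 :=
  (extD_swap ξ.someForm x (0 : EuclideanSpace ℝ (Fin (2 * m + 1))) u).trans
    (neg_eq_zero.2 (extD_someForm_zero_right x u))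

/-- Pairing with the vertical direction shows that u lies in the contact hyperplane, pairing with
contact vectors and the contact condition that u vanishes, and pairing with a vector of α-value one
that the vertical component a vanishes. -/
lemma isNondegenerate_canForm : IsNondegenerate ξ.canForm := by
  rintro p ⟨u, a⟩ hu
  have hu' : ∀ v : EuclideanSpace ℝ (Fin (2 * m + 1)) × ℝ,
      a * ξ.someForm p.base v.1 - v.2 * ξ.someForm p.base u +
        extD (𝓡 (2 * m + 1)) ξ.someForm p.base u v.1 = 0 := fun v => by
    have h1 := (extD_canForm p (u, a) v).symm.trans (hu v)
    exact (mul_eq_zero.1 h1).resolve_left (Real.exp_pos _).ne'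
  have h1 : ξ.someForm p.base u = 0 := by
    have h2 := hu' (0, 1)
    have h3 : ξ.someForm p.base (0 : EuclideanSpace ℝ (Fin (2 * m + 1))) = 0 := map_zero _
    have h4 := extD_someForm_zero_right (ξ := ξ) p.base u
    change a * ξ.someForm p.base (0 : EuclideanSpace ℝ (Fin (2 * m + 1))) - 1 * ξ.someForm p.base u
      + extD (𝓡 (2 * m + 1)) ξ.someForm p.base u
        (0 : EuclideanSpace ℝ (Fin (2 * m + 1))) = 0 at h2
    rw [h3, h4] at h2
    linarith
  have h2 : u = 0 := by
    by_contra hne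
    obtain ⟨v, hv, hv'⟩ := ξ.isContactForm_someForm.nondegenerate p.base u h1 hne
    have h3 := hu' (v, 0)
    change a * ξ.someForm p.base v - 0 * ξ.someForm p.base u
      + extD (𝓡 (2 * m + 1)) ξ.someForm p.base u v = 0 at h3
    rw [hv] at h3
    exact hv' (by linarith)
  have h3 : a = 0 := by
    have h4 := hu' (ξ.someVec p.base, 0)
    change a * ξ.someForm p.base (ξ.someVec p.base) - 0 * ξ.someForm p.base u
      + extD (𝓡 (2 * m + 1)) ξ.someForm p.base u (ξ.someVec p.base) = 0 at h4
    have h5 : extD (𝓡 (2 * m + 1)) ξ.someForm p.base u (ξ.someVec p.base) = 0 := by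
      rw [h2]
      exact extD_someForm_zero_left p.base _
    rw [ξ.someForm_someVec, h5] at h4
    linarith
  exact Prod.ext h2 h3

lemma height_push (t : ℝ) (p : ξ.Symp) : (ξ.push t p).height = p.height + t := by
  change Real.log (Real.exp t * p.covector (ξ.someVec p.base)) = _
  rw [Real.log_mul (Real.exp_pos t).ne' p.positive.apply_someVec_pos.ne', Real.log_exp, add_comm]
  rfl

lemma Symp.ext_height {p q : ξ.Symp} (h : p.base = q.base) (h' : p.height = q.height) : p = q :=
  ξ.trivialization.injective (Prod.ext h h')

lemma contMDiff_push : ContMDiff (𝓘(ℝ, ℝ).prod (sympModel m)) (sympModel m) ∞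
    (fun q : ℝ × ξ.Symp => ξ.push q.1 q.2) := by
  have h1 : ContMDiff (𝓘(ℝ, ℝ).prod (sympModel m)) (sympModel m) ∞
      (fun q : ℝ × ξ.Symp => (q.2.base, q.2.height + q.1)) :=
    (contMDiff_base.comp contMDiff_snd).prodMk
      ((contMDiff_height.comp contMDiff_snd).add contMDiff_fst)
  refine (contMDiff_trivialization_symm.comp h1).congr fun q => ?_
  change _ = ξ.trivialization.symm _
  rw [Equiv.eq_symm_apply]
  exact Prod.ext rfl (height_push _ _)

lemma hasVelocityAt_push (p : ξ.Symp) :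
    HasVelocityAt (sympModel m) (fun t => ξ.push t p)
      ((0 : EuclideanSpace ℝ (Fin (2 * m + 1))), (1 : ℝ)) 0 := by
  have hs : ContMDiff 𝓘(ℝ, ℝ) (sympModel m) ∞ fun t => ξ.push t p :=
    contMDiff_push.comp (contMDiff_id.prodMk contMDiff_const)
  have h1 := hasVelocityAt_of_mdifferentiableAt (hs.mdifferentiableAt (x := 0) (by simp))
  refine h1.congr_velocity ?_
  have h2 := h1.map (I' := 𝓡 (2 * m + 1)) (contMDiff_base.mdifferentiableAt (by simp))
  have h3 := h1.map (I' := 𝓘(ℝ, ℝ)) (contMDiff_height.mdifferentiableAt (by simp))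
  rw [mderiv_base] at h2
  rw [mderiv_height] at h3
  refine Prod.ext ?_ ?_
  · exact h2.unique (hasVelocityAt_const p.base 0)
  · refine h3.unique (hasVelocityAt_iff_hasDerivAt.2 ?_)
    have h4 : (fun t => (ξ.push t p).height) = fun t => p.height + t :=
      funext fun t => height_push t p
    rw [h4]
    exact (hasDerivAt_id (0 : ℝ)).const_add p.height

lemma preimage_height (s : Set ℝ) : (Symp.height : ξ.Symp → ℝ) ⁻¹' s =
    ξ.trivialization.symm '' (univ ×ˢ s) := by
  rw [Equiv.image_symm_eq_preimage]
  ext p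
  simp only [mem_preimage, mem_prod, mem_univ, true_and]
  rfl

lemma continuous_trivialization_symm :
    Continuous (ξ.trivialization.symm : M × ℝ → ξ.Symp) :=
  ξ.trivializationHomeo.symm.continuous

/-- The symplectization as a Liouville manifold. -/
def liouvilleCyl (ξ : ContactStructure m M) [CompactSpace M] [ConnectedSpace M] :
    LiouvilleCyl ξ.canForm where
  smooth_form := isSmoothForm_canForm
  nondegenerate := isNondegenerate_canForm
  push := ξ.push
  smooth := contMDiff_push
  push_zero p := by
    refine Symp.ext_height rfl ?_
    rw [height_push, add_zero]
  push_add s t p := by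
    refine Symp.ext_height rfl ?_
    rw [height_push, height_push, height_push]
    ring
  push_form t p v := by
    have hs : ContMDiff (sympModel m) (sympModel m) ∞ (ξ.push t) :=
      contMDiff_push.comp (contMDiff_const.prodMk contMDiff_id)
    have h1 := mderiv_comp (I := sympModel m) (I' := sympModel m) (I'' := 𝓡 (2 * m + 1))
      (f := ξ.push t) (g := (Symp.base : ξ.Symp → M)) (x := p)
      (contMDiff_base.mdifferentiableAt (by simp)) (hs.mdifferentiableAt (by simp)) v
    rw [mderiv_base] at h1
    have h2 : mderiv (sympModel m) (𝓡 (2 * m + 1)) (fun q : ξ.Symp => (ξ.push t q).base) p v =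
      v.1 := mderiv_base p v
    have h3 := canForm_apply (ξ.push t p) (mderiv (sympModel m) (sympModel m) (ξ.push t) p v)
    refine h3.trans ?_
    have h4 : ξ.someForm (ξ.push t p).base (mderiv (sympModel m) (sympModel m) (ξ.push t) p v).1 =
      ξ.someForm p.base v.1 :=
      congrArg (fun w : EuclideanSpace ℝ (Fin (2 * m + 1)) => ξ.someForm p.base w)
        (h1.symm.trans h2)
    rw [h4, height_push, canForm_apply, Real.exp_add]
    ring
  vec p := ((0 : EuclideanSpace ℝ (Fin (2 * m + 1))), (1 : ℝ))
  vec_velocity := hasVelocityAt_push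
  extD_vec p w := by
    refine (extD_canForm p (0, 1) w).trans ?_
    rw [canForm_apply]
    have h1 : ξ.someForm p.base (0 : EuclideanSpace ℝ (Fin (2 * m + 1))) = 0 := map_zero _
    have h2 : extD (𝓡 (2 * m + 1)) ξ.someForm p.base
        (0 : EuclideanSpace ℝ (Fin (2 * m + 1))) w.1 = 0 :=
      extD_someForm_zero_left p.base w.1
    change Real.exp p.height * (1 * ξ.someForm p.base w.1 -
      w.2 * ξ.someForm p.base (0 : EuclideanSpace ℝ (Fin (2 * m + 1))) + extD (𝓡 (2 * m + 1))
        ξ.someForm p.base (0 : EuclideanSpace ℝ (Fin (2 * m + 1))) w.1) = _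
    rw [h1, h2]
    ring
  height := Symp.height
  height_smooth := contMDiff_height
  height_push := height_push
  isCompact_preimage a b := by
    rw [preimage_height]
    exact (isCompact_univ.prod isCompact_Icc).image continuous_trivialization_symm
  isPreconnected_preimage s hs := by
    rw [preimage_height]
    exact (isPreconnected_univ.prod hs).image _ continuous_trivialization_symm.continuousOn
  nonempty := ⟨ξ.trivialization.symm (Classical.arbitrary M, 0)⟩

end ContactStructure

end

noncomputable section

/-! ### Sections, heights and cylinders over Legendrians -/

namespace ContactStructure

variable {m : ℕ} {M : Type*} [TopologicalSpace M]
  [ChartedSpace (EuclideanSpace ℝ (Fin (2 * m + 1))) M] [IsManifold (𝓡 (2 * m + 1)) ∞ M]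
  {ξ : ContactStructure m M}

lemma someVec_mem_posSide (ξ : ContactStructure m M) (x : M) : ξ.someVec x ∈ ξ.posSide x := by
  rw [← (ξ.someForm_positive x).2, mem_ofPred_eq, ξ.someForm_someVec]
  exact one_pos

/-- Positive covectors at x are positive multiples of one another, so their values on one positive
vector decide the comparison. -/
lemma IsPositiveCovector.forall_le_iff {x : M}
    {p q : TangentSpace (𝓡 (2 * m + 1)) x →L[ℝ] ℝ} (hp : ξ.IsPositiveCovector x p)
    (hq : ξ.IsPositiveCovector x q) :
    (∀ v ∈ ξ.posSide x, p v ≤ q v) ↔ Real.log (p (ξ.someVec x)) ≤ Real.log (q (ξ.someVec x)) := by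
  rw [Real.log_le_log_iff hp.apply_someVec_pos hq.apply_someVec_pos]
  refine ⟨fun h => h _ (ξ.someVec_mem_posSide x), fun h v hv => ?_⟩
  rw [← (ξ.someForm_positive x).2, mem_ofPred_eq] at hv
  rw [hp.eq_smul, hq.eq_smul]
  exact mul_le_mul_of_nonneg_right h hv.le

namespace Form

/-- The logarithm of the ratio of a section and the contact form. -/
def level (α : ξ.Form) (x : M) : ℝ := Real.log (α.form x (ξ.someVec x))

lemma contMDiff_level (α : ξ.Form) : ContMDiff (𝓡 (2 * m + 1)) 𝓘(ℝ, ℝ) ∞ α.level := by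
  have h1 : IsSmoothForm (𝓡 (2 * m + 1)) fun x => α.form x (ξ.someVec x) • ξ.someForm x := by
    have h2 : (fun x => α.form x (ξ.someVec x) • ξ.someForm x) = α.form :=
      funext fun x => ((α.positive x).eq_smul).symm
    rw [h2]
    exact α.smooth
  have h3 := contMDiff_of_smul ξ.isContactForm_someForm.smooth ξ.isContactForm_someForm.ne_zero h1
  intro x
  exact (Real.contDiffAt_log.2 (α.positive x).apply_someVec_pos.ne').contMDiffAt.comp x (h3 x)

lemma Below.level_lt {α α' : ξ.Form} (h : α.Below α') (x : M) : α.level x < α'.level x :=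
  Real.log_lt_log (α.positive x).apply_someVec_pos (h x _ (ξ.someVec_mem_posSide x))

/-- The positive continuous difference of levels has a minimum on the compact M. This is the width
of the collar in which a composition can be cut. -/
lemma Below.exists_pos [CompactSpace M] {α α' : ξ.Form} (h : α.Below α') :
    ∃ ε > 0, ∀ x, α.level x + ε ≤ α'.level x := by
  rcases isEmpty_or_nonempty M with hM | hM
  · exact ⟨1, one_pos, fun x => (hM.false x).elim⟩
  · obtain ⟨x₀, -, hx₀⟩ := isCompact_univ.exists_isMinOn univ_nonempty
      (f := fun x => α'.level x - α.level x)
      (α'.contMDiff_level.continuous.sub α.contMDiff_level.continuous).continuousOn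
    refine ⟨α'.level x₀ - α.level x₀, sub_pos.2 (h.level_lt x₀), fun x => ?_⟩
    have h1 : α'.level x₀ - α.level x₀ ≤ α'.level x - α.level x := hx₀ (mem_univ x)
    linarith

lemma exists_abs_level_le [CompactSpace M] (α : ξ.Form) : ∃ R, ∀ x, |α.level x| ≤ R := by
  obtain ⟨R, hR⟩ := isCompact_univ.exists_bound_of_continuousOn
    α.contMDiff_level.continuous.continuousOn
  exact ⟨R, fun x => hR x (mem_univ x)⟩

/-- The height relative to a section. -/
def height (α : ξ.Form) (p : ξ.Symp) : ℝ := p.height - α.level p.base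

lemma contMDiff_height (α : ξ.Form) : ContMDiff (sympModel m) 𝓘(ℝ, ℝ) ∞ α.height :=
  ContactStructure.contMDiff_height.sub (α.contMDiff_level.comp contMDiff_base)

lemma height_push (α : ξ.Form) (t : ℝ) (p : ξ.Symp) :
    α.height (ξ.push t p) = α.height p + t := by
  rw [height, ContactStructure.height_push, height]
  change p.height + t - α.level p.base = _
  ring

lemma mem_above (α : ξ.Form) (p : ξ.Symp) : p ∈ ξ.above α ↔ 0 ≤ α.height p :=
  ((α.positive p.base).forall_le_iff p.positive).trans sub_nonneg.symm

lemma mem_below (α : ξ.Form) (p : ξ.Symp) : p ∈ ξ.below α ↔ α.height p ≤ 0 :=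
  (p.positive.forall_le_iff (α.positive p.base)).trans sub_nonpos.symm

end Form

/-- The section at a given height. -/
def formAt (ξ : ContactStructure m M) (c : ℝ) : ξ.Form where
  form x := Real.exp c • ξ.someForm x
  smooth := ξ.isContactForm_someForm.smooth.smul contMDiff_const
  positive x := (ξ.someForm_positive x).smul (Real.exp_pos c)

lemma level_formAt (c : ℝ) (x : M) : (ξ.formAt c).level x = c := by
  change Real.log (Real.exp c * ξ.someForm x (ξ.someVec x)) = c
  rw [ξ.someForm_someVec, mul_one, Real.log_exp]

lemma mem_above_formAt {c : ℝ} {p : ξ.Symp} : p ∈ ξ.above (ξ.formAt c) ↔ c ≤ p.height := by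
  rw [Form.mem_above, Form.height, level_formAt, sub_nonneg]

lemma mem_below_formAt {c : ℝ} {p : ξ.Symp} : p ∈ ξ.below (ξ.formAt c) ↔ p.height ≤ c := by
  rw [Form.mem_below, Form.height, level_formAt, sub_nonpos]

lemma formAt_below {c c' : ℝ} (h : c < c') : (ξ.formAt c).Below (ξ.formAt c') := by
  intro x v hv
  rw [← (ξ.someForm_positive x).2, mem_ofPred_eq] at hv
  exact mul_lt_mul_of_pos_right (Real.exp_lt_exp.2 h) hv

instance [T2Space M] : T2Space ξ.Symp := ξ.trivializationHomeo.symm.t2Space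

/-- The product of a chart that flattens Λ with the coordinate on ℝ flattens the cylinder, with
slice V × ℝ. -/
lemma isSubmanifold_cyl {k : ℕ} {Λ : Set M} (hΛ : IsSubmanifold (𝓡 (2 * m + 1)) k Λ) :
    IsSubmanifold (sympModel m) (k + 1) (ξ.cyl Λ) := by
  intro p hp
  obtain ⟨e, he, hpe, V, hV, heV⟩ := hΛ p.base hp
  have h1 := IsManifold.mem_maximalAtlas_prod (I' := 𝓘(ℝ, ℝ)) he
    (IsManifold.chart_mem_maximalAtlas (I := 𝓘(ℝ, ℝ)) (n := ∞) (0 : ℝ))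
  have hc : (chartAt ℝ (0 : ℝ)).source = univ := by
    rw [chartAt_self_eq]; rfl
  refine ⟨_, trans_mem_maximalAtlas (ξ := ξ) h1, ?_, V.prod ⊤, ?_, ?_⟩
  · simp only [mfld_simps]
    exact ⟨hpe, hc ▸ mem_univ _⟩
  · have e : (V.prod (⊤ : Submodule ℝ ℝ)) ≃ₗ[ℝ] V × ℝ :=
      { toFun := fun z => (⟨z.1.1, z.2.1⟩, z.1.2)
        invFun := fun z => ⟨(z.1, z.2), z.1.2, trivial⟩
        map_add' := fun _ _ => rfl
        map_smul' := fun _ _ => rfl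
        left_inv := fun _ => rfl
        right_inv := fun _ => rfl }
    rw [e.finrank_eq, Module.finrank_prod, hV, Module.finrank_self]
  · intro q hq
    have hq' : q.base ∈ e.source := by
      simp only [mfld_simps] at hq
      exact hq.1
    refine (heV q.base hq').trans ?_
    rw [Submodule.mem_prod]
    exact (and_iff_left Submodule.mem_top).symm

variable [T2Space M] [CompactSpace M] [ConnectedSpace M]

/-- A curve in the cylinder projects to a curve in Λ, whose velocity lies in the contact hyperplane;
hence λ vanishes on the cylinder and zero is a primitive. -/
lemma IsClosedLegendrian.isCylinder {Λ : Set M} (hΛ : ξ.IsClosedLegendrian Λ) :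
    ξ.liouvilleCyl.IsCylinder (m + 1) (ξ.cyl Λ) where
  submanifold := isSubmanifold_cyl hΛ.submanifold
  isClosed := hΛ.compact.isClosed.preimage contMDiff_base.continuous
  push_mem _ _ hp := hp
  primitive := by
    rw [isPrimitiveOn_iff contMDiff_const]
    rintro ⟨p, v⟩ ⟨γ, hγ, hγΛ, h⟩
    have h0 : p = γ 0 := congrArg Bundle.TotalSpace.proj h
    subst h0
    have hv : v = mfderiv 𝓘(ℝ, ℝ) (sympModel m) γ 0 (1 : ℝ) := by
      simpa using h
    have h1 := mderiv_comp (I := 𝓘(ℝ, ℝ)) (I' := sympModel m) (I'' := 𝓡 (2 * m + 1))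
      (f := γ) (g := (Symp.base : ξ.Symp → M)) (x := 0)
      (contMDiff_base.mdifferentiableAt (by simp)) (hγ.mdifferentiableAt (by simp)) (1 : ℝ)
    rw [mderiv_base] at h1
    have h2 := hΛ.tangent _ ⟨fun t => (γ t).base, contMDiff_base.comp hγ, hγΛ, rfl⟩
    have h3 : ξ.someForm (γ 0).base (mderiv 𝓘(ℝ, ℝ) (𝓡 (2 * m + 1)) (fun t => (γ t).base) 0 1) =
        0 := by
      rw [← (ξ.someForm_positive (γ 0).base).1] at h2
      exact h2
    have h4 := canForm_apply (γ 0) (mderiv 𝓘(ℝ, ℝ) (sympModel m) γ 0 1)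
    rw [← h1, h3, mul_zero] at h4
    change ξ.canForm (γ 0) v = mfderiv (sympModel m) 𝓘(ℝ, ℝ) (fun _ => (0 : ℝ)) (γ 0) v
    rw [hv, mfderiv_const]
    exact h4

lemma finrank_sympModel (m : ℕ) :
    Module.finrank ℝ (EuclideanSpace ℝ (Fin (2 * m + 1)) × ℝ) = 2 * (m + 1) := by
  rw [Module.finrank_prod, finrank_euclideanSpace_fin, Module.finrank_self]
  ring

end ContactStructure

end

noncomputable section

/-! ### Translation between sections and heights -/

namespace ContactStructure

variable {m : ℕ} {M : Type*} [TopologicalSpace M]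
  [ChartedSpace (EuclideanSpace ℝ (Fin (2 * m + 1))) M] [IsManifold (𝓡 (2 * m + 1)) ∞ M]
  {ξ : ContactStructure m M}

lemma smoothTransition_mem_Icc (t : ℝ) : Real.smoothTransition t ∈ Icc (0 : ℝ) 1 :=
  ⟨Real.smoothTransition.nonneg t, Real.smoothTransition.le_one t⟩

/-- A Hamiltonian isotopy on the unit interval, reparametrized so that it is defined for all
times. -/
lemma IsHamiltonianIsotopy.exists_hamIsotopy
    {φ : ℝ → ξ.Symp ≃ₘ⟮sympModel m, sympModel m⟯ ξ.Symp} (hφ : ξ.IsHamiltonianIsotopy φ) :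
    ∃ ψ : HamIsotopy ξ.canForm, ∀ t, ψ.map t = φ (Real.smoothTransition t) := by
  obtain ⟨h1, h2, K, h3, h4⟩ := hφ
  have hθ : ContDiff ℝ ∞ Real.smoothTransition := Real.smoothTransition.contDiff
  have hθ' : ContDiff ℝ ∞ (deriv Real.smoothTransition) := hθ.deriv'
  -- The transition function takes values in [0, 1], so only the prescribed part of φ and K is used,
  -- and derivatives within the interval turn into derivatives on the whole line.
  have hq : ContMDiff (𝓘(ℝ, ℝ).prod (sympModel m)) (𝓘(ℝ, ℝ).prod (sympModel m)) ∞
      (fun q : ℝ × ξ.Symp => (Real.smoothTransition q.1, q.2)) :=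
    (hθ.contMDiff.comp contMDiff_fst).prodMk contMDiff_snd
  have hmaps : ∀ q : ℝ × ξ.Symp, (Real.smoothTransition q.1, q.2) ∈
      Icc (0 : ℝ) 1 ×ˢ (univ : Set ξ.Symp) := fun q => ⟨smoothTransition_mem_Icc _, mem_univ _⟩
  refine ⟨⟨fun t => φ (Real.smoothTransition t),
    fun t p => deriv Real.smoothTransition t * K (Real.smoothTransition t) p,
    h1.comp_contMDiff hq hmaps, fun p => ?_, ?_, fun t p => ?_⟩, fun t => rfl⟩
  · rw [Real.smoothTransition.zero, h2]
  · exact (hθ'.contMDiff.comp contMDiff_fst).mul (h3.comp_contMDiff hq hmaps)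
  · have ht := smoothTransition_mem_Icc t
    obtain ⟨X, hX, hXK⟩ := h4 _ ht p
    have hd : HasMFDerivWithinAt 𝓘(ℝ, ℝ) 𝓘(ℝ, ℝ) Real.smoothTransition univ t
        ((1 : ℝ →L[ℝ] ℝ).smulRight (deriv Real.smoothTransition t)) :=
      (((hθ.differentiable (by simp)) t).hasDerivAt.hasFDerivAt.hasMFDerivAt).hasMFDerivWithinAt
    have hv := HasMFDerivWithinAt.comp t hX hd fun s _ => smoothTransition_mem_Icc s
    rw [hasMFDerivWithinAt_univ] at hv
    have hKs : MDifferentiableAt (sympModel m) 𝓘(ℝ, ℝ) (K (Real.smoothTransition t))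
        (φ (Real.smoothTransition t) p) := by
      have h5 : ContMDiff (sympModel m) 𝓘(ℝ, ℝ) ∞ (K (Real.smoothTransition t)) :=
        h3.comp_contMDiff (contMDiff_const.prodMk contMDiff_id) fun q => ⟨ht, mem_univ _⟩
      exact h5.mdifferentiableAt (by simp)
    refine ⟨deriv Real.smoothTransition t •
      (show EuclideanSpace ℝ (Fin (2 * m + 1)) × ℝ from X), ?_, ?_⟩
    · refine HasMFDerivAt.congr_mfderiv hv (ContinuousLinearMap.ext_ring ?_)
      exact smul_assoc (1 : ℝ) (deriv Real.smoothTransition t)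
        (show EuclideanSpace ℝ (Fin (2 * m + 1)) × ℝ from X)
    · have hX' : IsHamVec ξ.canForm (K (Real.smoothTransition t)) (φ (Real.smoothTransition t) p)
          (show EuclideanSpace ℝ (Fin (2 * m + 1)) × ℝ from X) := hXK
      exact hX'.smul hKs _

lemma isHamiltonianIsotopy_map (φ : HamIsotopy ξ.canForm) : ξ.IsHamiltonianIsotopy φ.map := by
  refine ⟨φ.smooth.contMDiffOn, φ.map_zero, φ.ham, φ.ham_smooth.contMDiffOn, fun t _ p => ?_⟩
  obtain ⟨v, hv, hk⟩ := φ.velocity t p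
  exact ⟨v, HasMFDerivAt.hasMFDerivWithinAt hv, hk⟩

lemma hamiltonianIsotopic_iff {A B : Set ξ.Symp} :
    ξ.HamiltonianIsotopic A B ↔ ∃ φ : HamIsotopy ξ.canForm, φ.map 1 '' A = B := by
  constructor
  · rintro ⟨φ, hφ, h⟩
    obtain ⟨ψ, hψ⟩ := hφ.exists_hamIsotopy
    refine ⟨ψ, ?_⟩
    rw [hψ, Real.smoothTransition.one_of_one_le le_rfl, h]
  · rintro ⟨φ, h⟩
    exact ⟨φ.map, isHamiltonianIsotopy_map φ, h⟩

variable [T2Space M] [CompactSpace M] [ConnectedSpace M]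

/-- Sections have bounded levels since M is compact, so they can be traded for constant heights;
conversely the sections of constant height serve. -/
lemma equivalent_iff {A B : Set ξ.Symp} :
    ξ.Equivalent A B ↔ ∃ a b, ξ.liouvilleCyl.RelIsotopic a b A B := by
  constructor
  · rintro ⟨φ, hφ, h, α, α', -, hfix⟩
    obtain ⟨ψ, hψ⟩ := hφ.exists_hamIsotopy
    obtain ⟨R, hR⟩ := α.exists_abs_level_le
    obtain ⟨R', hR'⟩ := α'.exists_abs_level_le
    refine ⟨-R, R', ψ, fun t p hp => ?_, ?_⟩
    · rw [hψ]
      refine hfix _ (smoothTransition_mem_Icc t) p ?_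
      rcases hp with hp | hp
      · refine Or.inr ((α.mem_below p).2 ?_)
        have h1 : p.height ≤ -R := hp
        rw [Form.height]
        linarith [(abs_le.1 (hR p.base)).1]
      · refine Or.inl ((α'.mem_above p).2 ?_)
        have h1 : R' ≤ p.height := hp
        rw [Form.height]
        linarith [(abs_le.1 (hR' p.base)).2]
    · rw [hψ, Real.smoothTransition.one_of_one_le le_rfl, h]
  · rintro ⟨a, b, h⟩
    obtain ⟨φ, hfix, hAB⟩ := h.mono le_rfl (le_max_left b (a + 1))
    refine ⟨φ.map, isHamiltonianIsotopy_map φ, hAB, ξ.formAt a, ξ.formAt (max b (a + 1)),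
      formAt_below (lt_of_lt_of_le (lt_add_one a) (le_max_right _ _)), fun t _ p hp => ?_⟩
    refine hfix t p ?_
    rcases hp with hp | hp
    · exact Or.inr (mem_above_formAt.1 hp)
    · exact Or.inl (mem_below_formAt.1 hp)

/-- Heights beyond the maximal levels of the two sections lie in the ends. What has to be proved is
that L is closed. -/
lemma IsExactCobordism.exists_isCob {L : Set ξ.Symp} {Λ Λ' : Set M}
    (h : ξ.IsExactCobordism L Λ Λ') :
    ∃ R, ξ.liouvilleCyl.IsCob (m + 1) (ξ.cyl Λ) (ξ.cyl Λ') R L := by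
  obtain ⟨α, α', -, htop, hbot, hcomp, g, hg, hgL, ⟨c', hc'⟩, c, hc⟩ := h.exists_sections
  obtain ⟨R₁, hR₁⟩ := α.exists_abs_level_le
  obtain ⟨R₂, hR₂⟩ := α'.exists_abs_level_le
  have hα : ∀ p : ξ.Symp, p.height ≤ -max R₁ R₂ → p ∈ ξ.below α := fun p hp => by
    rw [Form.mem_below, Form.height]
    linarith [(abs_le.1 (hR₁ p.base)).1, le_max_left R₁ R₂]
  have hα' : ∀ p : ξ.Symp, max R₁ R₂ ≤ p.height → p ∈ ξ.above α' := fun p hp => by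
    rw [Form.mem_above, Form.height]
    linarith [(abs_le.1 (hR₂ p.base)).2, le_max_right R₁ R₂]
  have hcl : ∀ α : ξ.Form, IsClosed (ξ.above α) ∧ IsClosed (ξ.below α) := fun α => by
    constructor
    · rw [show ξ.above α = {p | 0 ≤ α.height p} from Set.ext fun p => α.mem_above p]
      exact isClosed_le continuous_const α.contMDiff_height.continuous
    · rw [show ξ.below α = {p | α.height p ≤ 0} from Set.ext fun p => α.mem_below p]
      exact isClosed_le α.contMDiff_height.continuous continuous_const
  refine ⟨max R₁ R₂, h.lagrangian.submanifold, ?_, fun p hp => ?_, fun p hp => ?_, g, hg,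
    (isPrimitiveOn_iff hg).2 hgL, ⟨c, fun p hpL hp => hc p ⟨hpL, hα p hp⟩⟩,
    c', fun p hpL hp => hc' p ⟨hpL, hα' p hp⟩⟩
  · have hL : L = (L ∩ ξ.above α') ∪ (L ∩ ξ.below α) ∪ (L ∩ (ξ.above α ∩ ξ.below α')) := by
      ext p
      simp only [mem_union, mem_inter_iff, Form.mem_above, Form.mem_below]
      constructor
      · intro hp
        rcases le_total 0 (α'.height p) with h1 | h1
        · exact Or.inl (Or.inl ⟨hp, h1⟩)
        · rcases le_total (α.height p) 0 with h2 | h2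
          · exact Or.inl (Or.inr ⟨hp, h2⟩)
          · exact Or.inr ⟨hp, h2, h1⟩
      · rintro ((hp | hp) | hp) <;> exact hp.1
    rw [hL, htop, hbot]
    exact ((h.legendrian_top.isCylinder.isClosed.inter (hcl α').1).union
      (h.legendrian_bot.isCylinder.isClosed.inter (hcl α).2)).union hcomp.isClosed
  · have h1 := Set.ext_iff.1 hbot p
    simpa only [mem_inter_iff, hα p hp, and_true] using h1
  · have h1 := Set.ext_iff.1 htop p
    simpa only [mem_inter_iff, hα' p hp, and_true] using h1

lemma isExactCobordism_of_isCob {L : Set ξ.Symp} {Λ Λ' : Set M} (hΛ : ξ.IsClosedLegendrian Λ)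
    (hΛ' : ξ.IsClosedLegendrian Λ') {R : ℝ}
    (h : ξ.liouvilleCyl.IsCob (m + 1) (ξ.cyl Λ) (ξ.cyl Λ') R L) : ξ.IsExactCobordism L Λ Λ' := by
  have h := h.mono (le_max_left R 1)
  set R' := max R 1
  have hR' : 1 ≤ R' := le_max_right R 1
  obtain ⟨g, hg, hgL, ⟨c, hc⟩, c', hc'⟩ := h.exists_primitive
  refine ⟨⟨h.submanifold, hgL.isotropic isSmoothForm_canForm h.submanifold hg⟩, hΛ, hΛ',
    ξ.formAt (-R'), ξ.formAt R', formAt_below (by linarith), ?_, ?_, ?_, g, hg,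
    (isPrimitiveOn_iff hg).1 hgL, ⟨c', fun p hp => hc' p hp.1 (mem_above_formAt.1 hp.2)⟩,
    c, fun p hp => hc p hp.1 (mem_below_formAt.1 hp.2)⟩
  · ext p
    exact and_congr_left fun hp => h.top p (mem_above_formAt.1 hp)
  · ext p
    exact and_congr_left fun hp => h.bot p (mem_below_formAt.1 hp)
  · have h1 : ξ.above (ξ.formAt (-R')) ∩ ξ.below (ξ.formAt R') =
        (Symp.height : ξ.Symp → ℝ) ⁻¹' Icc (-R') R' := by
      ext p
      rw [mem_inter_iff, mem_above_formAt, mem_below_formAt]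
      rfl
    rw [h1]
    exact (ξ.liouvilleCyl.isCompact_preimage (-R') R').inter_left h.isClosed

lemma mem_push_image {t : ℝ} {L : Set ξ.Symp} {p : ξ.Symp} :
    p ∈ ξ.push t '' L ↔ ξ.push (-t) p ∈ L :=
  ξ.liouvilleCyl.mem_push_image

/-- A composition in the sense of contact sections is one in the sense of the height. -/
lemma IsComposition.exists_relIsotopic {Λ' Λ'' : Set M} {L L' K Q : Set ξ.Symp}
    (hΛ' : ξ.IsClosedLegendrian Λ') {R : ℝ}
    (hL' : ξ.liouvilleCyl.IsCob (m + 1) (ξ.cyl Λ') (ξ.cyl Λ'') R L')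
    (h : ξ.IsComposition Λ' L L' K) (hK : ξ.Equivalent K Q) :
    ∃ a b t₁ : ℝ, ∀ t, t₁ ≤ t →
      ξ.liouvilleCyl.RelIsotopic a (b + t) (ξ.liouvilleCyl.comp L L' t) Q := by
  obtain ⟨t, -, α, α', hαα', hL, hLt, rfl⟩ := h
  obtain ⟨ε, hε, hεα⟩ := hαα'.exists_pos
  obtain ⟨a, b, hab⟩ := equivalent_iff.1 hK
  have hLu : ∀ p, 0 ≤ α.height p → (p ∈ L ↔ p ∈ ξ.cyl Λ') := fun p hp => by
    have h1 := Set.ext_iff.1 hL p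
    simpa only [mem_inter_iff, (α.mem_above p).2 hp, and_true] using h1
  have hb : ∀ p, α.height p ≤ ε → p ∈ ξ.below α' := fun p hp => by
    rw [Form.mem_below]
    rw [Form.height] at hp ⊢
    linarith [hεα p.base]
  have hLu' : ∀ p, α.height p ≤ ε → (ξ.push (-t) p ∈ L' ↔ p ∈ ξ.cyl Λ') := fun p hp => by
    have h1 := Set.ext_iff.1 hLt p
    simpa only [mem_inter_iff, hb p hp, and_true, mem_push_image] using h1
  refine LiouvilleCyl.exists_relIsotopic_comp (finrank_sympModel m) hΛ'.isCylinder hL'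
    α.contMDiff_height α.height_push hε hLu (t₀ := t) hLu' (a₀ := a) (b₀ := b) ?_
  -- The given composition uses both pieces in the region between the two sections. There both equal
  -- the cylinder over Λ', so a sharp cut along α describes the same set.
  have hKeq : {p | (α.height p ≤ 0 ∧ p ∈ L) ∨ (0 < α.height p ∧ ξ.push (-t) p ∈ L')} =
      L ∩ ξ.below α' ∪ ξ.push t '' L' ∩ ξ.above α := by
    ext p
    rw [mem_ofPred_eq, mem_union, mem_inter_iff, mem_inter_iff, mem_push_image, Form.mem_above]
    constructor
    · rintro (⟨h1, h2⟩ | ⟨h1, h2⟩)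
      · exact Or.inl ⟨h2, hb p (h1.trans hε.le)⟩
      · exact Or.inr ⟨h2, h1.le⟩
    · rintro (⟨h1, h2⟩ | ⟨h1, h2⟩)
      · rcases le_or_gt (α.height p) 0 with h3 | h3
        · exact Or.inl ⟨h3, h1⟩
        · refine Or.inr ⟨h3, ?_⟩
          have h4 : p ∈ ξ.push t '' L' ∩ ξ.below α' := by
            rw [hLt]
            exact ⟨(hLu p h3.le).1 h1, h2⟩
          exact mem_push_image.1 h4.1
      · rcases h2.eq_or_lt with h3 | h3
        · refine Or.inl ⟨h3.symm.le, (hLu p h2).2 ?_⟩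
          exact (hLu' p (h3.symm.le.trans hε.le)).1 h1
        · exact Or.inr ⟨h3, h1⟩
  exact hKeq ▸ hab

/-- The cut at t / 2 lies in a collar from t / 2 - 1 to t / 2 + 1 on which both L and the translate
of L' are the cylinder, because t / 2 ≥ R + 1; the two boundary heights provide the required
sections. -/
lemma isComposition_comp {Λ Λ' Λ'' : Set M} {L L' : Set ξ.Symp} {R t : ℝ}
    (hL : ξ.liouvilleCyl.IsCob (m + 1) (ξ.cyl Λ) (ξ.cyl Λ') R L)
    (hL' : ξ.liouvilleCyl.IsCob (m + 1) (ξ.cyl Λ') (ξ.cyl Λ'') R L') (ht0 : 0 ≤ t)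
    (ht : R + 1 ≤ t / 2) : ξ.IsComposition Λ' L L' (ξ.liouvilleCyl.comp L L' t) := by
  have h1 : ∀ p : ξ.Symp, t / 2 - 1 ≤ p.height → (p ∈ L ↔ p ∈ ξ.cyl Λ') := fun p hp =>
    hL.top p (le_trans (by linarith) hp)
  have h2 : ∀ p : ξ.Symp, p.height ≤ t / 2 + 1 → (ξ.push (-t) p ∈ L' ↔ p ∈ ξ.cyl Λ') :=
    fun p hp => hL'.bot (ξ.push (-t) p) (by
      have h3 : (ξ.push (-t) p).height = p.height + -t := height_push _ _
      change (ξ.push (-t) p).height ≤ -R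
      linarith)
  refine ⟨t, ht0, ξ.formAt (t / 2 - 1), ξ.formAt (t / 2 + 1), formAt_below (by linarith),
    ?_, ?_, ?_⟩
  · ext p
    exact and_congr_left fun hp => h1 p (mem_above_formAt.1 hp)
  · ext p
    refine and_congr_left fun hp => mem_push_image.trans (h2 p (mem_below_formAt.1 hp))
  · ext p
    rw [mem_union, mem_inter_iff, mem_inter_iff, mem_push_image, mem_above_formAt,
      mem_below_formAt]
    rcases le_or_gt p.height (t / 2) with h3 | h3
    · refine (LiouvilleCyl.mem_comp_of_le (S := ξ.liouvilleCyl) h3).trans ⟨fun h => ?_, ?_⟩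
      · exact Or.inl ⟨h, by linarith⟩
      · rintro (⟨h, -⟩ | ⟨h, h4⟩)
        · exact h
        · exact (h1 p h4).2 ((h2 p (by linarith)).1 h)
    · refine (LiouvilleCyl.mem_comp_of_lt (S := ξ.liouvilleCyl) h3).trans ⟨fun h => ?_, ?_⟩
      · exact Or.inr ⟨h, by linarith⟩
      · rintro (⟨h, h4⟩ | ⟨h, -⟩)
        · exact (h2 p h4).2 ((h1 p (by linarith)).1 h)
        · exact h

lemma exists_isComposition_equivalent {Λ Λ' Λ'' : Set M} {L L' Q : Set ξ.Symp} {R : ℝ}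
    (hL : ξ.liouvilleCyl.IsCob (m + 1) (ξ.cyl Λ) (ξ.cyl Λ') R L)
    (hL' : ξ.liouvilleCyl.IsCob (m + 1) (ξ.cyl Λ') (ξ.cyl Λ'') R L')
    (h : ∃ a b t₁ : ℝ, ∀ t, t₁ ≤ t →
      ξ.liouvilleCyl.RelIsotopic a (b + t) (ξ.liouvilleCyl.comp L L' t) Q) :
    ∃ K, ξ.IsComposition Λ' L L' K ∧ ξ.Equivalent K Q := by
  obtain ⟨a, b, t₁, h⟩ := h
  set t := max t₁ (max 0 (2 * (R + 1)))
  have ht2 : 2 * (R + 1) ≤ t := (le_max_right _ _).trans (le_max_right _ _)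
  exact ⟨_, isComposition_comp hL hL' (le_trans (le_max_left _ _) (le_max_right _ _))
    (by linarith : R + 1 ≤ t / 2), equivalent_iff.2 ⟨_, _, h t (le_max_left _ _)⟩⟩

end ContactStructure

end

/-! ### The theorem -/

theorem mainTheorem3 (m : ℕ) {M : Type*} [TopologicalSpace M] [T2Space M]
    [ChartedSpace (EuclideanSpace ℝ (Fin (2 * m + 1))) M] [IsManifold (𝓡 (2 * m + 1)) ∞ M]
    [CompactSpace M] [ConnectedSpace M] (ξ : ContactStructure m M) (Λ Λ' : Set M)
    (hΛ : ξ.IsClosedLegendrian Λ) (hΛ' : ξ.IsClosedLegendrian Λ') :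
    ξ.HamiltonianIsotopic (ξ.cyl Λ) (ξ.cyl Λ') ↔
      ∃ L : Set ξ.Symp, ξ.IsInvertibleCobordism L Λ Λ' := by
  constructor
  · intro h
    obtain ⟨φ, hφ⟩ := ContactStructure.hamiltonianIsotopic_iff.1 h
    obtain ⟨R, L, L', hL, hL', h₁, h₂⟩ := LiouvilleCyl.exists_invertible_of_isotopy
      (ContactStructure.finrank_sympModel m) hΛ.isCylinder hΛ'.isCylinder hφ
    exact ⟨L, ContactStructure.isExactCobordism_of_isCob hΛ hΛ' hL, L',
      ContactStructure.isExactCobordism_of_isCob hΛ' hΛ hL',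
      ContactStructure.exists_isComposition_equivalent hL hL' h₁,
      ContactStructure.exists_isComposition_equivalent hL' hL h₂⟩
  · rintro ⟨L, hL, L', hL', ⟨K, hK, hKe⟩, K', hK', hKe'⟩
    obtain ⟨R, hR⟩ := hL.exists_isCob
    obtain ⟨R', hR'⟩ := hL'.exists_isCob
    exact ContactStructure.hamiltonianIsotopic_iff.2
      (LiouvilleCyl.exists_isotopy_of_invertible hΛ.isCylinder hΛ'.isCylinder
        (hR.mono (le_max_left R R')) (hR'.mono (le_max_right R R'))
        (hK.exists_relIsotopic hΛ' hR' hKe) (hK'.exists_relIsotopic hΛ hR hKe'))
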